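/- Let $d,d'\ge 1$ be integers, $p\in[1,2]$, and let $\mathcal P_p(\mathbb R^d)$ be the set of probability measures on $\mathbb R^d$ with finite $p$-th moment, with the Wasserstein distance $W_p$. Let $\mathcal C$ be the space of continuous paths $x:[0,\infty)\to\mathbb R^d$ with uniform convergence on compact intervals, and let $\mathcal P_p(\mathcal C)$ be the set of Borel probability measures $\rho$ on $\mathcal C$ with $\int\sup_{t\le T}\|x_t\|^p\,d\rho(x)<\infty$ for all $T>0$, with the distance $\mathsf W_p(\rho,\rho')=\sum_{m\ge1}2^{-m}\bigl(1\wedge W_p((\pi_{[0,m]})_\#\rho,(\pi_{[0,m]})_\#\rho')\bigr)$, where $\pi_{[0,m]}:\mathcal C\to C([0,m],\mathbb R^d)$ is the restriction and $C([0,m],\mathbb R^d)$ has the sup norm. Write $\rho_t$ for the marginal of $\rho$ at time $t$ and $\kappa_r(\mu)=\int\|x\|^r d\mu$. Coefficients. (A1) $b:\mathbb R^d\times\mathcal P_p(\mathbb R^d)\to\mathbb R^d$ and $\sigma:\mathbb R^d\times\mathcal P_p(\mathbb R^d)\to\mathbb R^{d\times d'}$ are continuous, and for some $C>0$ and all $(x,\mu)$,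 $\|b(x,\mu)\|\le C(1+\|x\|+\int\|y\|d\mu(y))$ and $\|\sigma(x,\mu)\|\le C$. (A2) $(\gamma_k)_{k\ge1}$ is a deterministic non-negative sequence with $\gamma_k\to0$ and $\sum_k\gamma_k=+\infty$. Particles. On a probability space, for each $n\ge1$ let $(X_0^{i,n})_{i\le n}$, $(\xi_k^{i,n})_{i\le n,k\ge1}$, $(\zeta_k^{i,n})_{i\le n,k\ge1}$ be $\mathbb R^d$-valued random variables and $(\mathcal F^n_k)_{k\ge0}$ a filtration such that $X_0^{i,n}$ is $\mathcal F_0^n$-measurable and $\xi_k^{i,n},\zeta_k^{i,n}$ are $\mathcal F_k^n$-measurable. Put, for $k\ge0$, $$X_{k+1}^{i,n}=X_k^{i,n}+\gamma_{k+1}b(X_k^{i,n},\mu_k^n)+\sqrt{2\gamma_{k+1}}\,\xi_{k+1}^{i,n}+\gamma_{k+1}\zeta_{k+1}^{i,n},\qquad \mu_k^n=\frac1n\sum_{i=1}^n\delta_{X_k^{i,n}} .$$ (A3) For each $n$, the $n$-tuple $\bigl(X_0^{i,n},(\zeta_k^{i,n})_{k},(\xi_k^{i,n})_{k}\bigr)_{i\le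 n}$ is exchangeable; $\sup_{k,n}\mathbb E\|\xi_k^{1,n}\|^4<\infty$; for all $k\ge 0$, $n$, $i,j$, $\mathbb E[\xi_{k+1}^{1,n}|\mathcal F_k^n]=0$ and $\mathbb E[\xi_{k+1}^{i,n}(\xi_{k+1}^{j,n})^T|\mathcal F_k^n]=\sigma(X_k^{i,n},\mu_k^n)\sigma(X_k^{j,n},\mu_k^n)^T\mathbf 1_{i=j}$; $\mathbb E\|\zeta_k^{1,n}\|<\infty$ for all $k,n$, and $\mathbb E\|\mathbb E[\zeta_{k+1}^{1,n}|\mathcal F_k^n]\|\to0$ as $(k,n)\to(\infty,\infty)$. (A4) $\sup_n\mathbb E\|X_0^{1,n}\|^2<\infty$, $\sup_{k,n}\mathbb E\|\zeta_k^{1,n}\|^2<\infty$, and there are $c,C>0$ with $\int\langle x,b(x,\mu)\rangle d\mu(x)\le-c\,\kappa_2(\mu)+C$ for all $\mu\in\mathcal P_2(\mathbb R^d)$. (A4') In addition to (A4), $\sup_n\mathbb E\|X_0^{1,n}\|^4<\infty$, $\sup_{k,n}\mathbb E\|\zeta_k^{1,n}\|^4<\infty$, and there are $c,C>0$ with $\int\langle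 x,b(x,\mu)\rangle\|x\|^2d\mu(x)\le-c\,\kappa_4(\mu)+C(1+\kappa_2(\mu))(1+\sqrt{\kappa_4(\mu)})$ for all $\mu\in\mathcal P_4(\mathbb R^d)$. Recurrent McKean–Vlasov marginals. Let $L(\mu)(\phi)(x)=\langle b(x,\mu),\nabla\phi(x)\rangle+\mathrm{tr}(\sigma(x,\mu)^TH_\phi(x)\sigma(x,\mu))$, where $H_\phi$ is the Hessian of $\phi$. Let $\mathsf V_p$ be the set of $\rho\in\mathcal P_p(\mathcal C)$ such that for every $\phi\in C_c^2(\mathbb R^d,\mathbb R)$ the process $\phi(x_t)-\int_0^tL(\rho_s)(\phi)(x_s)ds$ is, under $\rho$, a martingale for the natural filtration of the canonical process. Let $\Phi_t(\rho)$ be the push-forward of $\rho$ by the shift $x\mapsto x_{t+\cdot}$, let $\omega(\rho)=\bigcap_{t>0}\overline{\{\Phi_s(\rho):s>t\}}$, and let $\mathrm{BC}^0_p=\overline{\{\rho_0:\rho\in\mathsf V_p,\ \rho\in\omega(\rho)\}}$, the closure being in $(\mathcal P_p(\mathbb R^d),W_p)$. Write $W_p(\mu,A)=\inf_{\nu\in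 A}W_p(\mu,\nu)$, with $\inf\emptyset=\infty$. Claim. Assume (A1)–(A4) and either $1\le p<2$, or $p=2$ and (A4'). Then $$\frac{\sum_{l=1}^k\gamma_l\,W_p(\mu_l^n,\mathrm{BC}^0_p)}{\sum_{l=1}^k\gamma_l}\longrightarrow0\quad\text{in probability as }(k,n)\to(\infty,\infty),$$ that is, for every $\varepsilon>0$ the probability that the left-hand side exceeds $\varepsilon$ tends to $0$ as $k$ and $n$ both tend to infinity, with no constraint on their relative rates. The same holds with $W_p(\mu_l^n,\mathrm{BC}^0_p)^p$ in place of $W_p(\mu_l^n,\mathrm{BC}^0_p)$. -/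

import Mathlib

open MeasureTheory ProbabilityTheory Filter Topology
open scoped ENNReal NNReal

noncomputable section

namespace MKV

/-! ### Wasserstein distances -/

/-- Spaces of continuous functions carry their Borel σ-algebra. -/
instance instMeasurableSpaceContinuousMap {X Y : Type*} [TopologicalSpace X]
    [TopologicalSpace Y] : MeasurableSpace C(X, Y) := borel _

instance instBorelSpaceContinuousMap {X Y : Type*} [TopologicalSpace X]
    [TopologicalSpace Y] : BorelSpace C(X, Y) := ⟨rfl⟩

/-- `IsCoupling π μ ν`: the measure `π` on the product has marginals `μ` and `ν`. -/
def IsCoupling {F : Type*} [MeasurableSpace F] (π : Measure (F × F)) (μ ν : Measure F) : Prop :=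
  π.map Prod.fst = μ ∧ π.map Prod.snd = ν

/-- The Wasserstein distance of order `p`,
`(inf_π ∫ ‖x - y‖ ^ p dπ(x, y)) ^ (1 / p)`, the infimum being over all couplings. -/
def wasserstein {F : Type*} [NormedAddCommGroup F] [MeasurableSpace F] (p : ℝ)
    (μ ν : Measure F) : ℝ≥0∞ :=
  (⨅ (π : Measure (F × F)) (_ : IsCoupling π μ ν), ∫⁻ z, ‖z.1 - z.2‖ₑ ^ p ∂π) ^ (1 / p)

section Wasserstein

variable {F : Type*} [NormedAddCommGroup F] [MeasurableSpace F]

theorem wasserstein_le {p : ℝ} (hp : 1 ≤ p) {μ ν : Measure F} {π : Measure (F × F)}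
    (h : IsCoupling π μ ν) :
    wasserstein p μ ν ≤ (∫⁻ z, ‖z.1 - z.2‖ₑ ^ p ∂π) ^ (1 / p) :=
  ENNReal.rpow_le_rpow (iInf₂_le π h) (by positivity)

theorem exists_coupling_lt {p : ℝ} (hp : 1 ≤ p) {μ ν : Measure F} {c : ℝ≥0∞}
    (h : wasserstein p μ ν < c) :
    ∃ π : Measure (F × F), IsCoupling π μ ν ∧ (∫⁻ z, ‖z.1 - z.2‖ₑ ^ p ∂π) ^ (1 / p) < c := by
  have hp0 : 0 < p := by linarith
  have h' := (ENNReal.lt_rpow_inv_iff (by positivity : 0 < 1 / p)).2 h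
  simp only [iInf_lt_iff] at h'
  obtain ⟨π, hπ, hlt⟩ := h'
  exact ⟨π, hπ, (ENNReal.lt_rpow_inv_iff (by positivity : 0 < 1 / p)).1 hlt⟩

variable [BorelSpace F] [SecondCountableTopology F]

theorem wasserstein_self {p : ℝ} (hp : 1 ≤ p) (μ : Measure F) : wasserstein p μ μ = 0 := by
  have hp0 : 0 < p := by linarith
  have hm : Measurable (fun x : F => (x, x)) := measurable_id.prodMk measurable_id
  have hc : IsCoupling (μ.map fun x => (x, x)) μ μ := by
    constructor
    · rw [Measure.map_map measurable_fst hm]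
      exact Measure.map_id
    · rw [Measure.map_map measurable_snd hm]
      exact Measure.map_id
  refine le_antisymm ((wasserstein_le hp hc).trans ?_) zero_le
  rw [lintegral_map (by fun_prop) hm]
  simp [hp0]

theorem wasserstein_comm_le {p : ℝ} (hp : 1 ≤ p) (μ ν : Measure F) :
    wasserstein p μ ν ≤ wasserstein p ν μ := by
  refine le_of_forall_gt fun c hc => ?_
  obtain ⟨π, ⟨h1, h2⟩, hlt⟩ := exists_coupling_lt hp hc
  have hs : IsCoupling (π.map Prod.swap) μ ν := by
    constructor
    · rw [Measure.map_map measurable_fst measurable_swap]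
      exact h2
    · rw [Measure.map_map measurable_snd measurable_swap]
      exact h1
  refine (wasserstein_le hp hs).trans_lt (lt_of_eq_of_lt ?_ hlt)
  rw [lintegral_map (by fun_prop) measurable_swap]
  congr 1
  refine lintegral_congr fun z => ?_
  rw [Prod.fst_swap, Prod.snd_swap, enorm_sub_rev]

theorem wasserstein_comm {p : ℝ} (hp : 1 ≤ p) (μ ν : Measure F) :
    wasserstein p μ ν = wasserstein p ν μ :=
  le_antisymm (wasserstein_comm_le hp μ ν) (wasserstein_comm_le hp ν μ)

theorem wasserstein_triangle [CompleteSpace F] {p : ℝ} (hp : 1 ≤ p) (μ ν ρ : Measure F)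
    [IsProbabilityMeasure μ] [IsProbabilityMeasure ν] [IsProbabilityMeasure ρ] :
    wasserstein p μ ρ ≤ wasserstein p μ ν + wasserstein p ν ρ := by
  by_cases ht1 : wasserstein p μ ν = ⊤
  · simp [ht1]
  by_cases ht2 : wasserstein p ν ρ = ⊤
  · simp [ht2]
  refine ENNReal.le_of_forall_pos_le_add fun ε hε _ => ?_
  have hε' : ((ε / 2 : ℝ≥0) : ℝ≥0∞) ≠ 0 := by
    simpa using hε.ne'
  obtain ⟨π₁, ⟨h11, h12⟩, hlt1⟩ := exists_coupling_lt hp (ENNReal.lt_add_right ht1 hε')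
  obtain ⟨π₂, ⟨h21, h22⟩, hlt2⟩ := exists_coupling_lt hp (ENNReal.lt_add_right ht2 hε')
  have : IsProbabilityMeasure π₁ := by
    have : IsProbabilityMeasure (π₁.map Prod.fst) := h11 ▸ inferInstance
    exact Measure.isProbabilityMeasure_of_map Prod.fst
  have : IsProbabilityMeasure π₂ := by
    have : IsProbabilityMeasure (π₂.map Prod.fst) := h21 ▸ inferInstance
    exact Measure.isProbabilityMeasure_of_map Prod.fst
  let G : Measure ((F × F) × F) := π₁ ⊗ₘ (π₂.condKernel.comap Prod.snd measurable_snd)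
  have hG1 : G.map Prod.fst = π₁ := Measure.fst_compProd _ _
  have hm2 : Measurable (fun z : (F × F) × F => (z.1.2, z.2)) := by fun_prop
  have hG2 : G.map (fun z => (z.1.2, z.2)) = π₂ := by
    have hd : π₂ = ν ⊗ₘ π₂.condKernel := by
      have := π₂.disintegrate π₂.condKernel
      rw [Measure.fst, h21] at this
      exact this.symm
    refine Measure.ext_of_lintegral _ fun f hf => ?_
    rw [lintegral_map hf hm2]
    conv_rhs => rw [hd]
    rw [Measure.lintegral_compProd (by fun_prop), Measure.lintegral_compProd hf, ← h12,
      lintegral_map (by fun_prop) measurable_snd]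
    rfl
  have hm3 : Measurable (fun z : (F × F) × F => (z.1.1, z.2)) := by fun_prop
  have hG3 : IsCoupling (G.map fun z => (z.1.1, z.2)) μ ρ := by
    constructor
    · rw [Measure.map_map measurable_fst hm3, ← h11, ← hG1,
        Measure.map_map measurable_fst measurable_fst]
      rfl
    · rw [Measure.map_map measurable_snd hm3, ← h22, ← hG2, Measure.map_map measurable_snd hm2]
      rfl
  have key : (∫⁻ z, ‖z.1 - z.2‖ₑ ^ p ∂(G.map fun z => (z.1.1, z.2))) ^ (1 / p) ≤
      (∫⁻ z, ‖z.1 - z.2‖ₑ ^ p ∂π₁) ^ (1 / p) + (∫⁻ z, ‖z.1 - z.2‖ₑ ^ p ∂π₂) ^ (1 / p) := by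
    rw [lintegral_map (by fun_prop) hm3]
    conv_rhs => rw [← hG2, lintegral_map (by fun_prop) hm2]
    have e1 : ∫⁻ z, ‖z.1 - z.2‖ₑ ^ p ∂π₁ = ∫⁻ z, ‖z.1.1 - z.1.2‖ₑ ^ p ∂G := by
      conv_lhs => rw [← hG1]
      rw [lintegral_map (by fun_prop) measurable_fst]
    rw [e1]
    refine le_trans (ENNReal.rpow_le_rpow (lintegral_mono fun z => ?_) (by positivity))
      (ENNReal.lintegral_Lp_add_le (f := fun z : (F × F) × F => ‖z.1.1 - z.1.2‖ₑ)
        (g := fun z : (F × F) × F => ‖z.1.2 - z.2‖ₑ) (by fun_prop) (by fun_prop) hp)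
    refine ENNReal.rpow_le_rpow ?_ (by linarith)
    have : z.1.1 - z.2 = (z.1.1 - z.1.2) + (z.1.2 - z.2) := by abel
    simp only [Pi.add_apply]
    rw [this]
    exact enorm_add_le _ _
  refine (wasserstein_le hp hG3).trans (key.trans ((add_le_add hlt1.le hlt2.le).trans ?_))
  have : (ε : ℝ≥0∞) = ((ε / 2 : ℝ≥0) : ℝ≥0∞) + ((ε / 2 : ℝ≥0) : ℝ≥0∞) := by
    rw [← ENNReal.coe_add, add_halves]
  rw [this]
  exact le_of_eq (by ring)

end Wasserstein

/-! ### The spaces of probability measures with finite `p`-th moments -/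

/-- Probability measures on the normed space `F` with finite moment of order `p`. -/
@[ext]
structure WSpace (p : ℝ) (F : Type*) [NormedAddCommGroup F] [MeasurableSpace F] where
  toMeasure : Measure F
  isProb : IsProbabilityMeasure toMeasure
  moment_lt_top : ∫⁻ x, ‖x‖ₑ ^ p ∂toMeasure < ⊤

attribute [instance] WSpace.isProb

/-- The space of probability measures of finite `p`-th moment is equipped with `W_p`. -/
instance instPseudoEMetricSpaceWSpace {p : ℝ} [hp : Fact (1 ≤ p)] {F : Type*}
    [NormedAddCommGroup F] [MeasurableSpace F] [BorelSpace F] [SecondCountableTopology F]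
    [CompleteSpace F] : PseudoEMetricSpace (WSpace p F) where
  edist μ ν := wasserstein p μ.toMeasure ν.toMeasure
  edist_self μ := wasserstein_self hp.out _
  edist_comm μ ν := wasserstein_comm hp.out _ _
  edist_triangle μ ν ρ := wasserstein_triangle hp.out _ _ _

/-- The state space `ℝ^d` with its Euclidean norm. -/
abbrev State (d : ℕ) : Type := EuclideanSpace ℝ (Fin d)

/-- The space of continuous paths `[0, ∞) → ℝ^d`; its (compact-open) topology is that of uniform
convergence on compact intervals. -/
abbrev PathSpace (d : ℕ) : Type := C(ℝ≥0, State d)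

/-- Restriction of a path to `[0, T]`, in the Banach space `C([0, T], ℝ^d)` (sup norm). -/
def restrictPath {d : ℕ} (T : ℝ≥0) (x : PathSpace d) : C(Set.Icc (0 : ℝ≥0) T, State d) :=
  x.restrict (Set.Icc 0 T)

theorem continuous_restrictPath {d : ℕ} (T : ℝ≥0) :
    Continuous (restrictPath (d := d) T) :=
  ContinuousMap.continuous_restrict _

/-- Probability measures `ρ` on the path space such that `∫ sup_{t ∈ [0, T]} ‖x_t‖ ^ p dρ(x)` is
finite for every `T`. -/
@[ext]
structure PathWSpace (p : ℝ) (d : ℕ) where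
  toMeasure : Measure (PathSpace d)
  isProb : IsProbabilityMeasure toMeasure
  moment_lt_top : ∀ T : ℝ≥0, 0 < T →
    ∫⁻ x, (⨆ (t : ℝ≥0) (_ : t ≤ T), ‖x t‖ₑ ^ p) ∂toMeasure < ⊤

attribute [instance] PathWSpace.isProb

/-- The law of the path restricted to `[0, T]`. -/
def PathWSpace.restrict {p : ℝ} {d : ℕ} (ρ : PathWSpace p d) (T : ℝ≥0) :
    Measure C(Set.Icc (0 : ℝ≥0) T, State d) :=
  ρ.toMeasure.map (restrictPath T)

instance PathWSpace.instIsProbRestrict {p : ℝ} {d : ℕ} (ρ : PathWSpace p d) (T : ℝ≥0) :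
    IsProbabilityMeasure (ρ.restrict T) :=
  Measure.isProbabilityMeasure_map (continuous_restrictPath T).measurable.aemeasurable

/-- The distance `∑_{n ≥ 1} 2^{-n} (1 ∧ W_p(ρ|_{[0,n]}, ρ'|_{[0,n]}))` between laws of paths. -/
def pathWasserstein {p : ℝ} {d : ℕ} (ρ ρ' : PathWSpace p d) : ℝ≥0∞ :=
  ∑' n : ℕ, (2 : ℝ≥0∞)⁻¹ ^ (n + 1) *
    min 1 (wasserstein p (ρ.restrict ((n : ℝ≥0) + 1)) (ρ'.restrict ((n : ℝ≥0) + 1)))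

instance instPseudoEMetricSpacePathWSpace {p : ℝ} [hp : Fact (1 ≤ p)] {d : ℕ} :
    PseudoEMetricSpace (PathWSpace p d) where
  edist ρ ρ' := pathWasserstein ρ ρ'
  edist_self ρ := by simp [pathWasserstein, wasserstein_self hp.out]
  edist_comm ρ ρ' := by
    simp only [pathWasserstein]
    congr 1 with n
    rw [wasserstein_comm hp.out]
  edist_triangle ρ₁ ρ₂ ρ₃ := by
    simp only [pathWasserstein]
    rw [← ENNReal.tsum_add]
    refine ENNReal.tsum_le_tsum fun n => ?_
    rw [← mul_add]
    gcongr
    refine (min_le_min le_rfl (wasserstein_triangle hp.out _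
      (ρ₂.restrict ((n : ℝ≥0) + 1)) _)).trans ?_
    rcases le_total 1 (wasserstein p (ρ₁.restrict ((n : ℝ≥0) + 1))
      (ρ₂.restrict ((n : ℝ≥0) + 1))) with h | h
    · rw [min_eq_left h]
      exact (min_le_left _ _).trans le_self_add
    rcases le_total 1 (wasserstein p (ρ₂.restrict ((n : ℝ≥0) + 1))
      (ρ₃.restrict ((n : ℝ≥0) + 1))) with h' | h'
    · rw [min_eq_left h']
      exact (min_le_left _ _).trans le_add_self
    · rw [min_eq_right h, min_eq_right h']
      exact min_le_right _ _

/-- The marginal `ρ_t` of `ρ` at time `t`. -/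
def PathWSpace.marginal {p : ℝ} {d : ℕ} (ρ : PathWSpace p d) (t : ℝ≥0) :
    WSpace p (State d) where
  toMeasure := ρ.toMeasure.map fun x => x t
  isProb := Measure.isProbabilityMeasure_map
    (continuous_eval_const t).measurable.aemeasurable
  moment_lt_top := by
    rw [lintegral_map (by fun_prop) (continuous_eval_const t).measurable]
    refine lt_of_le_of_lt (lintegral_mono fun x => ?_) (ρ.moment_lt_top (t + 1) (by positivity))
    exact le_iSup₂_of_le (f := fun (s : ℝ≥0) (_ : s ≤ t + 1) => ‖x s‖ₑ ^ p) t le_self_add le_rfl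

/-- The shift `x ↦ x_{t + ·}` on paths. -/
def shiftPath {d : ℕ} (t : ℝ≥0) (x : PathSpace d) : PathSpace d :=
  x.comp ⟨fun s => t + s, by fun_prop⟩

theorem continuous_shiftPath {d : ℕ} (t : ℝ≥0) : Continuous (shiftPath (d := d) t) :=
  ContinuousMap.continuous_precomp _

theorem measurable_iSup_enorm_rpow {p : ℝ} {d : ℕ} (T : ℝ≥0) :
    Measurable fun x : PathSpace d => ⨆ (t : ℝ≥0) (_ : t ≤ T), ‖x t‖ₑ ^ p := by
  refine (lowerSemicontinuous_biSup fun t _ => ?_).measurable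
  refine Continuous.lowerSemicontinuous ?_
  exact (ENNReal.continuous_rpow_const).comp
    (continuous_enorm.comp (continuous_eval_const t))

/-- The semi-flow of shifts: `Φ_t(ρ)` is the law of `x_{t + ·}` when `x` has law `ρ`. -/
def PathWSpace.shift {p : ℝ} {d : ℕ} (t : ℝ≥0) (ρ : PathWSpace p d) :
    PathWSpace p d where
  toMeasure := ρ.toMeasure.map (shiftPath t)
  isProb := Measure.isProbabilityMeasure_map (continuous_shiftPath t).measurable.aemeasurable
  moment_lt_top T hT := by
    rw [lintegral_map (measurable_iSup_enorm_rpow T)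
      (continuous_shiftPath t).measurable]
    refine lt_of_le_of_lt (lintegral_mono fun x => ?_) (ρ.moment_lt_top (t + T) (by positivity))
    refine iSup₂_le fun s hs => ?_
    exact le_iSup₂_of_le (f := fun (s : ℝ≥0) (_ : s ≤ t + T) => ‖x s‖ₑ ^ p) (t + s)
      (by gcongr) le_rfl

/-! ### McKean–Vlasov distributions and recurrence -/

/-- The Hessian matrix of `φ` at `x`. -/
def hessianMatrix {d : ℕ} (φ : State d → ℝ) (x : State d) : Matrix (Fin d) (Fin d) ℝ :=
  Matrix.of fun i j =>
    fderiv ℝ (fderiv ℝ φ) x (EuclideanSpace.single i 1) (EuclideanSpace.single j 1)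

/-- `L(μ)(φ)(x) = ⟨b(x, μ), ∇φ(x)⟩ + tr(σ(x, μ)ᵀ H_φ(x) σ(x, μ))`. -/
def generator {p : ℝ} {d d' : ℕ} (b : State d → WSpace p (State d) → State d)
    (σ : State d → WSpace p (State d) → Matrix (Fin d) (Fin d') ℝ)
    (μ : WSpace p (State d)) (φ : State d → ℝ) (x : State d) : ℝ :=
  inner ℝ (b x μ) (gradient φ x) +
    Matrix.trace ((σ x μ).transpose * hessianMatrix φ x * σ x μ)

/-- The natural filtration of the canonical process on the path space. -/
def canonicalFiltration (d : ℕ) :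
    Filtration ℝ≥0 (inferInstance : MeasurableSpace (PathSpace d)) :=
  Filtration.natural (fun t (x : PathSpace d) => x t)
    fun t => (continuous_eval_const t).stronglyMeasurable

/-- The class of McKean–Vlasov distributions of order `p`: the solutions of the nonlinear
martingale problem associated with `L`. -/
def mckeanVlasov {p : ℝ} {d d' : ℕ} (b : State d → WSpace p (State d) → State d)
    (σ : State d → WSpace p (State d) → Matrix (Fin d) (Fin d') ℝ) : Set (PathWSpace p d) :=
  {ρ | ∀ φ : State d → ℝ, ContDiff ℝ 2 φ → HasCompactSupport φ →
    Martingale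
      (fun (t : ℝ≥0) (x : PathSpace d) =>
        φ (x t) - ∫ s in (0 : ℝ)..t,
          generator b σ (ρ.marginal s.toNNReal) φ (x s.toNNReal))
      (canonicalFiltration d) ρ.toMeasure}

/-- The omega-limit set of `ρ` for the semi-flow of shifts. -/
def omegaLimitSet {p : ℝ} [Fact (1 ≤ p)] {d : ℕ} (ρ : PathWSpace p d) : Set (PathWSpace p d) :=
  ⋂ (t : ℝ≥0) (_ : 0 < t), closure {ρ' | ∃ s : ℝ≥0, t < s ∧ ρ' = ρ.shift s}

/-- The closure in `(P_p(ℝ^d), W_p)` of the set of the marginals `ρ_0` of recurrent McKean–Vlasov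
distributions `ρ`. -/
def recurrentMarginals {p : ℝ} [Fact (1 ≤ p)] {d d' : ℕ}
    (b : State d → WSpace p (State d) → State d)
    (σ : State d → WSpace p (State d) → Matrix (Fin d) (Fin d') ℝ) :
    Set (WSpace p (State d)) :=
  closure {μ | ∃ ρ ∈ mckeanVlasov b σ, ρ ∈ omegaLimitSet ρ ∧ ρ.marginal 0 = μ}

/-! ### The particle system and the assumptions -/

/-- The empirical measure `(1 / n) ∑_i δ_{x_i}`. -/
def empirical {p : ℝ} [hp : Fact (1 ≤ p)] {d : ℕ} {n : ℕ+} (x : Fin n → State d) :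
    WSpace p (State d) where
  toMeasure := ((n : ℕ) : ℝ≥0∞)⁻¹ • ∑ i, Measure.dirac (x i)
  isProb := by
    constructor
    simp [ENNReal.inv_mul_cancel]
  moment_lt_top := by
    have hp0 : 0 ≤ p := by linarith [hp.out]
    rw [lintegral_smul_measure, lintegral_finsetSum_measure]
    refine ENNReal.mul_lt_top (by simp) (ENNReal.sum_lt_top.2 fun i _ => ?_)
    rw [lintegral_dirac]
    exact ENNReal.rpow_lt_top_of_nonneg hp0 (by simp)

/-- Continuity of the coefficients, linear growth of `b`, boundedness of `σ` (in Frobenius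
norm). -/
structure CoefficientAssumption {p : ℝ} [Fact (1 ≤ p)] {d d' : ℕ}
    (b : State d → WSpace p (State d) → State d)
    (σ : State d → WSpace p (State d) → Matrix (Fin d) (Fin d') ℝ) : Prop where
  continuous_b : Continuous fun z : State d × WSpace p (State d) => b z.1 z.2
  continuous_σ : Continuous fun z : State d × WSpace p (State d) => σ z.1 z.2
  bound : ∃ C : ℝ, 0 < C ∧ ∀ (x : State d) (μ : WSpace p (State d)),
    ‖b x μ‖ ≤ C * (1 + ‖x‖ + ∫ y, ‖y‖ ∂μ.toMeasure) ∧
    √(∑ i, ∑ j, σ x μ i j ^ 2) ≤ C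

/-- The step sizes `γ_1, γ_2, …` are non-negative, vanish, and have an infinite sum; the value
`γ 0` plays no role. -/
structure StepAssumption (γ : ℕ → ℝ) : Prop where
  nonneg : ∀ k, 0 ≤ γ (k + 1)
  tendsto_zero : Tendsto γ atTop (𝓝 0)
  sum_eq_top : Tendsto (fun k => ∑ l ∈ Finset.Icc 1 k, γ l) atTop atTop

/-- Exchangeability: the joint law is invariant under permutations of the indices. -/
def Exchangeable {Ω S ι : Type*} [MeasurableSpace Ω] [MeasurableSpace S] (Y : ι → Ω → S)
    (P : Measure Ω) : Prop :=
  ∀ π : Equiv.Perm ι, IdentDistrib (fun ω i => Y (π i) ω) (fun ω i => Y i ω) P P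

section Particles

variable {p : ℝ} [Fact (1 ≤ p)] {d d' : ℕ} {Ω : Type*} [mΩ : MeasurableSpace Ω]

/-- The particle system. Here `X n k i`, `ξ n k i`, `ζ n k i` stand for `X_k^{i,n}`, `ξ_k^{i,n}`,
`ζ_k^{i,n}`, the particles being indexed by `i : Fin n` (so that the first one is `i = 0`); the
noises are indexed by `k ≥ 1`, and `ξ n 0`, `ζ n 0` play no role. The initial positions and the
noises up to time `k` are measurable with respect to `ℱ n k`. -/
structure IsParticleSystem (b : State d → WSpace p (State d) → State d) (γ : ℕ → ℝ)
    (X ξ ζ : (n : ℕ+) → ℕ → Fin n → Ω → State d) (ℱ : ℕ+ → Filtration ℕ mΩ) : Prop where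
  step : ∀ (n : ℕ+) (k : ℕ) (i : Fin n) (ω : Ω),
    X n (k + 1) i ω = X n k i ω
      + γ (k + 1) • b (X n k i ω) (empirical fun j => X n k j ω)
      + √(2 * γ (k + 1)) • ξ n (k + 1) i ω
      + γ (k + 1) • ζ n (k + 1) i ω
  measurable_init : ∀ (n : ℕ+) (i : Fin n), Measurable[ℱ n 0] (X n 0 i)
  measurable_ξ : ∀ (n : ℕ+) (k : ℕ) (i : Fin n), Measurable[ℱ n (k + 1)] (ξ n (k + 1) i)
  measurable_ζ : ∀ (n : ℕ+) (k : ℕ) (i : Fin n), Measurable[ℱ n (k + 1)] (ζ n (k + 1) i)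

/-- Assumptions on the noises and the initial condition. -/
structure NoiseAssumption (σ : State d → WSpace p (State d) → Matrix (Fin d) (Fin d') ℝ)
    (X ξ ζ : (n : ℕ+) → ℕ → Fin n → Ω → State d) (ℱ : ℕ+ → Filtration ℕ mΩ)
    (P : Measure Ω) : Prop where
  exchangeable : ∀ n : ℕ+,
    Exchangeable (fun (i : Fin n) ω =>
      (X n 0 i ω, (fun k : ℕ => ζ n (k + 1) i ω), (fun k : ℕ => ξ n (k + 1) i ω))) P
  moment_ξ : ⨆ (n : ℕ+) (k : ℕ), ∫⁻ ω, ‖ξ n (k + 1) 0 ω‖ₑ ^ 4 ∂P < ⊤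
  condExp_ξ : ∀ (n : ℕ+) (k : ℕ), P[ξ n (k + 1) 0 | ℱ n k] =ᵐ[P] 0
  condCov_ξ : ∀ (n : ℕ+) (k : ℕ) (i j : Fin n) (a c : Fin d),
    P[fun ω => ξ n (k + 1) i ω a * ξ n (k + 1) j ω c | ℱ n k] =ᵐ[P] fun ω =>
      if i = j then
        (σ (X n k i ω) (empirical fun l => X n k l ω) *
          (σ (X n k j ω) (empirical fun l => X n k l ω)).transpose) a c
      else 0
  integrable_ζ : ∀ (n : ℕ+) (k : ℕ), Integrable (ζ n (k + 1) 0) P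
  condExp_ζ : Tendsto (fun q : ℕ × ℕ+ => ∫ ω, ‖(P[ζ q.2 (q.1 + 1) 0 | ℱ q.2 q.1]) ω‖ ∂P)
    (atTop ×ˢ atTop) (𝓝 0)

/-- Second order moments, and dissipativity of `b` over measures with finite second moment. -/
structure MomentAssumption (b : State d → WSpace p (State d) → State d)
    (X ζ : (n : ℕ+) → ℕ → Fin n → Ω → State d) (P : Measure Ω) : Prop where
  moment_init : ⨆ n : ℕ+, ∫⁻ ω, ‖X n 0 0 ω‖ₑ ^ 2 ∂P < ⊤
  moment_ζ : ⨆ (n : ℕ+) (k : ℕ), ∫⁻ ω, ‖ζ n (k + 1) 0 ω‖ₑ ^ 2 ∂P < ⊤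
  dissipative : ∃ c C : ℝ, 0 < c ∧ 0 < C ∧ ∀ μ : WSpace p (State d),
    Integrable (fun x => ‖x‖ ^ 2) μ.toMeasure →
    ∫ x, inner ℝ x (b x μ) ∂μ.toMeasure ≤ -c * (∫ x, ‖x‖ ^ 2 ∂μ.toMeasure) + C

/-- Fourth order moments, and the corresponding dissipativity condition over measures with finite
fourth moment. -/
structure FourthMomentAssumption (b : State d → WSpace p (State d) → State d)
    (X ζ : (n : ℕ+) → ℕ → Fin n → Ω → State d) (P : Measure Ω) : Prop where
  moment_init : ⨆ n : ℕ+, ∫⁻ ω, ‖X n 0 0 ω‖ₑ ^ 4 ∂P < ⊤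
  moment_ζ : ⨆ (n : ℕ+) (k : ℕ), ∫⁻ ω, ‖ζ n (k + 1) 0 ω‖ₑ ^ 4 ∂P < ⊤
  dissipative : ∃ c C : ℝ, 0 < c ∧ 0 < C ∧ ∀ μ : WSpace p (State d),
    Integrable (fun x => ‖x‖ ^ 4) μ.toMeasure →
    ∫ x, inner ℝ x (b x μ) * ‖x‖ ^ 2 ∂μ.toMeasure ≤
      -c * (∫ x, ‖x‖ ^ 4 ∂μ.toMeasure) +
        C * (1 + ∫ x, ‖x‖ ^ 2 ∂μ.toMeasure) * (1 + √(∫ x, ‖x‖ ^ 4 ∂μ.toMeasure))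

/-- The weighted average `(∑_{l=1}^k γ_l g(μ_l^n)) / (∑_{l=1}^k γ_l)`, where `μ_l^n` is the
empirical measure of the particles at time `l`. -/
def ergodicAverage (γ : ℕ → ℝ) (X : (n : ℕ+) → ℕ → Fin n → Ω → State d)
    (g : WSpace p (State d) → ℝ≥0∞) (k : ℕ) (n : ℕ+) (ω : Ω) : ℝ≥0∞ :=
  (∑ l ∈ Finset.Icc 1 k, ENNReal.ofReal (γ l) * g (empirical fun i => X n l i ω)) /
    ENNReal.ofReal (∑ l ∈ Finset.Icc 1 k, γ l)

/-- Convergence to `0` in probability, as `(k, n) → (∞, ∞)`, of non-negative (possibly infinite)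
random variables. -/
def TendstoZeroInProbability (U : ℕ → ℕ+ → Ω → ℝ≥0∞) (P : Measure Ω) : Prop :=
  ∀ ε : ℝ, 0 < ε →
    Tendsto (fun q : ℕ × ℕ+ => P {ω | ENNReal.ofReal ε < U q.1 q.2 ω}) (atTop ×ˢ atTop) (𝓝 0)

end Particles

end MKV

end

open MKV

open MKV
open Finset (Icc abs_sum_le_sum_abs card_univ measurable_sum mem_range mem_univ mul_sum range
  single_le_sum sum_add_distrib sum_comm sum_congr sum_const sum_const_zero sum_div sum_eq_zero
  sum_le_card_nsmul sum_le_sum sum_mul sum_nonneg sum_range_sub sum_range_succ sum_smul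
  sum_sub_distrib univ)
open ENNReal (add_lt_top coe_le_coe continuous_ofReal continuous_rpow_const div_lt_top div_ne_top
  le_tsum mul_ne_top ofReal ofReal_add ofReal_le_ofReal ofReal_lt_top ofReal_mul ofReal_pos
  ofReal_pow ofReal_sum_of_nonneg one_ne_top rpow_add rpow_le_rpow rpow_mul rpow_natCast
  rpow_ne_top_of_nonneg rpow_neg rpow_one sum_le_tsum summable tendsto_nhds_zero toReal_mono
  toReal_ofNat tsum_le_tsum zero_rpow_of_pos ofReal_ne_top ofReal_inv_of_pos toReal_nonneg)
open Real (norm_eq_abs norm_of_nonneg sqrt_nonneg sq_sqrt sqrt_mul)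
open MeasureTheory.Measure (dirac map_dirac')

noncomputable section

namespace MKV

/-- Drift coefficients. -/
abbrev Drift (p : ℝ) [Fact (1 ≤ p)] (d : ℕ) := State d → WSpace p (State d) → State d

/-- Diffusion coefficients. -/
abbrev Diffusion (p : ℝ) [Fact (1 ≤ p)] (d d' : ℕ) :=
  State d → WSpace p (State d) → Matrix (Fin d) (Fin d') ℝ

/-- Families of random variables indexed by the particles and the time steps. -/
abbrev Particles (Ω : Type*) (d : ℕ) := (n : ℕ+) → ℕ → Fin n → Ω → State d

section WassersteinTools

variable {F : Type*} [NormedAddCommGroup F] [MeasurableSpace F]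

lemma IsCoupling.isProbabilityMeasure {π : Measure (F × F)} {μ ν : Measure F}
    (h : IsCoupling π μ ν) [hμ : IsProbabilityMeasure μ] : IsProbabilityMeasure π := by
  have : IsProbabilityMeasure (π.map Prod.fst) := h.1 ▸ hμ
  exact Measure.isProbabilityMeasure_of_map Prod.fst

lemma lintegral_rpow_le_of_rpow_inv_le {p : ℝ} (hp : 1 ≤ p) {a c : ℝ≥0∞} (h : a ^ (1 / p) ≤ c) :
    a ≤ c ^ p := by
  have hp0 : 0 < p := by linarith
  have := rpow_le_rpow h hp0.le
  rwa [← rpow_mul, one_div, inv_mul_cancel₀ hp0.ne', rpow_one] at this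

variable [BorelSpace F] [SecondCountableTopology F]

/-- Two maps on a common measure space give a coupling of the push-forwards. -/
lemma wasserstein_map_map_le {A : Type*} [MeasurableSpace A] {p : ℝ} (hp : 1 ≤ p)
    (m : Measure A) {f g : A → F} (hf : Measurable f) (hg : Measurable g) :
    wasserstein p (m.map f) (m.map g) ≤ (∫⁻ a, ‖f a - g a‖ₑ ^ p ∂m) ^ (1 / p) := by
  have hfg : Measurable fun a => (f a, g a) := hf.prodMk hg
  have hc : IsCoupling (m.map fun a => (f a, g a)) (m.map f) (m.map g) := by
    constructor
    · rw [Measure.map_map measurable_fst hfg]; rfl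
    · rw [Measure.map_map measurable_snd hfg]; rfl
  refine (wasserstein_le hp hc).trans (le_of_eq ?_)
  rw [lintegral_map (by fun_prop) hfg]

lemma wasserstein_map_le_of_nonexpansive {F' : Type*} [NormedAddCommGroup F'] [MeasurableSpace F']
    [BorelSpace F'] [SecondCountableTopology F'] {p : ℝ} (hp : 1 ≤ p) (μ ν : Measure F)
    {f : F → F'} (hf : Measurable f) (h : ∀ x y, ‖f x - f y‖ ≤ ‖x - y‖) :
    wasserstein p (μ.map f) (ν.map f) ≤ wasserstein p μ ν := by
  refine le_of_forall_gt fun c hc => ?_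
  obtain ⟨π, ⟨h1, h2⟩, hlt⟩ := exists_coupling_lt hp hc
  have e1 : μ.map f = π.map (fun z => f z.1) := by
    rw [← h1, Measure.map_map hf measurable_fst]; rfl
  have e2 : ν.map f = π.map (fun z => f z.2) := by
    rw [← h2, Measure.map_map hf measurable_snd]; rfl
  rw [e1, e2]
  refine (wasserstein_map_map_le hp π (hf.comp measurable_fst) (hf.comp measurable_snd)).trans_lt
    (lt_of_le_of_lt ?_ hlt)
  refine rpow_le_rpow (lintegral_mono fun z => ?_) (by positivity)
  refine rpow_le_rpow ?_ (by linarith)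
  rw [← ofReal_norm, ← ofReal_norm]
  exact ofReal_le_ofReal (h _ _)

/-- Integrals of functions depending continuously on a point and on a parameter converge when the
measures converge in the Wasserstein distance and the parameters converge. -/
lemma tendsto_integral_of_tendsto_wasserstein {ι Z : Type*} {l : Filter ι} [TopologicalSpace Z]
    [FirstCountableTopology Z] {p : ℝ} (hp : 1 ≤ p) {μ : ι → Measure F} {ν : Measure F}
    [∀ i, IsProbabilityMeasure (μ i)] [IsProbabilityMeasure ν]
    (h : Tendsto (fun i => wasserstein p (μ i) ν) l (𝓝 0)) {z : ι → Z} {z₀ : Z}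
    (hz : Tendsto z l (𝓝 z₀)) {f : F → Z → ℝ} (hf : Continuous (Function.uncurry f)) {M : ℝ}
    (hM : ∀ᶠ w in 𝓝 z₀, ∀ x, |f x w| ≤ M) :
    Tendsto (fun i => ∫ x, f x (z i) ∂μ i) l (𝓝 (∫ x, f x z₀ ∂ν)) := by
  have hp0 : 0 < p := by linarith
  have hfz : ∀ w, Continuous fun x => f x w := fun w =>
    hf.comp (continuous_id.prodMk continuous_const)
  have hM0 : ∀ x, |f x z₀| ≤ M := hM.self_of_nhds
  have hMnn : 0 ≤ M := (abs_nonneg _).trans (hM0 0)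
  obtain ⟨U, hU⟩ := (𝓝 z₀).exists_antitone_basis
  refine Metric.tendsto_nhds.2 fun ε' hε' => ?_
  obtain ⟨ε, hε, hε1, hεε⟩ : ∃ ε : ℝ, 0 < ε ∧ ε ≤ 1 ∧ ε + 2 * M * (ε + ε) < ε' := by
    refine ⟨min 1 (ε' / (2 * (1 + 4 * M))), by positivity, min_le_left _ _, ?_⟩
    have : min 1 (ε' / (2 * (1 + 4 * M))) * (1 + 4 * M) ≤ ε' / 2 := by
      calc _ ≤ (ε' / (2 * (1 + 4 * M))) * (1 + 4 * M) := by gcongr; exact min_le_right _ _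
        _ = ε' / 2 := by field_simp
    nlinarith
  let A : ℕ → Set F := fun n => {y | ∃ x, ∃ w ∈ U n, ‖x - y‖ < 1 / ((n : ℝ) + 1) ∧
    ε < |f x w - f y z₀|}
  have hAopen : ∀ n, IsOpen (A n) := by
    intro n
    have : A n = ⋃ (x : F) (w ∈ U n), {y | ‖x - y‖ < 1 / ((n : ℝ) + 1)} ∩
        {y | ε < |f x w - f y z₀|} := by
      ext y
      simp only [A, Set.mem_ofPred_eq, Set.mem_iUnion, Set.mem_inter_iff, exists_prop]
    rw [this]
    refine isOpen_iUnion fun x => isOpen_iUnion fun w => isOpen_iUnion fun _ => ?_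
    refine (isOpen_lt (by fun_prop) continuous_const).inter (isOpen_lt continuous_const ?_)
    exact (continuous_const.sub (hfz z₀)).abs
  have hAanti : Antitone A := by
    intro m n hmn y ⟨x, w, hw, h1, h2⟩
    refine ⟨x, w, hU.antitone hmn hw, h1.trans_le ?_, h2⟩
    gcongr
  have hAempty : ⋂ n, A n = ∅ := by
    refine Set.eq_empty_iff_forall_notMem.2 fun y hy => ?_
    have hc : ∀ᶠ q in 𝓝 y ×ˢ 𝓝 z₀, |f q.1 q.2 - f y z₀| < ε := by
      rw [← nhds_prod_eq]
      have := Metric.tendsto_nhds.1 (hf.tendsto (y, z₀)) ε hε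
      exact this
    obtain ⟨pa, hpa, pb, hpb, hpab⟩ := eventually_prod_iff.1 hc
    obtain ⟨δ, hδ, hball⟩ := Metric.eventually_nhds_iff.1 hpa
    obtain ⟨n, hn⟩ := hU.mem_iff.1 hpb
    obtain ⟨m, hm⟩ := exists_nat_one_div_lt hδ
    obtain ⟨x, w, hw, h1, h2⟩ := Set.mem_iInter.1 hy (max n m)
    refine lt_asymm h2 (hpab (hball ?_) (hn (hU.antitone (le_max_left _ _) hw)))
    rw [dist_eq_norm]
    refine h1.trans (lt_of_le_of_lt ?_ hm)
    gcongr
    exact le_max_right _ _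
  have hAlim : Tendsto (fun n => ν (A n)) atTop (𝓝 0) := by
    have := tendsto_measure_iInter_atTop (μ := ν) (s := A)
      (fun n => (hAopen n).measurableSet.nullMeasurableSet) hAanti ⟨0, measure_ne_top _ _⟩
    rwa [hAempty, measure_empty] at this
  obtain ⟨n, hn⟩ := (hAlim.eventually_lt_const (ofReal_pos.2 hε)).exists
  set δ : ℝ := 1 / ((n : ℝ) + 1) with hδ
  have hδ0 : 0 < δ := by positivity
  have hcpos : 0 < ofReal (δ * ε) := ofReal_pos.2 (by positivity)
  filter_upwards [h.eventually_lt_const hcpos, hz.eventually (hU.mem_of_mem trivial : U n ∈ 𝓝 z₀),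
    hz.eventually hM] with i hi hzi hMi
  obtain ⟨π, hπ, hlt⟩ := exists_coupling_lt hp hi
  have : IsProbabilityMeasure π := hπ.isProbabilityMeasure
  have e1 : ∫ x, f x (z i) ∂μ i = ∫ q, f q.1 (z i) ∂π := by
    rw [← hπ.1, integral_map measurable_fst.aemeasurable (hfz _).aestronglyMeasurable]
  have e2 : ∫ x, f x z₀ ∂ν = ∫ q, f q.2 z₀ ∂π := by
    rw [← hπ.2, integral_map measurable_snd.aemeasurable (hfz _).aestronglyMeasurable]
  have i1 : Integrable (fun q : F × F => f q.1 (z i)) π :=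
    Integrable.of_bound ((hfz _).measurable.comp measurable_fst).aestronglyMeasurable M
      (ae_of_all _ fun q => hMi _)
  have i2 : Integrable (fun q : F × F => f q.2 z₀) π :=
    Integrable.of_bound ((hfz _).measurable.comp measurable_snd).aestronglyMeasurable M
      (ae_of_all _ fun q => hM0 _)
  rw [Real.dist_eq, e1, e2, ← integral_sub i1 i2]
  let B : Set (F × F) := {q | ofReal δ ^ p ≤ ‖q.1 - q.2‖ₑ ^ p}
  let S : Set (F × F) := Prod.snd ⁻¹' A n ∪ B
  have hBm : MeasurableSet B := measurableSet_le measurable_const (by fun_prop)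
  have hSm : MeasurableSet S := ((hAopen n).measurableSet.preimage measurable_snd).union hBm
  have hB : π B ≤ ofReal ε := by
    have hm := mul_meas_ge_le_lintegral₀ (μ := π) (f := fun q : F × F => ‖q.1 - q.2‖ₑ ^ p)
      (by fun_prop) (ofReal δ ^ p)
    have h2 := lintegral_rpow_le_of_rpow_inv_le hp hlt.le
    rw [ofReal_mul hδ0.le, ENNReal.mul_rpow_of_nonneg _ _ hp0.le] at h2
    have h3 := hm.trans h2
    have hne : ofReal δ ^ p ≠ 0 := by
      simp [ENNReal.rpow_eq_zero_iff, hδ0, hp0]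
    have hnt : ofReal δ ^ p ≠ ⊤ := rpow_ne_top_of_nonneg hp0.le (by simp)
    have h4 : π B ≤ ofReal ε ^ p := (ENNReal.mul_le_mul_iff_right hne hnt).1 h3
    refine h4.trans ?_
    calc ofReal ε ^ p ≤ ofReal ε ^ (1 : ℝ) :=
          ENNReal.rpow_le_rpow_of_exponent_ge (by simpa using hε1) hp
      _ = _ := rpow_one _
  have hA : π (Prod.snd ⁻¹' A n) ≤ ofReal ε := by
    rw [← Measure.map_apply measurable_snd (hAopen n).measurableSet, hπ.2]
    exact hn.le
  have hS : π.real S ≤ ε + ε := by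
    rw [measureReal_def]
    refine ENNReal.toReal_le_of_le_ofReal (by positivity) ?_
    rw [ofReal_add hε.le hε.le]
    exact (measure_union_le _ _).trans (add_le_add hA hB)
  have hpt : ∀ q : F × F, ‖f q.1 (z i) - f q.2 z₀‖ ≤ ε + S.indicator (fun _ => 2 * M) q := by
    intro q
    by_cases hq : q ∈ S
    · rw [Set.indicator_of_mem hq]
      have := abs_sub (f q.1 (z i)) (f q.2 z₀)
      have h1 := hMi q.1
      have h2 := hM0 q.2
      rw [norm_eq_abs]
      linarith
    · rw [Set.indicator_of_notMem hq, add_zero, norm_eq_abs]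
      by_contra hcon
      push Not at hcon
      refine hq ?_
      by_cases hd : ‖q.1 - q.2‖ < δ
      · exact Or.inl ⟨q.1, z i, hzi, hd, hcon⟩
      · refine Or.inr ?_
        refine rpow_le_rpow ?_ hp0.le
        rw [← ofReal_norm]
        exact ofReal_le_ofReal (not_lt.1 hd)
  calc |∫ q, (f q.1 (z i) - f q.2 z₀) ∂π| ≤ ∫ q, ε + S.indicator (fun _ => 2 * M) q ∂π := by
        rw [← norm_eq_abs]
        refine norm_integral_le_of_norm_le ?_ (ae_of_all _ hpt)
        exact (integrable_const _).add ((integrable_const _).indicator hSm)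
    _ = ε + 2 * M * π.real S := by
        rw [integral_add (integrable_const _) ((integrable_const _).indicator hSm),
          integral_indicator hSm]
        simp [mul_comm]
    _ ≤ ε + 2 * M * (ε + ε) := by gcongr
    _ < ε' := hεε

end WassersteinTools

section Quantization

variable {F : Type*} [NormedAddCommGroup F] [MeasurableSpace F] [BorelSpace F]
  [SecondCountableTopology F]

/-- The image of `μ` under the finitely supported kernel `x ↦ ∑ i, g i x • δ (c i)`. -/
def quantize {ι : Type*} [Fintype ι] (g : ι → F → ℝ≥0∞) (c : ι → F)
    (μ : Measure F) : Measure F :=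
  ∑ i, (∫⁻ x, g i x ∂μ) • dirac (c i)

lemma quantize_isProbabilityMeasure {ι : Type*} [Fintype ι] {g : ι → F → ℝ≥0∞}
    (hg : ∀ i, Measurable (g i)) (hsum : ∀ x, ∑ i, g i x = 1) (c : ι → F) (μ : Measure F)
    [IsProbabilityMeasure μ] : IsProbabilityMeasure (quantize g c μ) := by
  constructor
  simp only [quantize, Measure.coe_finsetSum, Finset.sum_apply, Measure.smul_apply, measure_univ,
    smul_eq_mul, mul_one]
  rw [← lintegral_finsetSum _ fun i _ => hg i]
  simp [hsum]

lemma wasserstein_quantize_le {ι : Type*} [Fintype ι] {p : ℝ} (hp : 1 ≤ p) {g : ι → F → ℝ≥0∞}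
    (hg : ∀ i, Measurable (g i)) (hsum : ∀ x, ∑ i, g i x = 1) (c : ι → F) (μ : Measure F) :
    wasserstein p μ (quantize g c μ) ≤ (∫⁻ x, ∑ i, g i x * ‖x - c i‖ₑ ^ p ∂μ) ^ (1 / p) := by
  have hm : ∀ i, Measurable fun x : F => (x, c i) := fun i => by fun_prop
  have hc : IsCoupling (∑ i, (μ.withDensity (g i)).map fun x => (x, c i)) μ (quantize g c μ) := by
    constructor
    · rw [Measure.map_finset_sum measurable_fst.aemeasurable]
      simp_rw [Measure.map_map measurable_fst (hm _)]
      have : ∀ i, (μ.withDensity (g i)).map (Prod.fst ∘ fun x => (x, c i)) =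
          μ.withDensity (g i) := fun i => Measure.map_id
      simp_rw [this]
      ext s hs
      simp only [Measure.coe_finsetSum, Finset.sum_apply, withDensity_apply _ hs]
      rw [← lintegral_finsetSum _ fun i _ => hg i]
      simp [hsum]
    · rw [Measure.map_finset_sum measurable_snd.aemeasurable, quantize]
      simp_rw [Measure.map_map measurable_snd (hm _)]
      refine sum_congr rfl fun i _ => ?_
      have : (Prod.snd ∘ fun x : F => (x, c i)) = fun _ => c i := rfl
      rw [this, Measure.map_const, withDensity_apply _ MeasurableSet.univ, Measure.restrict_univ]
  refine (wasserstein_le hp hc).trans (rpow_le_rpow (le_of_eq ?_) (by positivity))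
  rw [lintegral_finsetSum_measure, lintegral_finsetSum _ fun i _ => by fun_prop]
  refine sum_congr rfl fun i _ => ?_
  rw [lintegral_map (by fun_prop) (hm i), lintegral_withDensity_eq_lintegral_mul _ (hg i)
    (by fun_prop)]
  rfl

lemma wasserstein_sum_dirac_le {ι : Type*} [Fintype ι] {p : ℝ} (hp : 1 ≤ p) {a b : ι → ℝ≥0∞}
    (ha : ∑ i, a i = 1) (hb : ∑ i, b i = 1) (c : ι → F) {D : ℝ≥0∞}
    (hD : ∀ i k, ‖c i - c k‖ₑ ^ p ≤ D) :
    wasserstein p (∑ i, a i • dirac (c i)) (∑ i, b i • dirac (c i)) ≤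
      ((∑ i, (a i - b i)) * D) ^ (1 / p) := by
  have hp0 : 0 < p := by linarith
  have hma : ∑ i, min (a i) (b i) + ∑ i, (a i - b i) = 1 := by
    rw [← ha, ← sum_add_distrib]
    exact sum_congr rfl fun i _ => by rw [add_comm]; exact tsub_add_min
  have hmb : ∑ i, min (a i) (b i) + ∑ i, (b i - a i) = 1 := by
    rw [← hb, ← sum_add_distrib]
    exact sum_congr rfl fun i _ => by rw [add_comm, min_comm]; exact tsub_add_min
  have hmt : ∑ i, min (a i) (b i) ≠ ⊤ := by
    refine ne_top_of_le_ne_top one_ne_top ?_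
    rw [← hma]; exact le_self_add
  set δ := ∑ i, (a i - b i) with hδ
  have hδb : ∑ i, (b i - a i) = δ := by
    have := hma.trans hmb.symm
    exact ((ENNReal.add_right_inj hmt).1 this).symm
  have hδt : δ ≠ ⊤ := by
    refine ne_top_of_le_ne_top one_ne_top ?_
    rw [← hma]; exact le_add_self
  by_cases hδ0 : δ = 0
  · have h1 : ∀ i, a i - b i = 0 := fun i =>
      (Finset.sum_eq_zero_iff.1 (hδ.symm.trans hδ0)) i (mem_univ i)
    have h2 : ∀ i, b i - a i = 0 := fun i =>
      (Finset.sum_eq_zero_iff.1 (hδb.trans hδ0)) i (mem_univ i)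
    have : a = b := funext fun i =>
      le_antisymm (tsub_eq_zero_iff_le.1 (h1 i)) (tsub_eq_zero_iff_le.1 (h2 i))
    rw [this, wasserstein_self hp]
    exact zero_le
  let π : Measure (F × F) := ∑ i, min (a i) (b i) • dirac (c i, c i) +
    ∑ i, ∑ k, (δ⁻¹ * (a i - b i) * (b k - a k)) • dirac (c i, c k)
  have hfac : ∀ i, ∑ k, δ⁻¹ * (a i - b i) * (b k - a k) = a i - b i := by
    intro i
    rw [← mul_sum, hδb, mul_comm δ⁻¹, mul_assoc, ENNReal.inv_mul_cancel hδ0 hδt, mul_one]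
  have hfac' : ∀ k, ∑ i, δ⁻¹ * (a i - b i) * (b k - a k) = b k - a k := by
    intro k
    rw [← sum_mul, ← mul_sum, ENNReal.inv_mul_cancel hδ0 hδt, one_mul]
  have hπ : IsCoupling π (∑ i, a i • dirac (c i)) (∑ i, b i • dirac (c i)) := by
    constructor
    · simp only [π, Measure.map_add _ _ measurable_fst,
        Measure.map_finset_sum measurable_fst.aemeasurable, Measure.map_smul,
        map_dirac' measurable_fst]
      simp_rw [← sum_smul, hfac]
      rw [← sum_add_distrib]
      refine sum_congr rfl fun i _ => ?_
      rw [← add_smul, add_comm, tsub_add_min]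
    · simp only [π, Measure.map_add _ _ measurable_snd,
        Measure.map_finset_sum measurable_snd.aemeasurable, Measure.map_smul,
        map_dirac' measurable_snd]
      rw [sum_comm (f := fun i k => (δ⁻¹ * (a i - b i) * (b k - a k)) •
        dirac (c k))]
      simp_rw [← sum_smul, hfac']
      rw [← sum_add_distrib]
      refine sum_congr rfl fun i _ => ?_
      rw [← add_smul, add_comm, min_comm, tsub_add_min]
  refine (wasserstein_le hp hπ).trans (rpow_le_rpow ?_ (by positivity))
  simp only [π, lintegral_add_measure, lintegral_finsetSum_measure, lintegral_smul_measure]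
  have hd : ∀ u v : F, ∫⁻ z, ‖z.1 - z.2‖ₑ ^ p ∂(dirac (u, v)) = ‖u - v‖ₑ ^ p := fun u v =>
    lintegral_dirac' _ (by fun_prop)
  simp only [hd, sub_self, enorm_zero, zero_rpow_of_pos hp0, smul_eq_mul, mul_zero,
    sum_const_zero, zero_add]
  calc ∑ i, ∑ k, δ⁻¹ * (a i - b i) * (b k - a k) * ‖c i - c k‖ₑ ^ p
      ≤ ∑ i, ∑ k, δ⁻¹ * (a i - b i) * (b k - a k) * D := by gcongr; exact hD _ _
    _ = δ * D := by
        simp_rw [← sum_mul, hfac]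
        rw [hδ]

variable [CompleteSpace F]

/-- Convergence in distribution together with bounded moments of order `q > p` implies convergence
in the Wasserstein distance of order `p`. -/
lemma tendsto_wasserstein_of_tendsto {ι : Type*} {l : Filter ι} {p q : ℝ} (hp : 1 ≤ p) (hpq : p < q)
    {μ : ι → ProbabilityMeasure F} {ν : ProbabilityMeasure F} (h : Tendsto μ l (𝓝 ν)) {R : ℝ≥0∞}
    (hR : R ≠ ⊤) (hμ : ∀ᶠ i in l, ∫⁻ x, ‖x‖ₑ ^ q ∂(μ i : Measure F) ≤ R)
    (hν : ∫⁻ x, ‖x‖ₑ ^ q ∂(ν : Measure F) ≤ R) :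
    Tendsto (fun i => wasserstein p (μ i : Measure F) (ν : Measure F)) l (𝓝 0) := by
  have hp0 : 0 < p := by linarith
  refine tendsto_nhds_zero.2 fun ε' hε' => ?_
  wlog hε't : ε' ≠ ⊤ generalizing ε'
  · exact (this 1 one_pos one_ne_top).mono fun i hi =>
      hi.trans (by rw [not_not.1 hε't]; exact le_top)
  obtain ⟨η, hη0, hηt, hη⟩ : ∃ η : ℝ≥0∞, η ≠ 0 ∧ η ≠ ⊤ ∧ 3 * (3 * η) ^ (1 / p) ≤ ε' := by
    refine ⟨(ε' / 3) ^ p / 3, ?_, ?_, ?_⟩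
    · simp [ENNReal.rpow_eq_zero_iff, hε'.ne', hp0, hp0.le]
    · exact div_ne_top (rpow_ne_top_of_nonneg hp0.le
        (div_ne_top hε't (by simp))) (by simp)
    · rw [ENNReal.mul_div_cancel (by simp) (by simp), one_div, ENNReal.rpow_rpow_inv hp0.ne',
        ENNReal.mul_div_cancel (by simp) (by simp)]
  obtain ⟨ε, hε0, hε⟩ : ∃ ε : ℝ, 0 < ε ∧ ofReal (2 * ε) ^ p ≤ η := by
    have : Tendsto (fun ε : ℝ => ofReal (2 * ε) ^ p) (𝓝[>] 0) (𝓝 0) := by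
      have h1 : Continuous fun ε : ℝ => ofReal (2 * ε) ^ p :=
        continuous_rpow_const.comp (continuous_ofReal.comp (by fun_prop))
      have := (h1.tendsto 0).mono_left (nhdsWithin_le_nhds (s := Set.Ioi 0))
      simpa [hp0] using this
    obtain ⟨ε, h1, h2⟩ := ((this.eventually_le_const (pos_iff_ne_zero.2 hη0)).and
      self_mem_nhdsWithin).exists
    exact ⟨ε, h2, h1⟩
  obtain ⟨A, hA1, hA⟩ : ∃ A : ℝ≥0, 1 ≤ A ∧ R * (A : ℝ≥0∞) ^ (p - q) ≤ η := by
    have h1 : Tendsto (fun A : ℝ≥0 => R * (A : ℝ≥0∞) ^ (p - q)) atTop (𝓝 (R * 0)) := by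
      refine ENNReal.Tendsto.const_mul ?_ (Or.inr hR)
      have h2 : Tendsto (fun A : ℝ≥0 => (A : ℝ≥0∞)) atTop (𝓝 ⊤) :=
        ENNReal.tendsto_coe_nhds_top.2 tendsto_id
      have h3 := (continuous_rpow_const (y := p - q)).tendsto (⊤ : ℝ≥0∞)
      rw [ENNReal.top_rpow_of_neg (by linarith)] at h3
      exact h3.comp h2
    rw [mul_zero] at h1
    obtain ⟨A, h2, h3⟩ := ((h1.eventually_le_const (pos_iff_ne_zero.2 hη0)).and
      (eventually_ge_atTop 1)).exists
    exact ⟨A, h3, h2⟩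
  obtain ⟨y, hy⟩ := TopologicalSpace.exists_dense_seq F
  let φ : ℕ → F → ℝ := fun i x => max 0 (min 1 (2 - ‖x - y i‖ / ε))
  have hφc : ∀ i, Continuous (φ i) := fun i => by fun_prop
  have hφ0 : ∀ i x, 0 ≤ φ i x := fun i x => le_max_left _ _
  have hφ1 : ∀ i x, φ i x ≤ 1 := fun i x => max_le zero_le_one (min_le_left _ _)
  let r : ℕ → F → ℝ := fun N x => ∏ i ∈ range N, (1 - φ i x)
  have hrc : ∀ N, Continuous (r N) := fun N => continuous_finsetProd _ fun i _ => by fun_prop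
  have hr0 : ∀ N x, 0 ≤ r N x := fun N x => Finset.prod_nonneg fun i _ => by linarith [hφ1 i x]
  have hr1 : ∀ N x, r N x ≤ 1 := fun N x =>
    Finset.prod_le_one (fun i _ => by linarith [hφ1 i x]) fun i _ => by linarith [hφ0 i x]
  have hrlim : Tendsto (fun N => ∫⁻ x, ofReal (r N x) ∂(ν : Measure F)) atTop (𝓝 0) := by
    have h1 := tendsto_lintegral_of_dominated_convergence (μ := (ν : Measure F))
      (F := fun N x => ofReal (r N x)) (f := fun _ => 0) (fun _ => 1)
      (fun N => by have := (hrc N).measurable; fun_prop)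
      (fun N => ae_of_all _ fun x => by simpa using hr1 N x) (by simp)
      (ae_of_all _ fun x => ?_)
    · simpa using h1
    · obtain ⟨i, hi⟩ := hy.exists_dist_lt x hε0
      refine tendsto_const_nhds.congr' ?_
      filter_upwards [eventually_gt_atTop i] with N hN
      have : r N x = 0 := by
        refine Finset.prod_eq_zero (mem_range.2 hN) ?_
        have h2 : ‖x - y i‖ / ε ≤ 1 := by
          rw [div_le_one hε0, ← dist_eq_norm]; exact hi.le
        have : φ i x = 1 := by
          simp only [φ]
          rw [min_eq_left (by linarith), max_eq_right zero_le_one]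
        rw [this, sub_self]
      simp [this]
  have hAp0 : (A : ℝ≥0∞) ^ p ≠ ⊤ := rpow_ne_top_of_nonneg hp0.le (by simp)
  obtain ⟨N, hN⟩ : ∃ N, (A : ℝ≥0∞) ^ p * ∫⁻ x, ofReal (r N x) ∂(ν : Measure F) < η := by
    have h1 := ENNReal.Tendsto.const_mul hrlim (Or.inr hAp0)
    rw [mul_zero] at h1
    exact (h1.eventually_lt_const (pos_iff_ne_zero.2 hη0)).exists
  let g : Fin (N + 1) → F → ℝ := fun i x => if (i : ℕ) < N then r i x * φ i x else r N x
  let c : Fin (N + 1) → F := fun i => if (i : ℕ) < N then y i else 0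
  have hgc : ∀ i, Continuous (g i) := by
    intro i
    simp only [g]
    split_ifs
    · exact (hrc _).mul (hφc _)
    · exact hrc N
  have hg0 : ∀ i x, 0 ≤ g i x := by
    intro i x
    simp only [g]
    split_ifs
    · exact mul_nonneg (hr0 _ _) (hφ0 _ _)
    · exact hr0 _ _
  have hg1 : ∀ i x, g i x ≤ 1 := by
    intro i x
    simp only [g]
    split_ifs
    · exact mul_le_one₀ (hr1 _ _) (hφ0 _ _) (hφ1 _ _)
    · exact hr1 _ _
  have hgsum : ∀ x, ∑ i, g i x = 1 := by
    intro x
    rw [Fin.sum_univ_castSucc]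
    have h1 : ∀ i : Fin N, g i.castSucc x = r i x - r (i + 1) x := by
      intro i
      simp only [g, Fin.val_castSucc, i.2, if_true, r, Finset.prod_range_succ]
      ring
    have h2 : g (Fin.last N) x = r N x := by simp [g]
    simp_rw [h1]
    rw [h2, Fin.sum_univ_eq_sum_range (fun i => r i x - r (i + 1) x), Finset.sum_range_sub']
    simp [r]
  let G : Fin (N + 1) → F → ℝ≥0∞ := fun i x => ofReal (g i x)
  have hGm : ∀ i, Measurable (G i) := fun i => by have := (hgc i).measurable; fun_prop
  have hGsum : ∀ x, ∑ i, G i x = 1 := by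
    intro x
    rw [← ofReal_sum_of_nonneg fun i _ => hg0 i x, hgsum, ENNReal.ofReal_one]
  have hcost : ∀ m : ProbabilityMeasure F, ∫⁻ x, ‖x‖ₑ ^ q ∂(m : Measure F) ≤ R →
      (A : ℝ≥0∞) ^ p * ∫⁻ x, ofReal (r N x) ∂(m : Measure F) < η →
      wasserstein p (m : Measure F) (quantize G c m) ≤ (3 * η) ^ (1 / p) := by
    intro m hm1 hm2
    refine (wasserstein_quantize_le hp hGm hGsum c m).trans
      (rpow_le_rpow ?_ (by positivity))
    have hpt : ∀ x, ∑ i, G i x * ‖x - c i‖ₑ ^ p ≤ η + ((A : ℝ≥0∞) ^ p * ofReal (r N x) +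
        (A : ℝ≥0∞) ^ (p - q) * ‖x‖ₑ ^ q) := by
      intro x
      rw [Fin.sum_univ_castSucc]
      refine add_le_add ?_ ?_
      · calc ∑ i : Fin N, G i.castSucc x * ‖x - c i.castSucc‖ₑ ^ p
            ≤ ∑ i : Fin N, G i.castSucc x * η := by
              refine sum_le_sum fun i _ => ?_
              by_cases h0 : φ i x = 0
              · have : G i.castSucc x = 0 := by simp [G, g, h0]
                simp [this]
              · gcongr
                refine le_trans (rpow_le_rpow ?_ hp0.le) hε
                have : c i.castSucc = y i := by simp [c]
                rw [this, ← ofReal_norm]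
                refine ofReal_le_ofReal ?_
                by_contra hcon
                push Not at hcon
                refine h0 ?_
                have : 2 < ‖x - y i‖ / ε := by rw [lt_div_iff₀ hε0]; exact hcon
                simp only [φ]
                rw [max_eq_left]
                exact (min_le_right _ _).trans (by linarith)
          _ = (∑ i : Fin N, G i.castSucc x) * η := by rw [sum_mul]
          _ ≤ 1 * η := by
              gcongr
              rw [← hGsum x, Fin.sum_univ_castSucc]
              exact le_self_add
          _ = η := one_mul _
      · have h1 : G (Fin.last N) x = ofReal (r N x) := by simp [G, g]
        have h2 : c (Fin.last N) = 0 := by simp [c]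
        rw [h1, h2, sub_zero]
        rcases le_total ‖x‖ₑ A with hx | hx
        · refine le_trans ?_ le_self_add
          rw [mul_comm]
          gcongr
        · refine le_trans ?_ le_add_self
          calc ofReal (r N x) * ‖x‖ₑ ^ p ≤ 1 * ‖x‖ₑ ^ p := by
                gcongr
                simpa using hr1 N x
            _ = ‖x‖ₑ ^ (p - q) * ‖x‖ₑ ^ q := by
                have hx0 : ‖x‖ₑ ≠ 0 := by
                  have : (1 : ℝ≥0∞) ≤ ‖x‖ₑ := le_trans (by exact_mod_cast hA1) hx
                  exact (lt_of_lt_of_le one_pos this).ne'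
                rw [one_mul, ← rpow_add _ _ hx0 (by simp)]
                simp
            _ ≤ (A : ℝ≥0∞) ^ (p - q) * ‖x‖ₑ ^ q := by
                refine mul_le_mul_left ?_ _
                have : p - q = -(q - p) := by ring
                rw [this, rpow_neg, rpow_neg]
                exact ENNReal.inv_le_inv.2 (rpow_le_rpow hx (by linarith))
    have hrm := (hrc N).measurable
    calc ∫⁻ x, ∑ i, G i x * ‖x - c i‖ₑ ^ p ∂(m : Measure F)
        ≤ ∫⁻ x, η + ((A : ℝ≥0∞) ^ p * ofReal (r N x) +
          (A : ℝ≥0∞) ^ (p - q) * ‖x‖ₑ ^ q) ∂(m : Measure F) := lintegral_mono hpt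
      _ = η + ((A : ℝ≥0∞) ^ p * ∫⁻ x, ofReal (r N x) ∂(m : Measure F) +
          (A : ℝ≥0∞) ^ (p - q) * ∫⁻ x, ‖x‖ₑ ^ q ∂(m : Measure F)) := by
          rw [lintegral_add_left (by fun_prop), lintegral_add_left (by fun_prop),
            lintegral_const_mul _ (by fun_prop), lintegral_const_mul _ (by fun_prop)]
          simp
      _ ≤ η + (η + η) := by
          gcongr
          calc (A : ℝ≥0∞) ^ (p - q) * ∫⁻ x, ‖x‖ₑ ^ q ∂(m : Measure F)
              ≤ (A : ℝ≥0∞) ^ (p - q) * R := by gcongr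
            _ ≤ η := by rw [mul_comm]; exact hA
      _ = 3 * η := by ring
  have hbcf : ∀ f : F → ℝ, Continuous f → (∀ x, 0 ≤ f x) → (∀ x, f x ≤ 1) →
      Tendsto (fun i => ∫⁻ x, ofReal (f x) ∂(μ i : Measure F)) l
        (𝓝 (∫⁻ x, ofReal (f x) ∂(ν : Measure F))) := by
    intro f hf h0 h1
    let f' : BoundedContinuousFunction F ℝ≥0 := BoundedContinuousFunction.mkOfBound
      ⟨fun x => (f x).toNNReal, continuous_real_toNNReal.comp hf⟩ 1 (fun x y => by
        simp only [ContinuousMap.coe_mk, NNReal.dist_eq, Real.coe_toNNReal _ (h0 _)]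
        exact abs_sub_le_iff.2 ⟨by linarith [h1 x, h0 y], by linarith [h1 y, h0 x]⟩)
    exact ProbabilityMeasure.tendsto_iff_forall_lintegral_tendsto.1 h f'
  obtain ⟨D, hDt, hD⟩ : ∃ D : ℝ≥0∞, D ≠ ⊤ ∧ ∀ i k, ‖c i - c k‖ₑ ^ p ≤ D := by
    refine ⟨∑ i, ∑ k, ‖c i - c k‖ₑ ^ p, ?_, fun i k => ?_⟩
    · simp [ENNReal.sum_eq_top, ENNReal.rpow_eq_top_iff, hp0, hp0.not_gt]
    · exact (single_le_sum (f := fun k => ‖c i - c k‖ₑ ^ p) (fun _ _ => zero_le)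
        (mem_univ k)).trans (single_le_sum
          (f := fun i => ∑ k, ‖c i - c k‖ₑ ^ p) (fun _ _ => zero_le) (mem_univ i))
  have hdisc : Tendsto (fun i => (∑ k, ((∫⁻ x, G k x ∂(μ i : Measure F)) -
      ∫⁻ x, G k x ∂(ν : Measure F))) * D) l (𝓝 0) := by
    have h1 : Tendsto (fun i => ∑ k, ((∫⁻ x, G k x ∂(μ i : Measure F)) -
      ∫⁻ x, G k x ∂(ν : Measure F))) l (𝓝 (∑ k : Fin (N + 1), 0)) := by
      refine tendsto_finsetSum _ fun k _ => ?_
      have hne : ∫⁻ x, G k x ∂(ν : Measure F) ≠ ⊤ := by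
        refine ne_top_of_le_ne_top one_ne_top ?_
        calc ∫⁻ x, G k x ∂(ν : Measure F) ≤ ∫⁻ x, 1 ∂(ν : Measure F) :=
              lintegral_mono fun x => by simpa [G] using hg1 k x
          _ = 1 := by simp
      have := ENNReal.Tendsto.sub (hbcf (g k) (hgc k) (hg0 k) (hg1 k))
        (tendsto_const_nhds (x := ∫⁻ x, G k x ∂(ν : Measure F))) (Or.inr hne)
      rwa [tsub_self] at this
    rw [sum_const_zero] at h1
    have := ENNReal.Tendsto.mul_const h1 (Or.inr hDt)
    rwa [zero_mul] at this
  have hrN := ENNReal.Tendsto.const_mul (hbcf (r N) (hrc N) (hr0 N) (hr1 N)) (Or.inr hAp0)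
  filter_upwards [hdisc.eventually_le_const (pos_iff_ne_zero.2 hη0),
    hrN.eventually_lt_const hN, hμ] with i hi1 hi2 hi3
  have : IsProbabilityMeasure (quantize G c (μ i : Measure F)) :=
    quantize_isProbabilityMeasure hGm hGsum c _
  have : IsProbabilityMeasure (quantize G c (ν : Measure F)) :=
    quantize_isProbabilityMeasure hGm hGsum c _
  have hs : ∀ m : ProbabilityMeasure F, ∑ k, ∫⁻ x, G k x ∂(m : Measure F) = 1 := by
    intro m
    rw [← lintegral_finsetSum _ fun k _ => hGm k]
    simp [hGsum]
  have t2 : wasserstein p (quantize G c (μ i : Measure F)) (quantize G c (ν : Measure F)) ≤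
      (3 * η) ^ (1 / p) := by
    refine (wasserstein_sum_dirac_le hp (hs _) (hs _) c hD).trans
      (rpow_le_rpow (hi1.trans ?_) (by positivity))
    calc η = 1 * η := (one_mul _).symm
      _ ≤ 3 * η := by gcongr; norm_num
  have t1 := hcost (μ i) hi3 hi2
  have t3 := hcost ν hν hN
  rw [wasserstein_comm hp] at t3
  calc wasserstein p (μ i : Measure F) (ν : Measure F)
      ≤ wasserstein p (μ i : Measure F) (quantize G c (μ i : Measure F)) +
        wasserstein p (quantize G c (μ i : Measure F)) (ν : Measure F) :=
        wasserstein_triangle hp _ _ _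
    _ ≤ wasserstein p (μ i : Measure F) (quantize G c (μ i : Measure F)) +
        (wasserstein p (quantize G c (μ i : Measure F)) (quantize G c (ν : Measure F)) +
          wasserstein p (quantize G c (ν : Measure F)) (ν : Measure F)) := by
        gcongr
        exact wasserstein_triangle hp _ _ _
    _ ≤ (3 * η) ^ (1 / p) + ((3 * η) ^ (1 / p) + (3 * η) ^ (1 / p)) := by gcongr
    _ = 3 * (3 * η) ^ (1 / p) := by ring
    _ ≤ ε' := hη

end Quantization

section PathTopology

variable {d : ℕ}

/-- A path on `[0, T]`, extended by its value at `T`. -/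
def extendPath (T : ℝ≥0) (y : C(Set.Icc (0 : ℝ≥0) T, State d)) : PathSpace d :=
  y.comp ⟨Set.projIcc 0 T zero_le, continuous_projIcc⟩

lemma continuous_extendPath (T : ℝ≥0) : Continuous (extendPath (d := d) T) :=
  ContinuousMap.continuous_precomp _

/-- The path stopped at time `T`. -/
def stopPath (T : ℝ≥0) (x : PathSpace d) : PathSpace d := extendPath T (restrictPath T x)

lemma stopPath_apply_of_le {T t : ℝ≥0} (h : t ≤ T) (x : PathSpace d) : stopPath T x t = x t := by
  change x (Set.projIcc 0 T zero_le t : ℝ≥0) = x t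
  rw [Set.projIcc_of_mem _ ⟨zero_le, h⟩]

lemma continuous_stopPath (T : ℝ≥0) : Continuous (stopPath (d := d) T) :=
  (continuous_extendPath T).comp (continuous_restrictPath T)

lemma tendsto_stopPath (x : PathSpace d) :
    Tendsto (fun n : ℕ => stopPath ((n : ℝ≥0) + 1) x) atTop (𝓝 x) := by
  refine ContinuousMap.tendsto_iff_forall_isCompact_tendstoUniformlyOn.2 fun K hK => ?_
  obtain ⟨B, hB⟩ := hK.bddAbove
  obtain ⟨N, hN⟩ := exists_nat_ge B
  intro u hu
  filter_upwards [eventually_ge_atTop N] with n hn t ht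
  have : t ≤ (n : ℝ≥0) + 1 :=
    (hB ht).trans (hN.trans ((Nat.cast_le.2 hn).trans le_self_add))
  rw [stopPath_apply_of_le this]
  exact refl_mem_uniformity hu

lemma norm_restrictPath_le {T : ℝ≥0} {x : PathSpace d} {B : ℝ} (hB : 0 ≤ B)
    (h : ∀ t ≤ T, ‖x t‖ ≤ B) : ‖restrictPath T x‖ ≤ B :=
  (ContinuousMap.norm_le _ hB).2 fun t => h t t.2.2

lemma norm_le_norm_restrictPath {T t : ℝ≥0} (h : t ≤ T) (x : PathSpace d) :
    ‖x t‖ ≤ ‖restrictPath T x‖ :=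
  ContinuousMap.norm_coe_le_norm (restrictPath T x) ⟨t, zero_le, h⟩

lemma iSup_enorm_rpow_eq {p : ℝ} (hp : 1 ≤ p) (T : ℝ≥0) (x : PathSpace d) :
    (⨆ (t : ℝ≥0) (_ : t ≤ T), ‖x t‖ₑ ^ p) = ‖restrictPath T x‖ₑ ^ p := by
  have hp0 : 0 < p := by linarith
  refine le_antisymm (iSup₂_le fun t ht => rpow_le_rpow ?_ hp0.le) ?_
  · rw [← ofReal_norm, ← ofReal_norm]
    exact ofReal_le_ofReal (norm_le_norm_restrictPath ht x)
  · have hne : (Set.univ : Set (Set.Icc (0 : ℝ≥0) T)).Nonempty := ⟨⟨0, le_rfl, zero_le⟩, trivial⟩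
    obtain ⟨t, -, ht⟩ := isCompact_univ.exists_isMaxOn hne
      (restrictPath T x).continuous.norm.continuousOn
    refine le_iSup₂_of_le (f := fun (t : ℝ≥0) (_ : t ≤ T) => ‖x t‖ₑ ^ p) t.1 t.2.2
      (rpow_le_rpow ?_ hp0.le)
    rw [← ofReal_norm, ← ofReal_norm]
    refine ofReal_le_ofReal ((ContinuousMap.norm_le _ (norm_nonneg _)).2 fun s => ?_)
    exact ht (Set.mem_univ s)

end PathTopology

section PathWSpace

variable {p : ℝ} [hp : Fact (1 ≤ p)] {d : ℕ}

lemma wasserstein_restrict_mono (ρ ρ' : PathWSpace p d) {S T : ℝ≥0} (h : S ≤ T) :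
    wasserstein p (ρ.restrict S) (ρ'.restrict S) ≤
      wasserstein p (ρ.restrict T) (ρ'.restrict T) := by
  let j : C(Set.Icc (0 : ℝ≥0) S, Set.Icc (0 : ℝ≥0) T) :=
    ⟨fun t => ⟨t.1, t.2.1, t.2.2.trans h⟩, by fun_prop⟩
  let f : C(Set.Icc (0 : ℝ≥0) T, State d) → C(Set.Icc (0 : ℝ≥0) S, State d) := fun y => y.comp j
  have hf : Continuous f := ContinuousMap.continuous_precomp _
  have e : ∀ r : PathWSpace p d, r.restrict S = (r.restrict T).map f := by
    intro r
    simp only [PathWSpace.restrict]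
    rw [Measure.map_map hf.measurable (continuous_restrictPath T).measurable]
    rfl
  rw [e, e]
  refine wasserstein_map_le_of_nonexpansive hp.out _ _ hf.measurable fun x y => ?_
  refine (ContinuousMap.norm_le _ (norm_nonneg _)).2 fun t => ?_
  exact ContinuousMap.norm_coe_le_norm (x - y) (j t)

lemma PathWSpace.edist_le (ρ ρ' : PathWSpace p d) (N : ℕ) :
    edist ρ ρ' ≤ wasserstein p (ρ.restrict N) (ρ'.restrict N) + (2 : ℝ≥0∞)⁻¹ ^ N := by
  change pathWasserstein ρ ρ' ≤ _
  rw [pathWasserstein, ← summable.sum_add_tsum_nat_add' (k := N)]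
  have hg : ∑' n : ℕ, (2 : ℝ≥0∞)⁻¹ ^ (n + 1) = 1 := by
    simp_rw [pow_succ]
    rw [ENNReal.tsum_mul_right, ENNReal.tsum_geometric, ENNReal.one_sub_inv_two, inv_inv]
    exact ENNReal.mul_inv_cancel (by simp) (by simp)
  refine add_le_add ?_ ?_
  · calc ∑ n ∈ range N, (2 : ℝ≥0∞)⁻¹ ^ (n + 1) *
          min 1 (wasserstein p (ρ.restrict ((n : ℝ≥0) + 1)) (ρ'.restrict ((n : ℝ≥0) + 1)))
        ≤ ∑ n ∈ range N, (2 : ℝ≥0∞)⁻¹ ^ (n + 1) *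
          wasserstein p (ρ.restrict N) (ρ'.restrict N) := by
          refine sum_le_sum fun n hn => ?_
          gcongr
          refine (min_le_right _ _).trans (wasserstein_restrict_mono _ _ ?_)
          exact_mod_cast mem_range.1 hn
      _ = (∑ n ∈ range N, (2 : ℝ≥0∞)⁻¹ ^ (n + 1)) *
          wasserstein p (ρ.restrict N) (ρ'.restrict N) := by rw [sum_mul]
      _ ≤ 1 * wasserstein p (ρ.restrict N) (ρ'.restrict N) := by
          gcongr
          rw [← hg]
          exact sum_le_tsum _
      _ = _ := one_mul _
  · calc ∑' n : ℕ, (2 : ℝ≥0∞)⁻¹ ^ (n + N + 1) * min 1 (wasserstein p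
          (ρ.restrict (((n + N : ℕ) : ℝ≥0) + 1)) (ρ'.restrict (((n + N : ℕ) : ℝ≥0) + 1)))
        ≤ ∑' n : ℕ, (2 : ℝ≥0∞)⁻¹ ^ (n + 1) * (2 : ℝ≥0∞)⁻¹ ^ N := by
          refine tsum_le_tsum fun n => ?_
          rw [← pow_add, add_right_comm n 1 N]
          calc _ ≤ (2 : ℝ≥0∞)⁻¹ ^ (n + N + 1) * 1 := by gcongr; exact min_le_left _ _
            _ = _ := mul_one _
      _ = _ := by rw [ENNReal.tsum_mul_right, hg, one_mul]

lemma PathWSpace.tendsto_wasserstein_restrict {ι : Type*} {l : Filter ι}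
    {ρ : ι → PathWSpace p d} {ρ₀ : PathWSpace p d} (h : Tendsto ρ l (𝓝 ρ₀)) (T : ℝ≥0) :
    Tendsto (fun i => wasserstein p ((ρ i).restrict T) (ρ₀.restrict T)) l (𝓝 0) := by
  have h' := tendsto_iff_edist_tendsto_0.1 h
  obtain ⟨N, hN⟩ := exists_nat_ge T
  refine tendsto_nhds_zero.2 fun ε hε => ?_
  have h2 : (2 : ℝ≥0∞)⁻¹ ^ (N + 1) ≠ 0 := by simp
  have hpos : 0 < (2 : ℝ≥0∞)⁻¹ ^ (N + 1) * min ε 2⁻¹ :=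
    ENNReal.mul_pos h2 (by simp [hε.ne'])
  filter_upwards [h'.eventually_lt_const hpos] with i hi
  have h3 : (2 : ℝ≥0∞)⁻¹ ^ (N + 1) * min 1 (wasserstein p ((ρ i).restrict ((N : ℝ≥0) + 1))
      (ρ₀.restrict ((N : ℝ≥0) + 1))) ≤ edist (ρ i) ρ₀ := le_tsum N
  have h4 := h3.trans_lt hi
  have h5 := (ENNReal.mul_lt_mul_iff_right h2 (by simp)).1 h4
  have h6 : wasserstein p ((ρ i).restrict ((N : ℝ≥0) + 1)) (ρ₀.restrict ((N : ℝ≥0) + 1)) ≤ ε := by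
    rcases min_lt_iff.1 h5 with h7 | h7
    · exact absurd (h7.trans_le (min_le_right _ _)) (by simp)
    · exact h7.le.trans (min_le_left _ _)
  exact (wasserstein_restrict_mono _ _ (hN.trans le_self_add)).trans h6

lemma PathWSpace.tendsto_of_tendsto_wasserstein {ι : Type*} {l : Filter ι}
    {ρ : ι → PathWSpace p d} {ρ₀ : PathWSpace p d}
    (h : ∀ N : ℕ, Tendsto (fun i => wasserstein p ((ρ i).restrict N) (ρ₀.restrict N)) l (𝓝 0)) :
    Tendsto ρ l (𝓝 ρ₀) := by
  rw [tendsto_iff_edist_tendsto_0]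
  refine tendsto_nhds_zero.2 fun ε hε => ?_
  have h1 : Tendsto (fun N : ℕ => (2 : ℝ≥0∞)⁻¹ ^ N) atTop (𝓝 0) :=
    ENNReal.tendsto_pow_atTop_nhds_zero_of_lt_one (by simp)
  have hε2 : 0 < ε / 2 := ENNReal.half_pos hε.ne'
  obtain ⟨N, hN⟩ := (h1.eventually_le_const hε2).exists
  filter_upwards [(h N).eventually_le_const hε2] with i hi
  calc _ ≤ _ := PathWSpace.edist_le (ρ i) ρ₀ N
    _ ≤ ε / 2 + ε / 2 := add_le_add hi hN
    _ = ε := ENNReal.add_halves ε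

lemma PathWSpace.integral_stopPath (ρ : PathWSpace p d) (T : ℝ≥0) {f : PathSpace d → ℝ}
    (hf : Continuous f) :
    ∫ x, f (stopPath T x) ∂ρ.toMeasure = ∫ y, f (extendPath T y) ∂ρ.restrict T := by
  have h : Continuous fun y => f (extendPath T y) := hf.comp (continuous_extendPath T)
  rw [PathWSpace.restrict, integral_map (continuous_restrictPath T).measurable.aemeasurable
    h.aestronglyMeasurable]
  rfl

/-- Integrals, against laws of paths that converge in the Wasserstein distance, of functions that
depend continuously on the path up to time `T` and on a parameter. -/
lemma PathWSpace.tendsto_integral {ι Z : Type*} {l : Filter ι} [TopologicalSpace Z]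
    [FirstCountableTopology Z] {ρ : ι → PathWSpace p d} {ρ₀ : PathWSpace p d}
    (h : Tendsto ρ l (𝓝 ρ₀)) {z : ι → Z} {z₀ : Z} (hz : Tendsto z l (𝓝 z₀))
    {f : PathSpace d → Z → ℝ} (hf : Continuous (Function.uncurry f)) {M : ℝ} (T : ℝ≥0)
    (hM : ∀ᶠ w in 𝓝 z₀, ∀ x, |f x w| ≤ M) (hT : ∀ᶠ w in 𝓝 z₀, ∀ x, f (stopPath T x) w = f x w) :
    Tendsto (fun i => ∫ x, f x (z i) ∂(ρ i).toMeasure) l (𝓝 (∫ x, f x z₀ ∂ρ₀.toMeasure)) := by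
  have hfz : ∀ w, Continuous fun x => f x w := fun w =>
    hf.comp (continuous_id.prodMk continuous_const)
  have h1 := tendsto_integral_of_tendsto_wasserstein hp.out
    (PathWSpace.tendsto_wasserstein_restrict h T) hz
    (f := fun y w => f (extendPath T y) w)
    (hf.comp (((continuous_extendPath T).comp continuous_fst).prodMk continuous_snd))
    (M := M) (hM.mono fun w hw y => hw _)
  have h2 : ∫ x, f x z₀ ∂ρ₀.toMeasure = ∫ y, f (extendPath T y) z₀ ∂ρ₀.restrict T := by
    rw [← PathWSpace.integral_stopPath ρ₀ T (hfz z₀)]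
    exact integral_congr_ae (ae_of_all _ fun x => (hT.self_of_nhds x).symm)
  rw [h2]
  refine h1.congr' ?_
  filter_upwards [hz.eventually hT] with i hi
  rw [← PathWSpace.integral_stopPath (ρ i) T (hfz _)]
  exact integral_congr_ae (ae_of_all _ fun x => hi x)

instance : T0Space (PathWSpace p d) := by
  refine (t0Space_iff_inseparable _).2 fun ρ ρ' h => ?_
  have hc : Tendsto (fun _ : ℕ => ρ) atTop (𝓝 ρ') := by
    rw [← h.nhds_eq]
    exact tendsto_const_nhds
  have hm : ρ.toMeasure = ρ'.toMeasure := by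
    refine ext_of_forall_integral_eq_of_IsFiniteMeasure fun f => ?_
    have hb : ∀ x, |f x| ≤ ‖f‖ := fun x => by
      rw [← norm_eq_abs]; exact f.norm_coe_le_norm x
    have hlim : ∀ r : PathWSpace p d, Tendsto (fun n : ℕ => ∫ x, f (stopPath ((n : ℝ≥0) + 1) x)
        ∂r.toMeasure) atTop (𝓝 (∫ x, f x ∂r.toMeasure)) := by
      intro r
      refine tendsto_integral_of_dominated_convergence (fun _ => ‖f‖)
        (fun n => (f.continuous.comp (continuous_stopPath _)).aestronglyMeasurable)
        (integrable_const _) (fun n => ae_of_all _ fun x => f.norm_coe_le_norm _)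
        (ae_of_all _ fun x => (f.continuous.tendsto x).comp (tendsto_stopPath x))
    refine tendsto_nhds_unique (hlim ρ) ((hlim ρ').congr fun n => ?_)
    have hfc : Continuous fun x => f (stopPath ((n : ℝ≥0) + 1) x) :=
      f.continuous.comp (continuous_stopPath _)
    have h1 := PathWSpace.tendsto_integral hc (z := fun _ => ()) (z₀ := ())
      tendsto_const_nhds (f := fun x _ => f (stopPath ((n : ℝ≥0) + 1) x)) (M := ‖f‖)
      (hfc.comp continuous_fst) ((n : ℝ≥0) + 1)
      (Eventually.of_forall fun _ x => hb _) (Eventually.of_forall fun _ x => by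
        congr 1
        ext t : 1
        change stopPath _ x (Set.projIcc 0 _ zero_le t : ℝ≥0) = stopPath _ x t
        rw [stopPath_apply_of_le (Set.projIcc 0 _ zero_le t).2.2]
        rfl)
    exact tendsto_nhds_unique h1 tendsto_const_nhds
  exact PathWSpace.ext hm

instance : MeasurableSpace (PathWSpace p d) := borel _

instance : BorelSpace (PathWSpace p d) := ⟨rfl⟩

lemma shiftPath_apply (t s : ℝ≥0) (x : PathSpace d) : shiftPath t x s = x (t + s) := rfl

lemma PathWSpace.shift_shift (s t : ℝ≥0) (ρ : PathWSpace p d) :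
    (ρ.shift s).shift t = ρ.shift (s + t) := by
  refine PathWSpace.ext ?_
  simp only [PathWSpace.shift]
  rw [Measure.map_map (continuous_shiftPath t).measurable (continuous_shiftPath s).measurable]
  congr 1
  funext x
  ext u : 1
  simp [shiftPath_apply, add_assoc]

lemma PathWSpace.continuous_shift (t : ℝ≥0) :
    Continuous (PathWSpace.shift t : PathWSpace p d → PathWSpace p d) := by
  refine continuous_iff_continuousAt.2 fun ρ₀ =>
    PathWSpace.tendsto_of_tendsto_wasserstein fun N => ?_
  let j : C(Set.Icc (0 : ℝ≥0) N, Set.Icc (0 : ℝ≥0) (t + N)) :=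
    ⟨fun s => ⟨t + s.1, zero_le, by gcongr; exact s.2.2⟩, by fun_prop⟩
  let f : C(Set.Icc (0 : ℝ≥0) (t + N), State d) → C(Set.Icc (0 : ℝ≥0) N, State d) :=
    fun y => y.comp j
  have hf : Continuous f := ContinuousMap.continuous_precomp _
  have e : ∀ r : PathWSpace p d, (r.shift t).restrict N = (r.restrict (t + N)).map f := by
    intro r
    simp only [PathWSpace.restrict, PathWSpace.shift]
    rw [Measure.map_map hf.measurable (continuous_restrictPath _).measurable,
      Measure.map_map (continuous_restrictPath _).measurable (continuous_shiftPath t).measurable]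
    rfl
  refine tendsto_of_tendsto_of_tendsto_of_le_of_le tendsto_const_nhds
    (PathWSpace.tendsto_wasserstein_restrict (tendsto_id (x := 𝓝 ρ₀)) (t + N))
    (fun _ => zero_le) fun ρ => ?_
  rw [e, e]
  refine wasserstein_map_le_of_nonexpansive hp.out _ _ hf.measurable fun x y => ?_
  refine (ContinuousMap.norm_le _ (norm_nonneg _)).2 fun s => ?_
  exact ContinuousMap.norm_coe_le_norm (x - y) (j s)

lemma wasserstein_marginal_le (ρ ρ' : PathWSpace p d) {t T : ℝ≥0} (h : t ≤ T) :
    edist (ρ.marginal t) (ρ'.marginal t) ≤ wasserstein p (ρ.restrict T) (ρ'.restrict T) := by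
  let f : C(Set.Icc (0 : ℝ≥0) T, State d) → State d := fun y => y ⟨t, zero_le, h⟩
  have hf : Continuous f := continuous_eval_const _
  have e : ∀ r : PathWSpace p d, (r.marginal t).toMeasure = (r.restrict T).map f := by
    intro r
    simp only [PathWSpace.restrict, PathWSpace.marginal]
    rw [Measure.map_map hf.measurable (continuous_restrictPath T).measurable]
    rfl
  change wasserstein p _ _ ≤ _
  rw [e, e]
  refine wasserstein_map_le_of_nonexpansive hp.out _ _ hf.measurable fun x y => ?_
  exact ContinuousMap.norm_coe_le_norm (x - y) _

lemma PathWSpace.continuous_marginal :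
    Continuous fun z : ℝ≥0 × PathWSpace p d => z.2.marginal z.1 := by
  have hp0 : 0 < p := by linarith [hp.out]
  refine continuous_iff_continuousAt.2 fun z₀ => ?_
  obtain ⟨t₀, ρ₀⟩ := z₀
  change Tendsto _ _ _
  rw [tendsto_iff_edist_tendsto_0]
  set T : ℝ≥0 := t₀ + 1
  have h1 : Tendsto (fun z : ℝ≥0 × PathWSpace p d =>
      wasserstein p (z.2.restrict T) (ρ₀.restrict T)) (𝓝 (t₀, ρ₀)) (𝓝 0) :=
    PathWSpace.tendsto_wasserstein_restrict (continuous_snd.tendsto (t₀, ρ₀)) T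
  have h2 : Tendsto (fun t : ℝ≥0 => (∫⁻ x, ‖x t - x t₀‖ₑ ^ p ∂ρ₀.toMeasure) ^ (1 / p))
      (𝓝 t₀) (𝓝 0) := by
    have h3 : Tendsto (fun t : ℝ≥0 => ∫⁻ x, ‖x t - x t₀‖ₑ ^ p ∂ρ₀.toMeasure) (𝓝 t₀)
        (𝓝 (∫⁻ x, 0 ∂ρ₀.toMeasure)) := by
      refine tendsto_lintegral_filter_of_dominated_convergence
        (fun x => 2 ^ p * ⨆ (t : ℝ≥0) (_ : t ≤ T), ‖x t‖ₑ ^ p)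
        (Eventually.of_forall fun t => ?_) ?_ ?_ ?_
      · have h4 := (continuous_eval_const (F := PathSpace d) t).measurable
        have h5 := (continuous_eval_const (F := PathSpace d) t₀).measurable
        exact (h4.sub h5).enorm.pow_const p
      · filter_upwards [Iio_mem_nhds (lt_add_one t₀ : t₀ < T)] with t ht
        refine ae_of_all _ fun x => ?_
        rw [iSup_enorm_rpow_eq hp.out, ← ENNReal.mul_rpow_of_nonneg _ _ hp0.le]
        refine rpow_le_rpow ?_ hp0.le
        calc ‖x t - x t₀‖ₑ ≤ ‖x t‖ₑ + ‖x t₀‖ₑ := enorm_sub_le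
          _ ≤ ‖restrictPath T x‖ₑ + ‖restrictPath T x‖ₑ := by
              refine add_le_add ?_ ?_
              · rw [← ofReal_norm, ← ofReal_norm]
                exact ofReal_le_ofReal (norm_le_norm_restrictPath (le_of_lt ht) x)
              · rw [← ofReal_norm, ← ofReal_norm]
                exact ofReal_le_ofReal (norm_le_norm_restrictPath le_self_add x)
          _ = 2 * ‖restrictPath T x‖ₑ := (two_mul _).symm
      · rw [lintegral_const_mul _ (measurable_iSup_enorm_rpow T)]
        refine mul_ne_top (rpow_ne_top_of_nonneg hp0.le (by simp)) ?_
        exact (ρ₀.moment_lt_top T (by positivity)).ne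
      · refine ae_of_all _ fun x => ?_
        have hc : Continuous fun t : ℝ≥0 => ‖x t - x t₀‖ₑ ^ p :=
          continuous_rpow_const.comp
            (continuous_enorm.comp (x.continuous.sub continuous_const))
        have := hc.tendsto t₀
        simpa [hp0] using this
    rw [lintegral_zero] at h3
    have h4 := (continuous_rpow_const (y := 1 / p)).tendsto 0 |>.comp h3
    simpa [hp0, Function.comp_def] using h4
  have h5 := h1.add (h2.comp (continuous_fst.tendsto (t₀, ρ₀)))
  rw [add_zero] at h5
  refine tendsto_of_tendsto_of_tendsto_of_le_of_le' tendsto_const_nhds h5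
    (Eventually.of_forall fun _ => zero_le) ?_
  filter_upwards [continuous_fst.tendsto (t₀, ρ₀) (Iio_mem_nhds (lt_add_one t₀ : t₀ < T))]
    with z hz
  refine (edist_triangle _ (ρ₀.marginal z.1) _).trans (add_le_add ?_ ?_)
  · exact wasserstein_marginal_le _ _ (le_of_lt hz)
  · exact wasserstein_map_map_le hp.out ρ₀.toMeasure (continuous_eval_const z.1).measurable
      (continuous_eval_const t₀).measurable

end PathWSpace

section Empirical

variable {p : ℝ} [hp : Fact (1 ≤ p)] {d : ℕ} {n : ℕ+}

lemma empirical_eq_map {A : Type*} [MeasurableSpace A] (x : Fin n → A) :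
    (n : ℝ≥0∞)⁻¹ • ∑ i, dirac (x i) = ((n : ℝ≥0∞)⁻¹ • ∑ i : Fin n, dirac i).map x := by
  rw [Measure.map_smul, Measure.map_finset_sum (measurable_of_finite x).aemeasurable]
  simp_rw [map_dirac' (measurable_of_finite x)]

lemma lintegral_uniform (f : Fin n → ℝ≥0∞) : ∫⁻ i, f i ∂((n : ℝ≥0∞)⁻¹ • ∑ i : Fin n, dirac i) =
      (n : ℝ≥0∞)⁻¹ * ∑ i, f i := by
  rw [lintegral_smul_measure, lintegral_finsetSum_measure]
  simp

lemma edist_empirical_le (x y : Fin n → State d) :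
    edist (empirical x : WSpace p (State d)) (empirical y) ≤
      ((n : ℝ≥0∞)⁻¹ * ∑ i, ‖x i - y i‖ₑ ^ p) ^ (1 / p) := by
  change wasserstein p ((n : ℝ≥0∞)⁻¹ • ∑ i, dirac (x i))
    ((n : ℝ≥0∞)⁻¹ • ∑ i, dirac (y i)) ≤ _
  rw [empirical_eq_map x, empirical_eq_map y]
  refine (wasserstein_map_map_le hp.out _ (measurable_of_finite _) (measurable_of_finite _)).trans ?_
  rw [lintegral_uniform fun i => ‖x i - y i‖ₑ ^ p]

lemma continuous_empirical :
    Continuous fun x : Fin n → State d => (empirical x : WSpace p (State d)) := by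
  have hp0 : 0 < p := by linarith [hp.out]
  refine continuous_iff_continuousAt.2 fun x₀ => ?_
  change Tendsto _ _ _
  rw [tendsto_iff_edist_tendsto_0]
  have hc : Continuous fun x : Fin n → State d =>
      ((n : ℝ≥0∞)⁻¹ * ∑ i, ‖x i - x₀ i‖ₑ ^ p) ^ (1 / p) := by
    refine continuous_rpow_const.comp (ENNReal.continuous_const_mul (by simp) |>.comp ?_)
    refine continuous_finsetSum _ fun i _ => continuous_rpow_const.comp ?_
    exact continuous_enorm.comp ((continuous_apply i).sub continuous_const)
  have := hc.tendsto x₀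
  simp only [sub_self, enorm_zero, zero_rpow_of_pos hp0, sum_const_zero, mul_zero,
    zero_rpow_of_pos (by positivity : 0 < 1 / p)] at this
  exact tendsto_of_tendsto_of_tendsto_of_le_of_le tendsto_const_nhds this (fun _ => zero_le)
    fun x => edist_empirical_le x x₀

/-- The empirical measure of finitely many paths. -/
def empiricalPath (x : Fin n → PathSpace d) : PathWSpace p d where
  toMeasure := (n : ℝ≥0∞)⁻¹ • ∑ i, dirac (x i)
  isProb := by
    constructor
    simp [ENNReal.inv_mul_cancel]
  moment_lt_top T _ := by
    have hp0 : 0 ≤ p := by linarith [hp.out]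
    rw [lintegral_smul_measure, lintegral_finsetSum_measure]
    refine ENNReal.mul_lt_top (by simp) (ENNReal.sum_lt_top.2 fun i _ => ?_)
    rw [lintegral_dirac' _ (measurable_iSup_enorm_rpow T), iSup_enorm_rpow_eq hp.out]
    exact ENNReal.rpow_lt_top_of_nonneg hp0 (by simp)

lemma lintegral_empiricalPath (x : Fin n → PathSpace d) {f : PathSpace d → ℝ≥0∞} (hf : Measurable f)
    : ∫⁻ y, f y ∂(empiricalPath x : PathWSpace p d).toMeasure = (n : ℝ≥0∞)⁻¹ * ∑ i, f (x i) := by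
  change ∫⁻ y, f y ∂((n : ℝ≥0∞)⁻¹ • ∑ i, dirac (x i)) = _
  rw [lintegral_smul_measure, lintegral_finsetSum_measure]
  simp [lintegral_dirac' _ hf]

lemma integral_empiricalPath (x : Fin n → PathSpace d) {f : PathSpace d → ℝ} (hf : Measurable f) :
    ∫ y, f y ∂(empiricalPath x : PathWSpace p d).toMeasure = (n : ℝ)⁻¹ * ∑ i, f (x i) := by
  change ∫ y, f y ∂((n : ℝ≥0∞)⁻¹ • ∑ i, dirac (x i)) = _
  rw [integral_smul_measure, integral_finsetSum_measure]
  · simp [integral_dirac' _ _ hf.stronglyMeasurable]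
  · intro i _
    exact (integrable_dirac' hf.stronglyMeasurable (by simp))

lemma integral_empirical (x : Fin n → State d) {f : State d → ℝ} :
    ∫ y, f y ∂(empirical x : WSpace p (State d)).toMeasure = (n : ℝ)⁻¹ * ∑ i, f (x i) := by
  change ∫ y, f y ∂((n : ℝ≥0∞)⁻¹ • ∑ i, dirac (x i)) = _
  rw [integral_smul_measure, integral_finsetSum_measure]
  · simp
  · intro i _
    exact integrable_dirac (by simp)

lemma integrable_empirical (x : Fin n → State d) (f : State d → ℝ) :
    Integrable f (empirical x : WSpace p (State d)).toMeasure := by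
  change Integrable f ((n : ℝ≥0∞)⁻¹ • ∑ i, dirac (x i))
  refine Integrable.smul_measure ?_ (by simp)
  exact integrable_finsetSum_measure.2 fun i _ => integrable_dirac (by simp)

lemma continuous_empiricalPath :
    Continuous fun x : Fin n → PathSpace d => (empiricalPath x : PathWSpace p d) := by
  have hp0 : 0 < p := by linarith [hp.out]
  refine continuous_iff_continuousAt.2 fun x₀ =>
    PathWSpace.tendsto_of_tendsto_wasserstein fun N => ?_
  have hr : ∀ x : Fin n → PathSpace d, (empiricalPath x : PathWSpace p d).restrict N =
      ((n : ℝ≥0∞)⁻¹ • ∑ i : Fin n, dirac i).map fun i => restrictPath N (x i) := by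
    intro x
    rw [← empirical_eq_map]
    change Measure.map _ ((n : ℝ≥0∞)⁻¹ • ∑ i, dirac (x i)) = _
    rw [Measure.map_smul,
      Measure.map_finset_sum (continuous_restrictPath _).measurable.aemeasurable]
    simp_rw [map_dirac' (continuous_restrictPath _).measurable]
  have hc : Continuous fun x : Fin n → PathSpace d => ((n : ℝ≥0∞)⁻¹ *
      ∑ i, ‖restrictPath N (x i) - restrictPath N (x₀ i)‖ₑ ^ p) ^ (1 / p) := by
    refine continuous_rpow_const.comp (ENNReal.continuous_const_mul (by simp) |>.comp ?_)
    refine continuous_finsetSum _ fun i _ => continuous_rpow_const.comp ?_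
    exact continuous_enorm.comp
      (((continuous_restrictPath _).comp (continuous_apply i)).sub continuous_const)
  have := hc.tendsto x₀
  have hz : ∀ i, ‖restrictPath N (x₀ i) - restrictPath N (x₀ i)‖ₑ = 0 := fun i => by
    rw [← ofReal_norm, sub_self, norm_zero, ENNReal.ofReal_zero]
  simp only [hz, zero_rpow_of_pos hp0, sum_const_zero, mul_zero,
    zero_rpow_of_pos (by positivity : 0 < 1 / p)] at this
  refine tendsto_of_tendsto_of_tendsto_of_le_of_le tendsto_const_nhds this (fun _ => zero_le)
    fun x => ?_
  rw [hr, hr]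
  refine (wasserstein_map_map_le hp.out _ (measurable_of_finite _)
    (measurable_of_finite _)).trans ?_
  rw [lintegral_uniform fun i => ‖restrictPath N (x i) - restrictPath N (x₀ i)‖ₑ ^ p]

lemma marginal_empiricalPath (x : Fin n → PathSpace d) (t : ℝ≥0) :
    (empiricalPath x : PathWSpace p d).marginal t = empirical fun i => x i t := by
  refine WSpace.ext ?_
  have hm := (continuous_eval_const (F := PathSpace d) t).measurable
  change Measure.map _ ((n : ℝ≥0∞)⁻¹ • ∑ i, dirac (x i)) =
    (n : ℝ≥0∞)⁻¹ • ∑ i, dirac (x i t)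
  rw [Measure.map_smul, Measure.map_finset_sum hm.aemeasurable]
  simp_rw [map_dirac' hm]

lemma shift_empiricalPath (x : Fin n → PathSpace d) (t : ℝ≥0) :
    (empiricalPath x : PathWSpace p d).shift t = empiricalPath fun i => shiftPath t (x i) := by
  refine PathWSpace.ext ?_
  have hm := (continuous_shiftPath (d := d) t).measurable
  change Measure.map _ ((n : ℝ≥0∞)⁻¹ • ∑ i, dirac (x i)) =
    (n : ℝ≥0∞)⁻¹ • ∑ i, dirac (shiftPath t (x i))
  rw [Measure.map_smul, Measure.map_finset_sum hm.aemeasurable]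
  simp_rw [map_dirac' hm]

end Empirical

section Chaining

variable {V : Type*} [NormedAddCommGroup V]

/-- The `i`-th dyadic increment of order `k` of a function on `[0, ∞)`. -/
def dyadicIncrement (y : ℝ≥0 → V) (k i : ℕ) : V :=
  y (((i : ℝ≥0) + 1) / 2 ^ k) - y ((i : ℝ≥0) / 2 ^ k)

/-- The largest dyadic number of order `k` below `t`. -/
def dyadicFloor (k : ℕ) (t : ℝ≥0) : ℝ≥0 := (⌊t * 2 ^ k⌋₊ : ℝ≥0) / 2 ^ k

lemma dyadicFloor_le (k : ℕ) (t : ℝ≥0) : dyadicFloor k t ≤ t := by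
  rw [dyadicFloor, div_le_iff₀ (by positivity)]
  exact Nat.floor_le zero_le

lemma lt_dyadicFloor_add (k : ℕ) (t : ℝ≥0) : t < dyadicFloor k t + (1 / 2) ^ k := by
  have : dyadicFloor k t + (1 / 2) ^ k = ((⌊t * 2 ^ k⌋₊ : ℝ≥0) + 1) / 2 ^ k := by
    rw [dyadicFloor, add_div, one_div, inv_pow, one_div]
  rw [this, lt_div_iff₀ (by positivity)]
  exact Nat.lt_floor_add_one _

lemma tendsto_dyadicFloor (t : ℝ≥0) : Tendsto (fun k => dyadicFloor k t) atTop (𝓝 t) := by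
  have h1 : Tendsto (fun k : ℕ => ((1 : ℝ) / 2) ^ k) atTop (𝓝 0) :=
    tendsto_pow_atTop_nhds_zero_of_lt_one (by norm_num) (by norm_num)
  rw [tendsto_iff_dist_tendsto_zero]
  refine squeeze_zero (fun _ => dist_nonneg) (fun k => ?_) h1
  rw [NNReal.dist_eq, abs_sub_comm, abs_of_nonneg]
  · have := (NNReal.coe_lt_coe.2 (lt_dyadicFloor_add k t)).le
    push_cast at this
    linarith
  · have := NNReal.coe_le_coe.2 (dyadicFloor_le k t)
    linarith

lemma norm_dyadicFloor_succ_sub_le {y : ℝ≥0 → V} {b : ℕ → ℝ} (hb0 : ∀ k, 0 ≤ b k) {m : ℕ}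
    (hb : ∀ k i, i < m * 2 ^ k → ‖dyadicIncrement y k i‖ ≤ b k) {t : ℝ≥0} (ht : t < m) (k : ℕ) :
    ‖y (dyadicFloor (k + 1) t) - y (dyadicFloor k t)‖ ≤ b (k + 1) := by
  set i := ⌊t * 2 ^ k⌋₊ with hi
  have h1 : (i : ℝ≥0) ≤ t * 2 ^ k := Nat.floor_le zero_le
  have h2 : t * 2 ^ k < i + 1 := Nat.lt_floor_add_one _
  have e0 : dyadicFloor k t = ((2 * i : ℕ) : ℝ≥0) / 2 ^ (k + 1) := by
    rw [dyadicFloor, ← hi, pow_succ]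
    push_cast
    field_simp
  have h3 : 2 * i ≤ ⌊t * 2 ^ (k + 1)⌋₊ := by
    refine Nat.le_floor ?_
    push_cast
    calc (2 : ℝ≥0) * i ≤ 2 * (t * 2 ^ k) := by gcongr
      _ = t * 2 ^ (k + 1) := by rw [pow_succ]; ring
  have h4 : ⌊t * 2 ^ (k + 1)⌋₊ < 2 * i + 2 := by
    rw [Nat.floor_lt zero_le]
    push_cast
    calc t * 2 ^ (k + 1) = 2 * (t * 2 ^ k) := by rw [pow_succ]; ring
      _ < 2 * (i + 1) := by gcongr
      _ = 2 * i + 2 := by ring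
  have h5 : ⌊t * 2 ^ (k + 1)⌋₊ = 2 * i ∨ ⌊t * 2 ^ (k + 1)⌋₊ = 2 * i + 1 := by omega
  rcases h5 with h5 | h5
  · rw [e0, dyadicFloor, h5, sub_self, norm_zero]
    exact hb0 _
  · have h6 : 2 * i < m * 2 ^ (k + 1) := by
      have : (i : ℝ≥0) < m * 2 ^ k := h1.trans_lt (by gcongr)
      have : i < m * 2 ^ k := by exact_mod_cast this
      rw [pow_succ, ← mul_assoc]
      omega
    have := hb (k + 1) (2 * i) h6
    rw [dyadicIncrement] at this
    rw [e0, dyadicFloor, h5]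
    push_cast at this ⊢
    exact this

lemma norm_sub_dyadicFloor_le {y : ℝ≥0 → V} (hy : Continuous y) {b : ℕ → ℝ} (hb0 : ∀ k, 0 ≤ b k)
    (hbs : Summable b) {m : ℕ} (hb : ∀ k i, i < m * 2 ^ k → ‖dyadicIncrement y k i‖ ≤ b k) {t : ℝ≥0}
    (ht : t < m) (k : ℕ) : ‖y t - y (dyadicFloor k t)‖ ≤ ∑' j, b (j + k + 1) := by
  have h1 := dist_le_tsum_of_dist_le_of_tendsto (f := fun j => y (dyadicFloor (j + k) t))
    (fun j => b (j + k + 1)) (fun j => ?_) ?_ (a := y t) ?_ 0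
  · simp only [zero_add] at h1
    rwa [dist_comm, dist_eq_norm] at h1
  · rw [dist_comm, dist_eq_norm, Nat.succ_eq_add_one, add_right_comm]
    exact norm_dyadicFloor_succ_sub_le hb0 hb ht _
  · exact (summable_nat_add_iff (k + 1)).2 hbs
  · exact ((hy.tendsto t).comp (tendsto_dyadicFloor t)).comp (tendsto_add_atTop_nat k)

/-- The modulus of continuity is controlled by the dyadic increments. -/
lemma norm_sub_le_of_dyadicIncrement {y : ℝ≥0 → V} (hy : Continuous y) {b : ℕ → ℝ}
    (hb0 : ∀ k, 0 ≤ b k) (hbs : Summable b) {m : ℕ}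
    (hb : ∀ k i, i < m * 2 ^ k → ‖dyadicIncrement y k i‖ ≤ b k) {s t : ℝ≥0} (hst : s ≤ t)
    (ht : t < m) {k : ℕ} (hk : t ≤ s + (1 / 2) ^ k) : ‖y t - y s‖ ≤ 2 * ∑' j, b (j + k) := by
  have h1 := norm_sub_dyadicFloor_le hy hb0 hbs hb ht k
  have h2 := norm_sub_dyadicFloor_le hy hb0 hbs hb (hst.trans_lt ht) k
  have h3 : ‖y (dyadicFloor k t) - y (dyadicFloor k s)‖ ≤ b k := by
    have h4 : ⌊s * 2 ^ k⌋₊ ≤ ⌊t * 2 ^ k⌋₊ := Nat.floor_le_floor (by gcongr)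
    have h5 : ⌊t * 2 ^ k⌋₊ < ⌊s * 2 ^ k⌋₊ + 2 := by
      rw [Nat.floor_lt zero_le]
      push_cast
      calc t * 2 ^ k ≤ (s + (1 / 2) ^ k) * 2 ^ k := by gcongr
        _ = s * 2 ^ k + 1 := by
          rw [add_mul, ← mul_pow]
          simp
        _ < (⌊s * 2 ^ k⌋₊ + 1) + 1 := by gcongr; exact Nat.lt_floor_add_one _
        _ = _ := by ring
    have h6 : ⌊t * 2 ^ k⌋₊ = ⌊s * 2 ^ k⌋₊ ∨ ⌊t * 2 ^ k⌋₊ = ⌊s * 2 ^ k⌋₊ + 1 := by omega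
    rcases h6 with h6 | h6
    · rw [dyadicFloor, dyadicFloor, h6, sub_self, norm_zero]
      exact hb0 k
    · have h7 : ⌊s * 2 ^ k⌋₊ < m * 2 ^ k := by
        rw [Nat.floor_lt zero_le]
        push_cast
        gcongr
        exact hst.trans_lt ht
      have := hb k _ h7
      rw [dyadicIncrement] at this
      rw [dyadicFloor, dyadicFloor, h6]
      push_cast at this ⊢
      exact this
  have h8 : ∑' j, b (j + k) = b k + ∑' j, b (j + k + 1) := by
    rw [((summable_nat_add_iff k).2 hbs).tsum_eq_zero_add]
    simp only [zero_add, add_right_comm]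
  have h9 : y t - y s = (y t - y (dyadicFloor k t)) +
      (y (dyadicFloor k t) - y (dyadicFloor k s)) - (y s - y (dyadicFloor k s)) := by abel
  rw [h9, h8]
  refine (norm_sub_le _ _).trans ?_
  have := norm_add_le (y t - y (dyadicFloor k t)) (y (dyadicFloor k t) - y (dyadicFloor k s))
  have := hb0 k
  linarith

lemma norm_sub_zero_le_of_dyadicIncrement {y : ℝ≥0 → V} (hy : Continuous y) {b : ℕ → ℝ}
    (hb0 : ∀ k, 0 ≤ b k) (hbs : Summable b) {m : ℕ}
    (hb : ∀ k i, i < m * 2 ^ k → ‖dyadicIncrement y k i‖ ≤ b k) {t : ℝ≥0} (ht : t < m) :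
    ‖y t - y 0‖ ≤ (m + 1) * ∑' j, b j := by
  have h1 := norm_sub_dyadicFloor_le hy hb0 hbs hb ht 0
  have e : dyadicFloor 0 t = (⌊t⌋₊ : ℝ≥0) := by simp [dyadicFloor]
  have h2 : ∀ N : ℕ, N ≤ m → ‖y N - y 0‖ ≤ N * b 0 := by
    intro N
    induction N with
    | zero => simp
    | succ N ih =>
      intro hN
      have h3 := hb 0 N (by omega)
      rw [dyadicIncrement] at h3
      simp only [pow_zero, div_one] at h3
      have h4 := ih (by omega)
      have h5 : y ((N + 1 : ℕ) : ℝ≥0) - y 0 = (y ((N : ℝ≥0) + 1) - y N) + (y N - y 0) := by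
        push_cast; abel
      rw [h5]
      push_cast
      have := norm_add_le (y ((N : ℝ≥0) + 1) - y N) (y N - y 0)
      linarith
  have h3 : ⌊t⌋₊ ≤ m := by
    have : (⌊t⌋₊ : ℝ≥0) ≤ t := Nat.floor_le zero_le
    exact_mod_cast (this.trans ht.le)
  have h4 := h2 _ h3
  rw [e] at h1
  have h5 : ∑' j, b j = b 0 + ∑' j, b (j + 1) := hbs.tsum_eq_zero_add
  have h6 : 0 ≤ ∑' j, b (j + 1) := tsum_nonneg fun j => hb0 _
  have h7 : y t - y 0 = (y t - y (⌊t⌋₊ : ℝ≥0)) + (y (⌊t⌋₊ : ℝ≥0) - y 0) := by abel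
  have h8 : (⌊t⌋₊ : ℝ) * b 0 ≤ m * b 0 :=
    mul_le_mul_of_nonneg_right (by exact_mod_cast h3) (hb0 0)
  rw [h7, h5]
  have h9 := norm_add_le (y t - y (⌊t⌋₊ : ℝ≥0)) (y (⌊t⌋₊ : ℝ≥0) - y 0)
  simp only [add_zero] at h1
  have h10 : 0 ≤ (m : ℝ) * ∑' j, b (j + 1) := by positivity
  have := hb0 0
  nlinarith

end Chaining

section Compactness

variable {d : ℕ}

/-- Paths with given bounds and given moduli of continuity form a compact set. -/
lemma isCompact_paths (B : ℕ → ℝ) (w : ℕ → ℕ → ℝ) (hw : ∀ m, Tendsto (w m) atTop (𝓝 0)) :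
    IsCompact {x : PathSpace d | (∀ (m : ℕ) (t : ℝ≥0), t ≤ m → ‖x t‖ ≤ B m) ∧
      ∀ (m k : ℕ) (s t : ℝ≥0), s ≤ t → t < m → t ≤ s + (1 / 2) ^ k → ‖x t - x s‖ ≤ w m k} := by
  have key : ∀ (t₀ : ℝ≥0) (ε : ℝ), 0 < ε → ∀ᶠ t in 𝓝 t₀, ∀ f : ℝ≥0 → State d,
      (∀ (m k : ℕ) (s t : ℝ≥0), s ≤ t → t < m → t ≤ s + (1 / 2) ^ k → ‖f t - f s‖ ≤ w m k) →
      dist (f t₀) (f t) < ε := by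
    intro t₀ ε hε
    obtain ⟨m, hm⟩ := exists_nat_gt t₀
    obtain ⟨k, hk⟩ := ((hw m).eventually_lt_const hε).exists
    have h1 : ∀ᶠ t in 𝓝 t₀, t < t₀ + (1 / 2) ^ k := Iio_mem_nhds (by simp)
    have h2 : ∀ᶠ t in 𝓝 t₀, t₀ < t + (1 / 2) ^ k := by
      have hc : Continuous fun t : ℝ≥0 => t + (1 / 2) ^ k := by fun_prop
      exact (hc.tendsto t₀).eventually_const_lt (by simp)
    filter_upwards [h1, h2, Iio_mem_nhds hm] with t ht1 ht2 htm f hf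
    rcases le_total t₀ t with h | h
    · rw [dist_comm, dist_eq_norm]
      exact (hf m k t₀ t h htm ht1.le).trans_lt hk
    · rw [dist_eq_norm]
      exact (hf m k t t₀ h hm ht2.le).trans_lt hk
  refine ArzelaAscoli.isCompact_of_equicontinuous _ ?_ ?_
  · have e : ContinuousMap.toFun '' {x : PathSpace d | (∀ (m : ℕ) (t : ℝ≥0), t ≤ m →
        ‖x t‖ ≤ B m) ∧ ∀ (m k : ℕ) (s t : ℝ≥0), s ≤ t → t < m → t ≤ s + (1 / 2) ^ k →
          ‖x t - x s‖ ≤ w m k} =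
        {f : ℝ≥0 → State d | (∀ (m : ℕ) (t : ℝ≥0), t ≤ m → ‖f t‖ ≤ B m) ∧
      ∀ (m k : ℕ) (s t : ℝ≥0), s ≤ t → t < m → t ≤ s + (1 / 2) ^ k → ‖f t - f s‖ ≤ w m k} := by
      ext f
      constructor
      · rintro ⟨x, hx, rfl⟩
        exact hx
      · intro hf
        refine ⟨⟨f, continuous_iff_continuousAt.2 fun t₀ => Metric.tendsto_nhds.2 fun ε hε => ?_⟩,
          hf, rfl⟩
        filter_upwards [key t₀ ε hε] with t ht
        rw [dist_comm]
        exact ht f hf.2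
    rw [e]
    refine (isCompact_univ_pi (fun t : ℝ≥0 =>
      isCompact_closedBall (0 : State d) (B ⌈t⌉₊))).of_isClosed_subset ?_ ?_
    · simp only [Set.ofPred_and, Set.ofPred_forall]
      refine IsClosed.inter ?_ ?_
      · refine isClosed_iInter fun m => isClosed_iInter fun t => isClosed_iInter fun _ => ?_
        exact isClosed_le (by fun_prop) continuous_const
      · refine isClosed_iInter fun m => isClosed_iInter fun k => isClosed_iInter fun s =>
          isClosed_iInter fun t => isClosed_iInter fun _ => isClosed_iInter fun _ =>
          isClosed_iInter fun _ => ?_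
        exact isClosed_le (by fun_prop) continuous_const
    · intro f hf t _
      rw [mem_closedBall_zero_iff]
      exact hf.1 _ t (Nat.le_ceil t)
  · intro t₀
    rw [Metric.equicontinuousAt_iff_right]
    intro ε hε
    filter_upwards [key t₀ ε hε] with t ht x
    exact ht x.1 x.2.2

/-- The components of the energy of a path: its norms on the intervals `[0, m + 1]`, and its
weighted dyadic increments. -/
def energyTerm (c : ℕ → ℝ) (q : ℕ) (a : ℕ × ℕ) (x : PathSpace d) : ℝ :=
  match a.2 with
  | 0 => c a.1 * ‖restrictPath ((a.1 : ℝ≥0) + 1) x‖ ^ q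
  | k + 1 => c a.1 * ((3 / 2) ^ k * ∑ i ∈ range ((a.1 + 1) * 2 ^ k),
      min (‖dyadicIncrement x k i‖ ^ 2) (‖dyadicIncrement x k i‖ ^ 4))

/-- A lower semicontinuous functional with compact sublevel sets on the path space. -/
def energy (c : ℕ → ℝ) (q : ℕ) (x : PathSpace d) : ℝ≥0∞ :=
  ∑' a : ℕ × ℕ, ofReal (energyTerm c q a x)

variable {c : ℕ → ℝ} {q : ℕ}

lemma continuous_energyTerm (a : ℕ × ℕ) : Continuous (energyTerm (d := d) c q a) := by
  obtain ⟨m, k⟩ := a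
  cases k with
  | zero =>
    exact continuous_const.mul ((continuous_norm.comp (continuous_restrictPath _)).pow q)
  | succ k =>
    have h : ∀ i, Continuous fun x : PathSpace d => dyadicIncrement x k i := fun i =>
      (continuous_eval_const _).sub (continuous_eval_const _)
    refine continuous_const.mul (continuous_const.mul (continuous_finsetSum _ fun i _ => ?_))
    exact ((h i).norm.pow 2).min ((h i).norm.pow 4)

lemma energyTerm_nonneg (hc : ∀ m, 0 < c m) (a : ℕ × ℕ) (x : PathSpace d) :
    0 ≤ energyTerm c q a x := by
  obtain ⟨m, k⟩ := a
  have := (hc m).le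
  cases k with
  | zero => exact mul_nonneg this (by positivity)
  | succ k => exact mul_nonneg this (by positivity)

lemma lowerSemicontinuous_energy : LowerSemicontinuous (energy (d := d) c q) :=
  lowerSemicontinuous_tsum fun a =>
    (continuous_ofReal.comp (continuous_energyTerm a)).lowerSemicontinuous

lemma measurable_energy : Measurable (energy (d := d) c q) :=
  lowerSemicontinuous_energy.measurable

lemma measurable_ofReal_energyTerm (a : ℕ × ℕ) :
    Measurable fun x : PathSpace d => ofReal (energyTerm c q a x) :=
  (continuous_ofReal.comp (continuous_energyTerm a)).measurable

lemma energyTerm_le {R : ℝ≥0} {x : PathSpace d} (h : energy c q x ≤ R) (a : ℕ × ℕ) :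
    energyTerm c q a x ≤ R := by
  have h1 : ofReal (energyTerm c q a x) ≤ R := (le_tsum a).trans h
  exact (ENNReal.ofReal_le_iff_le_toReal (by simp)).1 h1

lemma isCompact_energy_le (hc : ∀ m, 0 < c m) (hq : q ≠ 0) (R : ℝ≥0) :
    IsCompact {x : PathSpace d | energy c q x ≤ R} := by
  let A : ℕ → ℝ := fun m => R / c m
  have hA : ∀ m, 0 ≤ A m := fun m => div_nonneg R.2 (hc m).le
  let α : ℝ := 2 / 3
  let b : ℕ → ℕ → ℝ := fun m k => √(A m) * √α ^ k + √√(A m) * √√α ^ k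
  have hα1 : √α < 1 := by rw [Real.sqrt_lt' one_pos]; norm_num [α]
  have hα2 : √√α < 1 := by rw [Real.sqrt_lt' one_pos]; simpa using hα1
  have hb0 : ∀ m k, 0 ≤ b m k := fun m k => by positivity
  have hbs : ∀ m, Summable (b m) := fun m =>
    ((summable_geometric_of_lt_one (by positivity) hα1).mul_left _).add
      ((summable_geometric_of_lt_one (by positivity) hα2).mul_left _)
  refine (isCompact_paths (d := d) (fun m => 1 + A m)
    (fun m k => 2 * ∑' j, b m (j + k)) fun m => ?_).of_isClosed_subset
    (lowerSemicontinuous_energy.isClosed_preimage _) ?_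
  · have := (tendsto_sum_nat_add (b m)).const_mul 2
    rwa [mul_zero] at this
  · intro x hx
    have hinc : ∀ m k i, i < (m + 1) * 2 ^ k → ‖dyadicIncrement x k i‖ ≤ b m k := by
      intro m k i hi
      have h1 := energyTerm_le hx (m, k + 1)
      simp only [energyTerm] at h1
      set u := ‖dyadicIncrement x k i‖ with hu
      have hu0 : 0 ≤ u := norm_nonneg _
      have h2 : min (u ^ 2) (u ^ 4) ≤ ∑ i ∈ range ((m + 1) * 2 ^ k),
          min (‖dyadicIncrement x k i‖ ^ 2) (‖dyadicIncrement x k i‖ ^ 4) :=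
        single_le_sum
          (f := fun i => min (‖dyadicIncrement x k i‖ ^ 2) (‖dyadicIncrement x k i‖ ^ 4))
          (fun i _ => by positivity) (mem_range.2 hi)
      have h3 : min (u ^ 2) (u ^ 4) ≤ A m * α ^ k := by
        have h4 : c m * ((3 / 2) ^ k * min (u ^ 2) (u ^ 4)) ≤ R :=
          le_trans (mul_le_mul_of_nonneg_left
            (mul_le_mul_of_nonneg_left h2 (by positivity)) (hc m).le) h1
        have h5 : A m * α ^ k = R / (c m * (3 / 2) ^ k) := by
          simp only [A, α]
          have : (2 / 3 : ℝ) ^ k = ((3 / 2) ^ k)⁻¹ := by rw [← inv_pow]; norm_num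
          rw [this]
          field_simp
        rw [h5, le_div_iff₀ (mul_pos (hc m) (by positivity))]
        linarith
      have hpow : ∀ a : ℝ, 0 ≤ a → √(a ^ k) = √a ^ k := fun a ha => by
        rw [← Real.sqrt_sq (by positivity : 0 ≤ √a ^ k), ← pow_mul, mul_comm k, pow_mul,
          sq_sqrt ha]
      have hsq : √(A m * α ^ k) = √(A m) * √α ^ k := by
        rw [sqrt_mul (hA m), hpow _ (by norm_num [α])]
      have hsq' : √√(A m * α ^ k) = √√(A m) * √√α ^ k := by
        rw [hsq, sqrt_mul (by positivity), hpow _ (by positivity)]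
      rcases min_le_iff.1 h3 with h4 | h4
      · have : u ≤ √(A m * α ^ k) := Real.le_sqrt_of_sq_le h4
        rw [hsq] at this
        have : 0 ≤ √√(A m) * √√α ^ k := by positivity
        simp only [b]
        linarith
      · have : u ≤ √√(A m * α ^ k) :=
          Real.le_sqrt_of_sq_le (Real.le_sqrt_of_sq_le (by rw [← pow_mul]; exact h4))
        rw [hsq'] at this
        have : 0 ≤ √(A m) * √α ^ k := by positivity
        simp only [b]
        linarith
    refine ⟨fun m t ht => ?_, fun m k s t hst ht hk => ?_⟩
    · have h1 := energyTerm_le hx (m, 0)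
      simp only [energyTerm] at h1
      have h2 : ‖restrictPath ((m : ℝ≥0) + 1) x‖ ^ q ≤ A m := by
        rw [le_div_iff₀ (hc m)]
        linarith
      have h3 := norm_le_norm_restrictPath (ht.trans le_self_add : t ≤ (m : ℝ≥0) + 1) x
      refine h3.trans ?_
      rcases le_total ‖restrictPath ((m : ℝ≥0) + 1) x‖ 1 with h4 | h4
      · linarith [hA m]
      · linarith [le_self_pow₀ h4 hq]
    · refine norm_sub_le_of_dyadicIncrement x.continuous (hb0 m) (hbs m) (fun k i hi => ?_) hst
        ht hk
      refine hinc m k i (hi.trans_le ?_)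
      gcongr
      omega

lemma lintegral_le_of_tendsto {ι S : Type*} [TopologicalSpace S] [MeasurableSpace S]
    [BorelSpace S] {l : Filter ι} [l.NeBot] {μ : ι → ProbabilityMeasure S} {ν : ProbabilityMeasure S}
    (h : Tendsto μ l (𝓝 ν)) {f : S → ℝ} (hf : Continuous f) (h0 : ∀ x, 0 ≤ f x) {R : ℝ≥0∞}
    (hR : ∀ᶠ i in l, ∫⁻ x, ofReal (f x) ∂(μ i : Measure S) ≤ R) :
    ∫⁻ x, ofReal (f x) ∂(ν : Measure S) ≤ R := by
  have h1 : ∀ N : ℕ, ∫⁻ x, ofReal (min (f x) N) ∂(ν : Measure S) ≤ R := by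
    intro N
    have hm0 : ∀ x, 0 ≤ min (f x) N := fun x => le_min (h0 x) (Nat.cast_nonneg N)
    let f' : BoundedContinuousFunction S ℝ≥0 := BoundedContinuousFunction.mkOfBound
      ⟨fun x => (min (f x) N).toNNReal,
        continuous_real_toNNReal.comp (hf.min continuous_const)⟩ N (fun x y => by
        simp only [ContinuousMap.coe_mk, NNReal.dist_eq, Real.coe_toNNReal _ (hm0 _)]
        exact abs_sub_le_iff.2 ⟨by linarith [min_le_right (f x) N, hm0 y],
          by linarith [min_le_right (f y) N, hm0 x]⟩)
    have h2 := ProbabilityMeasure.tendsto_iff_forall_lintegral_tendsto.1 h f'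
    refine le_of_tendsto h2 (hR.mono fun i hi => (lintegral_mono fun x => ?_).trans hi)
    exact ofReal_le_ofReal (min_le_left _ _)
  have h2 : ∀ x, ofReal (f x) = ⨆ N : ℕ, ofReal (min (f x) N) := by
    intro x
    refine le_antisymm ?_ (iSup_le fun N => ofReal_le_ofReal (min_le_left _ _))
    obtain ⟨N, hN⟩ := exists_nat_ge (f x)
    refine le_iSup_of_le N ?_
    rw [min_eq_left hN]
  simp_rw [h2]
  rw [lintegral_iSup]
  · exact iSup_le h1
  · intro N
    have := hf.measurable
    fun_prop
  · intro M N hMN x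
    exact ofReal_le_ofReal (min_le_min le_rfl (by exact_mod_cast hMN))

variable {p : ℝ} [hp : Fact (1 ≤ p)]

/-- Forgetting the moment condition on a law of paths. -/
def PathWSpace.toProbabilityMeasure (ρ : PathWSpace p d) : ProbabilityMeasure (PathSpace d) :=
  ⟨ρ.toMeasure, ρ.isProb⟩

/-- The laws of paths with bounded mean energy form a compact set for the Wasserstein distance. -/
lemma isCompact_lintegral_energy_le (hc : ∀ m, 0 < c m) (hq : p < q) (R : ℝ≥0) :
    IsCompact {ρ : PathWSpace p d | ∫⁻ x, energy c q x ∂ρ.toMeasure ≤ R} := by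
  have hp1 := hp.out
  have hp0 : 0 < p := by linarith
  have hq0 : q ≠ 0 := by
    rintro rfl
    simp only [Nat.cast_zero] at hq
    linarith
  have hK : IsCompact {μ : ProbabilityMeasure (PathSpace d) |
      ∀ n : ℕ, μ {x : PathSpace d | energy c q x ≤ ((n : ℝ≥0) + 1 : ℝ≥0)}ᶜ ≤
        R / ((n : ℝ≥0) + 1)} := by
    refine isCompact_setOfPred_probabilityMeasure_mass_eq_compl_isCompact_le
      (u := fun n => R / ((n : ℝ≥0) + 1)) ?_
      (fun n => isCompact_energy_le hc hq0 _) (Or.inr ?_)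
    · rw [← NNReal.tendsto_coe]
      push_cast
      exact tendsto_const_div_atTop_nhds_zero_nat (R : ℝ) |>.comp (tendsto_add_atTop_nat 1) |>.congr
        (by intro n; simp)
    · intro m n hmn x hx
      refine le_trans (show energy c q x ≤ _ from hx) ?_
      gcongr
  rw [isCompact_iff_ultrafilter_le_nhds]
  intro f hf
  have hfR : ∀ᶠ ρ in (f : Filter (PathWSpace p d)), ∫⁻ x, energy c q x ∂ρ.toMeasure ≤ R :=
    le_principal_iff.1 hf
  rw [isCompact_iff_ultrafilter_le_nhds] at hK
  obtain ⟨ν, -, hν⟩ := hK (f.map PathWSpace.toProbabilityMeasure) (by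
    rw [Ultrafilter.coe_map, le_principal_iff, mem_map]
    filter_upwards [hfR] with ρ hρ n
    have hcm : MeasurableSet {x : PathSpace d | energy c q x ≤ ((n : ℝ≥0) + 1 : ℝ≥0)}ᶜ :=
      (lowerSemicontinuous_energy.isClosed_preimage _).measurableSet.compl
    have h1 := mul_meas_ge_le_lintegral₀ (μ := ρ.toMeasure)
      (measurable_energy (d := d) (c := c) (q := q)).aemeasurable (((n : ℝ≥0) + 1 : ℝ≥0))
    have h2 : ρ.toMeasure {x : PathSpace d | energy c q x ≤ ((n : ℝ≥0) + 1 : ℝ≥0)}ᶜ ≤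
        ρ.toMeasure {x | (((n : ℝ≥0) + 1 : ℝ≥0) : ℝ≥0∞) ≤ energy c q x} :=
      measure_mono fun x hx => (not_le.1 (show ¬ energy c q x ≤ _ from hx)).le
    have h3 : (((n : ℝ≥0) + 1 : ℝ≥0) : ℝ≥0∞) *
        ρ.toMeasure {x : PathSpace d | energy c q x ≤ ((n : ℝ≥0) + 1 : ℝ≥0)}ᶜ ≤ R :=
      (mul_le_mul_right h2 _).trans (h1.trans hρ)
    rw [le_div_iff₀ (by positivity), mul_comm, ← coe_le_coe]
    push_cast
    rw [ProbabilityMeasure.ennreal_coeFn_eq_coeFn_toMeasure]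
    push_cast at h3
    exact h3)
  have hν' : Tendsto PathWSpace.toProbabilityMeasure (f : Filter (PathWSpace p d)) (𝓝 ν) := hν
  have hGν : ∫⁻ x, energy c q x ∂(ν : Measure (PathSpace d)) ≤ R := by
    simp only [energy]
    rw [lintegral_tsum fun a => (measurable_ofReal_energyTerm a).aemeasurable,
      ENNReal.tsum_eq_iSup_sum]
    refine iSup_le fun s => ?_
    rw [← lintegral_finsetSum _ fun a _ => measurable_ofReal_energyTerm a]
    have e : ∀ x : PathSpace d, ∑ a ∈ s, ofReal (energyTerm c q a x) =
        ofReal (∑ a ∈ s, energyTerm c q a x) := fun x =>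
      (ofReal_sum_of_nonneg fun a _ => energyTerm_nonneg hc a x).symm
    simp_rw [e]
    refine lintegral_le_of_tendsto hν' (continuous_finsetSum _ fun a _ => continuous_energyTerm a)
      (fun x => sum_nonneg fun a _ => energyTerm_nonneg hc a x) (hfR.mono fun ρ hρ => ?_)
    refine le_trans (lintegral_mono fun x => ?_) hρ
    rw [← e]
    exact sum_le_tsum s
  have hmom : ∀ (ρ : Measure (PathSpace d)), ∫⁻ x, energy c q x ∂ρ ≤ R → ∀ m : ℕ,
      ∫⁻ x, ‖restrictPath ((m : ℝ≥0) + 1) x‖ₑ ^ (q : ℝ) ∂ρ ≤ R / ofReal (c m) := by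
    intro ρ hρ m
    rw [ENNReal.le_div_iff_mul_le (Or.inl (by simpa using hc m)) (Or.inl (by simp)), mul_comm,
      ← lintegral_const_mul' _ _ (by simp)]
    refine le_trans (lintegral_mono fun x => ?_) hρ
    refine le_trans (le_of_eq ?_) (le_tsum (m, 0))
    simp only [energyTerm]
    rw [ofReal_mul (hc m).le, rpow_natCast, ofReal_pow (norm_nonneg _),
      ofReal_norm]
  let ρ₀ : PathWSpace p d := ⟨ν, inferInstance, fun T hT => by
    obtain ⟨m, hm⟩ := exists_nat_ge T
    have h1 := hmom ν hGν m
    refine lt_of_le_of_lt (lintegral_mono fun x => ?_ :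
      _ ≤ ∫⁻ x, 1 + ‖restrictPath ((m : ℝ≥0) + 1) x‖ₑ ^ (q : ℝ) ∂(ν : Measure (PathSpace d))) ?_
    · rw [iSup_enorm_rpow_eq hp1]
      have h2 : ‖restrictPath T x‖ₑ ≤ ‖restrictPath ((m : ℝ≥0) + 1) x‖ₑ := by
        rw [← ofReal_norm, ← ofReal_norm]
        exact ofReal_le_ofReal (norm_restrictPath_le (norm_nonneg _) fun t ht =>
          norm_le_norm_restrictPath (ht.trans (hm.trans le_self_add)) x)
      refine (rpow_le_rpow h2 hp0.le).trans ?_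
      rcases le_total ‖restrictPath ((m : ℝ≥0) + 1) x‖ₑ 1 with h3 | h3
      · refine le_trans ?_ le_self_add
        exact ENNReal.rpow_le_one h3 hp0.le
      · refine le_trans ?_ le_add_self
        exact ENNReal.rpow_le_rpow_of_exponent_le h3 hq.le
    · rw [lintegral_add_left measurable_const]
      refine add_lt_top.2 ⟨by simp, h1.trans_lt ?_⟩
      exact div_lt_top (by simp) (by simpa using hc m)⟩
  refine ⟨ρ₀, hGν, ?_⟩
  change Tendsto id (f : Filter (PathWSpace p d)) (𝓝 ρ₀)
  refine PathWSpace.tendsto_of_tendsto_wasserstein fun m => ?_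
  have hr := (continuous_restrictPath (d := d) ((m : ℝ≥0) + 1))
  have h1 : Tendsto (fun ρ : PathWSpace p d =>
      (ρ.toProbabilityMeasure).map hr.measurable.aemeasurable) f
      (𝓝 (ν.map hr.measurable.aemeasurable)) :=
    ProbabilityMeasure.tendsto_map_of_tendsto_of_continuous _ _ hν' hr
  have h2 := tendsto_wasserstein_of_tendsto hp1 hq h1 (R := R / ofReal (c m))
    (div_lt_top (by simp) (by simpa using hc m)).ne
    (hfR.mono fun ρ hρ => by
      rw [ProbabilityMeasure.toMeasure_map, lintegral_map (by fun_prop) hr.measurable]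
      exact hmom _ hρ m)
    (by rw [ProbabilityMeasure.toMeasure_map, lintegral_map (by fun_prop) hr.measurable]
        exact hmom _ hGν m)
  refine tendsto_of_tendsto_of_tendsto_of_le_of_le tendsto_const_nhds h2 (fun _ => zero_le)
    fun ρ => ?_
  exact wasserstein_restrict_mono ρ ρ₀ le_self_add

end Compactness

section FirstMoment

variable {p : ℝ} [hp : Fact (1 ≤ p)] {d : ℕ}

lemma enorm_le_one_add_rpow {V : Type*} [NormedAddCommGroup V] {p : ℝ} (hp : 1 ≤ p) (x : V) :
    ‖x‖ₑ ≤ 1 + ‖x‖ₑ ^ p := by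
  rcases le_total ‖x‖ₑ 1 with h | h
  · exact h.trans le_self_add
  · refine le_trans ?_ le_add_self
    calc ‖x‖ₑ = ‖x‖ₑ ^ (1 : ℝ) := (rpow_one _).symm
      _ ≤ _ := ENNReal.rpow_le_rpow_of_exponent_le h hp

lemma WSpace.lintegral_enorm_lt_top (μ : WSpace p (State d)) : ∫⁻ y, ‖y‖ₑ ∂μ.toMeasure < ⊤ := by
  refine lt_of_le_of_lt (lintegral_mono fun y => enorm_le_one_add_rpow hp.out y) ?_
  rw [lintegral_add_left measurable_const]
  exact add_lt_top.2 ⟨by simp, μ.moment_lt_top⟩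

lemma WSpace.integral_norm_nonneg (μ : WSpace p (State d)) : 0 ≤ ∫ y, ‖y‖ ∂μ.toMeasure :=
  integral_nonneg fun _ => norm_nonneg _

lemma WSpace.integral_norm_eq (μ : WSpace p (State d)) :
    ∫ y, ‖y‖ ∂μ.toMeasure = (∫⁻ y, ‖y‖ₑ ∂μ.toMeasure).toReal :=
  integral_norm_eq_lintegral_enorm measurable_id.aestronglyMeasurable

lemma WSpace.integral_norm_le_add_two {μ ν : WSpace p (State d)} (h : edist μ ν < 1) :
    ∫ y, ‖y‖ ∂μ.toMeasure ≤ ∫ y, ‖y‖ ∂ν.toMeasure + 2 := by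
  obtain ⟨π, hπ, hlt⟩ := exists_coupling_lt hp.out (show wasserstein p _ _ < 1 from h)
  have : IsProbabilityMeasure π := hπ.isProbabilityMeasure
  have h2 := lintegral_rpow_le_of_rpow_inv_le hp.out hlt.le
  rw [ENNReal.one_rpow] at h2
  have h3 : ∫⁻ y, ‖y‖ₑ ∂μ.toMeasure ≤ ∫⁻ y, ‖y‖ₑ ∂ν.toMeasure + 2 := by
    rw [← hπ.1, ← hπ.2, lintegral_map (by fun_prop) measurable_fst,
      lintegral_map (by fun_prop) measurable_snd]
    calc ∫⁻ z, ‖z.1‖ₑ ∂π ≤ ∫⁻ z, ‖z.2‖ₑ + (1 + ‖z.1 - z.2‖ₑ ^ p) ∂π := by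
          refine lintegral_mono fun z => ?_
          calc ‖z.1‖ₑ = ‖z.2 + (z.1 - z.2)‖ₑ := by rw [add_sub_cancel]
            _ ≤ ‖z.2‖ₑ + ‖z.1 - z.2‖ₑ := enorm_add_le _ _
            _ ≤ _ := by gcongr; exact enorm_le_one_add_rpow hp.out _
      _ = ∫⁻ z, ‖z.2‖ₑ ∂π + (1 + ∫⁻ z, ‖z.1 - z.2‖ₑ ^ p ∂π) := by
          rw [lintegral_add_left (by fun_prop), lintegral_add_left (by fun_prop)]
          simp
      _ ≤ ∫⁻ z, ‖z.2‖ₑ ∂π + (1 + 1) := by gcongr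
      _ = _ := by norm_num
  rw [WSpace.integral_norm_eq, WSpace.integral_norm_eq]
  have h4 := toReal_mono (add_lt_top.2 ⟨ν.lintegral_enorm_lt_top, by simp⟩).ne h3
  rwa [ENNReal.toReal_add ν.lintegral_enorm_lt_top.ne (by simp), toReal_ofNat] at h4

lemma PathWSpace.exists_integral_norm_marginal_le (ρ : PathWSpace p d) (T : ℝ≥0) :
    ∃ B : ℝ, ∀ t ≤ T, ∫ y, ‖y‖ ∂(ρ.marginal t).toMeasure ≤ B := by
  have hm := ρ.moment_lt_top (T + 1) (by positivity)
  refine ⟨(1 + ∫⁻ x, (⨆ (t : ℝ≥0) (_ : t ≤ T + 1), ‖x t‖ₑ ^ p) ∂ρ.toMeasure).toReal,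
    fun t ht => ?_⟩
  rw [WSpace.integral_norm_eq]
  refine toReal_mono (add_lt_top.2 ⟨by simp, hm⟩).ne ?_
  change ∫⁻ y, ‖y‖ₑ ∂(ρ.toMeasure.map fun x => x t) ≤ _
  rw [lintegral_map (by fun_prop) (continuous_eval_const t).measurable]
  calc ∫⁻ x, ‖x t‖ₑ ∂ρ.toMeasure
      ≤ ∫⁻ x, 1 + (⨆ (t : ℝ≥0) (_ : t ≤ T + 1), ‖x t‖ₑ ^ p) ∂ρ.toMeasure := by
        refine lintegral_mono fun x => (enorm_le_one_add_rpow hp.out _).trans ?_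
        gcongr
        exact le_iSup₂_of_le (f := fun (s : ℝ≥0) (_ : s ≤ T + 1) => ‖x s‖ₑ ^ p) t
          (ht.trans le_self_add) le_rfl
    _ = _ := by
        rw [lintegral_add_left measurable_const]
        simp

lemma PathWSpace.eventually_integral_norm_marginal_le (ρ₀ : PathWSpace p d) (T : ℝ≥0) :
    ∃ B : ℝ, 0 ≤ B ∧ ∀ᶠ ρ in 𝓝 ρ₀, ∀ t ≤ T, ∫ y, ‖y‖ ∂(ρ.marginal t).toMeasure ≤ B := by
  obtain ⟨B, hB⟩ := ρ₀.exists_integral_norm_marginal_le T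
  have hB0 : 0 ≤ B := (WSpace.integral_norm_nonneg _).trans (hB 0 zero_le)
  refine ⟨B + 2, by positivity, ?_⟩
  filter_upwards [(PathWSpace.tendsto_wasserstein_restrict (tendsto_id (x := 𝓝 ρ₀))
    T).eventually_lt_const one_pos] with ρ hρ t ht
  have := WSpace.integral_norm_le_add_two ((wasserstein_marginal_le ρ ρ₀ ht).trans_lt hρ)
  linarith [hB t ht]

end FirstMoment

section Generator

variable {p : ℝ} [hp : Fact (1 ≤ p)] {d d' : ℕ} {b : Drift p d} {σ : Diffusion p d d'}
  {φ : State d → ℝ}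

lemma continuous_gradient (hφ : ContDiff ℝ 2 φ) : Continuous (gradient φ) := by
  have h := hφ.continuous_fderiv (by norm_num)
  exact (InnerProductSpace.toDual ℝ (State d)).symm.continuous.comp h

lemma contDiff_fderiv (hφ : ContDiff ℝ 2 φ) : ContDiff ℝ 1 (fderiv ℝ φ) :=
  hφ.fderiv_right (by norm_num)

lemma continuous_hessianMatrix (hφ : ContDiff ℝ 2 φ) : Continuous (hessianMatrix φ) := by
  have h := (contDiff_fderiv hφ).continuous_fderiv (by norm_num)
  refine continuous_matrix fun i j => ?_
  exact (h.clm_apply continuous_const).clm_apply continuous_const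

lemma continuous_generator (hcoef : CoefficientAssumption b σ) (hφ : ContDiff ℝ 2 φ) :
    Continuous fun z : State d × WSpace p (State d) => generator b σ z.2 φ z.1 := by
  have h1 := (continuous_gradient hφ).comp (continuous_fst (X := State d) (Y := WSpace p (State d)))
  have h2 := (continuous_hessianMatrix hφ).comp
    (continuous_fst (X := State d) (Y := WSpace p (State d)))
  have h3 := hcoef.continuous_σ
  refine (hcoef.continuous_b.inner h1).add (Continuous.matrix_trace ?_)
  exact (h3.matrix_transpose.matrix_mul h2).matrix_mul h3

lemma abs_le_sqrt_sum_sq {d d' : ℕ} (A : Matrix (Fin d) (Fin d') ℝ) (i : Fin d) (j : Fin d') :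
    |A i j| ≤ √(∑ i, ∑ j, A i j ^ 2) := by
  refine Real.abs_le_sqrt ?_
  exact (single_le_sum (f := fun j => A i j ^ 2) (fun _ _ => sq_nonneg _)
    (mem_univ j)).trans (single_le_sum (f := fun i => ∑ j, A i j ^ 2)
      (fun _ _ => sum_nonneg fun _ _ => sq_nonneg _) (mem_univ i))

lemma abs_trace_le {d d' : ℕ} {A : Matrix (Fin d) (Fin d') ℝ} {B : Matrix (Fin d) (Fin d) ℝ}
    {C H : ℝ} (hA : ∀ i j, |A i j| ≤ C) (hB : ∀ i j, |B i j| ≤ H) (hC : 0 ≤ C) (hH : 0 ≤ H) :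
    |Matrix.trace (A.transpose * B * A)| ≤ d' * (d * (d * (C * H * C))) := by
  have h1 : ∀ c j, |(A.transpose * B) j c * A c j| ≤ d * (C * H * C) := by
    intro c j
    rw [Matrix.mul_apply, sum_mul]
    refine (abs_sum_le_sum_abs _ _).trans ?_
    refine (sum_le_card_nsmul _ _ (C * H * C) fun a _ => ?_).trans_eq (by simp)
    rw [abs_mul, abs_mul, Matrix.transpose_apply]
    exact mul_le_mul (mul_le_mul (hA a j) (hB a c) (abs_nonneg _) hC) (hA c j) (abs_nonneg _)
      (mul_nonneg hC hH)
  rw [Matrix.trace]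
  refine (abs_sum_le_sum_abs _ _).trans ?_
  refine (sum_le_card_nsmul _ _ (d * (d * (C * H * C))) fun j _ => ?_).trans_eq (by simp)
  rw [Matrix.diag_apply, Matrix.mul_apply]
  refine (abs_sum_le_sum_abs _ _).trans ?_
  exact (sum_le_card_nsmul _ _ (d * (C * H * C)) fun c _ => h1 c j).trans_eq (by simp)

lemma hasCompactSupport_fderiv_fderiv {V : Type*} [NormedAddCommGroup V] [NormedSpace ℝ V]
    {φ : V → ℝ} (hφc : HasCompactSupport φ) : HasCompactSupport (fderiv ℝ (fderiv ℝ φ)) := by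
  have := HasCompactSupport.fderiv ℝ hφc
  exact HasCompactSupport.fderiv ℝ this

lemma hasCompactSupport_hessianMatrix (hφc : HasCompactSupport φ) (i j : Fin d) :
    HasCompactSupport fun x => hessianMatrix φ x i j := by
  have h1 := hasCompactSupport_fderiv_fderiv hφc
  exact h1.comp_left (g := fun L => L (EuclideanSpace.single i 1) (EuclideanSpace.single j 1)) rfl

lemma exists_abs_hessianMatrix_le (hφ : ContDiff ℝ 2 φ) (hφc : HasCompactSupport φ) :
    ∃ H : ℝ, 0 ≤ H ∧ ∀ x i j, |hessianMatrix φ x i j| ≤ H := by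
  have h1 : ∀ i j, ∃ H : ℝ, ∀ x, |hessianMatrix φ x i j| ≤ H := fun i j =>
    (hasCompactSupport_hessianMatrix hφc i j).exists_bound_of_continuous
      ((continuous_hessianMatrix hφ).matrix_elem i j)
  choose H hH using h1
  refine ⟨∑ i, ∑ j, |H i j|, by positivity, fun x i j => (hH i j x).trans ?_⟩
  refine (le_abs_self _).trans ?_
  exact (single_le_sum (f := fun j => |H i j|) (fun _ _ => abs_nonneg _)
    (mem_univ j)).trans (single_le_sum (f := fun i => ∑ j, |H i j|)
      (fun _ _ => sum_nonneg fun _ _ => abs_nonneg _) (mem_univ i))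

lemma hasCompactSupport_gradient (hφc : HasCompactSupport φ) : HasCompactSupport (gradient φ) :=
  (hφc.fderiv (𝕜 := ℝ)).comp_left (g := (InnerProductSpace.toDual ℝ (State d)).symm) (map_zero _)

lemma exists_norm_gradient_le (hφ : ContDiff ℝ 2 φ) (hφc : HasCompactSupport φ) :
    ∃ G : ℝ, 0 ≤ G ∧ ∀ x, (1 + ‖x‖) * ‖gradient φ x‖ ≤ G := by
  have hc : Continuous fun x : State d => (1 + ‖x‖) • gradient φ x :=
    (continuous_const.add continuous_norm).smul (continuous_gradient hφ)
  obtain ⟨G, hG⟩ := ((hasCompactSupport_gradient hφc).smul_left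
    (f := fun x : State d => 1 + ‖x‖)).exists_bound_of_continuous hc
  refine ⟨G, (norm_nonneg _).trans (hG 0), fun x => ?_⟩
  have h2 := hG x
  rwa [Pi.smul_apply', norm_smul, norm_of_nonneg
    (add_nonneg zero_le_one (norm_nonneg x))] at h2

lemma exists_abs_generator_le (hcoef : CoefficientAssumption b σ) (hφ : ContDiff ℝ 2 φ)
    (hφc : HasCompactSupport φ) : ∃ K : ℝ, 0 ≤ K ∧ ∀ (μ : WSpace p (State d)) (x : State d),
      |generator b σ μ φ x| ≤ K * (1 + ∫ y, ‖y‖ ∂μ.toMeasure) := by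
  obtain ⟨C, hC, hbound⟩ := hcoef.bound
  obtain ⟨G, hG0, hG⟩ := exists_norm_gradient_le hφ hφc
  obtain ⟨H, hH0, hH⟩ := exists_abs_hessianMatrix_le hφ hφc
  obtain ⟨D, hD⟩ : ∃ D : ℝ, D = d' * (d * (d * (C * H * C))) := ⟨_, rfl⟩
  have hD0 : 0 ≤ D := by rw [hD]; positivity
  refine ⟨C * G + D, by positivity, fun μ x => ?_⟩
  have hκ := WSpace.integral_norm_nonneg μ
  obtain ⟨hb, hσ⟩ := hbound x μ
  have h2 : |Matrix.trace ((σ x μ).transpose * hessianMatrix φ x * σ x μ)| ≤ D :=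
    hD ▸ abs_trace_le (fun i j => (abs_le_sqrt_sum_sq _ i j).trans hσ) (hH x) hC.le hH0
  generalize (∫ y, ‖y‖ ∂μ.toMeasure) = κ at hκ hb ⊢
  have h1 : |inner ℝ (b x μ) (gradient φ x)| ≤ C * G * (1 + κ) := by
    calc |inner ℝ (b x μ) (gradient φ x)| ≤ ‖b x μ‖ * ‖gradient φ x‖ := abs_real_inner_le_norm _ _
      _ ≤ C * (1 + ‖x‖ + κ) * ‖gradient φ x‖ := mul_le_mul_of_nonneg_right hb (norm_nonneg _)
      _ ≤ C * ((1 + ‖x‖) * (1 + κ)) * ‖gradient φ x‖ := by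
          refine mul_le_mul_of_nonneg_right (mul_le_mul_of_nonneg_left ?_ hC.le) (norm_nonneg _)
          nlinarith [mul_nonneg (norm_nonneg x) hκ]
      _ = C * ((1 + ‖x‖) * ‖gradient φ x‖) * (1 + κ) := by ring
      _ ≤ C * G * (1 + κ) := mul_le_mul_of_nonneg_right
          (mul_le_mul_of_nonneg_left (hG x) hC.le) (by linarith)
  have h3 : |generator b σ μ φ x| ≤ C * G * (1 + κ) + D :=
    (abs_add_le _ _).trans (add_le_add h1 h2)
  have h4 : 0 ≤ D * κ := mul_nonneg hD0 hκ
  linarith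

/-- The generator evaluated along a path: `L(ρ_v)(φ)(x_v)`. -/
def pathGenerator (b : Drift p d) (σ : Diffusion p d d') (φ : State d → ℝ)
    (v : ℝ≥0) (ρ : PathWSpace p d) (x : PathSpace d) : ℝ :=
  generator b σ (ρ.marginal v) φ (x v)

lemma continuous_pathGenerator (hcoef : CoefficientAssumption b σ) (hφ : ContDiff ℝ 2 φ) :
    Continuous fun z : PathSpace d × (ℝ≥0 × PathWSpace p d) =>
      pathGenerator b σ φ z.2.1 z.2.2 z.1 := by
  have h0 : Continuous fun z : PathSpace d × (ℝ≥0 × PathWSpace p d) => z.1 z.2.1 :=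
    continuous_fst.eval continuous_snd.fst
  have h2 : Continuous fun z : PathSpace d × (ℝ≥0 × PathWSpace p d) => z.2.2.marginal z.2.1 :=
    PathWSpace.continuous_marginal.comp continuous_snd
  have h1 := (continuous_generator hcoef hφ).comp (h0.prodMk h2)
  exact h1

lemma pathGenerator_stopPath {v T : ℝ≥0} (h : v ≤ T) (ρ : PathWSpace p d) (x : PathSpace d) :
    pathGenerator b σ φ v ρ (stopPath T x) = pathGenerator b σ φ v ρ x := by
  rw [pathGenerator, stopPath_apply_of_le h, pathGenerator]

lemma eventually_abs_pathGenerator_le (hcoef : CoefficientAssumption b σ) (hφ : ContDiff ℝ 2 φ)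
    (hφc : HasCompactSupport φ) (ρ₀ : PathWSpace p d) (T : ℝ≥0) :
    ∃ M : ℝ, 0 ≤ M ∧ ∀ᶠ ρ in 𝓝 ρ₀, ∀ v ≤ T, ∀ x, |pathGenerator b σ φ v ρ x| ≤ M := by
  obtain ⟨K, hK, hgen⟩ := exists_abs_generator_le hcoef hφ hφc
  obtain ⟨B, hB0, hB⟩ := ρ₀.eventually_integral_norm_marginal_le T
  refine ⟨K * (1 + B), by positivity, hB.mono fun ρ hρ v hv x => (hgen _ _).trans ?_⟩
  gcongr
  exact hρ v hv

lemma eq_of_stopPath_of_le {h : PathSpace d → ℝ} {s t : ℝ≥0} (hs : ∀ x, h (stopPath s x) = h x)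
    (hst : s ≤ t) (x : PathSpace d) : h (stopPath t x) = h x := by
  rw [← hs, ← hs x]
  congr 1
  ext r : 1
  exact stopPath_apply_of_le ((Set.projIcc 0 s zero_le r).2.2.trans hst) x

/-- `∫ L(ρ_v)(φ)(x_v) h(x) dρ(x)` depends continuously on `v` and `ρ`. -/
lemma continuous_integral_pathGenerator_mul (hcoef : CoefficientAssumption b σ)
    (hφ : ContDiff ℝ 2 φ) (hφc : HasCompactSupport φ) {h : PathSpace d → ℝ} (hh : Continuous h)
    (hh1 : ∀ x, |h x| ≤ 1) {s : ℝ≥0} (hs : ∀ x, h (stopPath s x) = h x) :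
    Continuous fun z : ℝ≥0 × PathWSpace p d =>
      ∫ x, pathGenerator b σ φ z.1 z.2 x * h x ∂z.2.toMeasure := by
  refine continuous_iff_continuousAt.2 fun z₀ => ?_
  set T : ℝ≥0 := z₀.1 + s + 1
  have hT : ∀ᶠ z in 𝓝 z₀, z.1 ≤ T := by
    have : z₀.1 < T := by
      simp only [T, add_assoc]
      exact lt_add_of_pos_right _ (by positivity)
    exact (continuous_fst.tendsto z₀).eventually (Iic_mem_nhds this)
  obtain ⟨M, -, hM⟩ := eventually_abs_pathGenerator_le hcoef hφ hφc z₀.2 T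
  have hst : ∀ x, h (stopPath T x) = h x := by
    refine eq_of_stopPath_of_le hs ?_
    simp only [T, add_assoc, add_comm z₀.1]
    exact le_self_add
  refine PathWSpace.tendsto_integral (continuous_snd.tendsto z₀) (tendsto_id (x := 𝓝 z₀))
    (f := fun x z => pathGenerator b σ φ z.1 z.2 x * h x) (M := M)
    ((continuous_pathGenerator hcoef hφ).mul (hh.comp continuous_fst)) T ?_ ?_
  · filter_upwards [hT, (continuous_snd.tendsto z₀).eventually hM] with z hz hzM x
    rw [abs_mul]
    calc _ ≤ M * 1 := mul_le_mul (hzM _ hz x) (hh1 x) (abs_nonneg _)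
          ((abs_nonneg _).trans (hzM _ hz x))
      _ = M := mul_one M
  · filter_upwards [hT] with z hz x
    rw [pathGenerator_stopPath hz, hst]

/-- The martingale defect of `ρ`, tested against `φ` between the times `s` and `t`, and against
the functional `h` of the path up to time `s`. -/
def defect (b : Drift p d) (σ : Diffusion p d d') (φ : State d → ℝ)
    (s t : ℝ≥0) (h : PathSpace d → ℝ) (ρ : PathWSpace p d) : ℝ :=
  ∫ x, (φ (x t) - φ (x s)) * h x ∂ρ.toMeasure -
    ∫ v in (s : ℝ)..t, ∫ x, pathGenerator b σ φ v.toNNReal ρ x * h x ∂ρ.toMeasure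

lemma continuous_defect (hcoef : CoefficientAssumption b σ)
    (hφ : ContDiff ℝ 2 φ) (hφc : HasCompactSupport φ) {h : PathSpace d → ℝ} (hh : Continuous h)
    (hh1 : ∀ x, |h x| ≤ 1) {s t : ℝ≥0} (hst : s ≤ t) (hs : ∀ x, h (stopPath s x) = h x) :
    Continuous (defect b σ φ s t h) := by
  refine Continuous.sub ?_ ?_
  · obtain ⟨B, hB⟩ := hφc.exists_bound_of_continuous hφ.continuous
    refine continuous_iff_continuousAt.2 fun ρ₀ => ?_
    refine PathWSpace.tendsto_integral (tendsto_id (x := 𝓝 ρ₀)) (z := fun _ => ()) (z₀ := ())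
      tendsto_const_nhds (f := fun x _ => (φ (x t) - φ (x s)) * h x) (M := B + B) ?_ t ?_ ?_
    · have h1 := hφ.continuous
      have h2 := hh.comp (continuous_fst (X := PathSpace d) (Y := Unit))
      exact Continuous.mul (by fun_prop) h2
    · refine Eventually.of_forall fun _ x => ?_
      have h1 := hB (x t)
      have h2 := hB (x s)
      rw [norm_eq_abs] at h1 h2
      rw [abs_mul]
      calc _ ≤ (B + B) * 1 := mul_le_mul ((abs_sub _ _).trans (add_le_add h1 h2)) (hh1 x)
            (abs_nonneg _) (by linarith [abs_nonneg (φ (x t))])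
        _ = _ := mul_one _
    · refine Eventually.of_forall fun _ x => ?_
      rw [eq_of_stopPath_of_le hs hst, stopPath_apply_of_le le_rfl, stopPath_apply_of_le hst]
  · have hJ := continuous_integral_pathGenerator_mul hcoef hφ hφc hh hh1 hs
    refine continuous_iff_continuousAt.2 fun ρ₀ => ?_
    obtain ⟨M, hM0, hM⟩ := eventually_abs_pathGenerator_le hcoef hφ hφc ρ₀ t
    refine intervalIntegral.continuousAt_of_dominated_interval (bound := fun _ => M) ?_ ?_ ?_ ?_
    · refine Eventually.of_forall fun ρ => Continuous.aestronglyMeasurable ?_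
      exact hJ.comp (continuous_real_toNNReal.prodMk continuous_const)
    · filter_upwards [hM] with ρ hρ
      refine ae_of_all _ fun v hv => ?_
      rw [Set.uIoc_of_le (by exact_mod_cast hst)] at hv
      have hvt : v.toNNReal ≤ t := Real.toNNReal_le_iff_le_coe.2 hv.2
      refine (norm_integral_le_of_norm_le_const (C := M) (ae_of_all _ fun x => ?_)).trans ?_
      · rw [norm_mul, norm_eq_abs, norm_eq_abs]
        calc _ ≤ M * 1 := mul_le_mul (hρ _ hvt x) (hh1 x) (abs_nonneg _) hM0
          _ = M := mul_one M
      · simp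
    · exact intervalIntegrable_const
    · exact ae_of_all _ fun v _ =>
        (hJ.comp (continuous_const.prodMk continuous_id)).continuousAt

lemma canonicalFiltration_le_comap_stopPath (s : ℝ≥0) :
    canonicalFiltration d s ≤ MeasurableSpace.comap (stopPath s) inferInstance := by
  refine iSup₂_le fun j hj => ?_
  rintro A ⟨B, hB, rfl⟩
  refine ⟨(fun x : PathSpace d => x j) ⁻¹' B, (continuous_eval_const j).measurable hB, ?_⟩
  ext x
  simp [stopPath_apply_of_le hj]

lemma measurable_eval_canonicalFiltration {s t : ℝ≥0} (h : s ≤ t) :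
    Measurable[canonicalFiltration d t] fun x : PathSpace d => x s := by
  have : MeasurableSpace.comap (fun x : PathSpace d => x s) inferInstance ≤
      canonicalFiltration d t := le_iSup₂ (f := fun (j : ℝ≥0) (_ : j ≤ t) =>
        MeasurableSpace.comap (fun x : PathSpace d => x j) inferInstance) s h
  exact (comap_measurable _).mono this le_rfl

lemma stronglyMeasurable_setIntegral_path {α : Type*} [MeasurableSpace α] {g : State d × ℝ → ℝ}
    (hg : Continuous g) {y : α → ℝ → State d} (hy : ∀ a, Continuous (y a))
    (hm : ∀ v, Measurable fun a => y a v) (A : Set ℝ) :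
    StronglyMeasurable fun a => ∫ v in A, g (y a v, v) := by
  have h1 : Measurable fun z : α × ℝ => y z.1 z.2 :=
    (measurable_uncurry_of_continuous_of_measurable (u := fun v a => y a v) hy hm).comp
      measurable_swap
  have h2 : Measurable fun z : α × ℝ => g (y z.1 z.2, z.2) :=
    hg.measurable.comp (h1.prodMk measurable_snd)
  exact StronglyMeasurable.integral_prod_right' h2.stronglyMeasurable

lemma stronglyMeasurable_integral_pathGenerator (hcoef : CoefficientAssumption b σ)
    (hφ : ContDiff ℝ 2 φ) (ρ : PathWSpace p d) (t : ℝ≥0) :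
    StronglyMeasurable[canonicalFiltration d t] fun x : PathSpace d =>
      ∫ v in (0 : ℝ)..t, pathGenerator b σ φ v.toNNReal ρ x := by
  have hg : Continuous fun q : State d × ℝ =>
      generator b σ (ρ.marginal q.2.toNNReal) φ q.1 := by
    refine (continuous_generator hcoef hφ).comp (f := fun q : State d × ℝ =>
      (q.1, ρ.marginal q.2.toNNReal)) (continuous_fst.prodMk ?_)
    exact PathWSpace.continuous_marginal.comp
      ((continuous_real_toNNReal.comp continuous_snd).prodMk continuous_const)
  have h1 := @stronglyMeasurable_setIntegral_path d (PathSpace d) (canonicalFiltration d t) _ hg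
    (fun x v => x (min v.toNNReal t))
    (fun x => x.continuous.comp (continuous_real_toNNReal.min continuous_const))
    (fun v => measurable_eval_canonicalFiltration (min_le_right _ _)) (Set.Ioc (0 : ℝ) t)
  convert h1 using 1
  funext x
  rw [intervalIntegral.integral_of_le t.coe_nonneg]
  refine setIntegral_congr_fun measurableSet_Ioc fun v hv => ?_
  simp only [pathGenerator]
  rw [min_eq_left (Real.toNNReal_le_iff_le_coe.2 hv.2)]

lemma stopPath_stopPath (s : ℝ≥0) (x : PathSpace d) : stopPath s (stopPath s x) = stopPath s x := by
  ext r : 1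
  change stopPath s x (Set.projIcc 0 _ zero_le r : ℝ≥0) = stopPath s x r
  rw [stopPath_apply_of_le (Set.projIcc 0 _ zero_le r).2.2]
  rfl

/-- Bounded increments orthogonal to the continuous functionals of the path up to time `s` have
vanishing integral over the events of the past. -/
lemma setIntegral_eq_zero_of_forall_stopPath {ν : Measure (PathSpace d)} [IsProbabilityMeasure ν]
    {s : ℝ≥0} {D : PathSpace d → ℝ} (hDm : Measurable D) {M : ℝ} (hM : ∀ x, |D x| ≤ M) (hzero : ∀ h
    : PathSpace d → ℝ, Continuous h → (∀ x, |h x| ≤ 1) → (∀ x, h (stopPath s x) = h x) → ∫ x, D x *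
    h x ∂ν = 0) {A : Set (PathSpace d)} (hA : MeasurableSet[canonicalFiltration d s] A) :
    ∫ x in A, D x ∂ν = 0 := by
  have hM0 : 0 ≤ M := (abs_nonneg _).trans (hM 0)
  have hD : ∀ x, 0 ≤ M + D x := fun x => by linarith [(abs_le.1 (hM x)).1]
  have hDi0 : Integrable D ν := Integrable.of_bound hDm.aestronglyMeasurable M (ae_of_all _ hM)
  have hDi : Integrable (fun x => M + D x) ν := (integrable_const _).add hDi0
  have hf1 : IsFiniteMeasure (ν.withDensity fun x => ofReal (M + D x)) :=
    isFiniteMeasure_withDensity_ofReal hDi.hasFiniteIntegral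
  have hf2 : IsFiniteMeasure (ν.withDensity fun _ => ofReal M) :=
    isFiniteMeasure_withDensity_ofReal (integrable_const M).hasFiniteIntegral
  have hsm := (continuous_stopPath (d := d) s).measurable
  have heq : (ν.withDensity fun x => ofReal (M + D x)).map (stopPath s) =
      (ν.withDensity fun _ => ofReal M).map (stopPath s) := by
    refine ext_of_forall_integral_eq_of_IsFiniteMeasure fun f => ?_
    have hfs : Continuous fun x : PathSpace d => f (stopPath s x) :=
      f.continuous.comp (continuous_stopPath s)
    rw [integral_map hsm.aemeasurable f.continuous.aestronglyMeasurable,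
      integral_map hsm.aemeasurable f.continuous.aestronglyMeasurable,
      integral_withDensity_eq_integral_toReal_smul (by fun_prop) (by simp),
      integral_withDensity_eq_integral_toReal_smul (by fun_prop) (by simp)]
    simp only [ENNReal.toReal_ofReal (hD _), ENNReal.toReal_ofReal hM0, smul_eq_mul, add_mul]
    have hfi : Integrable (fun x => f (stopPath s x)) ν :=
      Integrable.of_bound hfs.aestronglyMeasurable ‖f‖ (ae_of_all _ fun x => f.norm_coe_le_norm _)
    have hi2 : Integrable (fun x => D x * f (stopPath s x)) ν := by
      refine Integrable.of_bound (hDm.aestronglyMeasurable.mul hfs.aestronglyMeasurable)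
        (M * ‖f‖) (ae_of_all _ fun x => ?_)
      rw [norm_mul]
      exact mul_le_mul (hM x) (f.norm_coe_le_norm _) (norm_nonneg _) hM0
    rw [integral_add (hfi.const_mul M) hi2]
    have hpos : 0 < ‖f‖ + 1 := by positivity
    have hz := hzero (fun x => (‖f‖ + 1)⁻¹ * f (stopPath s x)) (continuous_const.mul hfs)
      (fun x => by
        rw [abs_mul, abs_of_pos (inv_pos.2 hpos), ← norm_eq_abs, inv_mul_le_one₀ hpos]
        linarith [f.norm_coe_le_norm (stopPath s x)])
      (fun x => by rw [stopPath_stopPath])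
    have e : ∀ x, D x * ((‖f‖ + 1)⁻¹ * f (stopPath s x)) =
        (‖f‖ + 1)⁻¹ * (D x * f (stopPath s x)) := fun x => by ring
    simp_rw [e] at hz
    rw [integral_const_mul] at hz
    have hz' := (mul_eq_zero.1 hz).resolve_left (inv_ne_zero hpos.ne')
    rw [hz', add_zero]
  have hA' : MeasurableSet A := (canonicalFiltration d).le s A hA
  obtain ⟨A', hA'm, rfl⟩ := canonicalFiltration_le_comap_stopPath s A hA
  have h1 := congrArg (fun m : Measure (PathSpace d) => m A') heq
  simp only [Measure.map_apply hsm hA'm] at h1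
  rw [withDensity_apply _ hA', withDensity_apply _ hA',
    ← ofReal_integral_eq_lintegral_ofReal hDi.integrableOn (ae_of_all _ hD),
    ← ofReal_integral_eq_lintegral_ofReal (integrable_const M) (ae_of_all _ fun _ => hM0),
    ENNReal.ofReal_eq_ofReal_iff (integral_nonneg hD) (integral_nonneg fun _ => hM0),
    integral_add (integrable_const _) hDi0.integrableOn] at h1
  linarith

lemma integral_defect_swap (hcoef : CoefficientAssumption b σ) (hφ : ContDiff ℝ 2 φ)
    (hφc : HasCompactSupport φ) (ρ : PathWSpace p d) {s t : ℝ≥0} (hst : s ≤ t) {h : PathSpace d → ℝ}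
    (hh : Continuous h) (hh1 : ∀ x, |h x| ≤ 1) : defect b σ φ s t h ρ = ∫ x, (φ (x t) - φ (x s) -
      ∫ v in (s : ℝ)..t, pathGenerator b σ φ v.toNNReal ρ x) * h x ∂ρ.toMeasure := by
  have hgc : Continuous fun z : ℝ × PathSpace d => pathGenerator b σ φ z.1.toNNReal ρ z.2 :=
    (continuous_pathGenerator hcoef hφ).comp (f := fun z : ℝ × PathSpace d =>
      (z.2, (z.1.toNNReal, ρ))) (by fun_prop)
  obtain ⟨B, hB⟩ := hφc.exists_bound_of_continuous hφ.continuous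
  obtain ⟨M, hM0, hM⟩ := eventually_abs_pathGenerator_le hcoef hφ hφc ρ t
  have hM' := hM.self_of_nhds
  have hst' : (s : ℝ) ≤ t := by exact_mod_cast hst
  have hI : Integrable (Function.uncurry fun (v : ℝ) (x : PathSpace d) =>
      pathGenerator b σ φ v.toNNReal ρ x * h x)
      ((volume.restrict (Set.uIoc (s : ℝ) t)).prod ρ.toMeasure) := by
    rw [Set.uIoc_of_le hst']
    refine Integrable.of_bound (C := M) (Continuous.aestronglyMeasurable
      (hgc.mul (hh.comp continuous_snd))) ?_
    have h3 : ∀ᵐ z ∂((volume.restrict (Set.Ioc (s : ℝ) t)).prod ρ.toMeasure),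
        z.1 ∈ Set.Ioc (s : ℝ) t :=
      Measure.quasiMeasurePreserving_fst.ae (ae_restrict_mem measurableSet_Ioc)
    filter_upwards [h3] with z hz
    simp only [Function.uncurry]
    rw [norm_mul, norm_eq_abs, norm_eq_abs]
    calc _ ≤ M * 1 := mul_le_mul (hM' _ (Real.toNNReal_le_iff_le_coe.2 hz.2) _) (hh1 _)
          (abs_nonneg _) hM0
      _ = M := mul_one M
  have hi : Integrable (fun x => (φ (x t) - φ (x s)) * h x) ρ.toMeasure := by
    refine Integrable.of_bound (C := B + B) (Continuous.aestronglyMeasurable ?_)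
      (ae_of_all _ fun x => ?_)
    · have := hφ.continuous
      exact Continuous.mul (by fun_prop) hh
    · have h1 := hB (x t)
      have h2 := hB (x s)
      rw [norm_mul]
      calc _ ≤ (B + B) * 1 := mul_le_mul ((norm_sub_le _ _).trans (add_le_add h1 h2)) (hh1 x)
            (abs_nonneg _) (by linarith [norm_nonneg (φ (x t))])
        _ = _ := mul_one _
  have hi3 : Integrable (fun x => ∫ v in (s : ℝ)..t,
      pathGenerator b σ φ v.toNNReal ρ x * h x) ρ.toMeasure := by
    simp_rw [intervalIntegral.integral_of_le hst']
    rw [Set.uIoc_of_le hst'] at hI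
    exact hI.integral_prod_right
  rw [defect, intervalIntegral_integral_swap hI, ← integral_sub hi hi3]
  refine integral_congr_ae (ae_of_all _ fun x => ?_)
  simp only [intervalIntegral.integral_mul_const]
  ring

/-- A law of paths with vanishing martingale defects is a McKean–Vlasov distribution. -/
lemma mem_mckeanVlasov_of_defect_eq_zero (hcoef : CoefficientAssumption b σ) {ρ : PathWSpace p d} (H
    : ∀ φ : State d → ℝ, ContDiff ℝ 2 φ → HasCompactSupport φ → ∀ s t : ℝ≥0, s ≤ t → ∀ h : PathSpace
    d → ℝ, Continuous h → (∀ x, |h x| ≤ 1) → (∀ x, h (stopPath s x) = h x) → defect b σ φ s t h ρ =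
    0) : ρ ∈ mckeanVlasov b σ := by
  intro φ hφ hφc
  obtain ⟨B, hB⟩ := hφc.exists_bound_of_continuous hφ.continuous
  have hgc : Continuous fun z : ℝ × PathSpace d => pathGenerator b σ φ z.1.toNNReal ρ z.2 :=
    (continuous_pathGenerator hcoef hφ).comp (f := fun z : ℝ × PathSpace d =>
      (z.2, (z.1.toNNReal, ρ))) (by fun_prop)
  have hgi : ∀ (x : PathSpace d) (a c : ℝ), IntervalIntegrable
      (fun v => pathGenerator b σ φ v.toNNReal ρ x) volume a c := fun x a c =>
    (hgc.comp (continuous_id.prodMk continuous_const)).intervalIntegrable _ _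
  obtain ⟨N, hN⟩ : ∃ N : ℝ≥0 → PathSpace d → ℝ, N = fun (t : ℝ≥0) x => φ (x t) - ∫ v in (0 : ℝ)..t,
    pathGenerator b σ φ v.toNNReal ρ x := ⟨_, rfl⟩
  suffices hmart : Martingale N (canonicalFiltration d) ρ.toMeasure by
    rw [hN] at hmart
    exact hmart
  have hadapt : StronglyAdapted (canonicalFiltration d) N := by
    intro t
    rw [hN]
    exact ((hφ.continuous.measurable.comp
      (measurable_eval_canonicalFiltration le_rfl)).stronglyMeasurable).sub
      (stronglyMeasurable_integral_pathGenerator hcoef hφ ρ t)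
  have hNb : ∀ t, ∃ M : ℝ, 0 ≤ M ∧ ∀ x, |N t x| ≤ M := by
    intro t
    obtain ⟨M, hM0, hM⟩ := eventually_abs_pathGenerator_le hcoef hφ hφc ρ t
    have hM' := hM.self_of_nhds
    have hB0 : 0 ≤ B := (norm_nonneg _).trans (hB 0)
    refine ⟨B + M * t, by positivity, fun x => ?_⟩
    rw [hN]
    refine (abs_sub _ _).trans (add_le_add (hB _) ?_)
    have := intervalIntegral.norm_integral_le_of_norm_le_const (C := M) (a := (0 : ℝ)) (b := t)
      (f := fun v => pathGenerator b σ φ v.toNNReal ρ x) (fun v hv => by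
        rw [Set.uIoc_of_le t.coe_nonneg] at hv
        exact hM' _ (Real.toNNReal_le_iff_le_coe.2 hv.2) x)
    simpa using this
  have hNm : ∀ t, Measurable (N t) := fun t =>
    ((hadapt t).measurable).mono ((canonicalFiltration d).le t) le_rfl
  have hNi : ∀ t, Integrable (N t) ρ.toMeasure := fun t => by
    obtain ⟨M, -, hM⟩ := hNb t
    exact Integrable.of_bound (hNm t).aestronglyMeasurable M (ae_of_all _ hM)
  refine ⟨hadapt, fun s t hst => ?_⟩
  have hzero : ∀ h : PathSpace d → ℝ, Continuous h → (∀ x, |h x| ≤ 1) →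
      (∀ x, h (stopPath s x) = h x) → ∫ x, (N t x - N s x) * h x ∂ρ.toMeasure = 0 := by
    intro h hh hh1 hhs
    rw [← H φ hφ hφc s t hst h hh hh1 hhs, integral_defect_swap hcoef hφ hφc ρ hst hh hh1]
    refine integral_congr_ae (ae_of_all _ fun x => ?_)
    simp only [hN]
    rw [← intervalIntegral.integral_interval_sub_left (hgi x 0 t) (hgi x 0 s)]
    ring
  obtain ⟨Ms, hMs0, hMs⟩ := hNb s
  obtain ⟨Mt, hMt0, hMt⟩ := hNb t
  symm
  refine ae_eq_condExp_of_forall_setIntegral_eq ((canonicalFiltration d).le s) (hNi t)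
    (fun A _ _ => (hNi s).integrableOn) (fun A hA _ => ?_) (hadapt s).aestronglyMeasurable
  have h1 := setIntegral_eq_zero_of_forall_stopPath (D := fun x => N t x - N s x)
    ((hNm t).sub (hNm s)) (M := Mt + Ms)
    (fun x => (abs_sub _ _).trans (add_le_add (hMt x) (hMs x))) hzero hA
  rw [integral_sub (hNi t).integrableOn (hNi s).integrableOn] at h1
  linarith

end Generator

section Moments

variable {Ω : Type*} [mΩ : MeasurableSpace Ω] {P : Measure Ω}

lemma memLp_of_lintegral_pow_lt_top {V : Type*} [NormedAddCommGroup V] {f : Ω → V}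
    (hf : AEStronglyMeasurable f P) {q : ℕ} (hq : q ≠ 0) (h : ∫⁻ w, ‖f w‖ₑ ^ q ∂P < ⊤) :
    MemLp f q P := by
  refine ⟨hf, ?_⟩
  rw [eLpNorm_lt_top_iff_lintegral_rpow_enorm_lt_top (by simpa using hq) (by simp)]
  simpa using h

lemma integral_norm_pow_le_of_lintegral {V : Type*} [NormedAddCommGroup V] {f : Ω → V}
    (hf : AEStronglyMeasurable f P) {q : ℕ} {C : ℝ} (hC : 0 ≤ C)
    (h : ∫⁻ w, ‖f w‖ₑ ^ q ∂P ≤ ofReal C) : ∫ w, ‖f w‖ ^ q ∂P ≤ C := by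
  rw [integral_eq_lintegral_of_nonneg_ae (ae_of_all _ fun _ => by positivity)
    (by exact hf.norm.pow q)]
  refine ENNReal.toReal_le_of_le_ofReal hC (le_trans (le_of_eq ?_) h)
  refine lintegral_congr fun w => ?_
  rw [ofReal_pow (norm_nonneg _), ofReal_norm]

lemma memLp_coord {d : ℕ} {f : Ω → State d} {q : ℝ≥0∞} (hf : MemLp f q P) (a : Fin d) :
    MemLp (fun w => f w a) q P := by
  refine MemLp.of_le hf ?_ (ae_of_all _ fun w => PiLp.norm_apply_le (f w) a)
  exact (EuclideanSpace.proj a : State d →L[ℝ] ℝ).continuous.comp_aestronglyMeasurable hf.1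

lemma condExp_coord {d : ℕ} {f : Ω → State d} (hf : Integrable f P) (m : MeasurableSpace Ω)
    (a : Fin d) : P[fun w => f w a | m] =ᵐ[P] fun w => (P[f | m]) w a := by
  have h := (EuclideanSpace.proj a : State d →L[ℝ] ℝ).comp_condExp_comm (m := m) hf
  filter_upwards [h] with w hw
  exact hw.symm

/-- A variable with vanishing conditional expectation is orthogonal to the past. -/
lemma integral_mul_eq_zero_of_condExp {m : MeasurableSpace Ω} (hm : m ≤ mΩ) [IsProbabilityMeasure P]
    {Z f : Ω → ℝ} (hZ : StronglyMeasurable[m] Z) (hf : Integrable f P)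
    (hZf : Integrable (fun w => Z w * f w) P) (h : P[f | m] =ᵐ[P] 0) : ∫ w, Z w * f w ∂P = 0 := by
  have h1 : P[fun w => Z w * f w | m] =ᵐ[P] Z * P[f | m] :=
    condExp_mul_of_stronglyMeasurable_left hZ hZf hf
  rw [← integral_condExp hm, integral_congr_ae h1,
    integral_congr_ae (g := fun _ => (0 : ℝ)) (by
      filter_upwards [h] with w hw
      simp [hw])]
  simp

end Moments

section Symmetrization

variable {p : ℝ} [hp : Fact (1 ≤ p)] {d d' : ℕ} {Ω : Type*} [mΩ : MeasurableSpace Ω]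

lemma measurable_drift {b : Drift p d}
    (hb : Continuous fun z : State d × WSpace p (State d) => b z.1 z.2) {n : ℕ+}
    {α : Type*} {m : MeasurableSpace α} {x : Fin n → α → State d} (hx : ∀ j, Measurable (x j))
    (i : Fin n) : Measurable fun a => b (x i a) (empirical fun j => x j a) := by
  have h1 : Continuous fun y : Fin n → State d => b (y i) (empirical y) :=
    hb.comp (f := fun y : Fin n → State d => (y i, (empirical y : WSpace p (State d))))
      ((continuous_apply i).prodMk continuous_empirical)
  exact h1.measurable.comp (measurable_pi_iff.2 hx)

lemma measurable_diffusion {σ : Diffusion p d d'}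
    (hσ : Continuous fun z : State d × WSpace p (State d) => σ z.1 z.2) {n : ℕ+} {α : Type*}
    {m : MeasurableSpace α} {x : Fin n → α → State d} (hx : ∀ j, Measurable (x j)) (i : Fin n)
    (a : Fin d) (c : Fin d') : Measurable fun w => σ (x i w) (empirical fun j => x j w) a c := by
  have h1 : Continuous fun y : Fin n → State d => σ (y i) (empirical y) :=
    hσ.comp (f := fun y : Fin n → State d => (y i, (empirical y : WSpace p (State d))))
      ((continuous_apply i).prodMk continuous_empirical)
  exact (h1.matrix_elem a c).measurable.comp (measurable_pi_iff.2 hx)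

/-- The initial position and the noises of one particle. -/
abbrev NoiseData (d : ℕ) : Type := State d × (ℕ → State d) × (ℕ → State d)

/-- The part of the data which is known at time `k`. -/
def truncateData {n : ℕ+} (k : ℕ) (y : Fin n → NoiseData d) : Fin n → NoiseData d :=
  fun i => ((y i).1, (fun l => if l < k then (y i).2.1 l else 0),
    fun l => if l < k then (y i).2.2 l else 0)

lemma measurable_truncateData {n : ℕ+} (k : ℕ) {α : Type*} {m : MeasurableSpace α}
    {Y : α → Fin n → NoiseData d} (h0 : ∀ i, Measurable fun a => (Y a i).1)
    (h1 : ∀ i, ∀ l < k, Measurable fun a => (Y a i).2.1 l)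
    (h2 : ∀ i, ∀ l < k, Measurable fun a => (Y a i).2.2 l) :
    Measurable fun a => truncateData k (Y a) := by
  refine measurable_pi_iff.2 fun i => (h0 i).prodMk (Measurable.prodMk ?_ ?_) <;>
    refine measurable_pi_iff.2 fun l => ?_ <;> by_cases hl : l < k
  · simpa [hl] using h1 i l hl
  · simp [hl]
  · simpa [hl] using h2 i l hl
  · simp [hl]

lemma measurable_truncateData_self {n : ℕ+} (k : ℕ) :
    Measurable (truncateData (d := d) (n := n) k) :=
  measurable_truncateData (Y := fun y => y) k (fun i => by fun_prop)
    (fun i l _ => by fun_prop) (fun i l _ => by fun_prop)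

lemma truncateData_truncateData {n : ℕ+} {k l : ℕ} (h : k ≤ l) (y : Fin n → NoiseData d) :
    truncateData k (truncateData l y) = truncateData k y := by
  funext i
  simp only [truncateData, Prod.mk.injEq, true_and]
  constructor <;>
  · funext j
    by_cases hj : j < k
    · simp [hj, hj.trans_le h]
    · simp [hj]

/-- The filtration generated by the data. -/
def dataFiltration {n : ℕ+} (Y : Ω → Fin n → NoiseData d) (hY : Measurable Y) :
    Filtration ℕ mΩ where
  seq k := MeasurableSpace.comap (fun w => truncateData k (Y w)) inferInstance
  mono' k l hkl := by
    rintro A ⟨B, hB, rfl⟩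
    refine ⟨truncateData k ⁻¹' B, measurable_truncateData_self k hB, ?_⟩
    ext w
    simp [truncateData_truncateData hkl]
  le' k := ((measurable_truncateData_self k).comp hY).comap_le

/-- A particle system whose noises satisfy, for every particle, the conditions which are imposed
on the first one. -/
structure SymmetrizedSystem (P : Measure Ω) (b : Drift p d) (σ : Diffusion p d d') (γ : ℕ → ℝ)
    (X ξ ζ : Particles Ω d) (F : ℕ+ → Filtration ℕ mΩ) (q : ℕ) (C : ℝ) (η : ℕ → ℕ+ → ℝ) : Prop where
  step : ∀ n k i w,
    X n (k + 1) i w = X n k i w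
      + γ (k + 1) • b (X n k i w) (empirical fun j => X n k j w)
      + √(2 * γ (k + 1)) • ξ n (k + 1) i w
      + γ (k + 1) • ζ n (k + 1) i w
  measurable_X : ∀ n k i, Measurable[F n k] (X n k i)
  measurable_ξ : ∀ n k i, Measurable[F n (k + 1)] (ξ n (k + 1) i)
  measurable_ζ : ∀ n k i, Measurable[F n (k + 1)] (ζ n (k + 1) i)
  memLp_init : ∀ n i, MemLp (X n 0 i) q P
  integral_init : ∀ n i, ∫ w, ‖X n 0 i w‖ ^ q ∂P ≤ C
  memLp_ξ : ∀ n k i, MemLp (ξ n (k + 1) i) 4 P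
  integral_ξ : ∀ n k i, ∫ w, ‖ξ n (k + 1) i w‖ ^ 4 ∂P ≤ C
  memLp_ζ : ∀ n k i, MemLp (ζ n (k + 1) i) q P
  integral_ζ : ∀ n k i, ∫ w, ‖ζ n (k + 1) i w‖ ^ q ∂P ≤ C
  condExp_ξ : ∀ n k i a,
    P[fun w => ξ n (k + 1) i w a | F n k] =ᵐ[P] 0
  condCov_ξ : ∀ n k i j a c,
    P[fun w => ξ n (k + 1) i w a * ξ n (k + 1) j w c | F n k] =ᵐ[P] fun w =>
      if i = j then
        (σ (X n k i w) (empirical fun l => X n k l w) *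
          (σ (X n k j w) (empirical fun l => X n k l w)).transpose) a c
      else 0
  condExp_ζ : ∀ n k i a,
    ∫ w, |(P[fun w => ζ n (k + 1) i w a | F n k]) w| ∂P ≤ η k n

section Exchange

variable {P : Measure Ω} [IsProbabilityMeasure P] {n : ℕ+} {Y : Fin n → Ω → NoiseData d}

lemma lintegral_exchange (hY : Exchangeable Y P) {f : NoiseData d → ℝ≥0∞} (hf : Measurable f)
    (i j : Fin n) : ∫⁻ w, f (Y i w) ∂P = ∫⁻ w, f (Y j w) ∂P := by
  have h := (hY (Equiv.swap j i)).comp (u := fun y : Fin n → NoiseData d => f (y j)) (by fun_prop)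
  have h2 := h.lintegral_eq
  simpa [Function.comp_def] using h2

lemma integral_exchange (hY : Exchangeable Y P) {W : (Fin n → NoiseData d) → ℝ}
    (hW : Measurable W) {f : NoiseData d → ℝ} (hf : Measurable f) (k : ℕ) (i j : Fin n) :
    ∫ w, W (truncateData k fun l => Y l w) * f (Y i w) ∂P =
      ∫ w, W (fun l => truncateData k (fun l => Y l w) (Equiv.swap j i l)) * f (Y j w) ∂P := by
  have hm : Measurable fun y : Fin n → NoiseData d => W (truncateData k y) * f (y i) :=
    (hW.comp (measurable_truncateData_self k)).mul (by fun_prop)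
  have h := ((hY (Equiv.swap j i)).comp hm).integral_eq
  simp only [Function.comp_def] at h
  rw [← h, Equiv.swap_apply_right]
  rfl

lemma integral_abs_condExp_exchange_le {Ω : Type*} {G m mΩ : MeasurableSpace Ω} {P : Measure Ω}
    [IsProbabilityMeasure P] {Y : Fin n → Ω → NoiseData d} (hY : Exchangeable Y P)
    (hYm : Measurable fun w i => Y i w) (hm : m ≤ mΩ) {k : ℕ}
    (hG : G = dataFiltration (fun w i => Y i w) hYm k)
    (hT : Measurable[m] fun w => truncateData k fun i => Y i w) {f : NoiseData d → ℝ}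
    (hf : Measurable f) (i j : Fin n) (hi : Integrable (fun w => f (Y i w)) P)
    (hj : Integrable (fun w => f (Y j w)) P) : ∫ w, |(P[fun w => f (Y i w) | G]) w| ∂P ≤
      ∫ w, |(P[fun w => f (Y j w) | m]) w| ∂P := by
  have hF : G ≤ mΩ := hG ▸ (dataFiltration _ hYm).le k
  have hTF : Measurable[G] fun w => truncateData k fun i => Y i w := hG ▸ comap_measurable _
  obtain ⟨W₀, hW₀, hW₀e⟩ := ((stronglyMeasurable_condExp (μ := P) (m := G)
    (f := fun w => f (Y i w))).measurable.mono hG.le le_rfl).exists_eq_measurable_comp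
  obtain ⟨W, hWdef⟩ : ∃ W : (Fin n → NoiseData d) → ℝ, W = fun y => if 0 ≤ W₀ y then 1 else -1 :=
    ⟨_, rfl⟩
  have hW : Measurable W := by
    rw [hWdef]
    exact Measurable.ite (measurableSet_le measurable_const hW₀) measurable_const measurable_const
  have hW1 : ∀ y, ‖W y‖ ≤ 1 := fun y => by
    simp only [hWdef]
    split_ifs <;> simp
  have e1 : ∀ w, |(P[fun w => f (Y i w) | G]) w| =
      W (truncateData k fun l => Y l w) *
        (P[fun w => f (Y i w) | G]) w := by
    intro w
    rw [hW₀e]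
    simp only [Function.comp_def, hWdef]
    split_ifs with h
    · rw [abs_of_nonneg h, one_mul]
    · rw [abs_of_neg (not_le.1 h), neg_one_mul]
  have hWm : StronglyMeasurable[G]
      fun w => W (truncateData k fun l => Y l w) := (hW.comp hTF).stronglyMeasurable
  have hWi : Integrable (fun w => W (truncateData k fun l => Y l w) * f (Y i w)) P :=
    hi.bdd_mul (c := 1) (hWm.mono hF).aestronglyMeasurable (ae_of_all _ fun w => hW1 _)
  have e2 : ∫ w, |(P[fun w => f (Y i w) | G]) w| ∂P =
      ∫ w, W (truncateData k fun l => Y l w) * f (Y i w) ∂P := by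
    simp_rw [e1]
    rw [← integral_condExp hF (f := fun w => W (truncateData k fun l => Y l w) * f (Y i w))]
    exact (integral_congr_ae (condExp_mul_of_stronglyMeasurable_left hWm hWi hi)).symm
  rw [e2, integral_exchange hY hW hf k i j]
  have hWm' : StronglyMeasurable[m] fun w =>
      W (fun l => truncateData k (fun l => Y l w) (Equiv.swap j i l)) := by
    have h3 : Measurable fun y : Fin n → NoiseData d => W (fun l => y (Equiv.swap j i l)) :=
      hW.comp (by fun_prop)
    exact (h3.comp hT).stronglyMeasurable
  have hWi' : Integrable (fun w => W (fun l => truncateData k (fun l => Y l w)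
      (Equiv.swap j i l)) * f (Y j w)) P :=
    hj.bdd_mul (c := 1) (hWm'.mono hm).aestronglyMeasurable (ae_of_all _ fun w => hW1 _)
  rw [← integral_condExp hm (f := fun w => W (fun l => truncateData k (fun l => Y l w)
      (Equiv.swap j i l)) * f (Y j w))]
  refine (le_of_eq (integral_congr_ae
    (condExp_mul_of_stronglyMeasurable_left hWm' hWi' hj))).trans ?_
  refine (le_abs_self _).trans ((abs_integral_le_integral_abs).trans ?_)
  refine integral_mono_of_nonneg (ae_of_all _ fun _ => abs_nonneg _) integrable_condExp.abs
    (ae_of_all _ fun w => ?_)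
  simp only [Pi.mul_apply, abs_mul]
  exact mul_le_of_le_one_left (abs_nonneg _) (hW1 _)

end Exchange

lemma measurable_add_smul {V α : Type*} [NormedAddCommGroup V] [NormedSpace ℝ V] [MeasurableSpace V]
    [BorelSpace V] [SecondCountableTopology V] {m : MeasurableSpace α} {f g h e : α → V}
    (hf : Measurable f) (hg : Measurable g) (hh : Measurable h) (he : Measurable e) (r s t : ℝ) :
    Measurable fun w => f w + r • g w + s • h w + t • e w :=
  ((hf.add (hg.const_smul r)).add (hh.const_smul s)).add (he.const_smul t)

lemma measurable_particles {b : Drift p d} {γ : ℕ → ℝ}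
    (hb : Continuous fun z : State d × WSpace p (State d) => b z.1 z.2) {n : ℕ+}
    {X ξ ζ : ℕ → Fin n → Ω → State d} (hstep : ∀ k i w, X (k + 1) i w = X k i w + γ (k + 1) • b (X k
    i w) (empirical fun j => X k j w) + √(2 * γ (k + 1)) • ξ (k + 1) i w + γ (k + 1) • ζ (k + 1) i
    w) (F : Filtration ℕ mΩ) (h0 : ∀ i, Measurable[F 0] (X 0 i))
    (hξ : ∀ k i, Measurable[F (k + 1)] (ξ (k + 1) i))
    (hζ : ∀ k i, Measurable[F (k + 1)] (ζ (k + 1) i)) (k : ℕ) : ∀ i, Measurable[F k] (X k i) := by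
  induction k with
  | zero => exact h0
  | succ k ih =>
    intro i
    have ih' : ∀ i, Measurable[F (k + 1)] (X k i) := fun i =>
      (ih i).mono (F.mono (Nat.le_succ k)) le_rfl
    have h1 := measurable_add_smul (ih' i) (measurable_drift hb ih' i) (hξ k i) (hζ k i)
      (γ (k + 1)) √(2 * γ (k + 1)) (γ (k + 1))
    simp_rw [← hstep k i] at h1
    exact h1

lemma measurable_covariance {σ : Diffusion p d d'}
    (hσ : Continuous fun z : State d × WSpace p (State d) => σ z.1 z.2) {n : ℕ+}
    {m : MeasurableSpace Ω} {x : Fin n → Ω → State d} (hx : ∀ j, Measurable[m] (x j)) (i : Fin n)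
    (a c : Fin d) : Measurable[m] fun w => (σ (x i w) (empirical fun j => x j w) *
      (σ (x i w) (empirical fun j => x j w)).transpose) a c := by
  simp only [Matrix.mul_apply, Matrix.transpose_apply]
  exact measurable_sum _ fun e _ =>
    (measurable_diffusion hσ hx i a e).mul (measurable_diffusion hσ hx i c e)

lemma abs_mul_transpose_le {A : Matrix (Fin d) (Fin d') ℝ} {C : ℝ} (hC : 0 ≤ C)
    (hA : √(∑ i, ∑ j, A i j ^ 2) ≤ C) (a c : Fin d) : |(A * A.transpose) a c| ≤ d' * (C * C) := by
  simp only [Matrix.mul_apply, Matrix.transpose_apply]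
  refine (abs_sum_le_sum_abs _ _).trans ?_
  refine (sum_le_card_nsmul _ _ (C * C) fun e _ => ?_).trans_eq (by simp)
  rw [abs_mul]
  exact mul_le_mul ((abs_le_sqrt_sum_sq _ a e).trans hA) ((abs_le_sqrt_sum_sq _ c e).trans hA)
    (abs_nonneg _) hC

lemma toReal_iSup_bound {ι : Type*} {f : ι → ℝ≥0∞} (h : ⨆ i, f i < ⊤) (i : ι) :
    f i ≤ ofReal (⨆ i, f i).toReal := by
  rw [ENNReal.ofReal_toReal h.ne]
  exact le_iSup f i

/-- The particle system satisfies symmetrized conditions with respect to the filtration generated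
by the initial positions and the noises. -/
lemma exists_symmetrizedSystem {P : Measure Ω} [IsProbabilityMeasure P] {b : Drift p d}
    {σ : Diffusion p d d'} {γ : ℕ → ℝ} {X ξ ζ : Particles Ω d} {ℱ : ℕ+ → Filtration ℕ mΩ}
    (hsys : IsParticleSystem b γ X ξ ζ ℱ) (hcoef : CoefficientAssumption b σ)
    (hnoise : NoiseAssumption σ X ξ ζ ℱ P) {q : ℕ} (hq : q ≠ 0)
    (hX0 : ⨆ n : ℕ+, ∫⁻ w, ‖X n 0 0 w‖ₑ ^ q ∂P < ⊤)
    (hζ0 : ⨆ (n : ℕ+) (k : ℕ), ∫⁻ w, ‖ζ n (k + 1) 0 w‖ₑ ^ q ∂P < ⊤) :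
    ∃ (F : ℕ+ → Filtration ℕ mΩ) (C : ℝ), 0 ≤ C ∧ SymmetrizedSystem P b σ γ X ξ ζ F q C
      (fun k n => ∫ w, ‖(P[ζ n (k + 1) 0 | ℱ n k]) w‖ ∂P) := by
  obtain ⟨Cσ, hCσ, hbound⟩ := hcoef.bound
  let Y : (n : ℕ+) → Fin n → Ω → NoiseData d := fun n i w =>
    (X n 0 i w, (fun k : ℕ => ζ n (k + 1) i w), (fun k : ℕ => ξ n (k + 1) i w))
  have hmX : ∀ n i, Measurable (X n 0 i) := fun n i =>
    (hsys.measurable_init n i).mono ((ℱ n).le 0) le_rfl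
  have hmξ : ∀ n k i, Measurable (ξ n (k + 1) i) := fun n k i =>
    (hsys.measurable_ξ n k i).mono ((ℱ n).le _) le_rfl
  have hmζ : ∀ n k i, Measurable (ζ n (k + 1) i) := fun n k i =>
    (hsys.measurable_ζ n k i).mono ((ℱ n).le _) le_rfl
  have hY : ∀ n, Measurable fun w i => Y n i w := fun n => measurable_pi_iff.2 fun i =>
    (hmX n i).prodMk ((measurable_pi_iff.2 fun k => hmζ n k i).prodMk
      (measurable_pi_iff.2 fun k => hmξ n k i))
  have hex : ∀ n, Exchangeable (Y n) P := hnoise.exchangeable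
  have hTℱ : ∀ n k, Measurable[ℱ n k] fun w => truncateData k fun i => Y n i w := fun n k =>
    measurable_truncateData (Y := fun w i => Y n i w) (m := ℱ n k) k
      (fun i => (hsys.measurable_init n i).mono ((ℱ n).mono (Nat.zero_le k)) le_rfl)
      (fun i l hl => (hsys.measurable_ζ n l i).mono ((ℱ n).mono hl) le_rfl)
      (fun i l hl => (hsys.measurable_ξ n l i).mono ((ℱ n).mono hl) le_rfl)
  let F : ℕ+ → Filtration ℕ mΩ := fun n => dataFiltration (fun w i => Y n i w) (hY n)
  have hTF : ∀ n k, Measurable[F n k] fun w => truncateData k fun i => Y n i w := fun n k =>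
    comap_measurable _
  have hFℱ : ∀ n k, F n k ≤ ℱ n k := fun n k => (hTℱ n k).comap_le
  have hξF : ∀ n k i, Measurable[F n (k + 1)] (ξ n (k + 1) i) := fun n k i => by
    have h1 : Measurable fun y : Fin n → NoiseData d => (y i).2.2 k := by fun_prop
    have h2 := h1.comp (hTF n (k + 1))
    simpa [Function.comp_def, truncateData, Y] using h2
  have hζF : ∀ n k i, Measurable[F n (k + 1)] (ζ n (k + 1) i) := fun n k i => by
    have h1 : Measurable fun y : Fin n → NoiseData d => (y i).2.1 k := by fun_prop
    have h2 := h1.comp (hTF n (k + 1))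
    simpa [Function.comp_def, truncateData, Y] using h2
  have hXF : ∀ n k, ∀ i, Measurable[F n k] (X n k i) := fun n =>
    measurable_particles hcoef.continuous_b (hsys.step n) (F n) (fun i =>
      (by fun_prop : Measurable fun y : Fin n → NoiseData d => (y i).1).comp (hTF n 0))
      (hξF n) (hζF n)
  have bX : ∀ n i, ∫⁻ w, ‖X n 0 i w‖ₑ ^ q ∂P ≤
      ofReal (⨆ n : ℕ+, ∫⁻ w, ‖X n 0 0 w‖ₑ ^ q ∂P).toReal := fun n i => by
    refine le_trans (le_of_eq ?_) (toReal_iSup_bound hX0 n)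
    exact lintegral_exchange (hex n) (f := fun y => ‖y.1‖ₑ ^ q) (by fun_prop) i 0
  have bζ : ∀ n k i, ∫⁻ w, ‖ζ n (k + 1) i w‖ₑ ^ q ∂P ≤
      ofReal (⨆ (n : ℕ+) (k : ℕ), ∫⁻ w, ‖ζ n (k + 1) 0 w‖ₑ ^ q ∂P).toReal :=
      fun n k i => by
    refine le_trans ?_ (toReal_iSup_bound hζ0 n)
    refine le_trans (le_of_eq ?_) (le_iSup _ k)
    exact lintegral_exchange (hex n) (f := fun y => ‖y.2.1 k‖ₑ ^ q) (by fun_prop) i 0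
  have bξ : ∀ n k i, ∫⁻ w, ‖ξ n (k + 1) i w‖ₑ ^ 4 ∂P ≤
      ofReal (⨆ (n : ℕ+) (k : ℕ), ∫⁻ w, ‖ξ n (k + 1) 0 w‖ₑ ^ 4 ∂P).toReal :=
      fun n k i => by
    refine le_trans ?_ (toReal_iSup_bound hnoise.moment_ξ n)
    refine le_trans (le_of_eq ?_) (le_iSup _ k)
    exact lintegral_exchange (hex n) (f := fun y => ‖y.2.2 k‖ₑ ^ 4) (by fun_prop) i 0
  have mX : ∀ n i, MemLp (X n 0 i) q P := fun n i => memLp_of_lintegral_pow_lt_top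
    (hmX n i).aestronglyMeasurable hq ((bX n i).trans_lt ofReal_lt_top)
  have mζ : ∀ n k i, MemLp (ζ n (k + 1) i) q P := fun n k i => memLp_of_lintegral_pow_lt_top
    (hmζ n k i).aestronglyMeasurable hq ((bζ n k i).trans_lt ofReal_lt_top)
  have mξ : ∀ n k i, MemLp (ξ n (k + 1) i) 4 P := fun n k i => by
    have := memLp_of_lintegral_pow_lt_top (q := 4)
      (hmξ n k i).aestronglyMeasurable (by norm_num) ((bξ n k i).trans_lt ofReal_lt_top)
    exact_mod_cast this
  have iζ : ∀ n k i, Integrable (ζ n (k + 1) i) P := fun n k i => (mζ n k i).integrable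
    (by exact_mod_cast Nat.one_le_iff_ne_zero.2 hq)
  have iξ : ∀ n k i, Integrable (ξ n (k + 1) i) P := fun n k i => (mξ n k i).integrable
    (by norm_num)
  have iζa : ∀ n k i a, Integrable (fun w => ζ n (k + 1) i w a) P := fun n k i a =>
    (memLp_coord (mζ n k i) a).integrable (by exact_mod_cast Nat.one_le_iff_ne_zero.2 hq)
  have iξa : ∀ n k i a, Integrable (fun w => ξ n (k + 1) i w a) P := fun n k i a =>
    (memLp_coord (mξ n k i) a).integrable (by norm_num)
  set C1 := (⨆ n : ℕ+, ∫⁻ w, ‖X n 0 0 w‖ₑ ^ q ∂P).toReal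
  set C2 := (⨆ (n : ℕ+) (k : ℕ), ∫⁻ w, ‖ζ n (k + 1) 0 w‖ₑ ^ q ∂P).toReal
  set C3 := (⨆ (n : ℕ+) (k : ℕ), ∫⁻ w, ‖ξ n (k + 1) 0 w‖ₑ ^ 4 ∂P).toReal
  have hC1 : 0 ≤ C1 := toReal_nonneg
  have hC2 : 0 ≤ C2 := toReal_nonneg
  have hC3 : 0 ≤ C3 := toReal_nonneg
  refine ⟨F, C1 + C2 + C3, by positivity, ?_⟩
  refine ⟨hsys.step, hXF, hξF, hζF, mX, fun n i => ?_, mξ, fun n k i => ?_, mζ, fun n k i => ?_,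
    fun n k i a => ?_, fun n k i j a c => ?_, fun n k i a => ?_⟩
  · have := integral_norm_pow_le_of_lintegral (hmX n i).aestronglyMeasurable hC1 (bX n i)
    linarith
  · have := integral_norm_pow_le_of_lintegral (hmξ n k i).aestronglyMeasurable hC3 (bξ n k i)
    linarith
  · have := integral_norm_pow_le_of_lintegral (hmζ n k i).aestronglyMeasurable hC2 (bζ n k i)
    linarith
  · have h1 := integral_abs_condExp_exchange_le (hex n) (hY n) ((ℱ n).le k) rfl (hTℱ n k)
      (f := fun y => y.2.2 k a) (by fun_prop) i 0 (iξa n k i a) (iξa n k 0 a)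
    have h2 : ∫ w, |(P[fun w => (Y n 0 w).2.2 k a | ℱ n k]) w| ∂P = 0 := by
      refine (integral_congr_ae (g := fun _ => (0 : ℝ)) ?_).trans (by simp)
      filter_upwards [condExp_coord (iξ n k 0) (ℱ n k) a, hnoise.condExp_ξ n k] with w h3 h4
      change |(P[fun w => ξ n (k + 1) 0 w a | ℱ n k]) w| = 0
      rw [h3, h4]
      simp
    have h3 := le_antisymm (h1.trans_eq h2) (integral_nonneg fun _ => abs_nonneg _)
    rw [integral_eq_zero_iff_of_nonneg (fun _ => abs_nonneg _) integrable_condExp.abs] at h3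
    filter_upwards [h3] with w hw
    exact abs_eq_zero.1 hw
  · have h1 := condExp_condExp_of_le (μ := P) (f := fun w => ξ n (k + 1) i w a * ξ n (k + 1) j w c)
      (hFℱ n k) ((ℱ n).le k)
    refine h1.symm.trans ((condExp_congr_ae (hnoise.condCov_ξ n k i j a c)).trans ?_)
    by_cases hij : i = j
    · subst hij
      simp only [if_true]
      have hm := measurable_covariance hcoef.continuous_σ (hXF n k) i a c
      rw [condExp_of_stronglyMeasurable ((F n).le k) hm.stronglyMeasurable]
      exact Integrable.of_bound (hm.mono ((F n).le k) le_rfl).aestronglyMeasurable _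
        (ae_of_all _ fun w => abs_mul_transpose_le hCσ.le (hbound _ _).2 a c)
    · simp only [hij, if_false]
      rw [show (fun _ : Ω => (0 : ℝ)) = 0 from rfl, condExp_zero]
  · refine (integral_abs_condExp_exchange_le (hex n) (hY n) ((ℱ n).le k) rfl (hTℱ n k)
      (f := fun y => y.2.1 k a) (by fun_prop) i 0 (iζa n k i a) (iζa n k 0 a)).trans ?_
    refine integral_mono_ae integrable_condExp.abs integrable_condExp.norm ?_
    filter_upwards [condExp_coord (iζ n k 0) (ℱ n k) a] with w h3
    change |(P[fun w => ζ n (k + 1) 0 w a | ℱ n k]) w| ≤ _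
    rw [h3]
    exact PiLp.norm_apply_le ((P[ζ n (k + 1) 0 | ℱ n k]) w) a

end Symmetrization

section Mean

/-- The arithmetic mean of finitely many numbers. -/
def mean {n : ℕ+} (f : Fin n → ℝ) : ℝ := (n : ℝ)⁻¹ * ∑ i, f i

variable {n : ℕ+}

lemma mean_mono {f g : Fin n → ℝ} (h : ∀ i, f i ≤ g i) : mean f ≤ mean g :=
  mul_le_mul_of_nonneg_left (sum_le_sum fun i _ => h i) (by positivity)

lemma mean_nonneg {f : Fin n → ℝ} (h : ∀ i, 0 ≤ f i) : 0 ≤ mean f :=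
  mul_nonneg (by positivity) (sum_nonneg fun i _ => h i)

lemma mean_add (f g : Fin n → ℝ) : mean (fun i => f i + g i) = mean f + mean g := by
  simp only [mean, sum_add_distrib, mul_add]

lemma mean_sub (f g : Fin n → ℝ) : mean (fun i => f i - g i) = mean f - mean g := by
  simp only [mean, sum_sub_distrib, mul_sub]

lemma mean_const_mul (c : ℝ) (f : Fin n → ℝ) : mean (fun i => c * f i) = c * mean f := by
  simp only [mean, ← mul_sum]
  ring

lemma mean_const (c : ℝ) : mean (fun _ : Fin n => c) = c := by
  simp [mean]

lemma abs_mean_le (f : Fin n → ℝ) : |mean f| ≤ mean fun i => |f i| := by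
  rw [mean, abs_mul, abs_of_nonneg (by positivity)]
  exact mul_le_mul_of_nonneg_left (abs_sum_le_sum_abs _ _) (by positivity)

lemma mean_sq_le (f : Fin n → ℝ) : mean f ^ 2 ≤ mean fun i => f i ^ 2 := by
  have h := sq_sum_le_card_mul_sum_sq (s := (univ : Finset (Fin n))) (f := f)
  have hn : (0 : ℝ) < (n : ℕ) := by positivity
  simp only [card_univ, Fintype.card_fin] at h
  calc mean f ^ 2 = ((n : ℝ)⁻¹) ^ 2 * (∑ i, f i) ^ 2 := mul_pow _ _ 2
    _ ≤ ((n : ℝ)⁻¹) ^ 2 * ((n : ℕ) * ∑ i, f i ^ 2) :=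
        mul_le_mul_of_nonneg_left h (by positivity)
    _ = mean fun i => f i ^ 2 := by
        simp only [mean]
        field_simp

lemma mean_le_of_forall_le {f : Fin n → ℝ} {c : ℝ} (h : ∀ i, f i ≤ c) : mean f ≤ c :=
  (mean_mono h).trans_eq (mean_const c)

variable {Ω : Type*} {mΩ : MeasurableSpace Ω} {P : Measure Ω}

lemma integrable_mean {f : Fin n → Ω → ℝ} (h : ∀ i, Integrable (f i) P) :
    Integrable (fun w => mean fun i => f i w) P :=
  (integrable_finsetSum _ fun i _ => h i).const_mul _

lemma integral_mean {f : Fin n → Ω → ℝ} (h : ∀ i, Integrable (f i) P) :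
    ∫ w, mean (fun i => f i w) ∂P = mean fun i => ∫ w, f i w ∂P := by
  simp only [mean]
  rw [integral_const_mul, integral_finsetSum _ fun i _ => h i]

lemma measurable_mean {m : MeasurableSpace Ω} {f : Fin n → Ω → ℝ} (h : ∀ i, Measurable[m] (f i)) :
    Measurable[m] fun w => mean fun i => f i w :=
  (measurable_sum _ fun i _ => h i).const_mul _

end Mean

section Recursion

lemma StepAssumption.exists_le {γ : ℕ → ℝ} (hγ : StepAssumption γ) :
    ∃ G : ℝ, 0 < G ∧ ∀ k, γ (k + 1) ≤ G := by
  obtain ⟨G, hG⟩ := hγ.tendsto_zero.bddAbove_range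
  exact ⟨max G 1, by positivity, fun k => (hG ⟨k + 1, rfl⟩).trans (le_max_left _ _)⟩

lemma exists_bound_of_recursion {γ : ℕ → ℝ} (hγ : StepAssumption γ) {c : ℝ} (hc : 0 < c) (A B : ℝ)
    (hB : 0 ≤ B) : ∃ M : ℝ, ∀ a : ℕ → ℝ, a 0 ≤ A → (∀ k, 0 ≤ a k) →
      (∀ k, a (k + 1) ≤ a k + γ (k + 1) * (-c * a k + B) + B * γ (k + 1) ^ 2 * (1 + a k)) →
      ∀ k, a k ≤ M := by
  obtain ⟨G, hG0, hG⟩ := hγ.exists_le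
  have hcrude : ∀ k, ∃ M : ℝ, ∀ a : ℕ → ℝ, a 0 ≤ A → (∀ k, 0 ≤ a k) →
      (∀ k, a (k + 1) ≤ a k + γ (k + 1) * (-c * a k + B) + B * γ (k + 1) ^ 2 * (1 + a k)) →
      a k ≤ M := by
    intro k
    induction k with
    | zero => exact ⟨A, fun a h0 _ _ => h0⟩
    | succ k ih =>
      obtain ⟨M, hM⟩ := ih
      refine ⟨M + γ (k + 1) * B + B * γ (k + 1) ^ 2 * (1 + M), fun a h0 hn hr => ?_⟩
      have h1 := hM a h0 hn hr
      have h2 := hn k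
      have h3 := hγ.nonneg k
      have h4 : 0 ≤ γ (k + 1) * c * a k := by positivity
      have h5 : B * γ (k + 1) ^ 2 * (1 + a k) ≤ B * γ (k + 1) ^ 2 * (1 + M) :=
        mul_le_mul_of_nonneg_left (by linarith) (by positivity)
      have h6 := hr k
      linarith
  have hev : ∃ K, ∀ k ≥ K, B * γ (k + 1) ≤ c / 2 := by
    have h1 : Tendsto (fun k => B * γ (k + 1)) atTop (𝓝 (B * 0)) :=
      ((tendsto_add_atTop_iff_nat 1).2 hγ.tendsto_zero).const_mul B
    rw [mul_zero] at h1
    exact eventually_atTop.1 (h1.eventually_le_const (by positivity))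
  obtain ⟨K, hK⟩ := hev
  choose M hM using hcrude
  set D : ℝ := 2 * (B + c / 2) / c with hD
  have hD0 : 0 ≤ D := by positivity
  have hDc : c / 2 * D = B + c / 2 := by rw [hD]; field_simp
  refine ⟨(∑ j ∈ range (K + 1), |M j|) + D + G * (B + c / 2), fun a h0 hn hr k => ?_⟩
  have hS : ∀ j ≤ K, a j ≤ ∑ j ∈ range (K + 1), |M j| := fun j hj =>
    (hM j a h0 hn hr).trans ((le_abs_self _).trans (single_le_sum
      (f := fun j => |M j|) (fun _ _ => abs_nonneg _) (by simp; omega)))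
  have hGB : 0 ≤ G * (B + c / 2) := by positivity
  have hS0 : 0 ≤ ∑ j ∈ range (K + 1), |M j| := sum_nonneg fun _ _ => abs_nonneg _
  rcases le_total k K with hk | hk
  · linarith [hS k hk]
  · induction k, hk using Nat.le_induction with
    | base => linarith [hS K le_rfl]
    | succ k hk ih =>
      have h1 := hr k
      have h2 := hn k
      have h3 := hγ.nonneg k
      have h4 : B * γ (k + 1) ^ 2 * (1 + a k) ≤ γ (k + 1) * (c / 2) * (1 + a k) := by
        have : B * γ (k + 1) ^ 2 = γ (k + 1) * (B * γ (k + 1)) := by ring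
        rw [this]
        exact mul_le_mul_of_nonneg_right (mul_le_mul_of_nonneg_left (hK k hk) h3) (by linarith)
      have h5 : a (k + 1) ≤ a k + γ (k + 1) * (B + c / 2 - c / 2 * a k) := by
        refine h1.trans ?_
        linarith
      rcases le_total (a k) D with h | h
      · have h6 : γ (k + 1) * (B + c / 2 - c / 2 * a k) ≤ G * (B + c / 2) := by
          calc _ ≤ γ (k + 1) * (B + c / 2) := mul_le_mul_of_nonneg_left (by nlinarith) h3
            _ ≤ _ := mul_le_mul_of_nonneg_right (hG k) (by positivity)
        linarith
      · have h6 : γ (k + 1) * (B + c / 2 - c / 2 * a k) ≤ 0 := by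
          refine mul_nonpos_of_nonneg_of_nonpos h3 ?_
          rw [← hDc]
          nlinarith
        linarith

lemma norm_sq_increment_le {V : Type*} [NormedAddCommGroup V] [NormedSpace ℝ V] (β ξ ζ : V)
    {γ s : ℝ} (hγ : 0 ≤ γ) (hs : s ^ 2 = 2 * γ) : ‖γ • β + s • ξ + γ • ζ‖ ^ 2 ≤
      3 * γ ^ 2 * ‖β‖ ^ 2 + 6 * γ * ‖ξ‖ ^ 2 + 3 * γ ^ 2 * ‖ζ‖ ^ 2 := by
  have h3 : ‖γ • β + s • ξ + γ • ζ‖ ≤ γ * ‖β‖ + |s| * ‖ξ‖ + γ * ‖ζ‖ := by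
    refine (norm_add₃_le).trans ?_
    rw [norm_smul, norm_smul, norm_smul, norm_of_nonneg hγ, norm_eq_abs]
  have h4 := pow_le_pow_left₀ (norm_nonneg _) h3 2
  have h5 : (|s| * ‖ξ‖) ^ 2 = 2 * γ * ‖ξ‖ ^ 2 := by rw [mul_pow, sq_abs, hs]
  nlinarith [sq_nonneg (γ * ‖β‖ - |s| * ‖ξ‖), sq_nonneg (γ * ‖β‖ - γ * ‖ζ‖),
    sq_nonneg (|s| * ‖ξ‖ - γ * ‖ζ‖)]

lemma norm_sq_step_le {V : Type*} [NormedAddCommGroup V] [InnerProductSpace ℝ V]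
    (x β ξ ζ : V) {γ s ε : ℝ} (hγ : 0 ≤ γ) (hs : s ^ 2 = 2 * γ) (hε : 0 < ε) :
    ‖x + γ • β + s • ξ + γ • ζ‖ ^ 2 ≤ ‖x‖ ^ 2 + 2 * γ * inner ℝ x β + 2 * s * inner ℝ x ξ +
      γ * (ε * ‖x‖ ^ 2 + ε⁻¹ * ‖ζ‖ ^ 2) +
      (3 * γ ^ 2 * ‖β‖ ^ 2 + 6 * γ * ‖ξ‖ ^ 2 + 3 * γ ^ 2 * ‖ζ‖ ^ 2) := by
  have h1 : x + γ • β + s • ξ + γ • ζ = x + (γ • β + s • ξ + γ • ζ) := by abel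
  have h2 := norm_sq_increment_le β ξ ζ hγ hs
  have h6 : 2 * inner ℝ x ζ ≤ ε * ‖x‖ ^ 2 + ε⁻¹ * ‖ζ‖ ^ 2 := by
    have h9 : 0 ≤ ε⁻¹ * (ε * ‖x‖ - ‖ζ‖) ^ 2 := by positivity
    have h10 : ε⁻¹ * (ε * ‖x‖ - ‖ζ‖) ^ 2 = ε * ‖x‖ ^ 2 - 2 * (‖x‖ * ‖ζ‖) + ε⁻¹ * ‖ζ‖ ^ 2 := by
      field_simp
      ring
    linarith [real_inner_le_norm x ζ]
  rw [h1, norm_add_sq_real, inner_add_right, inner_add_right, real_inner_smul_right,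
    real_inner_smul_right, real_inner_smul_right]
  linarith [mul_le_mul_of_nonneg_left h6 hγ]

lemma sq_add_two_mul_add_le {κ u v : ℝ} (hκ : 0 ≤ κ) (hv : 0 ≤ v) (hu : u ^ 2 ≤ κ * v) :
    (κ + 2 * u + v) ^ 2 ≤ κ ^ 2 + 4 * κ * u + 8 * (κ * v) + 3 * v ^ 2 := by
  have h2 : 4 * (u * v) ≤ 2 * (κ * v) + 2 * v ^ 2 := by
    have h3 : (u * v) ^ 2 ≤ ((κ * v + v ^ 2) / 2) ^ 2 := by
      have h4 : (u * v) ^ 2 ≤ κ * v * v ^ 2 := by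
        rw [mul_pow]
        exact mul_le_mul_of_nonneg_right hu (sq_nonneg v)
      nlinarith [sq_nonneg (κ * v - v ^ 2)]
    have h5 := le_of_abs_le (abs_le_of_sq_le_sq h3 (by positivity))
    linarith
  linarith

lemma mul_le_of_sq_le_mul {δ κ Z z : ℝ} (hδ0 : 0 < δ) (hκ : 0 ≤ κ) (hz : 0 ≤ z)
    (hZ : Z ^ 2 ≤ κ * z) : 4 * (κ * Z) ≤ 8 * δ * κ ^ 2 + 1 / (16 * δ ^ 3) * z ^ 2 := by
  have h3 : Z ≤ δ * κ + z / (4 * δ) := by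
    have h4 : Z ^ 2 ≤ (δ * κ + z / (4 * δ)) ^ 2 := by
      refine hZ.trans ?_
      have : (δ * κ + z / (4 * δ)) ^ 2 = κ * z + (δ * κ - z / (4 * δ)) ^ 2 := by
        field_simp
        ring
      rw [this]
      linarith [sq_nonneg (δ * κ - z / (4 * δ))]
    exact le_of_abs_le (abs_le_of_sq_le_sq h4 (by positivity))
  have h5 : κ * Z ≤ δ * κ ^ 2 + κ * (z / (4 * δ)) := by
    have := mul_le_mul_of_nonneg_left h3 hκ
    linarith
  have h6 : 4 * (κ * (z / (4 * δ))) ≤ 4 * δ * κ ^ 2 + 1 / (16 * δ ^ 3) * z ^ 2 := by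
    have h7 : 4 * δ * κ ^ 2 + 1 / (16 * δ ^ 3) * z ^ 2 - 4 * (κ * (z / (4 * δ))) =
        δ * (2 * κ - z / (4 * δ ^ 2)) ^ 2 := by
      field_simp
      ring
    linarith [mul_nonneg hδ0.le (sq_nonneg (2 * κ - z / (4 * δ ^ 2)))]
  linarith

lemma sq_mul_le_of_le {γ G c y : ℝ} (hγ : 0 ≤ γ) (hγG : γ ≤ G) (hc : 0 ≤ c) (hy : 0 ≤ y) :
    c * γ ^ 2 * y ≤ γ * (c * G * y) := by
  have h : 0 ≤ c * γ * (G - γ) * y := by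
    have : 0 ≤ G - γ := by linarith
    positivity
  linarith

set_option maxHeartbeats 1000000 in
/-- The growth of a squared squared norm along one step. -/
lemma sq_step_le {G ε : ℝ} (hG : 0 < G) (hε : 0 < ε) :
    ∃ D : ℝ, 0 ≤ D ∧ ∀ {γ s κ B S Z v β x z : ℝ}, 0 ≤ γ → γ ≤ G → 0 ≤ κ → 0 ≤ v → 0 ≤ β → 0 ≤ x →
      0 ≤ z → Z ^ 2 ≤ κ * z → (γ * B + s * S + γ * Z) ^ 2 ≤ κ * v →
      v ≤ 3 * γ ^ 2 * β + 6 * γ * x + 3 * γ ^ 2 * z →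
      (κ + 2 * (γ * B + s * S + γ * Z) + v) ^ 2 ≤ κ ^ 2 + 4 * γ * (κ * B) + 4 * s * (κ * S) +
        γ * (ε * κ ^ 2 + D * (x ^ 2 + z ^ 2)) + D * γ ^ 2 * (κ ^ 2 + β ^ 2) := by
  set δ := ε / 64 with hδ
  have hδ0 : 0 < δ := by positivity
  refine ⟨12 / δ + 324 * G + 1 / (16 * δ ^ 3) + 24 * G + 81 * G ^ 3 + 48 + 24 + 81 * G ^ 2,
    by positivity, ?_⟩
  intro γ s κ B S Z v β x z hγ hγG hκ hv hβ hx hz hZ hu hvle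
  set u := γ * B + s * S + γ * Z with hudef
  have h1 := sq_add_two_mul_add_le hκ hv hu
  have h2 := mul_le_of_sq_le_mul hδ0 hκ hz hZ
  have h3 : 48 * (κ * x) ≤ 48 * δ * κ ^ 2 + 12 / δ * x ^ 2 := by
    have : 48 * δ * κ ^ 2 + 12 / δ * x ^ 2 - 48 * (κ * x) = 12 * δ * (2 * κ - x / δ) ^ 2 := by
      field_simp
      ring
    nlinarith [mul_nonneg (by positivity : 0 ≤ 12 * δ) (sq_nonneg (2 * κ - x / δ))]
  have h4 : 8 * (κ * v) ≤ 24 * γ ^ 2 * (κ ^ 2 + β ^ 2) + γ * (48 * (κ * x)) +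
      24 * γ ^ 2 * (κ ^ 2 + z ^ 2) := by
    have h5 := mul_le_mul_of_nonneg_left hvle hκ
    have h6 : κ * β ≤ κ ^ 2 + β ^ 2 := by nlinarith [sq_nonneg (κ - β)]
    have h7 : κ * z ≤ κ ^ 2 + z ^ 2 := by nlinarith [sq_nonneg (κ - z)]
    have h8 := mul_le_mul_of_nonneg_left h6 (sq_nonneg γ)
    have h9 := mul_le_mul_of_nonneg_left h7 (sq_nonneg γ)
    linarith
  have h5 : 3 * v ^ 2 ≤ 81 * γ ^ 4 * β ^ 2 + 324 * γ ^ 2 * x ^ 2 + 81 * γ ^ 4 * z ^ 2 := by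
    have h6 := pow_le_pow_left₀ hv hvle 2
    nlinarith [sq_nonneg (γ ^ 2 * β - 2 * γ * x), sq_nonneg (γ ^ 2 * β - γ ^ 2 * z),
      sq_nonneg (2 * γ * x - γ ^ 2 * z)]
  have e1 : γ * (4 * (κ * Z)) ≤ γ * (8 * δ * κ ^ 2 + 1 / (16 * δ ^ 3) * z ^ 2) :=
    mul_le_mul_of_nonneg_left h2 hγ
  have e2 : γ * (48 * (κ * x)) ≤ γ * (48 * δ * κ ^ 2 + 12 / δ * x ^ 2) :=
    mul_le_mul_of_nonneg_left h3 hγ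
  have e3 : 24 * γ ^ 2 * z ^ 2 ≤ γ * (24 * G * z ^ 2) :=
    sq_mul_le_of_le hγ hγG (by norm_num) (sq_nonneg z)
  have e4 : 324 * γ ^ 2 * x ^ 2 ≤ γ * (324 * G * x ^ 2) :=
    sq_mul_le_of_le hγ hγG (by norm_num) (sq_nonneg x)
  have e5 : 81 * γ ^ 4 * z ^ 2 ≤ γ * (81 * G ^ 3 * z ^ 2) := by
    rw [show 81 * γ ^ 4 * z ^ 2 = γ * (81 * γ ^ 3 * z ^ 2) by ring]
    gcongr
  have e6 : 81 * γ ^ 4 * β ^ 2 ≤ 81 * G ^ 2 * (γ ^ 2 * β ^ 2) := by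
    rw [show 81 * γ ^ 4 * β ^ 2 = 81 * γ ^ 2 * (γ ^ 2 * β ^ 2) by ring]
    gcongr
  have hεδ : ε = 64 * δ := by rw [hδ]; ring
  have hA1 : 0 ≤ 12 / δ := by positivity
  have hA2 : 0 ≤ 1 / (16 * δ ^ 3) := by positivity
  generalize 12 / δ = A at *
  generalize 1 / (16 * δ ^ 3) = A' at *
  have hslack : 0 ≤ γ * x ^ 2 * (A' + 24 * G + 81 * G ^ 3 + 72 + 81 * G ^ 2) +
      γ * z ^ 2 * (A + 324 * G + 72 + 81 * G ^ 2) +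
      γ ^ 2 * κ ^ 2 * (A + A' + 348 * G + 81 * G ^ 3 + 24 + 81 * G ^ 2) +
      γ ^ 2 * β ^ 2 * (A + A' + 348 * G + 81 * G ^ 3 + 48) + 8 * δ * γ * κ ^ 2 := by positivity
  rw [hεδ]
  rw [hudef] at h1 ⊢
  linarith

end Recursion

section DriftBounds

variable {p : ℝ} [hp : Fact (1 ≤ p)] {d d' : ℕ} {n : ℕ+} {b : Drift p d} {Cb : ℝ}

/-- Linear growth of a drift. -/
abbrev LinearGrowth (b : Drift p d) (Cb : ℝ) : Prop :=
  ∀ x μ, ‖b x μ‖ ≤ Cb * (1 + ‖x‖ + ∫ y, ‖y‖ ∂μ.toMeasure)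

lemma norm_drift_empirical_le (hb : LinearGrowth b Cb) (x : Fin n → State d) (i : Fin n) :
    ‖b (x i) (empirical x)‖ ≤ Cb * (1 + ‖x i‖ + mean fun j => ‖x j‖) := by
  refine (hb _ _).trans_eq ?_
  rw [integral_empirical]
  rfl

lemma norm_drift_empirical_sq_le (hb : LinearGrowth b Cb) (x : Fin n → State d) (i : Fin n) :
    ‖b (x i) (empirical x)‖ ^ 2 ≤ 3 * Cb ^ 2 * (1 + ‖x i‖ ^ 2 + mean fun i => ‖x i‖ ^ 2) := by
  have h3 := mean_sq_le fun i => ‖x i‖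
  refine (pow_le_pow_left₀ (norm_nonneg _) (norm_drift_empirical_le hb x i) 2).trans ?_
  generalize (mean fun i => ‖x i‖ ^ 2) = κ at *
  generalize (mean fun i => ‖x i‖) = m at *
  have h4 : (1 + ‖x i‖ + m) ^ 2 ≤ 3 * (1 + ‖x i‖ ^ 2 + κ) := by
    nlinarith [sq_nonneg (1 - ‖x i‖), sq_nonneg (1 - m), sq_nonneg (‖x i‖ - m)]
  nlinarith [mul_le_mul_of_nonneg_left h4 (sq_nonneg Cb)]

lemma mean_norm_drift_sq_le (hb : LinearGrowth b Cb) (x : Fin n → State d) :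
    mean (fun i => ‖b (x i) (empirical x)‖ ^ 2) ≤
      3 * Cb ^ 2 * (1 + 2 * mean fun i => ‖x i‖ ^ 2) := by
  refine (mean_mono (norm_drift_empirical_sq_le hb x)).trans_eq ?_
  rw [mean_const_mul, mean_add, mean_add, mean_const, mean_const]
  ring

lemma mean_sq_sq_le {V : Type*} [NormedAddCommGroup V] (x : Fin n → V) :
    (mean fun i => ‖x i‖ ^ 2) ^ 2 ≤ mean fun i => ‖x i‖ ^ 4 := by
  refine (mean_sq_le _).trans_eq ?_
  simp only [← pow_mul, show 2 * 2 = 4 from rfl]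

lemma mean_norm_drift_pow_four_le (hb : LinearGrowth b Cb) (x : Fin n → State d) :
    mean (fun i => ‖b (x i) (empirical x)‖ ^ 4) ≤
      27 * Cb ^ 4 * (1 + 2 * mean fun i => ‖x i‖ ^ 4) := by
  have h1 : ∀ i, ‖b (x i) (empirical x)‖ ^ 4 ≤
      27 * Cb ^ 4 * (1 + ‖x i‖ ^ 4 + mean fun i => ‖x i‖ ^ 4) := fun i => by
    have h2 := pow_le_pow_left₀ (sq_nonneg _) (norm_drift_empirical_sq_le hb x i) 2
    have h3 := mean_sq_sq_le x
    generalize (mean fun i => ‖x i‖ ^ 4) = Q at *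
    generalize (mean fun i => ‖x i‖ ^ 2) = κ at *
    have h4 : (1 + ‖x i‖ ^ 2 + κ) ^ 2 ≤ 3 * (1 + ‖x i‖ ^ 4 + Q) := by
      nlinarith [sq_nonneg (1 - ‖x i‖ ^ 2), sq_nonneg (1 - κ), sq_nonneg (‖x i‖ ^ 2 - κ)]
    linarith [mul_le_mul_of_nonneg_left h4 (by positivity : 0 ≤ 9 * Cb ^ 4)]
  refine (mean_mono h1).trans_eq ?_
  rw [mean_const_mul, mean_add, mean_add, mean_const, mean_const]
  ring

end DriftBounds

section ParticleMoments

variable {p : ℝ} [hp : Fact (1 ≤ p)] {d d' : ℕ} {Ω : Type*} [mΩ : MeasurableSpace Ω]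
  {P : Measure Ω} [IsProbabilityMeasure P] {b : Drift p d} {σ : Diffusion p d d'} {γ : ℕ → ℝ}
  {X ξ ζ : Particles Ω d} {F : ℕ+ → Filtration ℕ mΩ} {q : ℕ} {C : ℝ} {η : ℕ → ℕ+ → ℝ}

lemma memLp_add_smul {V : Type*} [NormedAddCommGroup V] [NormedSpace ℝ V] {f g h e : Ω → V}
    {r : ℝ≥0∞} (hf : MemLp f r P) (hg : MemLp g r P) (hh : MemLp h r P) (he : MemLp e r P)
    (s t u : ℝ) : MemLp (fun w => f w + s • g w + t • h w + u • e w) r P :=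
  ((hf.add (hg.const_smul s)).add (hh.const_smul t)).add (he.const_smul u)

lemma SymmetrizedSystem.measurable_X' (h : SymmetrizedSystem P b σ γ X ξ ζ F q C η) (n : ℕ+)
    (k : ℕ) (i : Fin n) : Measurable (X n k i) :=
  (h.measurable_X n k i).mono ((F n).le k) le_rfl

lemma memLp_growth {V : Type*} [NormedAddCommGroup V] {n : ℕ+} {x : Fin n → Ω → V} {r : ℝ≥0∞}
    (hx : ∀ i, MemLp (x i) r P) (i : Fin n) (c : ℝ) :
    MemLp (fun w => c * (1 + ‖x i w‖ + mean fun j => ‖x j w‖)) r P := by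
  have h2 : MemLp (fun w => ∑ j, ‖x j w‖) r P :=
    memLp_finsetSum (p := r) (μ := P) univ fun j _ => (hx j).norm
  have h3 : MemLp (fun w => mean fun j => ‖x j w‖) r P := h2.const_mul _
  have h4 : MemLp (fun _ : Ω => (1 : ℝ)) r P := memLp_const 1
  have h5 : MemLp (fun w => ‖x i w‖) r P := (hx i).norm
  have h6 := (h4.add h5).add h3
  exact h6.const_mul c

lemma memLp_drift (hcoef : CoefficientAssumption b σ) {n : ℕ+} {x : Fin n → Ω → State d} {r : ℝ≥0∞}
    (hx : ∀ i, MemLp (x i) r P) (hm : ∀ i, Measurable (x i)) (i : Fin n) :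
    MemLp (fun w => b (x i w) (empirical fun j => x j w)) r P := by
  obtain ⟨Cb, hCb, hbound⟩ := hcoef.bound
  refine MemLp.of_le (memLp_growth hx i Cb) (measurable_drift hcoef.continuous_b hm i).aestronglyMeasurable
    (ae_of_all _ fun w => ?_)
  refine (norm_drift_empirical_le (fun x μ => (hbound x μ).1) (fun j => x j w) i).trans ?_
  exact le_abs_self _

lemma SymmetrizedSystem.memLp_X (h : SymmetrizedSystem P b σ γ X ξ ζ F q C η)
    (hcoef : CoefficientAssumption b σ) (hq4 : q ≤ 4) (n : ℕ+) (k : ℕ) :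
    ∀ i, MemLp (X n k i) q P := by
  induction k with
  | zero => exact h.memLp_init n
  | succ k ih =>
    intro i
    have h1 := memLp_add_smul (ih i)
      (memLp_drift hcoef ih (h.measurable_X' n k) i)
      ((h.memLp_ξ n k i).mono_exponent (by exact_mod_cast hq4))
      (h.memLp_ζ n k i) (γ (k + 1)) √(2 * γ (k + 1)) (γ (k + 1))
    simp_rw [← h.step n k i] at h1
    exact h1

/-- The noise is orthogonal to vectors which depend on the past. -/
lemma SymmetrizedSystem.integral_inner_ξ (h : SymmetrizedSystem P b σ γ X ξ ζ F q C η)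
    (n : ℕ+) (k : ℕ) (i : Fin n) {V : Ω → State d} (hV : Measurable[F n k] V)
    (hi : Integrable (fun w => ‖V w‖ * ‖ξ n (k + 1) i w‖) P) :
    Integrable (fun w => (inner ℝ (V w) (ξ n (k + 1) i w) : ℝ)) P ∧
      ∫ w, (inner ℝ (V w) (ξ n (k + 1) i w) : ℝ) ∂P = 0 := by
  have hV' : Measurable V := hV.mono ((F n).le k) le_rfl
  have hξm : Measurable (ξ n (k + 1) i) := (h.measurable_ξ n k i).mono ((F n).le _) le_rfl
  have hc : ∀ a : Fin d, Measurable fun v : State d => v a := fun a =>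
    (EuclideanSpace.proj a : State d →L[ℝ] ℝ).continuous.measurable
  have hia : ∀ a, Integrable (fun w => V w a * ξ n (k + 1) i w a) P := fun a => by
    refine hi.mono' (((hc a).comp hV').mul ((hc a).comp hξm)).aestronglyMeasurable
      (ae_of_all _ fun w => ?_)
    rw [norm_mul]
    exact mul_le_mul (PiLp.norm_apply_le (V w) a) (PiLp.norm_apply_le (ξ n (k + 1) i w) a)
      (norm_nonneg _) (norm_nonneg _)
  have e : ∀ w, (inner ℝ (V w) (ξ n (k + 1) i w) : ℝ) = ∑ a, V w a * ξ n (k + 1) i w a := by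
    intro w
    simp [PiLp.inner_apply, mul_comm]
  simp_rw [e]
  refine ⟨integrable_finsetSum _ fun a _ => hia a, ?_⟩
  rw [integral_finsetSum _ fun a _ => hia a]
  refine sum_eq_zero fun a _ => ?_
  exact integral_mul_eq_zero_of_condExp ((F n).le k) ((hc a).comp hV).stronglyMeasurable
    ((memLp_coord (h.memLp_ξ n k i) a).integrable (by norm_num)) (hia a) (h.condExp_ξ n k i a)

/-- Integrating one step of a random recursion. -/
lemma integral_recursion {Φ Φ' N R : Ω → ℝ} {g s c B R₀ : ℝ} (hΦ : Integrable Φ P)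
    (hΦ' : Integrable Φ' P) (hN : Integrable N P) (hN0 : ∫ w, N w ∂P = 0) (hR : Integrable R P)
    (hR0 : ∫ w, R w ∂P ≤ R₀) (hg : 0 ≤ g)
    (hle : ∀ w, Φ' w ≤ Φ w + g * (-c * Φ w + R w) + s * N w + B * g ^ 2 * (1 + Φ w)) :
    ∫ w, Φ' w ∂P ≤ ∫ w, Φ w ∂P + g * (-c * ∫ w, Φ w ∂P + R₀) + B * g ^ 2 * (1 + ∫ w, Φ w ∂P) := by
  have h1 : Integrable (fun w => g * (-c * Φ w + R w)) P := ((hΦ.const_mul _).add hR).const_mul _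
  have h2 : Integrable (fun w => B * g ^ 2 * (1 + Φ w)) P :=
    ((integrable_const 1).add hΦ).const_mul _
  refine (integral_mono hΦ' (((hΦ.add h1).add (hN.const_mul s)).add h2) hle).trans ?_
  simp only [Pi.add_apply]
  rw [integral_add (by exact (hΦ.add h1).add (hN.const_mul s)) h2,
    integral_add (by exact hΦ.add h1) (hN.const_mul s), integral_add hΦ h1, integral_const_mul,
    integral_const_mul, integral_const_mul, integral_add (hΦ.const_mul _) hR,
    integral_add (integrable_const 1) hΦ, integral_const_mul, hN0]
  simp only [integral_const, probReal_univ, smul_eq_mul, mul_one, mul_zero, add_zero]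
  have := mul_le_mul_of_nonneg_left hR0 hg
  linarith

lemma SymmetrizedSystem.integrable_X (h : SymmetrizedSystem P b σ γ X ξ ζ F q C η)
    (hcoef : CoefficientAssumption b σ) (hq4 : q ≤ 4) (n : ℕ+) (k : ℕ) (i : Fin n) :
    Integrable (fun w => ‖X n k i w‖ ^ q) P :=
  (h.memLp_X hcoef hq4 n k i).integrable_norm_pow'

/-- Moment bounds from one step inequalities. -/
lemma SymmetrizedSystem.exists_integral_le (h : SymmetrizedSystem P b σ γ X ξ ζ F q C η)
    (hC : 0 ≤ C) (hγ : StepAssumption γ) {Φ Z : ℕ+ → ℕ → Ω → ℝ} {V : Particles Ω d}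
    {c a S D B r : ℝ} (hc : 0 < c) (ha : 0 ≤ a) (hS : 0 ≤ S) (hD : 0 ≤ D) (hB : 0 ≤ B)
    (hΦ : ∀ n k w, 0 ≤ Φ n k w) (iΦ : ∀ n k, Integrable (Φ n k) P)
    (hV : ∀ n k i, Measurable[F n k] (V n k i))
    (iV : ∀ n k i, Integrable (fun w => ‖V n k i w‖ * ‖ξ n (k + 1) i w‖) P)
    (iZ : ∀ n k, Integrable (Z n k) P) (bZ : ∀ n k, ∫ w, Z n k w ∂P ≤ S)
    (hst0 : ∀ n, ∫ w, Φ n 0 w ∂P ≤ C) (hle : ∀ n k w, Φ n (k + 1) w ≤ Φ n k w + γ (k + 1) * (-c * Φ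
    n k w + (a + Z n k w + D * ((mean fun i => ‖ξ n (k + 1) i w‖ ^ 4) + mean fun i => ‖ζ n (k + 1) i
    w‖ ^ q))) + r * √(2 * γ (k + 1)) * (mean fun i => (inner ℝ (V n k i w) (ξ n (k + 1) i w) : ℝ)) +
    B * γ (k + 1) ^ 2 * (1 + Φ n k w)) : ∃ M : ℝ, ∀ n k, ∫ w, Φ n k w ∂P ≤ M := by
  set R₀ : ℝ := a + S + D * (C + C) with hR₀
  obtain ⟨M, hM⟩ := exists_bound_of_recursion hγ hc C (R₀ + B) (by positivity)
  refine ⟨M, fun n => hM _ (hst0 n) (fun k => integral_nonneg (hΦ n k)) fun k => ?_⟩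
  have hI := fun i => h.integral_inner_ξ n k i (hV n k i) (iV n k i)
  have jξ : ∀ i, Integrable (fun w => ‖ξ n (k + 1) i w‖ ^ 4) P := fun i =>
    (h.memLp_ξ n k i).integrable_norm_pow (by norm_num)
  have jζ := fun i => (h.memLp_ζ n k i).integrable_norm_pow'
  have iξ := integrable_mean jξ
  have iζ := integrable_mean jζ
  have i1 : Integrable (fun w => a + Z n k w) P := (integrable_const a).add (iZ n k)
  have i2 : Integrable (fun w => D * ((mean fun i => ‖ξ n (k + 1) i w‖ ^ 4) +
    mean fun i => ‖ζ n (k + 1) i w‖ ^ q)) P := (iξ.add iζ).const_mul D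
  refine (integral_recursion (R₀ := R₀) (iΦ n k) (iΦ n (k + 1))
    (integrable_mean fun i => (hI i).1)
    (by rw [integral_mean fun i => (hI i).1]; simp only [(hI _).2, mean_const])
    (i1.add i2) ?_ (hγ.nonneg k) (hle n k)).trans ?_
  · simp only [Pi.add_apply]
    rw [integral_add i1 i2, integral_add (integrable_const a) (iZ n k), integral_const_mul D,
      integral_add iξ iζ, integral_mean jξ, integral_mean jζ]
    have h3 := mul_le_mul_of_nonneg_left (add_le_add (mean_le_of_forall_le (h.integral_ξ n k))
      (mean_le_of_forall_le (h.integral_ζ n k))) hD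
    simp only [integral_const, probReal_univ, smul_eq_mul, one_mul]
    linarith [bZ n k]
  · have hg := hγ.nonneg k
    have h1 : 0 ≤ ∫ w, Φ n k w ∂P := integral_nonneg (hΦ n k)
    have h2 : 0 ≤ γ (k + 1) * B + R₀ * γ (k + 1) ^ 2 * (1 + ∫ w, Φ n k w ∂P) := by positivity
    linarith

lemma SymmetrizedSystem.exists_second_moment_le (h : SymmetrizedSystem P b σ γ X ξ ζ F 2 C η)
    (hC : 0 ≤ C) (hcoef : CoefficientAssumption b σ) (hγ : StepAssumption γ)
    (hmom : MomentAssumption b X ζ P) :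
    ∃ M : ℝ, ∀ n k, mean (fun i => ∫ w, ‖X n k i w‖ ^ 2 ∂P) ≤ M := by
  obtain ⟨Cb, -, hbound⟩ := hcoef.bound
  obtain ⟨c, C₀, hc, hC₀, hdiss⟩ := hmom.dissipative
  obtain ⟨G, hG, hγG⟩ := hγ.exists_le
  have hX : ∀ n k i, MemLp (X n k i) 2 P := by exact_mod_cast h.memLp_X hcoef (by norm_num)
  have iX := h.integrable_X hcoef (by norm_num)
  simp_rw [← integral_mean (iX _ _)]
  refine h.exists_integral_le (Z := fun _ _ _ => 0) (V := X) (a := 2 * C₀ + 6) (S := 0)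
    (D := c⁻¹ + 3 * G + 6) (B := 18 * Cb ^ 2) (r := 2) hC hγ hc (by positivity) le_rfl
    (by positivity) (by positivity) (fun n k w => mean_nonneg fun i => by positivity)
    (fun n k => integrable_mean (iX n k)) h.measurable_X
    (fun n k i => (hX n k i).norm.integrable_mul
      ((h.memLp_ξ n k i).mono_exponent (q := 4) (p := 2) (by norm_num)).norm)
    (fun _ _ => integrable_zero _ _ _) (by simp)
    (fun n => by rw [integral_mean (iX n 0)]; exact mean_le_of_forall_le (h.integral_init n))
    fun n k w => ?_
  have hg := hγ.nonneg k
  have hs : √(2 * γ (k + 1)) ^ 2 = 2 * γ (k + 1) := sq_sqrt (by positivity)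
  have hd := hdiss (empirical fun j => X n k j w) (integrable_empirical _ _)
  have h1 := mean_mono fun i => norm_sq_step_le (X n k i w)
    (b (X n k i w) (empirical fun j => X n k j w)) (ξ n (k + 1) i w) (ζ n (k + 1) i w) hg hs hc
  simp_rw [← h.step n k] at h1
  rw [integral_empirical (f := fun x => inner ℝ x (b x (empirical fun j => X n k j w))),
    integral_empirical (f := fun x => ‖x‖ ^ 2)] at hd
  change (mean fun i => (inner ℝ (X n k i w) (b (X n k i w) (empirical fun j => X n k j w)) : ℝ))
    ≤ -c * (mean fun i => ‖X n k i w‖ ^ 2) + C₀ at hd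
  have hbb := mean_norm_drift_sq_le (fun x μ => (hbound x μ).1) fun i => X n k i w
  simp only [mean_add, mean_const_mul] at h1
  refine h1.trans ?_
  have hξ : (mean fun i => ‖ξ n (k + 1) i w‖ ^ 2) ≤ 1 + mean fun i => ‖ξ n (k + 1) i w‖ ^ 4 := by
    have e1 := mean_sq_sq_le fun i => ξ n (k + 1) i w
    nlinarith [sq_nonneg ((mean fun i => ‖ξ n (k + 1) i w‖ ^ 2) - 1)]
  have hζ0 : 0 ≤ mean fun i => ‖ζ n (k + 1) i w‖ ^ 2 := mean_nonneg fun i => by positivity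
  have hξ0 : 0 ≤ mean fun i => ‖ξ n (k + 1) i w‖ ^ 4 := mean_nonneg fun i => by positivity
  generalize (mean fun i => ‖X n k i w‖ ^ 2) = κ at *
  generalize (mean fun i => ‖ζ n (k + 1) i w‖ ^ 2) = z at *
  generalize (mean fun i => ‖ξ n (k + 1) i w‖ ^ 4) = x at *
  have t1 := mul_le_mul_of_nonneg_left hd (by positivity : 0 ≤ 2 * γ (k + 1))
  have t2 := mul_le_mul_of_nonneg_left hbb (by positivity : 0 ≤ 3 * γ (k + 1) ^ 2)
  have t3 := sq_mul_le_of_le hg (hγG k) (by norm_num : (0 : ℝ) ≤ 3) hζ0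
  have t4 : 0 ≤ γ (k + 1) ^ 2 * Cb ^ 2 := by positivity
  have t5 := mul_le_mul_of_nonneg_left hξ hg
  have t6 : 0 ≤ γ (k + 1) * ((c⁻¹ + 3 * G) * x + 6 * z) := by positivity
  linarith

lemma mean_inner_sq_le {V : Type*} [NormedAddCommGroup V] [InnerProductSpace ℝ V] {n : ℕ+}
    (x y : Fin n → V) : (mean fun i => (inner ℝ (x i) (y i) : ℝ)) ^ 2 ≤ (mean fun i => ‖x i‖ ^ 2) *
    mean fun i => ‖y i‖ ^ 2 := by
  have h1 : (∑ i, (inner ℝ (x i) (y i) : ℝ)) ^ 2 ≤ (∑ i, ‖x i‖ * ‖y i‖) ^ 2 := by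
    refine sq_le_sq' ?_ ?_
    · rw [← Finset.sum_neg_distrib]
      exact sum_le_sum fun i _ => neg_le_of_abs_le (abs_real_inner_le_norm _ _)
    · exact sum_le_sum fun i _ => real_inner_le_norm _ _
  have h2 := h1.trans (Finset.sum_mul_sq_le_sq_mul_sq univ (fun i => ‖x i‖) fun i => ‖y i‖)
  have h3 : 0 ≤ ((n : ℝ)⁻¹) ^ 2 := by positivity
  have h4 := mul_le_mul_of_nonneg_left h2 h3
  simp only [mean]
  linarith

lemma mean_sq_step_le {G ε : ℝ} (hG : 0 < G) (hε : 0 < ε) :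
    ∃ D : ℝ, 0 ≤ D ∧ ∀ {V : Type} [NormedAddCommGroup V] [InnerProductSpace ℝ V] {n : ℕ+}
      (x β ξ ζ : Fin n → V) {γ s : ℝ}, 0 ≤ γ → γ ≤ G → s ^ 2 = 2 * γ →
      (mean fun i => ‖x i + γ • β i + s • ξ i + γ • ζ i‖ ^ 2) ^ 2 ≤ (mean fun i => ‖x i‖ ^ 2) ^ 2 +
        4 * γ * ((mean fun i => ‖x i‖ ^ 2) * mean fun i => (inner ℝ (x i) (β i) : ℝ)) +
        4 * s * ((mean fun i => ‖x i‖ ^ 2) * mean fun i => (inner ℝ (x i) (ξ i) : ℝ)) +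
        γ * (ε * (mean fun i => ‖x i‖ ^ 2) ^ 2 +
          D * ((mean fun i => ‖ξ i‖ ^ 4) + mean fun i => ‖ζ i‖ ^ 4)) +
        D * γ ^ 2 * ((mean fun i => ‖x i‖ ^ 2) ^ 2 + (mean fun i => ‖β i‖ ^ 2) ^ 2) := by
  obtain ⟨D, hD0, hD⟩ := sq_step_le hG hε
  refine ⟨D, hD0, fun {V _ _ n} x β ξ ζ γ s hγ hγG hs => ?_⟩
  have hn : ∀ f : Fin n → V, 0 ≤ mean fun i => ‖f i‖ ^ 2 := fun f =>
    mean_nonneg fun i => by positivity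
  have hu : (mean fun i => (inner ℝ (x i) (γ • β i + s • ξ i + γ • ζ i) : ℝ)) =
      γ * (mean fun i => (inner ℝ (x i) (β i) : ℝ)) + s * (mean fun i => (inner ℝ (x i) (ξ i) : ℝ)) +
        γ * mean fun i => (inner ℝ (x i) (ζ i) : ℝ) := by
    simp only [inner_add_right, real_inner_smul_right, mean_add, mean_const_mul]
  have hv : (mean fun i => ‖γ • β i + s • ξ i + γ • ζ i‖ ^ 2) ≤ 3 * γ ^ 2 *
      (mean fun i => ‖β i‖ ^ 2) + 6 * γ * (mean fun i => ‖ξ i‖ ^ 2) +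
        3 * γ ^ 2 * mean fun i => ‖ζ i‖ ^ 2 := by
    refine (mean_mono fun i => norm_sq_increment_le (β i) (ξ i) (ζ i) hγ hs).trans_eq ?_
    simp only [mean_add, mean_const_mul]
  have hk : (mean fun i => ‖x i + γ • β i + s • ξ i + γ • ζ i‖ ^ 2) =
      (mean fun i => ‖x i‖ ^ 2) + 2 * (γ * (mean fun i => (inner ℝ (x i) (β i) : ℝ)) +
        s * (mean fun i => (inner ℝ (x i) (ξ i) : ℝ)) +
        γ * mean fun i => (inner ℝ (x i) (ζ i) : ℝ)) +
        mean fun i => ‖γ • β i + s • ξ i + γ • ζ i‖ ^ 2 := by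
    rw [← hu, ← mean_const_mul, ← mean_add, ← mean_add]
    congr 1
    funext i
    rw [← norm_add_sq_real]
    congr 2
    abel
  rw [hk]
  refine (hD hγ hγG (hn x) (hn fun i => γ • β i + s • ξ i + γ • ζ i) (hn β) (hn ξ) (hn ζ)
    (mean_inner_sq_le x ζ) (by rw [← hu]; exact mean_inner_sq_le x _) hv).trans ?_
  have h1 := mean_sq_le fun i => ‖ξ i‖ ^ 2
  have h2 := mean_sq_le fun i => ‖ζ i‖ ^ 2
  simp only [← pow_mul, show 2 * 2 = 4 from rfl] at h1 h2
  have h3 := mul_le_mul_of_nonneg_left (add_le_add h1 h2) (mul_nonneg hγ hD0)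
  linarith

lemma norm_pow_four_step_le {G ε : ℝ} (hG : 0 < G) (hε : 0 < ε) :
    ∃ D : ℝ, 0 ≤ D ∧ ∀ {V : Type} [NormedAddCommGroup V] [InnerProductSpace ℝ V]
      (x β ξ ζ : V) {γ s : ℝ}, 0 ≤ γ → γ ≤ G → s ^ 2 = 2 * γ →
      ‖x + γ • β + s • ξ + γ • ζ‖ ^ 4 ≤ ‖x‖ ^ 4 + 4 * γ * (inner ℝ x β * ‖x‖ ^ 2) +
        4 * s * inner ℝ (‖x‖ ^ 2 • x) ξ + γ * (ε * ‖x‖ ^ 4 + D * (‖ξ‖ ^ 4 + ‖ζ‖ ^ 4)) +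
        D * γ ^ 2 * (‖x‖ ^ 4 + ‖β‖ ^ 4) := by
  obtain ⟨D, hD0, hD⟩ := mean_sq_step_le hG hε
  refine ⟨D, hD0, fun {V _ _} x β ξ ζ γ s hγ hγG hs => ?_⟩
  have h := hD (n := 1) (fun _ => x) (fun _ => β) (fun _ => ξ) (fun _ => ζ) hγ hγG hs
  simp only [mean_const, ← pow_mul, show 2 * 2 = 4 from rfl] at h
  rw [real_inner_smul_left]
  linarith

lemma SymmetrizedSystem.measurable_mean_sq (h : SymmetrizedSystem P b σ γ X ξ ζ F q C η)
    (n : ℕ+) (k : ℕ) : Measurable[F n k] fun w => mean fun i => ‖X n k i w‖ ^ 2 :=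
  measurable_mean fun i => (by fun_prop : Measurable fun x : State d => ‖x‖ ^ 2).comp
    (h.measurable_X n k i)

lemma SymmetrizedSystem.integrable_mean_sq_sq (h : SymmetrizedSystem P b σ γ X ξ ζ F 4 C η)
    (hcoef : CoefficientAssumption b σ) (n : ℕ+) (k : ℕ) :
    Integrable (fun w => (mean fun i => ‖X n k i w‖ ^ 2) ^ 2) P := by
  refine (integrable_mean (h.integrable_X hcoef le_rfl n k)).mono'
    (((h.measurable_mean_sq n k).mono ((F n).le k) le_rfl).pow_const 2).aestronglyMeasurable
    (ae_of_all _ fun w => ?_)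
  rw [norm_of_nonneg (sq_nonneg _)]
  exact mean_sq_sq_le _

lemma SymmetrizedSystem.integrable_smul_mul (h : SymmetrizedSystem P b σ γ X ξ ζ F 4 C η)
    (hcoef : CoefficientAssumption b σ) {n : ℕ+} {k : ℕ} {f : Ω → ℝ} (hf : Measurable[F n k] f)
    (hf2 : Integrable (fun w => f w ^ 2) P) (i : Fin n) :
    Integrable (fun w => ‖f w • X n k i w‖ * ‖ξ n (k + 1) i w‖) P := by
  refine ((hf2.add (h.integrable_X hcoef le_rfl n k i)).add
    ((h.memLp_ξ n k i).integrable_norm_pow (by norm_num))).mono'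
    (((hf.smul (h.measurable_X n k i)).mono ((F n).le k) le_rfl).norm.mul
      ((h.measurable_ξ n k i).mono ((F n).le _) le_rfl).norm).aestronglyMeasurable
    (ae_of_all _ fun w => ?_)
  simp only [Pi.add_apply]
  rw [norm_of_nonneg (by positivity), norm_smul, norm_eq_abs, ← sq_abs]
  generalize |f w| = κ
  generalize ‖X n k i w‖ = r
  generalize ‖ξ n (k + 1) i w‖ = t
  nlinarith [sq_nonneg (κ - r * t), sq_nonneg (r ^ 2 - t ^ 2)]

lemma SymmetrizedSystem.exists_mean_sq_moment_le (h : SymmetrizedSystem P b σ γ X ξ ζ F 4 C η)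
    (hC : 0 ≤ C) (hcoef : CoefficientAssumption b σ) (hγ : StepAssumption γ)
    (hmom : MomentAssumption b X ζ P) :
    ∃ M : ℝ, ∀ n k, ∫ w, (mean fun i => ‖X n k i w‖ ^ 2) ^ 2 ∂P ≤ M := by
  obtain ⟨Cb, -, hbound⟩ := hcoef.bound
  obtain ⟨c, C₀, hc, hC₀, hdiss⟩ := hmom.dissipative
  obtain ⟨G, hG, hγG⟩ := hγ.exists_le
  obtain ⟨D, hD0, hD⟩ := mean_sq_step_le hG hc
  have iX := h.integrable_X hcoef le_rfl
  have iκ := h.integrable_mean_sq_sq hcoef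
  have mκ := h.measurable_mean_sq
  refine h.exists_integral_le (Z := fun _ _ _ => 0)
    (V := fun n k i w => (mean fun i => ‖X n k i w‖ ^ 2) • X n k i w) (a := 4 * C₀ ^ 2 * c⁻¹)
    (S := 0) (B := D * (1 + 72 * Cb ^ 4)) (r := 4) hC hγ hc (by positivity) le_rfl hD0
    (by positivity) (fun n k w => sq_nonneg _) iκ
    (fun n k i => (mκ n k).smul (h.measurable_X n k i))
    (fun n k => h.integrable_smul_mul hcoef (mκ n k) (iκ n k))
    (fun _ _ => integrable_zero _ _ _) (by simp) (fun n => ?_) fun n k w => ?_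
  · refine (integral_mono (iκ n 0) (integrable_mean (iX n 0)) fun w => mean_sq_sq_le _).trans ?_
    rw [integral_mean (iX n 0)]
    exact mean_le_of_forall_le (h.integral_init n)
  have hg := hγ.nonneg k
  have hs : √(2 * γ (k + 1)) ^ 2 = 2 * γ (k + 1) := sq_sqrt (by positivity)
  have hd := hdiss (empirical fun j => X n k j w) (integrable_empirical _ _)
  have h1 := hD (fun i => X n k i w) (fun i => b (X n k i w) (empirical fun j => X n k j w))
    (fun i => ξ n (k + 1) i w) (fun i => ζ n (k + 1) i w) hg (hγG k) hs
  simp_rw [← h.step n k] at h1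
  rw [integral_empirical (f := fun x => inner ℝ x (b x (empirical fun j => X n k j w))),
    integral_empirical (f := fun x => ‖x‖ ^ 2)] at hd
  change (mean fun i => (inner ℝ (X n k i w) (b (X n k i w) (empirical fun j => X n k j w)) : ℝ))
    ≤ -c * (mean fun i => ‖X n k i w‖ ^ 2) + C₀ at hd
  have hbb := mean_norm_drift_sq_le (fun x μ => (hbound x μ).1) fun i => X n k i w
  have hβ : 0 ≤ mean fun i => ‖b (X n k i w) (empirical fun j => X n k j w)‖ ^ 2 :=
    mean_nonneg fun i => by positivity
  have hκ : 0 ≤ mean fun i => ‖X n k i w‖ ^ 2 := mean_nonneg fun i => by positivity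
  simp only [real_inner_smul_left, mean_const_mul]
  refine h1.trans ?_
  generalize (mean fun i => ‖X n k i w‖ ^ 2) = κ at *
  generalize (mean fun i => ‖b (X n k i w) (empirical fun j => X n k j w)‖ ^ 2) = β at *
  generalize (mean fun i =>
    (inner ℝ (X n k i w) (b (X n k i w) (empirical fun j => X n k j w)) : ℝ)) = Bi at *
  have t1 : κ * Bi ≤ κ * (-c * κ + C₀) := mul_le_mul_of_nonneg_left hd hκ
  have t2 : 4 * (κ * C₀) ≤ 2 * c * κ ^ 2 + 4 * C₀ ^ 2 * c⁻¹ := by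
    have e1 : 0 ≤ c⁻¹ * (c * κ - 2 * C₀) ^ 2 + c * κ ^ 2 := by positivity
    have e2 : c⁻¹ * (c * κ - 2 * C₀) ^ 2 = c * κ ^ 2 - 4 * (κ * C₀) + 4 * C₀ ^ 2 * c⁻¹ := by
      field_simp
      ring
    linarith
  have t3 : 4 * (κ * Bi) + c * κ ^ 2 ≤ -c * κ ^ 2 + 4 * C₀ ^ 2 * c⁻¹ := by linarith
  have t4 := mul_le_mul_of_nonneg_left t3 hg
  have t5 : β ^ 2 ≤ 72 * Cb ^ 4 * (1 + κ ^ 2) := by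
    have e1 := pow_le_pow_left₀ hβ hbb 2
    have e3 : (1 + 2 * κ) ^ 2 ≤ 8 * (1 + κ ^ 2) := by nlinarith [sq_nonneg (κ - 1)]
    linarith [mul_le_mul_of_nonneg_left e3 (by positivity : 0 ≤ 9 * Cb ^ 4)]
  have t6 : κ ^ 2 + β ^ 2 ≤ (1 + 72 * Cb ^ 4) * (1 + κ ^ 2) := by linarith
  linarith [mul_le_mul_of_nonneg_left t6 (by positivity : 0 ≤ D * γ (k + 1) ^ 2)]

lemma SymmetrizedSystem.exists_fourth_moment_le (h : SymmetrizedSystem P b σ γ X ξ ζ F 4 C η)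
    (hC : 0 ≤ C) (hcoef : CoefficientAssumption b σ) (hγ : StepAssumption γ)
    (hmom : MomentAssumption b X ζ P) (hmom4 : FourthMomentAssumption b X ζ P) :
    ∃ M : ℝ, ∀ n k, mean (fun i => ∫ w, ‖X n k i w‖ ^ 4 ∂P) ≤ M := by
  obtain ⟨S, hS⟩ := h.exists_mean_sq_moment_le hC hcoef hγ hmom
  obtain ⟨Cb, -, hbound⟩ := hcoef.bound
  obtain ⟨c, C₀, hc, hC₀, hdiss⟩ := hmom4.dissipative
  obtain ⟨G, hG, hγG⟩ := hγ.exists_le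
  obtain ⟨D, hD0, hD⟩ := norm_pow_four_step_le hG hc
  have iX := h.integrable_X hcoef le_rfl
  have hS0 : 0 ≤ S := (integral_nonneg fun w => sq_nonneg _).trans (hS 1 0)
  set E : ℝ := 8 * C₀ + 8 * C₀ ^ 2 * c⁻¹ with hE
  have hE0 : 0 ≤ E := by positivity
  have m0 : ∀ n k i, Measurable[F n k] fun w => ‖X n k i w‖ ^ 2 := fun n k i =>
    (by fun_prop : Measurable fun x : State d => ‖x‖ ^ 2).comp (h.measurable_X n k i)
  simp_rw [← integral_mean (iX _ _)]
  refine h.exists_integral_le (Z := fun n k w => E * (mean fun i => ‖X n k i w‖ ^ 2) ^ 2)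
    (V := fun n k i w => ‖X n k i w‖ ^ 2 • X n k i w) (a := E) (S := E * S)
    (B := D * (1 + 54 * Cb ^ 4)) (r := 4) hC hγ hc hE0 (by positivity) hD0
    (by positivity) (fun n k w => mean_nonneg fun i => by positivity)
    (fun n k => integrable_mean (iX n k)) (fun n k i => (m0 n k i).smul (h.measurable_X n k i))
    (fun n k i => h.integrable_smul_mul hcoef (m0 n k i)
      (by simpa only [← pow_mul] using iX n k i) i)
    (fun n k => (h.integrable_mean_sq_sq hcoef n k).const_mul E)
    (fun n k => by rw [integral_const_mul]; exact mul_le_mul_of_nonneg_left (hS n k) hE0)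
    (fun n => by rw [integral_mean (iX n 0)]; exact mean_le_of_forall_le (h.integral_init n))
    fun n k w => ?_
  have hg := hγ.nonneg k
  have hs : √(2 * γ (k + 1)) ^ 2 = 2 * γ (k + 1) := sq_sqrt (by positivity)
  have hd := hdiss (empirical fun j => X n k j w) (integrable_empirical _ _)
  have h1 := mean_mono fun i => hD (X n k i w) (b (X n k i w) (empirical fun j => X n k j w))
    (ξ n (k + 1) i w) (ζ n (k + 1) i w) hg (hγG k) hs
  simp_rw [← h.step n k] at h1
  rw [integral_empirical (f := fun x => inner ℝ x (b x (empirical fun j => X n k j w)) * ‖x‖ ^ 2),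
    integral_empirical (f := fun x => ‖x‖ ^ 2), integral_empirical (f := fun x => ‖x‖ ^ 4)] at hd
  change (mean fun i => (inner ℝ (X n k i w) (b (X n k i w) (empirical fun j => X n k j w)) : ℝ) *
    ‖X n k i w‖ ^ 2) ≤ -c * (mean fun i => ‖X n k i w‖ ^ 4) +
      C₀ * (1 + mean fun i => ‖X n k i w‖ ^ 2) * (1 + √(mean fun i => ‖X n k i w‖ ^ 4)) at hd
  have hbb := mean_norm_drift_pow_four_le (fun x μ => (hbound x μ).1) fun i => X n k i w
  have hF : 0 ≤ mean fun i => ‖X n k i w‖ ^ 4 := mean_nonneg fun i => by positivity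
  have hκ : 0 ≤ mean fun i => ‖X n k i w‖ ^ 2 := mean_nonneg fun i => by positivity
  have hr := sq_sqrt hF
  simp only [mean_add, mean_const_mul] at h1
  refine h1.trans ?_
  generalize √(mean fun i => ‖X n k i w‖ ^ 4) = r at *
  generalize (mean fun i => ‖X n k i w‖ ^ 4) = Q at *
  generalize (mean fun i => ‖X n k i w‖ ^ 2) = κ at *
  have t2 : 4 * (C₀ * (1 + κ) * (1 + r)) ≤ 2 * c * Q + E + E * κ ^ 2 := by
    have e1 : 0 ≤ c⁻¹ * (c * r - C₀ * (1 + κ)) ^ 2 + 2 * (C₀ ^ 2 * c⁻¹ * (1 + κ ^ 2)) :=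
      by positivity
    have e2 : c⁻¹ * (c * r - C₀ * (1 + κ)) ^ 2 =
        c * r ^ 2 - 2 * (C₀ * (1 + κ) * r) + C₀ ^ 2 * c⁻¹ * (1 + κ) ^ 2 := by
      field_simp
      ring
    have e3 : (1 + κ) ^ 2 ≤ 2 * (1 + κ ^ 2) := by nlinarith [sq_nonneg (κ - 1)]
    have e4 : 1 + κ ≤ 2 * (1 + κ ^ 2) := by nlinarith [sq_nonneg (κ - 1), sq_nonneg κ]
    have e5 := mul_le_mul_of_nonneg_left e3 (by positivity : 0 ≤ C₀ ^ 2 * c⁻¹)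
    have e6 := mul_le_mul_of_nonneg_left e4 hC₀.le
    rw [hr] at e2
    rw [hE]
    linarith
  have t4 := mul_le_mul_of_nonneg_left (by linarith : 4 * (-c * Q + C₀ * (1 + κ) * (1 + r)) +
    c * Q ≤ -c * Q + (E + E * κ ^ 2)) hg
  have t5 := mul_le_mul_of_nonneg_left hd hg
  have t6 : 0 ≤ Cb ^ 4 := by positivity
  have t7 := mul_le_mul_of_nonneg_left (by linarith : Q +
    (mean fun i => ‖b (X n k i w) (empirical fun j => X n k j w)‖ ^ 4) ≤
      (1 + 54 * Cb ^ 4) * (1 + Q)) (by positivity : 0 ≤ D * γ (k + 1) ^ 2)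
  linarith

end ParticleMoments

section Grid

/-- The times `γ_1 + ⋯ + γ_k`. -/
def gridTime (γ : ℕ → ℝ) (k : ℕ) : ℝ := ∑ l ∈ range k, γ (l + 1)

variable {γ : ℕ → ℝ}

lemma gridTime_succ (γ : ℕ → ℝ) (k : ℕ) : gridTime γ (k + 1) = gridTime γ k + γ (k + 1) :=
  sum_range_succ _ _

lemma gridTime_zero (γ : ℕ → ℝ) : gridTime γ 0 = 0 := rfl

lemma gridTime_mono (hγ : StepAssumption γ) : Monotone (gridTime γ) :=
  monotone_nat_of_le_succ fun k => by
    rw [gridTime_succ]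
    linarith [hγ.nonneg k]

lemma gridTime_nonneg (hγ : StepAssumption γ) (k : ℕ) : 0 ≤ gridTime γ k :=
  sum_nonneg fun l _ => hγ.nonneg l

lemma sum_Icc_eq_gridTime (γ : ℕ → ℝ) (k : ℕ) : ∑ l ∈ Icc 1 k, γ l = gridTime γ k := by
  induction k with
  | zero => simp [gridTime]
  | succ k ih => rw [Finset.sum_Icc_succ_top (by omega), ih, gridTime_succ]

lemma tendsto_gridTime (hγ : StepAssumption γ) : Tendsto (gridTime γ) atTop atTop := by
  have h := hγ.sum_eq_top
  simp_rw [sum_Icc_eq_gridTime] at h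
  exact h

lemma exists_le_gridTime (hγ : StepAssumption γ) (t : ℝ) : ∃ K, t ≤ gridTime γ K :=
  ((tendsto_gridTime hγ).eventually_ge_atTop t).exists

/-- The proportion of the `k`-th step which is completed at time `t`. -/
def gridWeight (γ : ℕ → ℝ) (k : ℕ) (t : ℝ) : ℝ :=
  (min t (gridTime γ (k + 1)) - min t (gridTime γ k)) / γ (k + 1)

lemma continuous_gridWeight (γ : ℕ → ℝ) (k : ℕ) : Continuous (gridWeight γ k) := by
  unfold gridWeight
  fun_prop

lemma mul_gridWeight (γ : ℕ → ℝ) (k : ℕ) (t : ℝ) :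
    γ (k + 1) * gridWeight γ k t = min t (gridTime γ (k + 1)) - min t (gridTime γ k) := by
  by_cases h : γ (k + 1) = 0
  · rw [h, gridTime_succ, h]
    simp
  · rw [gridWeight, mul_div_cancel₀ _ h]

lemma gridWeight_eq_zero {k : ℕ} {t : ℝ} (hγ : StepAssumption γ) (h : t ≤ gridTime γ k) :
    gridWeight γ k t = 0 := by
  rw [gridWeight, min_eq_left h, min_eq_left (h.trans (gridTime_mono hγ k.le_succ)), sub_self,
    zero_div]

lemma gridWeight_eq_one {k : ℕ} {t : ℝ} (hγ : StepAssumption γ) (h : gridTime γ (k + 1) ≤ t)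
    (h0 : γ (k + 1) ≠ 0) : gridWeight γ k t = 1 := by
  rw [gridWeight, min_eq_right h, min_eq_right ((gridTime_mono hγ k.le_succ).trans h),
    gridTime_succ, add_sub_cancel_left, div_self h0]

lemma gridWeight_mono (hγ : StepAssumption γ) (k : ℕ) : Monotone (gridWeight γ k) := by
  intro s t hst
  refine div_le_div_of_nonneg_right ?_ (hγ.nonneg k)
  have h1 := gridTime_mono hγ k.le_succ
  rcases le_total s (gridTime γ k) with h | h
  · rw [min_eq_left h, min_eq_left (h.trans h1), sub_self]
    exact sub_nonneg.2 (min_le_min_left t h1)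
  · rw [min_eq_right h, min_eq_right (h.trans hst)]
    exact sub_le_sub_right (min_le_min_right _ hst) _

lemma gridWeight_nonneg (hγ : StepAssumption γ) (k : ℕ) (t : ℝ) : 0 ≤ gridWeight γ k t :=
  div_nonneg (sub_nonneg.2 (min_le_min_left t (gridTime_mono hγ k.le_succ))) (hγ.nonneg k)

lemma gridWeight_le_one (hγ : StepAssumption γ) (k : ℕ) (t : ℝ) : gridWeight γ k t ≤ 1 := by
  refine div_le_one_of_le₀ ?_ (hγ.nonneg k)
  rw [gridTime_succ]
  have := hγ.nonneg k
  rcases le_total t (gridTime γ k) with h | h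
  · rw [min_eq_left h, min_eq_left (by linarith), sub_self]
    exact this
  · rw [min_eq_right h]
    have := min_le_right t (gridTime γ k + γ (k + 1))
    linarith

lemma sum_mul_gridWeight (K : ℕ) {t : ℝ} (ht : 0 ≤ t) :
    ∑ k ∈ range K, γ (k + 1) * gridWeight γ k t = min t (gridTime γ K) := by
  simp_rw [mul_gridWeight]
  rw [sum_range_sub fun k => min t (gridTime γ k), gridTime_zero, min_eq_right ht, sub_zero]

section Interpolation

variable {V : Type*} [NormedAddCommGroup V] [NormedSpace ℝ V]

lemma locallyFinite_gridWeight (hγ : StepAssumption γ) :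
    LocallyFinite fun k => Function.support fun z : (ℕ → V) × ℝ≥0 =>
      gridWeight γ k z.2 • (z.1 (k + 1) - z.1 k) := by
  intro z₀
  refine ⟨Prod.snd ⁻¹' Set.Iio (z₀.2 + 1), (isOpen_Iio.preimage continuous_snd).mem_nhds
    (by simp), ?_⟩
  obtain ⟨K, hK⟩ := exists_le_gridTime hγ (z₀.2 + 1)
  refine (Set.finite_Iio K).subset fun k hk => ?_
  obtain ⟨z, hz1, hz2⟩ := hk
  rw [Set.mem_Iio]
  by_contra hcon
  refine hz1 ?_
  have hz3 : (z.2 : ℝ) < z₀.2 + 1 := by exact_mod_cast hz2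
  simp only
  rw [gridWeight_eq_zero hγ (hz3.le.trans (hK.trans (gridTime_mono hγ (not_lt.1 hcon)))),
    zero_smul]

/-- Piecewise linear interpolation of a sequence, jointly in the sequence and the time. -/
def interpMap (hγ : StepAssumption γ) : C((ℕ → V) × ℝ≥0, V) where
  toFun z := z.1 0 + ∑ᶠ k, gridWeight γ k z.2 • (z.1 (k + 1) - z.1 k)
  continuous_toFun := by
    refine Continuous.add (by fun_prop) (continuous_finsum (fun k => ?_)
      (locallyFinite_gridWeight hγ))
    have := continuous_gridWeight γ k
    fun_prop

/-- The path which takes the value `x k` at time `γ_1 + ⋯ + γ_k`, linear in between. -/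
def interp {d : ℕ} (hγ : StepAssumption γ) (x : ℕ → State d) : PathSpace d :=
  (interpMap hγ).curry x

notation:max "traj" h:max x:max i:max w:max => interp h (fun k => x k i w)

variable {d : ℕ}

lemma continuous_interp (hγ : StepAssumption γ) : Continuous (interp (d := d) hγ) :=
  ((interpMap hγ).curry).continuous

lemma interp_eq_sum (hγ : StepAssumption γ) (x : ℕ → State d) {t : ℝ≥0} {K : ℕ}
    (h : t ≤ gridTime γ K) :
    interp hγ x t = x 0 + ∑ k ∈ range K, gridWeight γ k t • (x (k + 1) - x k) := by
  change x 0 + ∑ᶠ k, gridWeight γ k t • (x (k + 1) - x k) = _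
  congr 1
  refine finsum_eq_sum_of_support_subset _ fun k hk => ?_
  rw [Finset.coe_range, Set.mem_Iio]
  by_contra hcon
  refine hk ?_
  change gridWeight γ k t • (x (k + 1) - x k) = 0
  rw [gridWeight_eq_zero hγ (h.trans (gridTime_mono hγ (not_lt.1 hcon))), zero_smul]

lemma interp_sub_eq_sum (hγ : StepAssumption γ) (x : ℕ → State d) {s t : ℝ≥0} {K : ℕ}
    (hs : s ≤ gridTime γ K) (ht : t ≤ gridTime γ K) : interp hγ x t - interp hγ x s =
      ∑ k ∈ range K, (gridWeight γ k t - gridWeight γ k s) • (x (k + 1) - x k) := by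
  rw [interp_eq_sum hγ x hs, interp_eq_sum hγ x ht, add_sub_add_left_eq_sub,
    ← sum_sub_distrib]
  simp_rw [sub_smul]

lemma interp_congr (hγ : StepAssumption γ) {x y : ℕ → State d} {t : ℝ≥0} {K : ℕ}
    (h : t ≤ gridTime γ K) (hxy : ∀ k ≤ K, x k = y k) : interp hγ x t = interp hγ y t := by
  rw [interp_eq_sum hγ x h, interp_eq_sum hγ y h, hxy 0 (Nat.zero_le K)]
  congr 1
  refine sum_congr rfl fun k hk => ?_
  have := mem_range.1 hk
  rw [hxy k (by omega), hxy (k + 1) (by omega)]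

lemma interp_gridTime (hγ : StepAssumption γ) {x : ℕ → State d}
    (hx : ∀ k, γ (k + 1) = 0 → x (k + 1) = x k) (k : ℕ) {t : ℝ≥0} (ht : (t : ℝ) = gridTime γ k) :
    interp hγ x t = x k := by
  rw [interp_eq_sum hγ x ht.le]
  have : ∀ j ∈ range k, gridWeight γ j t • (x (j + 1) - x j) = x (j + 1) - x j := by
    intro j hj
    by_cases h0 : γ (j + 1) = 0
    · rw [hx j h0, sub_self, smul_zero]
    · rw [gridWeight_eq_one hγ (by rw [ht]; exact gridTime_mono hγ (mem_range.1 hj)) h0,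
        one_smul]
  rw [sum_congr rfl this, sum_range_sub, add_sub_cancel]

/-- The increments of the weights. -/
lemma gridWeight_sub_mem (hγ : StepAssumption γ) {s t : ℝ} (hst : s ≤ t) (k : ℕ) :
    0 ≤ gridWeight γ k t - gridWeight γ k s ∧ gridWeight γ k t - gridWeight γ k s ≤ 1 := by
  have h1 := gridWeight_mono hγ k hst
  have h2 := gridWeight_nonneg hγ k s
  have h3 := gridWeight_le_one hγ k t
  constructor <;> linarith

lemma sum_mul_gridWeight_sub {K : ℕ} {s t : ℝ} (h0 : 0 ≤ s)
    (hst : s ≤ t) (ht : t ≤ gridTime γ K) :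
    ∑ k ∈ range K, γ (k + 1) * (gridWeight γ k t - gridWeight γ k s) = t - s := by
  simp_rw [mul_sub]
  rw [sum_sub_distrib, sum_mul_gridWeight K (h0.trans hst), sum_mul_gridWeight K h0,
    min_eq_left ht, min_eq_left (hst.trans ht)]

end Interpolation

end Grid

section MartingaleDifferences

variable {Ω : Type*} [mΩ : MeasurableSpace Ω] {P : Measure Ω} [IsProbabilityMeasure P]

lemma sq_integral_mul_le {f g : Ω → ℝ} (hf : MemLp f 2 P) (hg : MemLp g 2 P) :
    (∫ w, f w * g w ∂P) ^ 2 ≤ (∫ w, f w ^ 2 ∂P) * ∫ w, g w ^ 2 ∂P := by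
  have i1 : Integrable (fun w => f w * g w) P := hf.integrable_mul hg
  have i2 : Integrable (fun w => f w ^ 2) P := hf.integrable_sq
  have i3 : Integrable (fun w => g w ^ 2) P := hg.integrable_sq
  have h : ∀ x : ℝ, 0 ≤ (∫ w, f w ^ 2 ∂P) * (x * x) + (2 * ∫ w, f w * g w ∂P) * x +
      ∫ w, g w ^ 2 ∂P := by
    intro x
    have e : ∫ w, (x * f w + g w) ^ 2 ∂P = (∫ w, f w ^ 2 ∂P) * (x * x) +
        (2 * ∫ w, f w * g w ∂P) * x + ∫ w, g w ^ 2 ∂P := by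
      have e1 : ∀ w, (x * f w + g w) ^ 2 = (x * x) * f w ^ 2 + (2 * x) * (f w * g w) + g w ^ 2 :=
        fun w => by ring
      simp_rw [e1]
      have i4 : Integrable (fun w => (x * x) * f w ^ 2 + (2 * x) * (f w * g w)) P :=
        (i2.const_mul _).add (i1.const_mul _)
      rw [integral_add i4 i3, integral_add (i2.const_mul _) (i1.const_mul _), integral_const_mul,
        integral_const_mul]
      ring
    rw [← e]
    exact integral_nonneg fun w => sq_nonneg _
  have := discrim_le_zero h
  rw [discrim] at this
  linarith

variable {F : Filtration ℕ mΩ} {f : ℕ → Ω → ℝ}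

lemma measurable_sum_filtration (hm : ∀ k, Measurable[F (k + 1)] (f k)) (K : ℕ) :
    Measurable[F K] fun w => ∑ k ∈ range K, f k w :=
  measurable_sum _ fun k hk =>
    (hm k).mono (F.mono (Nat.succ_le_of_lt (mem_range.1 hk))) le_rfl

lemma memLp_sum_range {r : ℝ≥0∞} (hf : ∀ k, MemLp (f k) r P) (K : ℕ) :
    MemLp (fun w => ∑ k ∈ range K, f k w) r P :=
  memLp_finsetSum _ fun k _ => hf k

lemma integral_sq_sum_le (hm : ∀ k, Measurable[F (k + 1)] (f k)) (hf : ∀ k, MemLp (f k) 2 P)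
    (h0 : ∀ k, P[f k | F k] =ᵐ[P] 0) (K : ℕ) :
    ∫ w, (∑ k ∈ range K, f k w) ^ 2 ∂P ≤ ∑ k ∈ range K, ∫ w, f k w ^ 2 ∂P := by
  induction K with
  | zero => simp
  | succ K ih =>
    have hN := memLp_sum_range hf K
    have i0 : Integrable (fun w => (∑ k ∈ range K, f k w) * f K w) P :=
      hN.integrable_mul (hf K)
    have hz := integral_mul_eq_zero_of_condExp (F.le K)
      (measurable_sum_filtration hm K).stronglyMeasurable ((hf K).integrable (by norm_num)) i0 (h0 K)
    have e : ∀ w, (∑ k ∈ range (K + 1), f k w) ^ 2 = (∑ k ∈ range K, f k w) ^ 2 +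
        2 * ((∑ k ∈ range K, f k w) * f K w) + f K w ^ 2 := fun w => by
      rw [sum_range_succ]
      ring
    simp_rw [e]
    have i1 : Integrable (fun w => (∑ k ∈ range K, f k w) ^ 2 +
        2 * ((∑ k ∈ range K, f k w) * f K w)) P := hN.integrable_sq.add (i0.const_mul 2)
    rw [integral_add i1 (hf K).integrable_sq, integral_add hN.integrable_sq (i0.const_mul 2),
      integral_const_mul, hz, sum_range_succ]
    linarith

lemma memLp_two_sq {f : Ω → ℝ} (hf : MemLp f 4 P) : MemLp (fun w => f w ^ 2) 2 P := by
  refine (memLp_two_iff_integrable_sq (by exact hf.1.pow 2)).2 ?_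
  have := hf.integrable_norm_pow (by norm_num)
  refine this.congr (ae_of_all _ fun w => ?_)
  simp only [norm_eq_abs]
  rw [← pow_mul, show 2 * 2 = 4 from rfl]
  exact Even.pow_abs (by decide) _

lemma integrable_pow_four {f : Ω → ℝ} (hf : MemLp f 4 P) : Integrable (fun w => f w ^ 4) P := by
  have := (memLp_two_sq hf).integrable_sq
  simpa only [← pow_mul, show 2 * 2 = 4 from rfl] using this

/-- Fourth moments of sums of martingale differences. -/
lemma integral_pow_four_sum_le {C : ℝ} (hC : 0 ≤ C) {v : ℕ → ℝ} (hv : ∀ k, 0 ≤ v k)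
    (hm : ∀ k, Measurable[F (k + 1)] (f k)) (hf : ∀ k, MemLp (f k) 4 P)
    (h0 : ∀ k, P[f k | F k] =ᵐ[P] 0) (hb : ∀ k, ∫ w, f k w ^ 4 ∂P ≤ C * v k ^ 2) (K : ℕ) :
    ∫ w, (∑ k ∈ range K, f k w) ^ 4 ∂P ≤ 16 * C * (∑ k ∈ range K, v k) ^ 2 := by
  induction K with
  | zero => simp
  | succ K ih =>
    have hN := memLp_sum_range hf K
    have hNm := measurable_sum_filtration hm K
    set N : Ω → ℝ := fun w => ∑ k ∈ range K, f k w with hNdef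
    set S := ∑ k ∈ range K, v k with hS
    have hS0 : 0 ≤ S := sum_nonneg fun k _ => hv k
    have i1 := integrable_pow_four hN
    have i2 := integrable_pow_four (hf K)
    have i3 : Integrable (fun w => N w ^ 2 * f K w ^ 2) P :=
      (memLp_two_sq hN).integrable_mul (memLp_two_sq (hf K))
    have i4 : Integrable (fun w => N w ^ 3 * f K w) P := by
      have m1 : Measurable N := hNm.mono (F.le K) le_rfl
      have m2 : Measurable (f K) := (hm K).mono (F.le _) le_rfl
      refine (i1.add i3).mono' ((m1.pow_const 3).mul m2).aestronglyMeasurable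
        (ae_of_all _ fun w => ?_)
      simp only [Pi.add_apply, norm_mul, norm_pow, norm_eq_abs]
      rw [← Even.pow_abs (show Even 4 by decide) (N w), ← sq_abs (N w), ← sq_abs (f K w)]
      nlinarith [sq_nonneg (|N w| ^ 2 - |N w| * |f K w|), abs_nonneg (N w), abs_nonneg (f K w),
        sq_nonneg (|N w| ^ 2), sq_nonneg (|N w| * |f K w|)]
    have hz : ∫ w, N w ^ 3 * f K w ∂P = 0 := by
      have m3 : Measurable[F K] fun w => N w ^ 3 :=
        (by fun_prop : Measurable fun x : ℝ => x ^ 3).comp hNm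
      exact integral_mul_eq_zero_of_condExp (F.le K) m3.stronglyMeasurable
        ((hf K).integrable (by norm_num)) i4 (h0 K)
    have hcs : ∫ w, N w ^ 2 * f K w ^ 2 ∂P ≤ 4 * C * S * v K := by
      have h1 := sq_integral_mul_le (memLp_two_sq hN) (memLp_two_sq (hf K))
      simp only [← pow_mul, show 2 * 2 = 4 from rfl] at h1
      have h2 : (∫ w, N w ^ 2 * f K w ^ 2 ∂P) ^ 2 ≤ (4 * C * S * v K) ^ 2 := by
        refine h1.trans ?_
        calc (∫ w, N w ^ 4 ∂P) * ∫ w, f K w ^ 4 ∂P ≤ (16 * C * S ^ 2) * (C * v K ^ 2) :=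
              mul_le_mul ih (hb K) (integral_nonneg fun w => by positivity) (by positivity)
          _ = _ := by ring
      have := hv K
      exact le_of_abs_le (abs_le_of_sq_le_sq h2 (by positivity))
    have e : ∀ w, (∑ k ∈ range (K + 1), f k w) ^ 4 ≤ N w ^ 4 + 4 * (N w ^ 3 * f K w) +
        8 * (N w ^ 2 * f K w ^ 2) + 3 * f K w ^ 4 := fun w => by
      rw [sum_range_succ]
      change (N w + f K w) ^ 4 ≤ _
      nlinarith [sq_nonneg (N w * f K w - f K w ^ 2)]
    have j1 : Integrable (fun w => N w ^ 4 + 4 * (N w ^ 3 * f K w)) P := i1.add (i4.const_mul 4)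
    have j2 : Integrable (fun w => N w ^ 4 + 4 * (N w ^ 3 * f K w) +
        8 * (N w ^ 2 * f K w ^ 2)) P := j1.add (i3.const_mul 8)
    have j3 : Integrable (fun w => N w ^ 4 + 4 * (N w ^ 3 * f K w) +
        8 * (N w ^ 2 * f K w ^ 2) + 3 * f K w ^ 4) P := j2.add (i2.const_mul 3)
    have h1 := integral_mono (integrable_pow_four (memLp_sum_range hf (K + 1))) j3 e
    rw [integral_add j2 (i2.const_mul 3), integral_add j1 (i3.const_mul 8),
      integral_add i1 (i4.const_mul 4), integral_const_mul, integral_const_mul, integral_const_mul,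
      hz] at h1
    refine h1.trans ?_
    rw [sum_range_succ, ← hS]
    have h2 := hb K
    have h3 : 0 ≤ C * v K ^ 2 := by positivity
    nlinarith

end MartingaleDifferences

section StepDynamics

variable {d : ℕ} {Ω : Type*} [mΩ : MeasurableSpace Ω]

/-- Random sequences driven by a drift `β` and a martingale difference noise `ξ`, with bounds on
the moments. -/
structure StepDynamics {n : ℕ+} (P : Measure Ω) (γ : ℕ → ℝ) (x β ξ : ℕ → Fin n → Ω → State d)
    (F : Filtration ℕ mΩ) (q : ℕ) (M : ℝ) : Prop where
  step : ∀ k i w, x (k + 1) i w = x k i w + (γ (k + 1) • β k i w + √(2 * γ (k + 1)) • ξ k i w)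
  measurable_x : ∀ k i, Measurable (x k i)
  measurable_ξ : ∀ k i, Measurable[F (k + 1)] (ξ k i)
  memLp_x : ∀ k i, MemLp (x k i) q P
  memLp_β : ∀ k i, MemLp (β k i) q P
  memLp_ξ : ∀ k i, MemLp (ξ k i) 4 P
  moment_x : ∀ k, mean (fun i => ∫ w, ‖x k i w‖ ^ q ∂P) ≤ M
  moment_β : ∀ k, mean (fun i => ∫ w, ‖β k i w‖ ^ q ∂P) ≤ M
  moment_ξ : ∀ k i, ∫ w, ‖ξ k i w‖ ^ 4 ∂P ≤ M
  condExp_ξ : ∀ k i a, P[fun w => ξ k i w a | F k] =ᵐ[P] 0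

lemma norm_pow_four_le (v : State d) : ‖v‖ ^ 4 ≤ d * ∑ a, v a ^ 4 := by
  have h := sq_sum_le_card_mul_sum_sq (s := univ) (f := fun a => v a ^ 2)
  rw [← EuclideanSpace.real_norm_sq_eq] at h
  simpa [← pow_mul] using h

lemma abs_coord_le (v : State d) (a : Fin d) : |v a| ≤ ‖v‖ := PiLp.norm_apply_le v a

variable {P : Measure Ω} [IsProbabilityMeasure P]

lemma integrable_norm_pow_four {V : Type*} [NormedAddCommGroup V] {f : Ω → V}
    (hf : MemLp f 4 P) : Integrable (fun w => ‖f w‖ ^ 4) P :=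
  MemLp.integrable_norm_pow' (p := 4) (by exact_mod_cast hf)

lemma integrable_norm_sq {V : Type*} [NormedAddCommGroup V] {f : Ω → V}
    (hf : MemLp f 2 P) : Integrable (fun w => ‖f w‖ ^ 2) P :=
  MemLp.integrable_norm_pow' (p := 2) (by exact_mod_cast hf)

lemma pow_sum_mul_le {u y : ℕ → ℝ} (hw : ∀ k, 0 ≤ u k) (hy : ∀ k, 0 ≤ y k) (K r : ℕ) :
    (∑ k ∈ range K, u k * y k) ^ (r + 1) ≤
      (∑ k ∈ range K, u k) ^ r * ∑ k ∈ range K, u k * y k ^ (r + 1) := by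
  set W := ∑ k ∈ range K, u k with hW
  have hW0 : 0 ≤ W := sum_nonneg fun k _ => hw k
  rcases hW0.eq_or_lt with h0 | h0
  · have hz : ∀ k ∈ range K, u k = 0 :=
      (Finset.sum_eq_zero_iff_of_nonneg fun k _ => hw k).1 (hW.symm.trans h0.symm)
    rw [sum_eq_zero fun k hk => by rw [hz k hk, zero_mul],
      sum_eq_zero fun k hk => by rw [hz k hk, zero_mul]]
    simp
  · have h := Real.pow_arith_mean_le_arith_mean_pow (range K) (fun k => u k / W) y
      (fun k _ => div_nonneg (hw k) hW0) (by rw [← sum_div, ← hW, div_self h0.ne'])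
      (fun k _ => hy k) (r + 1)
    simp_rw [div_mul_eq_mul_div] at h
    rw [← sum_div, ← sum_div, div_pow, div_le_iff₀ (by positivity)] at h
    refine h.trans (le_of_eq ?_)
    rw [pow_succ]
    field_simp

lemma mean_integral_pow_sum_le {n : ℕ+} {r : ℕ} (hr : r ≠ 0) {y : ℕ → Fin n → Ω → ℝ}
    (hy : ∀ k i w, 0 ≤ y k i w) (hyi : ∀ k i, MemLp (y k i) r P) {B : ℝ}
    (hB : ∀ k, mean (fun i => ∫ w, y k i w ^ r ∂P) ≤ B) {u : ℕ → ℝ} (hw : ∀ k, 0 ≤ u k) (K : ℕ) :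
    (∀ i, MemLp (fun w => ∑ k ∈ range K, u k * y k i w) r P) ∧
    (∀ i, Integrable (fun w => (∑ k ∈ range K, u k * y k i w) ^ r) P) ∧
    mean (fun i => ∫ w, (∑ k ∈ range K, u k * y k i w) ^ r ∂P) ≤ (∑ k ∈ range K, u k) ^ r * B := by
  obtain ⟨r, rfl⟩ := Nat.exists_eq_succ_of_ne_zero hr
  have i1 : ∀ i, MemLp (fun w => ∑ k ∈ range K, u k * y k i w) (r.succ : ℕ) P := fun i =>
    memLp_finsetSum _ fun k _ => (hyi k i).const_mul _
  have i2 : ∀ k i, Integrable (fun w => y k i w ^ (r + 1)) P := fun k i => by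
    simpa only [norm_eq_abs, abs_of_nonneg (hy k i _)] using (hyi k i).integrable_norm_pow'
  have i3 : ∀ i, Integrable (fun w => (∑ k ∈ range K, u k * y k i w) ^ (r + 1)) P := by
    intro i
    have h0 : ∀ w, 0 ≤ ∑ k ∈ range K, u k * y k i w := fun w =>
      sum_nonneg fun k _ => mul_nonneg (hw k) (hy k i w)
    simpa only [norm_eq_abs, abs_of_nonneg (h0 _)] using (i1 i).integrable_norm_pow'
  refine ⟨i1, i3, ?_⟩
  set W := ∑ k ∈ range K, u k with hW
  have hW0 : 0 ≤ W := sum_nonneg fun k _ => hw k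
  have h1 : ∀ i, ∫ w, (∑ k ∈ range K, u k * y k i w) ^ (r + 1) ∂P ≤
      W ^ r * ∑ k ∈ range K, u k * ∫ w, y k i w ^ (r + 1) ∂P := by
    intro i
    have i4 : Integrable (fun w => ∑ k ∈ range K, u k * y k i w ^ (r + 1)) P :=
      integrable_finsetSum _ fun k _ => (i2 k i).const_mul _
    refine (integral_mono (i3 i) (i4.const_mul (W ^ r)) fun w =>
      pow_sum_mul_le hw (fun k => hy k i w) K r).trans (le_of_eq ?_)
    rw [integral_const_mul, integral_finsetSum _ fun k _ => (i2 k i).const_mul _]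
    simp_rw [integral_const_mul]
  refine (mean_mono h1).trans ?_
  rw [mean_const_mul]
  have h2 : mean (fun i => ∑ k ∈ range K, u k * ∫ w, y k i w ^ (r + 1) ∂P) =
      ∑ k ∈ range K, u k * mean fun i => ∫ w, y k i w ^ (r + 1) ∂P := by
    unfold mean
    rw [sum_comm, mul_sum]
    refine sum_congr rfl fun k _ => ?_
    rw [← mul_sum]
    ring
  rw [h2]
  calc W ^ r * ∑ k ∈ range K, u k * mean (fun i => ∫ w, y k i w ^ (r + 1) ∂P)
      ≤ W ^ r * ∑ k ∈ range K, u k * B := by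
        gcongr with k _
        · exact hw k
        · exact hB k
    _ = W ^ (r + 1) * B := by rw [← sum_mul, ← hW]; ring

lemma ofReal_mean {n : ℕ+} {f : Fin n → ℝ} (hf : ∀ i, 0 ≤ f i) :
    ofReal (mean f) = (n : ℝ≥0∞)⁻¹ * ∑ i, ofReal (f i) := by
  have hn : (0 : ℝ) < (n : ℕ) := by exact_mod_cast n.pos
  rw [mean, ofReal_mul (by positivity), ofReal_inv_of_pos hn,
    ENNReal.ofReal_natCast, ofReal_sum_of_nonneg fun i _ => hf i]

lemma inv_mul_sum_le {n : ℕ+} {f : Fin n → ℝ≥0∞} {g : Fin n → ℝ} {B : ℝ} (hg : ∀ i, 0 ≤ g i)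
    (h : ∀ i, f i ≤ ofReal (g i)) (hB : mean g ≤ B) : (n : ℝ≥0∞)⁻¹ * ∑ i, f i ≤ ofReal B := by
  refine le_trans ?_ (ofReal_le_ofReal hB)
  rw [ofReal_mean hg]
  gcongr with i
  exact h i

lemma lintegral_ofReal_le {f g : Ω → ℝ} (hg : Integrable g P) (h0 : ∀ w, 0 ≤ g w)
    (h : ∀ w, f w ≤ g w) : ∫⁻ w, ofReal (f w) ∂P ≤ ofReal (∫ w, g w ∂P) := by
  rw [ofReal_integral_eq_lintegral_ofReal hg (ae_of_all _ h0)]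
  exact lintegral_mono fun w => ofReal_le_ofReal (h w)

lemma integral_sq_le_one_add {V : Type*} [NormedAddCommGroup V] {f : Ω → V} {q : ℕ}
    (hq : 2 ≤ q) (hf : MemLp f q P) : ∫ w, ‖f w‖ ^ 2 ∂P ≤ 1 + ∫ w, ‖f w‖ ^ q ∂P := by
  have i1 : Integrable (fun w => ‖f w‖ ^ q) P := hf.integrable_norm_pow'
  have i3 : Integrable (fun w => 1 + ‖f w‖ ^ q) P := (integrable_const (1 : ℝ)).add i1
  calc ∫ w, ‖f w‖ ^ 2 ∂P ≤ ∫ w, (1 + ‖f w‖ ^ q) ∂P := by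
        refine integral_mono_of_nonneg (ae_of_all _ fun w => by positivity) i3
          (ae_of_all _ fun w => ?_)
        simp only
        rcases le_total ‖f w‖ 1 with h | h
        · have := pow_le_one₀ (n := 2) (norm_nonneg (f w)) h
          have : 0 ≤ ‖f w‖ ^ q := by positivity
          linarith
        · have := pow_le_pow_right₀ h hq
          linarith
    _ = 1 + ∫ w, ‖f w‖ ^ q ∂P := by
        rw [integral_add (integrable_const (1 : ℝ)) i1, integral_const]
        simp

variable {n : ℕ+} {γ : ℕ → ℝ} {x β ξ : ℕ → Fin n → Ω → State d} {F : Filtration ℕ mΩ} {q : ℕ}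
  {M : ℝ}

namespace StepDynamics

lemma moment_nonneg (h : StepDynamics P γ x β ξ F q M) : 0 ≤ M :=
  (integral_nonneg fun _ => by positivity).trans (h.moment_ξ 0 0)

lemma integral_noise_pow_four_le (h : StepDynamics P γ x β ξ F q M) (a : ℕ → ℝ) (K : ℕ) (i : Fin n)
    : MemLp (fun w => ∑ k ∈ range K, a k • ξ k i w) 4 P ∧
    ∫ w, ‖∑ k ∈ range K, a k • ξ k i w‖ ^ 4 ∂P ≤ 16 * d ^ 2 * M * (∑ k ∈ range K, a k ^ 2) ^ 2 := by
  have m1 : MemLp (fun w => ∑ k ∈ range K, a k • ξ k i w) 4 P :=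
    memLp_finsetSum _ fun k _ => (h.memLp_ξ k i).const_smul (a k)
  refine ⟨m1, ?_⟩
  have e : ∀ w (c : Fin d), (∑ k ∈ range K, a k • ξ k i w) c =
      ∑ k ∈ range K, a k * ξ k i w c := fun w c => by simp
  have h1 : ∀ c : Fin d, ∫ w, (∑ k ∈ range K, a k • ξ k i w) c ^ 4 ∂P ≤
      16 * M * (∑ k ∈ range K, a k ^ 2) ^ 2 := by
    intro c
    simp_rw [e]
    refine integral_pow_four_sum_le (F := F) h.moment_nonneg (fun k => sq_nonneg (a k))
      (fun k => ?_) (fun k => (memLp_coord (h.memLp_ξ k i) c).const_mul _) (fun k => ?_)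
      (fun k => ?_) K
    · exact (by fun_prop : Measurable fun v : State d => a k * v c).comp (h.measurable_ξ k i)
    · filter_upwards [condExp_smul (a k) (fun w => ξ k i w c) (F k) (μ := P),
        h.condExp_ξ k i c] with w h1 h2
      refine Eq.trans h1 ?_
      rw [Pi.smul_apply, h2]
      simp
    · simp_rw [mul_pow]
      rw [integral_const_mul, ← pow_mul, mul_comm M]
      refine mul_le_mul_of_nonneg_left (le_trans (integral_mono
        (integrable_pow_four (memLp_coord (h.memLp_ξ k i) c))
        (integrable_norm_pow_four (h.memLp_ξ k i)) fun w => ?_) (h.moment_ξ k i)) (by positivity)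
      have := abs_coord_le (ξ k i w) c
      simp only
      rw [← Even.pow_abs (by decide) (ξ k i w c)]
      gcongr
  have i1 : ∀ c ∈ (univ : Finset (Fin d)),
      Integrable (fun w => (∑ k ∈ range K, a k • ξ k i w) c ^ 4) P := fun c _ =>
    integrable_pow_four (memLp_coord m1 c)
  calc ∫ w, ‖∑ k ∈ range K, a k • ξ k i w‖ ^ 4 ∂P
      ≤ ∫ w, d * ∑ c, (∑ k ∈ range K, a k • ξ k i w) c ^ 4 ∂P :=
        integral_mono (integrable_norm_pow_four m1)
          ((integrable_finsetSum _ i1).const_mul _) fun w => norm_pow_four_le _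
    _ ≤ d * ∑ c : Fin d, 16 * M * (∑ k ∈ range K, a k ^ 2) ^ 2 := by
        rw [integral_const_mul, integral_finsetSum _ i1]
        gcongr with c
        exact h1 c
    _ = 16 * d ^ 2 * M * (∑ k ∈ range K, a k ^ 2) ^ 2 := by
        rw [sum_const, card_univ, Fintype.card_fin, nsmul_eq_mul]
        ring

lemma memLp_β_two (h : StepDynamics P γ x β ξ F q M) (hq : 2 ≤ q) (k : ℕ) (i : Fin n) :
    MemLp (fun w => ‖β k i w‖) (2 : ℕ) P :=
  ((h.memLp_β k i).mono_exponent (by exact_mod_cast hq)).norm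

lemma moment_β_two (h : StepDynamics P γ x β ξ F q M) (hq : 2 ≤ q) (k : ℕ) :
    mean (fun i => ∫ w, ‖β k i w‖ ^ 2 ∂P) ≤ 1 + M := by
  have h1 := fun i => integral_sq_le_one_add hq (h.memLp_β k i)
  refine (mean_mono h1).trans ?_
  rw [mean_add, mean_const]
  have := h.moment_β k
  linarith

/-- Decomposition of the increments of the interpolated path. -/
lemma interp_sub (h : StepDynamics P γ x β ξ F q M) (hγ : StepAssumption γ) {s t : ℝ≥0} {K : ℕ}
    (hs : s ≤ gridTime γ K) (ht : t ≤ gridTime γ K) (i : Fin n) (w : Ω) :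
    traj hγ x i w t - traj hγ x i w s =
      ∑ k ∈ range K, (γ (k + 1) * (gridWeight γ k t - gridWeight γ k s)) • β k i w + ∑ k ∈ range K,
        (√(2 * γ (k + 1)) * (gridWeight γ k t - gridWeight γ k s)) • ξ k i w := by
  rw [interp_sub_eq_sum hγ _ hs ht, ← sum_add_distrib]
  refine sum_congr rfl fun k _ => ?_
  rw [h.step, add_sub_cancel_left, smul_add, smul_smul, smul_smul]
  ring_nf

lemma sum_sq_weight_le (hγ : StepAssumption γ) {K : ℕ} {s t : ℝ} (h0 : 0 ≤ s)
    (hst : s ≤ t) (ht : t ≤ gridTime γ K) :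
    ∑ k ∈ range K, (√(2 * γ (k + 1)) * (gridWeight γ k t - gridWeight γ k s)) ^ 2 ≤
      2 * (t - s) := by
  rw [← sum_mul_gridWeight_sub h0 hst ht, mul_sum]
  refine sum_le_sum fun k _ => ?_
  have hk := hγ.nonneg k
  rw [mul_pow, sq_sqrt (by positivity)]
  obtain ⟨h1, h2⟩ := gridWeight_sub_mem hγ hst k
  nlinarith [mul_nonneg hk (mul_nonneg h1 (sub_nonneg.2 h2))]

/-- Moments of the two parts of the increments. -/
lemma exists_increment (h : StepDynamics P γ x β ξ F q M) (hγ : StepAssumption γ) (hq : 2 ≤ q)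
    {s t : ℝ≥0} (hst : s ≤ t) : ∃ D N : Fin n → Ω → State d, (∀ i w, traj hγ x i w t -
        traj hγ x i w s = D i w + N i w) ∧ (∀ i, MemLp (D i) 2 P) ∧ (∀ i, MemLp (N i) 4 P) ∧
      mean (fun i => ∫ w, ‖D i w‖ ^ 2 ∂P) ≤ (1 + M) * ((t : ℝ) - s) ^ 2 ∧
      ∀ i, ∫ w, ‖N i w‖ ^ 4 ∂P ≤ 64 * d ^ 2 * M * ((t : ℝ) - s) ^ 2 := by
  have hst' : (s : ℝ) ≤ t := by exact_mod_cast hst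
  obtain ⟨K, hK⟩ := exists_le_gridTime hγ t
  refine ⟨_, _, fun i w => h.interp_sub hγ (hst'.trans hK) hK i w, fun i => ?_,
    fun i => (h.integral_noise_pow_four_le _ K i).1, ?_, fun i => ?_⟩
  · have h2 : ∀ k, MemLp (β k i) 2 P := fun k =>
      (h.memLp_β k i).mono_exponent (by exact_mod_cast hq)
    exact memLp_finsetSum _ fun k _ =>
      (h2 k).const_smul (γ (k + 1) * (gridWeight γ k t - gridWeight γ k s))
  · have hw : ∀ k, 0 ≤ γ (k + 1) * (gridWeight γ k t - gridWeight γ k s) := fun k =>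
      mul_nonneg (hγ.nonneg k) (gridWeight_sub_mem hγ hst' k).1
    obtain ⟨-, i2, i3⟩ := mean_integral_pow_sum_le two_ne_zero (fun k i w => norm_nonneg (β k i w))
      (h.memLp_β_two hq) (h.moment_β_two hq) hw K
    rw [sum_mul_gridWeight_sub s.coe_nonneg hst' hK, mul_comm] at i3
    refine (mean_mono fun i => ?_).trans i3
    refine integral_mono_of_nonneg (ae_of_all _ fun w => by positivity) (i2 i)
      (ae_of_all _ fun w => ?_)
    simp only
    gcongr
    refine (norm_sum_le _ _).trans (sum_le_sum fun k _ => ?_)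
    rw [norm_smul, norm_eq_abs, abs_of_nonneg (hw k)]
  · refine (h.integral_noise_pow_four_le _ K i).2.trans ?_
    have h1 := sum_sq_weight_le hγ s.coe_nonneg hst' hK
    have h2 : 0 ≤ ∑ k ∈ range K,
        (√(2 * γ (k + 1)) * (gridWeight γ k t - gridWeight γ k s)) ^ 2 :=
      sum_nonneg fun k _ => sq_nonneg _
    have hM := h.moment_nonneg
    calc _ ≤ 16 * d ^ 2 * M * (2 * ((t : ℝ) - s)) ^ 2 := by gcongr
      _ = _ := by ring

lemma mean_integral_sq_increment_le (h : StepDynamics P γ x β ξ F q M) (hγ : StepAssumption γ)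
    (hq : 2 ≤ q) {s t : ℝ≥0} (hst : s ≤ t) : (∀ i, Integrable (fun w =>
      ‖traj hγ x i w t - traj hγ x i w s‖ ^ 2) P) ∧ mean (fun i => ∫ w,
      ‖traj hγ x i w t - traj hγ x i w s‖ ^ 2 ∂P) ≤
      2 * (1 + M) * ((t : ℝ) - s) ^ 2 + (1 + 64 * d ^ 2 * M) * ((t : ℝ) - s) := by
  obtain ⟨D, N, hDN, hD, hN, hD2, hN4⟩ := h.exists_increment hγ hq hst
  have hN2 : ∀ i, MemLp (N i) 2 P := fun i => (hN i).mono_exponent (by norm_num)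
  have i0 : ∀ i, Integrable (fun w => ‖D i w + N i w‖ ^ 2) P := fun i =>
    integrable_norm_sq ((hD i).add (hN2 i))
  simp_rw [hDN]
  refine ⟨i0, ?_⟩
  have hst' : (s : ℝ) ≤ t := by exact_mod_cast hst
  rcases hst'.eq_or_lt with h0 | h0
  · have : s = t := by exact_mod_cast h0
    subst this
    have h1 : ∀ i w, D i w + N i w = 0 := fun i w => by rw [← hDN, sub_self]
    simp [h1, mean_const]
  set e : ℝ := (t : ℝ) - s
  have he : 0 < e := sub_pos.2 h0
  have h1 : ∀ i, ∫ w, ‖D i w + N i w‖ ^ 2 ∂P ≤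
      2 * ∫ w, ‖D i w‖ ^ 2 ∂P + (1 + 64 * d ^ 2 * M) * e := by
    intro i
    have i1 : Integrable (fun w => 2 * ‖D i w‖ ^ 2) P := (integrable_norm_sq (hD i)).const_mul 2
    have i2 : Integrable (fun w => e⁻¹ * ‖N i w‖ ^ 4) P :=
      (integrable_norm_pow_four (hN i)).const_mul _
    have i3 : Integrable (fun w => e⁻¹ * ‖N i w‖ ^ 4 + e) P := i2.add (integrable_const e)
    calc ∫ w, ‖D i w + N i w‖ ^ 2 ∂P
        ≤ ∫ w, (2 * ‖D i w‖ ^ 2 + (e⁻¹ * ‖N i w‖ ^ 4 + e)) ∂P := by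
          refine integral_mono (i0 i) (i1.add i3) fun w => ?_
          have h2 := norm_add_le (D i w) (N i w)
          have h3 : ‖D i w + N i w‖ ^ 2 ≤ (‖D i w‖ + ‖N i w‖) ^ 2 := by gcongr
          have h4 : 2 * ‖N i w‖ ^ 2 ≤ e⁻¹ * ‖N i w‖ ^ 4 + e := by
            have : e⁻¹ * ‖N i w‖ ^ 4 + e - 2 * ‖N i w‖ ^ 2 = e⁻¹ * (‖N i w‖ ^ 2 - e) ^ 2 := by
              field_simp
              ring
            have : 0 ≤ e⁻¹ * (‖N i w‖ ^ 2 - e) ^ 2 := by positivity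
            linarith
          simp only
          nlinarith [sq_nonneg (‖D i w‖ - ‖N i w‖)]
      _ = 2 * ∫ w, ‖D i w‖ ^ 2 ∂P + (e⁻¹ * ∫ w, ‖N i w‖ ^ 4 ∂P + e) := by
          rw [integral_add i1 i3, integral_add i2 (integrable_const e), integral_const_mul,
            integral_const_mul, integral_const]
          simp
      _ ≤ 2 * ∫ w, ‖D i w‖ ^ 2 ∂P + (e⁻¹ * (64 * d ^ 2 * M * e ^ 2) + e) := by
          gcongr
          exact hN4 i
      _ = _ := by
          field_simp
          ring
  refine (mean_mono h1).trans ?_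
  rw [mean_add, mean_const_mul, mean_const]
  linarith

lemma exists_min_increment_le (h : StepDynamics P γ x β ξ F q M) (hγ : StepAssumption γ)
    (hq : 2 ≤ q) {s t : ℝ≥0} (hst : s ≤ t) :
    ∃ g : Fin n → Ω → ℝ, (∀ i, Integrable (g i) P) ∧ (∀ i w, 0 ≤ g i w) ∧
      (∀ i w, min (‖traj hγ x i w t - traj hγ x i w s‖ ^ 2)
        (‖traj hγ x i w t - traj hγ x i w s‖ ^ 4) ≤ g i w) ∧
      mean (fun i => ∫ w, g i w ∂P) ≤ (4 * (1 + M) + 1024 * d ^ 2 * M) * ((t : ℝ) - s) ^ 2 := by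
  obtain ⟨D, N, hDN, hD, hN, hD2, hN4⟩ := h.exists_increment hγ hq hst
  have i1 : ∀ i, Integrable (fun w => 4 * ‖D i w‖ ^ 2) P := fun i =>
    (integrable_norm_sq (hD i)).const_mul 4
  have i2 : ∀ i, Integrable (fun w => 16 * ‖N i w‖ ^ 4) P := fun i =>
    (integrable_norm_pow_four (hN i)).const_mul 16
  refine ⟨fun i w => 4 * ‖D i w‖ ^ 2 + 16 * ‖N i w‖ ^ 4, fun i => (i1 i).add (i2 i),
    fun i w => by positivity, fun i w => ?_, ?_⟩
  · rw [hDN]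
    have h2 := norm_add_le (D i w) (N i w)
    have h5 : 0 ≤ ‖N i w‖ ^ 4 := by positivity
    have h6 : 0 ≤ ‖D i w‖ ^ 2 := by positivity
    rcases le_total ‖N i w‖ ‖D i w‖ with h3 | h3
    · refine (min_le_left _ _).trans ?_
      have : ‖D i w + N i w‖ ^ 2 ≤ (2 * ‖D i w‖) ^ 2 := by
        gcongr
        linarith
      nlinarith
    · refine (min_le_right _ _).trans ?_
      have : ‖D i w + N i w‖ ^ 4 ≤ (2 * ‖N i w‖) ^ 4 := by
        gcongr
        linarith
      rw [mul_pow] at this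
      linarith
  · have h1 : ∀ i, ∫ w, (4 * ‖D i w‖ ^ 2 + 16 * ‖N i w‖ ^ 4) ∂P ≤
        4 * ∫ w, ‖D i w‖ ^ 2 ∂P + 16 * (64 * d ^ 2 * M * ((t : ℝ) - s) ^ 2) := by
      intro i
      rw [integral_add (i1 i) (i2 i), integral_const_mul, integral_const_mul]
      have := hN4 i
      linarith
    refine (mean_mono h1).trans ?_
    rw [mean_add, mean_const_mul, mean_const]
    linarith

end StepDynamics

/-- Kolmogorov-type estimate: the supremum of a path is controlled by its dyadic increments. -/
lemma exists_norm_restrictPath_pow_four_le (m : ℕ) :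
    ∃ A : ℝ, 0 ≤ A ∧ ∀ y : PathSpace d, y 0 = 0 → ofReal (‖restrictPath m y‖ ^ 4) ≤
      ofReal A * ∑' j : ℕ, ofReal ((3 / 2) ^ j *
        ∑ i ∈ range ((m + 1) * 2 ^ j), ‖dyadicIncrement y j i‖ ^ 4) := by
  set r : ℝ := (2 / 3 : ℝ) ^ (1 / 4 : ℝ) with hr
  have hr0 : 0 ≤ r := by positivity
  have hr1 : r < 1 := Real.rpow_lt_one (by norm_num) (by norm_num) (by norm_num)
  have hr4 : r ^ 4 = 2 / 3 := by
    rw [hr, ← Real.rpow_natCast, ← Real.rpow_mul (by norm_num)]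
    norm_num
  refine ⟨((m + 1 + 1) * ∑' j : ℕ, r ^ j) ^ 4, by positivity, fun y hy => ?_⟩
  have hA : 0 < ((m : ℝ) + 1 + 1) * ∑' j : ℕ, r ^ j := by
    rw [tsum_geometric_of_lt_one hr0 hr1]
    have : 0 < 1 - r := by linarith
    positivity
  set f : ℕ → ℝ := fun j => (3 / 2) ^ j *
    ∑ i ∈ range ((m + 1) * 2 ^ j), ‖dyadicIncrement y j i‖ ^ 4 with hf
  have hf0 : ∀ j, 0 ≤ f j := fun j => by positivity
  by_cases htop : ∑' j, ofReal (f j) = ⊤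
  · rw [htop, ENNReal.mul_top]
    · exact le_top
    · rw [Ne, ENNReal.ofReal_eq_zero, not_le]
      positivity
  set W : ℝ := (∑' j, ofReal (f j)).toReal with hW
  have hW0 : 0 ≤ W := toReal_nonneg
  have hfW : ∀ j, f j ≤ W := fun j => by
    rw [hW, ← ENNReal.ofReal_le_iff_le_toReal htop]
    exact le_tsum j
  set v : ℝ := W ^ (1 / 4 : ℝ) with hv
  have hv0 : 0 ≤ v := by positivity
  have hv4 : v ^ 4 = W := by
    rw [hv, ← Real.rpow_natCast, ← Real.rpow_mul hW0]
    norm_num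
  have hinc : ∀ j i, i < (m + 1) * 2 ^ j → ‖dyadicIncrement y j i‖ ≤ v * r ^ j := by
    intro j i hi
    refine le_of_pow_le_pow_left₀ (n := 4) (by norm_num) (by positivity) ?_
    have h1 : ‖dyadicIncrement y j i‖ ^ 4 ≤
        ∑ i ∈ range ((m + 1) * 2 ^ j), ‖dyadicIncrement y j i‖ ^ 4 :=
      single_le_sum (f := fun i => ‖dyadicIncrement y j i‖ ^ 4)
        (fun i _ => by positivity) (mem_range.2 hi)
    rw [mul_pow, hv4, ← pow_mul, mul_comm j, pow_mul, hr4]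
    have h2 := hfW j
    simp only [hf] at h2
    have h3 : (2 / 3 : ℝ) ^ j * (3 / 2) ^ j = 1 := by
      rw [← mul_pow]
      norm_num
    calc ‖dyadicIncrement y j i‖ ^ 4 = (2 / 3 : ℝ) ^ j * ((3 / 2) ^ j * ‖dyadicIncrement y j i‖ ^ 4) := by
          rw [← mul_assoc, h3, one_mul]
      _ ≤ (2 / 3 : ℝ) ^ j * W := by
          gcongr
          exact le_trans (by gcongr) h2
      _ = _ := mul_comm _ _
  have hsup : ‖restrictPath m y‖ ≤ ((m : ℝ) + 1 + 1) * (∑' j : ℕ, r ^ j) * v := by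
    refine norm_restrictPath_le (by positivity) fun t ht => ?_
    have h1 := norm_sub_zero_le_of_dyadicIncrement (m := m + 1) y.continuous
      (fun j => mul_nonneg hv0 (pow_nonneg hr0 j))
      ((summable_geometric_of_lt_one hr0 hr1).mul_left v) hinc (t := t)
      (lt_of_le_of_lt ht (by push_cast; exact lt_add_one _))
    rw [hy, sub_zero, tsum_mul_left] at h1
    push_cast at h1
    linarith
  calc ofReal (‖restrictPath m y‖ ^ 4)
      ≤ ofReal ((((m : ℝ) + 1 + 1) * (∑' j : ℕ, r ^ j)) ^ 4 * W) := by
        refine ofReal_le_ofReal ?_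
        rw [← hv4, ← mul_pow]
        gcongr
    _ = _ := by
        rw [ofReal_mul (by positivity), hW, ENNReal.ofReal_toReal htop]

lemma exists_gridTime_le {γ : ℕ → ℝ} (hγ : StepAssumption γ) {t : ℝ} (ht : 0 ≤ t) :
    ∃ K, gridTime γ K ≤ t ∧ t ≤ gridTime γ (K + 1) := by
  classical
  have hex : ∃ K, t ≤ gridTime γ (K + 1) := by
    obtain ⟨K, hK⟩ := exists_le_gridTime hγ t
    exact ⟨K, hK.trans (gridTime_mono hγ K.le_succ)⟩
  refine ⟨Nat.find hex, ?_, Nat.find_spec hex⟩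
  rcases h : Nat.find hex with _ | K
  · rwa [gridTime_zero]
  · exact (not_le.1 (Nat.find_min hex (m := K) (by omega))).le

lemma interp_between {γ : ℕ → ℝ} (hγ : StepAssumption γ) {x : ℕ → State d}
    (hx : ∀ k, γ (k + 1) = 0 → x (k + 1) = x k) {K : ℕ} {t : ℝ≥0} (h1 : gridTime γ K ≤ t)
    (h2 : t ≤ gridTime γ (K + 1)) : interp hγ x t = x K + gridWeight γ K t • (x (K + 1) - x K) := by
  set s : ℝ≥0 := ⟨gridTime γ K, gridTime_nonneg hγ K⟩ with hs
  have hsK : (s : ℝ) = gridTime γ K := rfl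
  have h3 : ∀ k ∈ range K, gridWeight γ k t = gridWeight γ k s := by
    intro k hk
    have h4 : gridTime γ (k + 1) ≤ gridTime γ K := gridTime_mono hγ (mem_range.1 hk)
    have h5 := gridTime_mono hγ k.le_succ
    rw [gridWeight, gridWeight, min_eq_right (h4.trans h1), min_eq_right (h5.trans (h4.trans h1)),
      hsK, min_eq_right h4, min_eq_right (h5.trans h4)]
  rw [interp_eq_sum hγ x h2, sum_range_succ, ← add_assoc]
  congr 1
  rw [sum_congr rfl fun k hk => by rw [h3 k hk], ← interp_eq_sum hγ x hsK.le]
  exact interp_gridTime hγ hx K hsK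

lemma norm_interp_le {γ : ℕ → ℝ} (hγ : StepAssumption γ) {x : ℕ → State d}
    (hx : ∀ k, γ (k + 1) = 0 → x (k + 1) = x k) {K : ℕ} {t : ℝ≥0} (h1 : gridTime γ K ≤ t)
    (h2 : t ≤ gridTime γ (K + 1)) : ‖interp hγ x t‖ ≤ ‖x K‖ + ‖x (K + 1)‖ := by
  rw [interp_between hγ hx h1 h2]
  have h3 := gridWeight_nonneg hγ K t
  have h4 := gridWeight_le_one hγ K t
  have h5 : x K + gridWeight γ K t • (x (K + 1) - x K) =
      (1 - gridWeight γ K t) • x K + gridWeight γ K t • x (K + 1) := by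
    module
  rw [h5]
  refine (norm_add_le _ _).trans ?_
  rw [norm_smul, norm_smul, norm_eq_abs, norm_eq_abs, abs_of_nonneg h3,
    abs_of_nonneg (by linarith)]
  gcongr
  · exact mul_le_of_le_one_left (norm_nonneg _) (by linarith)
  · exact mul_le_of_le_one_left (norm_nonneg _) h4

lemma measurable_interp {γ : ℕ → ℝ} (hγ : StepAssumption γ) {x : ℕ → Ω → State d}
    (hx : ∀ k, Measurable (x k)) : Measurable fun w => interp hγ fun k => x k w :=
  (continuous_interp hγ).measurable.comp (measurable_pi_lambda _ hx)

namespace StepDynamics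

lemma eq_of_step_eq_zero (h : StepDynamics P γ x β ξ F q M) (i : Fin n) (w : Ω) (k : ℕ)
    (hk : γ (k + 1) = 0) : x (k + 1) i w = x k i w := by
  rw [h.step, hk]
  simp

lemma pow_add_three_le {a b c : ℝ} (ha : 0 ≤ a) (hb : 0 ≤ b) (hc : 0 ≤ c) (q : ℕ) :
    (a + b + c) ^ q ≤ 4 ^ q * (a ^ q + b ^ q + c ^ q) := by
  have h1 := add_pow_le (add_nonneg ha hb) hc q
  have h2 := add_pow_le ha hb q
  have h3 : (2 : ℝ) ^ (q - 1) ≤ 2 ^ q := pow_le_pow_right₀ (by norm_num) (by omega)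
  have h4 : (1 : ℝ) ≤ 2 ^ q := one_le_pow₀ (by norm_num)
  have ha' : 0 ≤ a ^ q := by positivity
  have hb' : 0 ≤ b ^ q := by positivity
  have hc' : 0 ≤ c ^ q := by positivity
  have h5 : (a + b) ^ q ≤ 2 ^ q * (a ^ q + b ^ q) := h2.trans (by gcongr)
  calc (a + b + c) ^ q ≤ 2 ^ q * (2 ^ q * (a ^ q + b ^ q) + 2 ^ q * c ^ q) :=
        h1.trans (by
          gcongr
          exact le_mul_of_one_le_left hc' h4)
    _ = 4 ^ q * (a ^ q + b ^ q + c ^ q) := by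
        rw [show (4 : ℝ) = 2 * 2 by norm_num, mul_pow]
        ring

/-- The martingale part of the interpolated path, started at time `u`. -/
def noisePath (hγ : StepAssumption γ) (ξ : ℕ → Fin n → Ω → State d) (u : ℝ≥0)
    (i : Fin n) (w : Ω) : PathSpace d :=
  shiftPath u (interp hγ fun k => ∑ l ∈ range k, √(2 * γ (l + 1)) • ξ l i w) -
    ContinuousMap.const _
      (interp hγ (fun k => ∑ l ∈ range k, √(2 * γ (l + 1)) • ξ l i w) u)

lemma noisePath_sub (hγ : StepAssumption γ) (ξ : ℕ → Fin n → Ω → State d) (u : ℝ≥0)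
    (i : Fin n) (w : Ω) {s t : ℝ≥0} {K : ℕ} (hs : (u + s : ℝ≥0) ≤ gridTime γ K)
    (ht : (u + t : ℝ≥0) ≤ gridTime γ K) :
    noisePath hγ ξ u i w t - noisePath hγ ξ u i w s = ∑ k ∈ range K,
      (√(2 * γ (k + 1)) * (gridWeight γ k (u + t : ℝ≥0) - gridWeight γ k (u + s : ℝ≥0))) •
        ξ k i w := by
  have e : ∀ t, noisePath hγ ξ u i w t =
      interp hγ (fun k => ∑ l ∈ range k, √(2 * γ (l + 1)) • ξ l i w) (u + t) -
      interp hγ (fun k => ∑ l ∈ range k, √(2 * γ (l + 1)) • ξ l i w) u := fun t => rfl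
  rw [e, e, sub_sub_sub_cancel_right, interp_sub_eq_sum hγ _ hs ht]
  refine sum_congr rfl fun k _ => ?_
  rw [sum_range_succ, add_sub_cancel_left, smul_smul, mul_comm]

lemma noisePath_zero (hγ : StepAssumption γ) (ξ : ℕ → Fin n → Ω → State d) (u : ℝ≥0)
    (i : Fin n) (w : Ω) : noisePath hγ ξ u i w 0 = 0 := by
  simp [noisePath, shiftPath_apply]

lemma integral_noisePath_pow_four_le (h : StepDynamics P γ x β ξ F q M)
    (hγ : StepAssumption γ) (u : ℝ≥0) (i : Fin n) {s t : ℝ≥0} (hst : s ≤ t) :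
    Integrable (fun w => ‖noisePath hγ ξ u i w t - noisePath hγ ξ u i w s‖ ^ 4) P ∧
    ∫ w, ‖noisePath hγ ξ u i w t - noisePath hγ ξ u i w s‖ ^ 4 ∂P ≤
      64 * d ^ 2 * M * ((t : ℝ) - s) ^ 2 := by
  have hst' : ((u + s : ℝ≥0) : ℝ) ≤ (u + t : ℝ≥0) := by exact_mod_cast add_le_add_right hst u
  obtain ⟨K, hK⟩ := exists_le_gridTime hγ (u + t : ℝ≥0)
  simp_rw [noisePath_sub hγ ξ u i _ (hst'.trans hK) hK]
  obtain ⟨h1, h2⟩ := h.integral_noise_pow_four_le (fun k => √(2 * γ (k + 1)) *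
    (gridWeight γ k (u + t : ℝ≥0) - gridWeight γ k (u + s : ℝ≥0))) K i
  refine ⟨integrable_norm_pow_four h1, h2.trans ?_⟩
  have h1 := sum_sq_weight_le hγ (u + s : ℝ≥0).coe_nonneg hst' hK
  have hM := h.moment_nonneg
  have e : ((u + t : ℝ≥0) : ℝ) - (u + s : ℝ≥0) = t - s := by push_cast; ring
  rw [e] at h1
  have h2 : 0 ≤ ∑ k ∈ range K, (√(2 * γ (k + 1)) *
      (gridWeight γ k (u + t : ℝ≥0) - gridWeight γ k (u + s : ℝ≥0))) ^ 2 :=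
    sum_nonneg fun k _ => sq_nonneg _
  calc _ ≤ 16 * d ^ 2 * M * (2 * ((t : ℝ) - s)) ^ 2 := by gcongr
    _ = _ := by ring

lemma measurable_noisePath (h : StepDynamics P γ x β ξ F q M) (hγ : StepAssumption γ) (u : ℝ≥0)
    (i : Fin n) : Measurable (noisePath hγ ξ u i) := by
  have hm : ∀ k, Measurable (ξ k i) := fun k => (h.measurable_ξ k i).mono (F.le _) le_rfl
  have h1 : Measurable fun w =>
      interp hγ fun k => ∑ l ∈ range k, √(2 * γ (l + 1)) • ξ l i w :=
    measurable_interp hγ fun k => measurable_sum _ fun l _ => (hm l).const_smul (√(2 * γ (l + 1)))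
  have hc : Continuous fun z : PathSpace d => shiftPath u z - ContinuousMap.const ℝ≥0 (z u) :=
    (continuous_shiftPath u).sub (ContinuousMap.continuous_const'.comp (continuous_eval_const u))
  exact hc.measurable.comp h1

lemma coe_dyadic_sub (j i : ℕ) :
    ((((i : ℝ≥0) + 1) / 2 ^ j : ℝ≥0) : ℝ) - ((i : ℝ≥0) / 2 ^ j : ℝ≥0) = (1 / 2) ^ j := by
  push_cast
  rw [div_sub_div_same, add_sub_cancel_left, one_div, one_div, inv_pow]

lemma dyadic_weight (A : ℝ) (m j : ℕ) :
    (3 / 2 : ℝ) ^ j * ∑ _i ∈ range ((m + 1) * 2 ^ j), A * ((1 / 2 : ℝ) ^ j) ^ 2 =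
      A * (m + 1) * (3 / 4) ^ j := by
  rw [sum_const, Finset.card_range, nsmul_eq_mul]
  push_cast
  have : (3 / 4 : ℝ) ^ j = (3 / 2) ^ j * (2 ^ j * ((1 / 2) ^ j) ^ 2) := by
    rw [← pow_mul, mul_comm j, pow_mul, ← mul_pow, ← mul_pow]
    norm_num
  rw [this]
  ring

lemma tsum_ofReal_geometric {A : ℝ} (hA : 0 ≤ A) :
    ∑' j : ℕ, ofReal (A * (3 / 4) ^ j) = ofReal (4 * A) := by
  rw [← ENNReal.ofReal_tsum_of_nonneg (fun j => by positivity)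
    ((summable_geometric_of_lt_one (by norm_num) (by norm_num)).mul_left A), tsum_mul_left,
    tsum_geometric_of_lt_one (by norm_num) (by norm_num)]
  congr 1
  ring

/-- Uniform bounds on the suprema of the martingale parts. -/
lemma exists_lintegral_noisePath_le (d : ℕ) (M : ℝ) (hM : 0 ≤ M) (m : ℕ) :
    ∃ A : ℝ, 0 ≤ A ∧ ∀ {n : ℕ+} {x β ξ : ℕ → Fin n → Ω → State d}
      {F : Filtration ℕ mΩ} {q : ℕ}, StepDynamics P γ x β ξ F q M → ∀ (hγ : StepAssumption γ)
      (u : ℝ≥0) (i : Fin n), ∫⁻ w, ofReal (‖restrictPath m (noisePath hγ ξ u i w)‖ ^ 4) ∂P ≤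
        ofReal A := by
  obtain ⟨A, hA, hA'⟩ := exists_norm_restrictPath_pow_four_le (d := d) m
  refine ⟨A * (4 * (64 * d ^ 2 * M * (m + 1))), by positivity, ?_⟩
  intro n x β ξ F q h hγ u i
  have hmeas : ∀ j, Measurable fun w => ofReal ((3 / 2) ^ j *
      ∑ l ∈ range ((m + 1) * 2 ^ j), ‖dyadicIncrement (noisePath hγ ξ u i w) j l‖ ^ 4) := by
    intro j
    have hc : Continuous fun y : PathSpace d => (3 / 2 : ℝ) ^ j *
        ∑ l ∈ range ((m + 1) * 2 ^ j), ‖dyadicIncrement y j l‖ ^ 4 := by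
      refine continuous_const.mul (continuous_finsetSum _ fun l _ => ?_)
      exact (((continuous_eval_const _).sub (continuous_eval_const _)).norm).pow 4
    exact (hc.measurable.comp (h.measurable_noisePath hγ u i)).ennreal_ofReal
  refine (lintegral_mono fun w => hA' _ (noisePath_zero hγ ξ u i w)).trans ?_
  rw [lintegral_const_mul' _ _ ofReal_ne_top,
    lintegral_tsum fun j => (hmeas j).aemeasurable, ofReal_mul hA,
    ← tsum_ofReal_geometric (A := 64 * d ^ 2 * M * (m + 1)) (by positivity)]
  gcongr with j
  have hi : ∀ l : ℕ, (l : ℝ≥0) / 2 ^ j ≤ ((l : ℝ≥0) + 1) / 2 ^ j := fun l => by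
    gcongr
    exact le_self_add
  have i1 := fun l : ℕ => h.integral_noisePath_pow_four_le hγ u i (hi l)
  have i2 : ∀ l ∈ range ((m + 1) * 2 ^ j),
      Integrable (fun w => ‖dyadicIncrement (noisePath hγ ξ u i w) j l‖ ^ 4) P := fun l _ =>
    (i1 l).1
  refine (lintegral_ofReal_le ((integrable_finsetSum _ i2).const_mul ((3 / 2) ^ j))
    (fun w => by positivity) fun w => le_rfl).trans (ofReal_le_ofReal ?_)
  rw [integral_const_mul, integral_finsetSum _ i2, ← dyadic_weight]
  gcongr with l _
  have := (i1 l).2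
  rwa [coe_dyadic_sub] at this

lemma integral_norm_interp_le (h : StepDynamics P γ x β ξ F q M) (hγ : StepAssumption γ) (u : ℝ≥0) :
    ∃ g : Fin n → Ω → ℝ, (∀ i, Integrable (g i) P) ∧ (∀ i w, 0 ≤ g i w) ∧
    (∀ i w, ‖traj hγ x i w u‖ ^ q ≤ g i w) ∧ mean (fun i => ∫ w, g i w ∂P) ≤ 2 ^ q * (2 * M) := by
  obtain ⟨K, hK1, hK2⟩ := exists_gridTime_le hγ u.coe_nonneg
  have i1 : ∀ k i, Integrable (fun w => ‖x k i w‖ ^ q) P := fun k i =>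
    (h.memLp_x k i).integrable_norm_pow'
  refine ⟨fun i w => 2 ^ q * (‖x K i w‖ ^ q + ‖x (K + 1) i w‖ ^ q),
    fun i => ((i1 K i).add (i1 (K + 1) i)).const_mul _, fun i w => by positivity, fun i w => ?_, ?_⟩
  · have h1 := norm_interp_le hγ (x := fun k => x k i w) (h.eq_of_step_eq_zero i w) hK1 hK2
    have h2 : ‖traj hγ x i w u‖ ^ q ≤ (‖x K i w‖ + ‖x (K + 1) i w‖) ^ q := by gcongr
    exact h2.trans ((add_pow_le (norm_nonneg _) (norm_nonneg _) q).trans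
      (mul_le_mul_of_nonneg_right (pow_le_pow_right₀ (by norm_num) (Nat.sub_le q 1))
        (by positivity)))
  · have : ∀ i, ∫ w, 2 ^ q * (‖x K i w‖ ^ q + ‖x (K + 1) i w‖ ^ q) ∂P =
        2 ^ q * (∫ w, ‖x K i w‖ ^ q ∂P + ∫ w, ‖x (K + 1) i w‖ ^ q ∂P) := fun i => by
      rw [integral_const_mul, integral_add (i1 K i) (i1 (K + 1) i)]
    simp_rw [this]
    rw [mean_const_mul, mean_add]
    have h1 := h.moment_x K
    have h2 := h.moment_x (K + 1)
    gcongr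
    linarith

/-- Uniform bounds on the suprema of the interpolated paths. -/
lemma exists_lintegral_restrictPath_le (d : ℕ) (M : ℝ) (hM : 0 ≤ M) {q : ℕ} (hq2 : 2 ≤ q)
    (hq4 : q ≤ 4) (m : ℕ) : ∃ A : ℝ, 0 ≤ A ∧ ∀ {n : ℕ+} {x β ξ : ℕ → Fin n → Ω → State d}
      {F : Filtration ℕ mΩ}, StepDynamics P γ x β ξ F q M → ∀ (hγ : StepAssumption γ)
      (u : ℝ≥0), (n : ℝ≥0∞)⁻¹ * ∑ i : Fin n, ∫⁻ ω, ofReal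
        (‖restrictPath m (shiftPath u (traj hγ x i ω))‖ ^ q) ∂P ≤ ofReal A := by
  obtain ⟨A, hA, hA'⟩ := exists_lintegral_noisePath_le (P := P) (γ := γ) d M hM m
  refine ⟨4 ^ q * (2 ^ q * (2 * M) + (m : ℝ) ^ q * M + (1 + A)), by positivity, ?_⟩
  intro n x β ξ F h hγ u
  obtain ⟨g, g1, g2, g3, g4⟩ := h.integral_norm_interp_le hγ u
  obtain ⟨K, hK⟩ := exists_le_gridTime hγ (u + m : ℝ≥0)
  have hum : (u : ℝ) ≤ (u + m : ℝ≥0) := by exact_mod_cast le_self_add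
  set w : ℕ → ℝ := fun k => γ (k + 1) * (gridWeight γ k (u + m : ℝ≥0) - gridWeight γ k u) with hwdef
  have hw : ∀ k, 0 ≤ w k := fun k => mul_nonneg (hγ.nonneg k) (gridWeight_sub_mem hγ hum k).1
  have hws : ∑ k ∈ range K, w k = m := by
    rw [hwdef, sum_mul_gridWeight_sub u.coe_nonneg hum hK]
    push_cast
    ring
  obtain ⟨-, i2, i3⟩ := mean_integral_pow_sum_le (r := q) (by omega)
    (fun k i ω => norm_nonneg (β k i ω)) (fun k i => (h.memLp_β k i).norm) h.moment_β hw K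
  rw [hws] at i3
  have hnoise : ∀ i ω, ‖restrictPath m (noisePath hγ ξ u i ω)‖ ^ q ≤
      1 + ‖restrictPath m (noisePath hγ ξ u i ω)‖ ^ 4 := by
    intro i ω
    set r := ‖restrictPath m (noisePath hγ ξ u i ω)‖
    have hr : 0 ≤ r := norm_nonneg _
    rcases le_total r 1 with h1 | h1
    · have := pow_le_one₀ (n := q) hr h1
      have : 0 ≤ r ^ 4 := by positivity
      linarith
    · have := pow_le_pow_right₀ h1 hq4
      linarith
  have hpt : ∀ i ω, ‖restrictPath m (shiftPath u (traj hγ x i ω))‖ ^ q ≤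
      4 ^ q * (g i ω + (∑ k ∈ range K, w k * ‖β k i ω‖) ^ q +
        (1 + ‖restrictPath m (noisePath hγ ξ u i ω)‖ ^ 4)) := by
    intro i ω
    have hS : 0 ≤ ∑ k ∈ range K, w k * ‖β k i ω‖ :=
      sum_nonneg fun k _ => mul_nonneg (hw k) (norm_nonneg _)
    have h1 : ‖restrictPath m (shiftPath u (traj hγ x i ω))‖ ≤
        ‖traj hγ x i ω u‖ + ∑ k ∈ range K, w k * ‖β k i ω‖ +
          ‖restrictPath m (noisePath hγ ξ u i ω)‖ := by
      refine norm_restrictPath_le (by positivity) fun t ht => ?_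
      have htm : ((u + t : ℝ≥0) : ℝ) ≤ (u + m : ℝ≥0) := by exact_mod_cast add_le_add_right ht u
      have hut : (u : ℝ) ≤ (u + t : ℝ≥0) := by exact_mod_cast le_self_add
      have e1 := h.interp_sub hγ (hum.trans hK) (htm.trans hK) i ω
      have e2 := noisePath_sub hγ ξ u i ω (s := 0) (t := t) (K := K) (by simpa using hum.trans hK)
        (htm.trans hK)
      rw [noisePath_zero, sub_zero, add_zero] at e2
      rw [← e2, sub_eq_iff_eq_add] at e1
      rw [shiftPath_apply, e1, add_comm, ← add_assoc]
      refine (norm_add₃_le).trans ?_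
      gcongr
      · refine (norm_sum_le _ _).trans (sum_le_sum fun k _ => ?_)
        obtain ⟨j1, -⟩ := gridWeight_sub_mem hγ hut k
        have j2 := gridWeight_mono hγ k htm
        rw [norm_smul, norm_eq_abs, abs_of_nonneg (mul_nonneg (hγ.nonneg k) j1)]
        have := hγ.nonneg k
        simp only [hwdef]
        gcongr
      · exact norm_le_norm_restrictPath ht _
    calc _ ≤ (‖traj hγ x i ω u‖ + ∑ k ∈ range K, w k * ‖β k i ω‖ +
          ‖restrictPath m (noisePath hγ ξ u i ω)‖) ^ q := by gcongr
      _ ≤ _ := by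
        refine (pow_add_three_le (norm_nonneg _) hS (norm_nonneg _) q).trans ?_
        gcongr
        · exact g3 i ω
        · exact hnoise i ω
  have hI : ∀ i, ∫⁻ ω, ofReal
      (‖restrictPath m (shiftPath u (traj hγ x i ω))‖ ^ q) ∂P ≤
      ofReal (4 ^ q * (∫ ω, g i ω ∂P +
        ∫ ω, (∑ k ∈ range K, w k * ‖β k i ω‖) ^ q ∂P + (1 + A))) := by
    intro i
    have hS : ∀ ω, 0 ≤ (∑ k ∈ range K, w k * ‖β k i ω‖) ^ q := fun ω =>
      pow_nonneg (sum_nonneg fun k _ => mul_nonneg (hw k) (norm_nonneg _)) _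
    have i4 : Integrable (fun ω => 4 ^ q * (g i ω +
        (∑ k ∈ range K, w k * ‖β k i ω‖) ^ q + 1)) P :=
      (((g1 i).add (i2 i)).add (integrable_const (1 : ℝ))).const_mul _
    have i5 : ∫ ω, 4 ^ q * (g i ω + (∑ k ∈ range K, w k * ‖β k i ω‖) ^ q + 1) ∂P =
        4 ^ q * (∫ ω, g i ω ∂P + ∫ ω, (∑ k ∈ range K, w k * ‖β k i ω‖) ^ q ∂P + 1) := by
      have i6 : Integrable (fun ω => g i ω + (∑ k ∈ range K, w k * ‖β k i ω‖) ^ q) P :=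
        (g1 i).add (i2 i)
      rw [integral_const_mul, integral_add i6 (integrable_const (1 : ℝ)),
        integral_add (g1 i) (i2 i), integral_const]
      simp
    have n1 : 0 ≤ ∫ ω, g i ω ∂P := integral_nonneg (g2 i)
    have n2 : 0 ≤ ∫ ω, (∑ k ∈ range K, w k * ‖β k i ω‖) ^ q ∂P := integral_nonneg hS
    calc _ ≤ ∫⁻ ω, (ofReal (4 ^ q * (g i ω +
          (∑ k ∈ range K, w k * ‖β k i ω‖) ^ q + 1)) + ofReal (4 ^ q) *
            ofReal (‖restrictPath m (noisePath hγ ξ u i ω)‖ ^ 4)) ∂P := by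
          refine lintegral_mono fun ω => ?_
          have := g2 i ω
          have := hS ω
          simp only
          rw [← ofReal_mul (by positivity),
            ← ofReal_add (by positivity) (by positivity)]
          refine ofReal_le_ofReal ((hpt i ω).trans (le_of_eq (by ring)))
      _ ≤ ofReal (4 ^ q * (∫ ω, g i ω ∂P +
          ∫ ω, (∑ k ∈ range K, w k * ‖β k i ω‖) ^ q ∂P + 1)) +
          ofReal (4 ^ q) * ofReal A := by
          rw [lintegral_add_left' i4.aestronglyMeasurable.aemeasurable.ennreal_ofReal,
            lintegral_const_mul' _ _ ofReal_ne_top, ← i5]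
          gcongr
          · refine lintegral_ofReal_le i4 (fun ω => ?_) fun ω => le_rfl
            have := g2 i ω
            have := hS ω
            positivity
          · exact hA' h hγ u i
      _ = _ := by
          rw [← ofReal_mul (by positivity),
            ← ofReal_add (by positivity) (by positivity)]
          congr 1
          ring
  refine inv_mul_sum_le (fun i => ?_) hI ?_
  · have n1 : 0 ≤ ∫ ω, g i ω ∂P := integral_nonneg (g2 i)
    have n2 : 0 ≤ ∫ ω, (∑ k ∈ range K, w k * ‖β k i ω‖) ^ q ∂P := integral_nonneg fun ω =>
      pow_nonneg (sum_nonneg fun k _ => mul_nonneg (hw k) (norm_nonneg _)) _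
    positivity
  · rw [mean_const_mul, mean_add, mean_add, mean_const]
    gcongr

/-- The energy of the shifted interpolated paths is bounded in mean. -/
lemma exists_lintegral_energy_le (d : ℕ) (M : ℝ) (hM : 0 ≤ M) {q : ℕ} (hq2 : 2 ≤ q) (hq4 : q ≤ 4) :
    ∃ c : ℕ → ℝ, (∀ m, 0 < c m) ∧ ∀ {n : ℕ+} {x β ξ : ℕ → Fin n → Ω → State d}
      {F : Filtration ℕ mΩ}, StepDynamics P γ x β ξ F q M → ∀ (hγ : StepAssumption γ)
      (u : ℝ≥0), (n : ℝ≥0∞)⁻¹ * ∑ i : Fin n, ∫⁻ w,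
        energy c q (shiftPath u (traj hγ x i w)) ∂P ≤ 2 := by
  choose A hA hA' using fun m : ℕ => exists_lintegral_restrictPath_le (P := P) (γ := γ) d M hM
    hq2 hq4 (m + 1)
  set B : ℝ := 4 * (1 + M) + 1024 * d ^ 2 * M with hB
  have hB0 : 0 ≤ B := by positivity
  have hden : ∀ m : ℕ, 0 < A m + 4 * (B * (m + 1)) + 1 := fun m => by
    have := hA m
    positivity
  set c : ℕ → ℝ := fun m => (1 / 2) ^ m / (A m + 4 * (B * (m + 1)) + 1) with hc
  have hc0 : ∀ m, 0 < c m := fun m => div_pos (by positivity) (hden m)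
  refine ⟨c, hc0, ?_⟩
  intro n x β ξ F h hγ u
  have hmeas : ∀ i, Measurable fun w => shiftPath u (traj hγ x i w) := fun i =>
    (continuous_shiftPath u).measurable.comp (measurable_interp hγ fun k => h.measurable_x k i)
  have e1 : (n : ℝ≥0∞)⁻¹ * ∑ i : Fin n, ∫⁻ w,
      energy c q (shiftPath u (traj hγ x i w)) ∂P =
      ∑' a : ℕ × ℕ, (n : ℝ≥0∞)⁻¹ * ∑ i : Fin n, ∫⁻ w, ofReal
        (energyTerm c q a (shiftPath u (traj hγ x i w))) ∂P := by
    rw [ENNReal.tsum_mul_left]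
    congr 1
    rw [Summable.tsum_finsetSum fun i _ => summable]
    refine sum_congr rfl fun i _ => ?_
    simp only [energy]
    exact lintegral_tsum fun a => ((measurable_ofReal_energyTerm a).comp (hmeas i)).aemeasurable
  have hm0 : ∀ m, (n : ℝ≥0∞)⁻¹ * ∑ i : Fin n, ∫⁻ w, ofReal
      (energyTerm c q (m, 0) (shiftPath u (traj hγ x i w))) ∂P ≤
      ofReal (c m * A m) := by
    intro m
    have h1 := hA' m h hγ u
    rw [Nat.cast_add, Nat.cast_one] at h1
    simp only [energyTerm]
    simp_rw [ofReal_mul (hc0 m).le]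
    simp_rw [lintegral_const_mul' _ _ ofReal_ne_top]
    rw [← mul_sum, mul_left_comm]
    gcongr
  have hmk : ∀ m k, (n : ℝ≥0∞)⁻¹ * ∑ i : Fin n, ∫⁻ w, ofReal
      (energyTerm c q (m, k + 1) (shiftPath u (traj hγ x i w))) ∂P ≤
      ofReal (c m * (B * (m + 1)) * (3 / 4) ^ k) := by
    intro m k
    have hi : ∀ l : ℕ, u + (l : ℝ≥0) / 2 ^ k ≤ u + ((l : ℝ≥0) + 1) / 2 ^ k := fun l => by
      gcongr
      exact le_self_add
    choose g g1 g2 g3 g4 using fun l : ℕ => h.exists_min_increment_le hγ hq2 (hi l)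
    have i0 : ∀ i, ∀ l ∈ range ((m + 1) * 2 ^ k), Integrable (g l i) P := fun i l _ => g1 l i
    refine inv_mul_sum_le (g := fun i => ∫ w, c m * ((3 / 2) ^ k *
      ∑ l ∈ range ((m + 1) * 2 ^ k), g l i w) ∂P) (fun i => ?_) (fun i => ?_) ?_
    · exact integral_nonneg fun w => mul_nonneg (hc0 m).le (mul_nonneg (by positivity)
        (sum_nonneg fun l _ => g2 l i w))
    · refine lintegral_ofReal_le (((integrable_finsetSum _ (i0 i)).const_mul _).const_mul _)
        (fun w => ?_) fun w => ?_
      · exact mul_nonneg (hc0 m).le (mul_nonneg (by positivity)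
          (sum_nonneg fun l _ => g2 l i w))
      · simp only [energyTerm]
        have := hc0 m
        gcongr with l _
        exact g3 l i w
    · have e2 : ∀ i, ∫ w, c m * ((3 / 2) ^ k * ∑ l ∈ range ((m + 1) * 2 ^ k), g l i w) ∂P =
          c m * ((3 / 2) ^ k * ∑ l ∈ range ((m + 1) * 2 ^ k), ∫ w, g l i w ∂P) := fun i => by
        rw [integral_const_mul, integral_const_mul, integral_finsetSum _ (i0 i)]
      simp_rw [e2]
      rw [mean_const_mul, mean_const_mul, mul_assoc (c m), ← dyadic_weight]
      have e3 : mean (fun i => ∑ l ∈ range ((m + 1) * 2 ^ k), ∫ w, g l i w ∂P) =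
          ∑ l ∈ range ((m + 1) * 2 ^ k), mean fun i => ∫ w, g l i w ∂P := by
        unfold mean
        rw [sum_comm, mul_sum]
      rw [e3]
      have := hc0 m
      gcongr with l _
      refine (g4 l).trans (le_of_eq ?_)
      rw [← coe_dyadic_sub k l]
      push_cast
      ring
  rw [e1]
  have e4 := ENNReal.tsum_prod (f := fun m k => (n : ℝ≥0∞)⁻¹ * ∑ i : Fin n, ∫⁻ w,
    ofReal (energyTerm c q (m, k) (shiftPath u (traj hγ x i w))) ∂P)
  simp only [Prod.mk.eta] at e4
  rw [e4]
  calc _ ≤ ∑' m : ℕ, (2 : ℝ≥0∞)⁻¹ ^ m := by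
        refine tsum_le_tsum fun m => ?_
        rw [tsum_eq_zero_add' summable]
        refine (add_le_add (hm0 m) (tsum_le_tsum (hmk m))).trans ?_
        have := (hc0 m).le
        have := hA m
        rw [tsum_ofReal_geometric (by positivity), ← ofReal_add (by positivity)
          (by positivity)]
        have e5 : (2 : ℝ≥0∞)⁻¹ ^ m = ofReal ((1 / 2) ^ m) := by
          rw [ofReal_pow (by norm_num), one_div, ofReal_inv_of_pos (by norm_num)]
          norm_num
        rw [e5]
        refine ofReal_le_ofReal ?_
        have e6 : c m * (A m + 4 * (B * (m + 1)) + 1) = (1 / 2) ^ m := by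
          simp only [hc]
          exact div_mul_cancel₀ _ (hden m).ne'
        nlinarith [hc0 m]
    _ = 2 := by
        rw [ENNReal.tsum_geometric, ENNReal.one_sub_inv_two, inv_inv]

end StepDynamics

end StepDynamics

section Taylor

lemma abs_taylor_le {V : Type*} [NormedAddCommGroup V] [NormedSpace ℝ V] {φ : V → ℝ}
    (hφ : ContDiff ℝ 2 φ) (x a : V) {c κ : ℝ}
    (hκ : ∀ θ ∈ Set.Icc (0 : ℝ) 1, |fderiv ℝ (fderiv ℝ φ) (x + θ • a) a a - c| ≤ κ) :
    |φ (x + a) - φ x - fderiv ℝ φ x a - c / 2| ≤ κ := by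
  have hκ0 : 0 ≤ κ := (abs_nonneg _).trans (hκ 0 (by simp))
  have hl : ∀ θ : ℝ, HasDerivAt (fun θ : ℝ => x + θ • a) a θ := fun θ => by
    simpa using ((hasDerivAt_id θ).smul_const a).const_add x
  have h1 : ∀ θ : ℝ, HasDerivAt (fun θ : ℝ => φ (x + θ • a)) (fderiv ℝ φ (x + θ • a) a) θ :=
    fun θ => ((hφ.differentiable (by norm_num)) _).hasFDerivAt.comp_hasDerivAt θ (hl θ)
  have hd : Differentiable ℝ (fderiv ℝ φ) :=
    ((contDiff_succ_iff_fderiv (n := 1)).1 hφ).2.2.differentiable (by norm_num)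
  have h2 : ∀ θ : ℝ, HasDerivAt (fun θ : ℝ => fderiv ℝ φ (x + θ • a) a)
      (fderiv ℝ (fderiv ℝ φ) (x + θ • a) a a) θ := by
    intro θ
    have := (hd (x + θ • a)).hasFDerivAt.comp_hasDerivAt θ (hl θ)
    exact (ContinuousLinearMap.apply ℝ ℝ a).hasFDerivAt.comp_hasDerivAt θ this
  have h3 : ∀ θ ∈ Set.Icc (0 : ℝ) 1, |fderiv ℝ φ (x + θ • a) a - fderiv ℝ φ x a - θ * c| ≤ κ := by
    intro θ hθ
    have hder : ∀ r : ℝ, HasDerivAt (fun r : ℝ => fderiv ℝ φ (x + r • a) a - r * c)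
        (fderiv ℝ (fderiv ℝ φ) (x + r • a) a a - c) r := fun r =>
      HasDerivAt.congr_deriv ((h2 r).sub ((hasDerivAt_id r).mul_const c)) (by simp)
    have := norm_image_sub_le_of_norm_deriv_le_segment'
      (fun r _ => (hder r).hasDerivWithinAt) (C := κ) (a := 0) (b := 1)
      (fun r hr => hκ r ⟨hr.1, hr.2.le⟩) θ hθ
    rw [zero_smul, add_zero, zero_mul, sub_zero, sub_zero, norm_eq_abs] at this
    rw [sub_right_comm]
    exact this.trans (mul_le_of_le_one_right hκ0 hθ.2)
  have hder : ∀ r : ℝ, HasDerivAt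
      (fun r : ℝ => φ (x + r • a) - (r * fderiv ℝ φ x a + r ^ 2 * (c / 2)))
      (fderiv ℝ φ (x + r • a) a - (fderiv ℝ φ x a + r * c)) r := fun r => by
    refine (h1 r).sub (HasDerivAt.congr_deriv (((hasDerivAt_id r).mul_const _).add
      ((hasDerivAt_pow 2 r).mul_const _)) ?_)
    simp
    ring
  have := norm_image_sub_le_of_norm_deriv_le_segment_01' (C := κ)
    (fun r _ => (hder r).hasDerivWithinAt) (fun r hr => by
      rw [norm_eq_abs, ← sub_sub]
      exact h3 r ⟨hr.1, hr.2.le⟩)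
  rw [norm_eq_abs] at this
  refine le_trans (le_of_eq ?_) this
  congr 1
  simp
  ring

lemma abs_fderiv_sub_le {V : Type*} [NormedAddCommGroup V] [NormedSpace ℝ V] {φ : V → ℝ}
    (hφ : ContDiff ℝ 2 φ) (x a e : V) {κ : ℝ}
    (hκ : ∀ θ ∈ Set.Icc (0 : ℝ) 1, |fderiv ℝ (fderiv ℝ φ) (x + θ • a) a e| ≤ κ) :
    |fderiv ℝ φ (x + a) e - fderiv ℝ φ x e| ≤ κ := by
  have hl : ∀ θ : ℝ, HasDerivAt (fun θ : ℝ => x + θ • a) a θ := fun θ => by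
    simpa using ((hasDerivAt_id θ).smul_const a).const_add x
  have hd : Differentiable ℝ (fderiv ℝ φ) :=
    ((contDiff_succ_iff_fderiv (n := 1)).1 hφ).2.2.differentiable (by norm_num)
  have h2 : ∀ θ : ℝ, HasDerivAt (fun θ : ℝ => fderiv ℝ φ (x + θ • a) e)
      (fderiv ℝ (fderiv ℝ φ) (x + θ • a) a e) θ := fun θ =>
    (ContinuousLinearMap.apply ℝ ℝ e).hasFDerivAt.comp_hasDerivAt θ
      ((hd (x + θ • a)).hasFDerivAt.comp_hasDerivAt θ (hl θ))
  have := norm_image_sub_le_of_norm_deriv_le_segment_01' (C := κ)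
    (fun r _ => (h2 r).hasDerivWithinAt) (fun r hr => hκ r ⟨hr.1, hr.2.le⟩)
  simpa using this

variable {d : ℕ} {φ : State d → ℝ}

lemma fderiv_fderiv_apply (φ : State d → ℝ) (x a e : State d) :
    fderiv ℝ (fderiv ℝ φ) x a e = ∑ i, ∑ j, a i * e j * hessianMatrix φ x i j := by
  have h : ∀ v : State d, v = ∑ i, v i • EuclideanSpace.single i (1 : ℝ) := fun v => by
    ext j
    simp [Finset.sum_apply, Pi.single_apply]
  conv_lhs => rw [h a, h e]
  simp only [map_sum, map_smul, ContinuousLinearMap.sum_apply, ContinuousLinearMap.smul_apply,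
    smul_eq_mul, mul_sum, hessianMatrix, Matrix.of_apply]
  refine (sum_comm).trans (sum_congr rfl fun i _ => sum_congr rfl fun j _ => ?_)
  ring

lemma abs_sum_sum_mul_le {A : Matrix (Fin d) (Fin d) ℝ} {H : ℝ} (hA : ∀ i j, |A i j| ≤ H)
    (a e : State d) : |∑ i, ∑ j, a i * e j * A i j| ≤ d ^ 2 * H * (‖a‖ * ‖e‖) := by
  have h : ∀ i j, |a i * e j * A i j| ≤ ‖a‖ * ‖e‖ * H := fun i j => by
    rw [abs_mul, abs_mul]
    gcongr
    · exact abs_coord_le a i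
    · exact abs_coord_le e j
    · exact hA i j
  calc |∑ i, ∑ j, a i * e j * A i j| ≤ ∑ i : Fin d, ∑ j : Fin d, ‖a‖ * ‖e‖ * H :=
        (abs_sum_le_sum_abs _ _).trans (sum_le_sum fun i _ =>
          (abs_sum_le_sum_abs _ _).trans (sum_le_sum fun j _ => h i j))
    _ = _ := by
        simp
        ring

lemma exists_hessianMatrix_sub_le (hφ : ContDiff ℝ 2 φ) (hφc : HasCompactSupport φ) {ε : ℝ}
    (hε : 0 < ε) : ∃ C : ℝ, 0 ≤ C ∧ ∀ x y i j, |hessianMatrix φ y i j - hessianMatrix φ x i j| ≤ ε +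
    C * ‖y - x‖ ^ 2 := by
  obtain ⟨H, hH0, hH⟩ := exists_abs_hessianMatrix_le hφ hφc
  have hu : ∀ i j, ∃ δ : ℝ, 0 < δ ∧ ∀ x y, dist y x < δ →
      |hessianMatrix φ y i j - hessianMatrix φ x i j| < ε := by
    intro i j
    have hc : Continuous fun x => hessianMatrix φ x i j :=
      (continuous_hessianMatrix hφ).matrix_elem i j
    have := (hasCompactSupport_hessianMatrix hφc i j).uniformContinuous_of_continuous hc
    obtain ⟨δ, hδ, h⟩ := Metric.uniformContinuous_iff.1 this ε hε
    exact ⟨δ, hδ, fun x y hxy => h hxy⟩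
  choose δ hδ hδ' using hu
  refine ⟨∑ i, ∑ j, 2 * H / δ i j ^ 2, by positivity, fun x y i j => ?_⟩
  have h1 : 2 * H / δ i j ^ 2 ≤ ∑ i, ∑ j, 2 * H / δ i j ^ 2 :=
    le_trans (single_le_sum (f := fun j => 2 * H / δ i j ^ 2) (fun j _ => by positivity)
      (mem_univ j)) (single_le_sum (f := fun i => ∑ j, 2 * H / δ i j ^ 2)
        (fun i _ => by positivity) (mem_univ i))
  rcases lt_or_ge (dist y x) (δ i j) with h | h
  · have := hδ' i j x y h
    have : 0 ≤ (∑ i, ∑ j, 2 * H / δ i j ^ 2) * ‖y - x‖ ^ 2 := by positivity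
    linarith
  · rw [dist_eq_norm] at h
    have h2 : 2 * H ≤ 2 * H / δ i j ^ 2 * ‖y - x‖ ^ 2 := by
      have := hδ i j
      rw [div_mul_eq_mul_div, le_div_iff₀ (by positivity)]
      gcongr
    have h3 : 2 * H / δ i j ^ 2 * ‖y - x‖ ^ 2 ≤
        (∑ i, ∑ j, 2 * H / δ i j ^ 2) * ‖y - x‖ ^ 2 := by gcongr
    have h4 := abs_sub (hessianMatrix φ y i j) (hessianMatrix φ x i j)
    linarith [hH y i j, hH x i j]

lemma fderiv_eq_inner_gradient (φ : State d → ℝ) (x v : State d) :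
    fderiv ℝ φ x v = inner ℝ (gradient φ x) v := by
  rw [gradient, InnerProductSpace.toDual_symm_apply]

/-- Second order expansion, with different treatments of the drift part `e` and of the noise part
`a` of the increment. -/
lemma exists_taylor_le (hφ : ContDiff ℝ 2 φ) (hφc : HasCompactSupport φ) {ε : ℝ} (hε : 0 < ε) : ∃ C
    : ℝ, 0 ≤ C ∧ ∀ x a e : State d, |φ (x + (e + a)) - φ x - inner ℝ (gradient φ x) e - inner ℝ
    (gradient φ x) a - (∑ i, ∑ j, a i * a j * hessianMatrix φ x i j) / 2| ≤ C *
    (‖e‖ ^ 2 + ‖e‖ * ‖a‖ + ‖a‖ ^ 4) + ε * ‖a‖ ^ 2 := by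
  obtain ⟨H, hH0, hH⟩ := exists_abs_hessianMatrix_le hφ hφc
  obtain ⟨C, hC0, hC⟩ := exists_hessianMatrix_sub_le hφ hφc (ε := ε / (d ^ 2 + 1)) (by positivity)
  refine ⟨d ^ 2 * (H + C), by positivity, fun x a e => ?_⟩
  have h1 : |φ (x + a + e) - φ (x + a) - fderiv ℝ φ (x + a) e - 0 / 2| ≤
      d ^ 2 * H * (‖e‖ * ‖e‖) := by
    refine abs_taylor_le hφ _ _ fun θ _ => ?_
    rw [sub_zero, fderiv_fderiv_apply]
    exact abs_sum_sum_mul_le (hH _) e e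
  have h2 : |fderiv ℝ φ (x + a) e - fderiv ℝ φ x e| ≤ d ^ 2 * H * (‖a‖ * ‖e‖) := by
    refine abs_fderiv_sub_le hφ _ _ _ fun θ _ => ?_
    rw [fderiv_fderiv_apply]
    exact abs_sum_sum_mul_le (hH _) a e
  have h3 : |φ (x + a) - φ x - fderiv ℝ φ x a -
      (∑ i, ∑ j, a i * a j * hessianMatrix φ x i j) / 2| ≤
      d ^ 2 * (ε / (d ^ 2 + 1) + C * ‖a‖ ^ 2) * (‖a‖ * ‖a‖) := by
    refine abs_taylor_le hφ _ _ fun θ hθ => ?_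
    rw [fderiv_fderiv_apply]
    have := abs_sum_sum_mul_le (A := hessianMatrix φ (x + θ • a) - hessianMatrix φ x)
      (H := ε / (d ^ 2 + 1) + C * ‖a‖ ^ 2) (fun i j => ?_) a a
    · simpa only [Matrix.sub_apply, mul_sub, sum_sub_distrib] using this
    · refine (hC x (x + θ • a) i j).trans ?_
      rw [add_sub_cancel_left, norm_smul, norm_eq_abs, abs_of_nonneg hθ.1, mul_pow]
      gcongr
      exact mul_le_of_le_one_left (by positivity) (pow_le_one₀ hθ.1 hθ.2)
  have h4 : d ^ 2 * (ε / (d ^ 2 + 1)) ≤ ε := by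
    rw [← mul_div_assoc, div_le_iff₀ (by positivity)]
    linarith
  rw [fderiv_eq_inner_gradient, fderiv_eq_inner_gradient] at *
  have e1 : x + (e + a) = x + a + e := by abel
  rw [e1]
  have n1 := norm_nonneg a
  have n2 := norm_nonneg e
  have h5 : d ^ 2 * (ε / (d ^ 2 + 1)) * ‖a‖ ^ 2 ≤ ε * ‖a‖ ^ 2 := by gcongr
  have h6 : (0 : ℝ) ≤ d ^ 2 * H * ‖a‖ ^ 4 := by positivity
  have h7 : (0 : ℝ) ≤ d ^ 2 * C * (‖e‖ ^ 2 + ‖e‖ * ‖a‖) := by positivity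
  rw [abs_le] at *
  constructor <;> nlinarith [h1.1, h1.2, h2.1, h2.2, h3.1, h3.2]

end Taylor

section MartingaleSums

variable {Ω : Type*} {m mΩ : MeasurableSpace Ω} {P : Measure Ω} [IsProbabilityMeasure P]

lemma memLp_mul_bounded {Z f : Ω → ℝ} (hZ : Measurable Z) {B : ℝ} (hB : ∀ w, |Z w| ≤ B)
    {r : ℝ≥0∞} (hf : MemLp f r P) : MemLp (fun w => Z w * f w) r P := by
  refine (hf.const_mul B).of_le (hZ.aestronglyMeasurable.mul hf.1) (ae_of_all _ fun w => ?_)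
  simp only [norm_mul, norm_eq_abs]
  exact mul_le_mul_of_nonneg_right ((hB w).trans (le_abs_self B)) (abs_nonneg _)

lemma condExp_sum_mul_eq_zero (hm : m ≤ mΩ) {ι : Type*} (s : Finset ι) {Z f : ι → Ω → ℝ}
    (hZ : ∀ j, Measurable[m] (Z j)) {B : ℝ} (hB : ∀ j w, |Z j w| ≤ B) (hf : ∀ j, Integrable (f j) P)
    (h0 : ∀ j, P[f j | m] =ᵐ[P] 0) : P[fun w => ∑ j ∈ s, Z j w * f j w | m] =ᵐ[P] 0 := by
  have hi : ∀ j, Integrable (fun w => Z j w * f j w) P := fun j => by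
    have := memLp_mul_bounded ((hZ j).mono hm le_rfl) (hB j) (memLp_one_iff_integrable.2 (hf j))
    exact memLp_one_iff_integrable.1 this
  have h1 := condExp_finsetSum (s := s) (fun j _ => hi j) m
  have h2 : ∀ j ∈ s, P[fun w => Z j w * f j w | m] =ᵐ[P] 0 := fun j _ => by
    filter_upwards [condExp_mul_of_stronglyMeasurable_left (hZ j).stronglyMeasurable (hi j) (hf j),
      h0 j] with w e1 e2
    refine Eq.trans e1 ?_
    simp [e2]
  have h3 : ∀ᵐ w ∂P, ∀ j ∈ s, (P[fun w => Z j w * f j w | m]) w = 0 :=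
    (Finset.eventually_all s).2 fun j hj => h2 j hj
  have e0 : (fun w => ∑ j ∈ s, Z j w * f j w) = ∑ j ∈ s, fun w => Z j w * f j w := by
    ext w
    simp
  rw [e0]
  filter_upwards [h1, h3] with w e1 e2
  rw [e1, Finset.sum_apply]
  exact sum_eq_zero e2

lemma integral_sq_sub_condExp_le (hm : m ≤ mΩ) {f : Ω → ℝ} (hf : MemLp f 2 P) :
    MemLp (fun w => f w - (P[f | m]) w) 2 P ∧ P[fun w => f w - (P[f | m]) w | m] =ᵐ[P] 0 ∧
      ∫ w, (f w - (P[f | m]) w) ^ 2 ∂P ≤ ∫ w, f w ^ 2 ∂P := by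
  have hg : MemLp (P[f | m]) 2 P := hf.condExp (by norm_num)
  have h1 : MemLp (fun w => f w - (P[f | m]) w) 2 P := hf.sub hg
  have h2 : P[fun w => f w - (P[f | m]) w | m] =ᵐ[P] 0 := by
    have i1 := hf.integrable (by norm_num)
    filter_upwards [condExp_sub i1 (integrable_condExp (f := f) (m := m)) m] with w e1
    refine Eq.trans e1 ?_
    rw [condExp_of_stronglyMeasurable hm stronglyMeasurable_condExp integrable_condExp]
    simp
  refine ⟨h1, h2, ?_⟩
  have i3 : Integrable (fun w => (P[f | m]) w * (f w - (P[f | m]) w)) P := hg.integrable_mul h1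
  have h3 := integral_mul_eq_zero_of_condExp hm stronglyMeasurable_condExp
    (h1.integrable (by norm_num)) i3 h2
  have e : ∀ w, (f w - (P[f | m]) w) ^ 2 = f w ^ 2 - (P[f | m]) w ^ 2 -
      2 * ((P[f | m]) w * (f w - (P[f | m]) w)) := fun w => by ring
  have i4 : Integrable (fun w => f w ^ 2 - (P[f | m]) w ^ 2) P :=
    hf.integrable_sq.sub hg.integrable_sq
  simp_rw [e]
  rw [integral_sub i4 (i3.const_mul 2), integral_sub hf.integrable_sq hg.integrable_sq,
    integral_const_mul, h3]
  have : 0 ≤ ∫ w, (P[f | m]) w ^ 2 ∂P := integral_nonneg fun w => sq_nonneg _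
  linarith

lemma integral_abs_le_sqrt {f : Ω → ℝ} (hf : MemLp f 2 P) {B : ℝ}
    (hB : ∫ w, f w ^ 2 ∂P ≤ B) : ∫ w, |f w| ∂P ≤ √B := by
  refine Real.le_sqrt_of_sq_le (le_trans ?_ hB)
  have h1 : MemLp (fun w => |f w|) 2 P := hf.abs
  have h2 : MemLp (fun _ : Ω => (1 : ℝ)) 2 P := memLp_const 1
  have := sq_integral_mul_le h1 h2
  simpa using this

variable {n : ℕ+} {ι : Type*} [Fintype ι] {c y : Fin n → ι → Ω → ℝ} {G B : ℝ}

lemma memLp_mean_sum (hc : ∀ i j, Measurable (c i j)) (hcG : ∀ i j w, |c i j w| ≤ G)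
    (hy : ∀ i j, MemLp (y i j) 2 P) : MemLp (fun w => mean fun i => ∑ j, c i j w * y i j w) 2 P :=
  (memLp_finsetSum _ fun i _ => memLp_finsetSum _ fun j _ =>
    memLp_mul_bounded (hc i j) (hcG i j) (hy i j)).const_mul _

lemma integral_sq_sum_coeff_le (hc : ∀ i j, Measurable (c i j)) (hcG : ∀ i j w, |c i j w| ≤ G)
    (hy : ∀ i j, MemLp (y i j) 2 P) (hB : ∀ i j, ∫ w, y i j w ^ 2 ∂P ≤ B) (i : Fin n) :
    ∫ w, (∑ j, c i j w * y i j w) ^ 2 ∂P ≤ Fintype.card ι ^ 2 * G ^ 2 * B := by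
  have m1 : ∀ i j, MemLp (fun w => c i j w * y i j w) 2 P := fun i j =>
    memLp_mul_bounded (hc i j) (hcG i j) (hy i j)
  have m2 : ∀ i, MemLp (fun w => ∑ j, c i j w * y i j w) 2 P := fun i =>
    memLp_finsetSum _ fun j _ => m1 i j
  calc ∫ w, (∑ j, c i j w * y i j w) ^ 2 ∂P
      ≤ ∫ w, ∑ j : ι, (Fintype.card ι * G ^ 2) * y i j w ^ 2 ∂P := by
        refine integral_mono (m2 i).integrable_sq
          (integrable_finsetSum _ fun j _ => (hy i j).integrable_sq.const_mul _) fun w => ?_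
        simp only
        refine (sq_sum_le_card_mul_sum_sq).trans ?_
        rw [card_univ, mul_sum]
        refine sum_le_sum fun j _ => ?_
        rw [mul_pow, mul_assoc]
        exact mul_le_mul_of_nonneg_left (mul_le_mul_of_nonneg_right
          (sq_le_sq' (abs_le.1 (hcG i j w)).1 (abs_le.1 (hcG i j w)).2) (sq_nonneg _))
          (by positivity)
    _ ≤ ∑ _j : ι, (Fintype.card ι * G ^ 2) * B := by
        rw [integral_finsetSum _ fun j _ => (hy i j).integrable_sq.const_mul _]
        refine sum_le_sum fun j _ => ?_
        rw [integral_const_mul]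
        gcongr
        exact hB i j
    _ = _ := by
        rw [sum_const, card_univ, nsmul_eq_mul]
        ring

lemma integral_sq_mean_sum_le (hc : ∀ i j, Measurable (c i j)) (hcG : ∀ i j w, |c i j w| ≤ G)
    (hy : ∀ i j, MemLp (y i j) 2 P) (hB : ∀ i j, ∫ w, y i j w ^ 2 ∂P ≤ B) :
    ∫ w, (mean fun i => ∑ j, c i j w * y i j w) ^ 2 ∂P ≤ Fintype.card ι ^ 2 * G ^ 2 * B := by
  have m2 : ∀ i, MemLp (fun w => ∑ j, c i j w * y i j w) 2 P := fun i =>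
    memLp_finsetSum _ fun j _ => memLp_mul_bounded (hc i j) (hcG i j) (hy i j)
  have i1 : ∀ i, Integrable (fun w => (∑ j, c i j w * y i j w) ^ 2) P := fun i =>
    (m2 i).integrable_sq
  refine (integral_mono (memLp_mean_sum hc hcG hy).integrable_sq (integrable_mean i1)
    fun w => mean_sq_le _).trans ?_
  rw [integral_mean i1]
  exact mean_le_of_forall_le fun i => integral_sq_sum_coeff_le hc hcG hy hB i

/-- Orthogonality of the contributions of the different particles. -/
lemma integral_sq_mean_sum_le_div (hc : ∀ i j, Measurable (c i j)) (hcG : ∀ i j w, |c i j w| ≤ G)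
    (hy : ∀ i j, MemLp (y i j) 2 P) (hB : ∀ i j, ∫ w, y i j w ^ 2 ∂P ≤ B)
    (horth : ∀ i i', i ≠ i' → ∫ w, (∑ j, c i j w * y i j w) * ∑ j, c i' j w * y i' j w ∂P = 0) :
    ∫ w, (mean fun i => ∑ j, c i j w * y i j w) ^ 2 ∂P ≤
      Fintype.card ι ^ 2 * G ^ 2 * B / (n : ℕ) := by
  set U : Fin n → Ω → ℝ := fun i w => ∑ j, c i j w * y i j w with hU
  have m2 : ∀ i, MemLp (U i) 2 P := fun i =>
    memLp_finsetSum _ fun j _ => memLp_mul_bounded (hc i j) (hcG i j) (hy i j)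
  have i1 : ∀ i i', Integrable (fun w => U i w * U i' w) P := fun i i' =>
    (m2 i).integrable_mul (m2 i')
  have hn : (0 : ℝ) < (n : ℕ) := by exact_mod_cast n.pos
  have e : ∀ w, (mean fun i => U i w) ^ 2 =
      (n : ℝ)⁻¹ ^ 2 * ∑ i, ∑ i', U i w * U i' w := fun w => by
    rw [mean, mul_pow, sq (∑ i, U i w), Finset.sum_mul_sum]
  calc ∫ w, (mean fun i => U i w) ^ 2 ∂P
      = (n : ℝ)⁻¹ ^ 2 * ∑ i, ∑ i', ∫ w, U i w * U i' w ∂P := by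
        simp_rw [e]
        rw [integral_const_mul, integral_finsetSum _ fun i _ =>
          integrable_finsetSum _ fun i' _ => i1 i i']
        congr 1
        exact sum_congr rfl fun i _ => integral_finsetSum _ fun i' _ => i1 i i'
    _ = (n : ℝ)⁻¹ ^ 2 * ∑ i, ∫ w, U i w * U i w ∂P := by
        congr 1
        refine sum_congr rfl fun i _ => ?_
        exact Finset.sum_eq_single i (fun i' _ hne => horth i i' hne.symm) (by simp)
    _ ≤ (n : ℝ)⁻¹ ^ 2 * ∑ _i : Fin n, (Fintype.card ι ^ 2 * G ^ 2 * B) := by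
        gcongr with i
        have := integral_sq_sum_coeff_le hc hcG hy hB i
        simpa only [sq] using this
    _ = _ := by
        rw [sum_const, card_univ, Fintype.card_fin, nsmul_eq_mul]
        field_simp

end MartingaleSums

section MartingaleTransforms

variable {Ω : Type*} [mΩ : MeasurableSpace Ω] {P : Measure Ω} [IsProbabilityMeasure P]
  {F : Filtration ℕ mΩ} {n : ℕ+} {ι : Type*} [Fintype ι] {c y : ℕ → Fin n → ι → Ω → ℝ} {G : ℝ}

/-- The filtration started at time `k₀`. -/
def shiftFiltration (F : Filtration ℕ mΩ) (k₀ : ℕ) : Filtration ℕ mΩ where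
  seq k := F (k₀ + k)
  mono' _ _ h := F.mono (Nat.add_le_add_left h k₀)
  le' k := F.le (k₀ + k)

lemma shiftFiltration_apply (F : Filtration ℕ mΩ) (k₀ k : ℕ) :
    shiftFiltration F k₀ k = F (k₀ + k) := rfl

/-- Weighted sums of martingale increments have small first moments. -/
lemma integral_abs_martingaleTransform_le {u : ℕ → ℝ} {B S : ℝ}
    (hc : ∀ k i j, Measurable[F k] (c k i j)) (hcG : ∀ k i j w, |c k i j w| ≤ G)
    (hym : ∀ k i j, Measurable[F (k + 1)] (y k i j)) (hy : ∀ k i j, MemLp (y k i j) 2 P)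
    (h0 : ∀ k i j, P[y k i j | F k] =ᵐ[P] 0)
    (hB : ∀ k, ∫ w, (mean fun i => ∑ j, c k i j w * y k i j w) ^ 2 ∂P ≤ B) (K : ℕ)
    (hS : ∑ k ∈ range K, u k ^ 2 ≤ S) :
    Integrable (fun w => ∑ k ∈ range K, u k * mean fun i => ∑ j, c k i j w * y k i j w) P ∧
    ∫ w, |∑ k ∈ range K, u k * mean fun i => ∑ j, c k i j w * y k i j w| ∂P ≤ √(S * B) := by
  have hm : ∀ k, Measurable[F (k + 1)] fun w =>
      u k * mean fun i => ∑ j, c k i j w * y k i j w := by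
    intro k
    have h1 : ∀ i, Measurable[F (k + 1)] fun w => ∑ j, c k i j w * y k i j w := fun i =>
      measurable_sum _ fun j _ =>
        ((hc k i j).mono (F.mono k.le_succ) le_rfl).mul (hym k i j)
    exact (measurable_const_mul (u k)).comp (measurable_mean h1)
  have hL : ∀ k, MemLp (fun w => u k * mean fun i => ∑ j, c k i j w * y k i j w) 2 P := fun k =>
    (memLp_mean_sum (fun i j => (hc k i j).mono (F.le k) le_rfl) (hcG k) (hy k)).const_mul _
  have hce : ∀ k, P[fun w => u k * mean fun i => ∑ j, c k i j w * y k i j w | F k] =ᵐ[P] 0 := by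
    intro k
    have h1 := condExp_sum_mul_eq_zero (P := P) (F.le k) (univ : Finset (Fin n × ι))
      (Z := fun z w => c k z.1 z.2 w) (f := fun z => y k z.1 z.2) (fun z => hc k z.1 z.2)
      (fun z => hcG k z.1 z.2) (fun z => (hy k z.1 z.2).integrable (by norm_num))
      (fun z => h0 k z.1 z.2)
    have e : (fun w => u k * mean fun i => ∑ j, c k i j w * y k i j w) =
        (u k * (n : ℝ)⁻¹) • fun w => ∑ z : Fin n × ι, c k z.1 z.2 w * y k z.1 z.2 w := by
      ext w
      simp only [mean, Pi.smul_apply, smul_eq_mul, Fintype.sum_prod_type]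
      ring
    rw [e]
    filter_upwards [condExp_smul (u k * (n : ℝ)⁻¹)
      (fun w => ∑ z : Fin n × ι, c k z.1 z.2 w * y k z.1 z.2 w) (F k) (μ := P), h1] with w e1 e2
    rw [e1, Pi.smul_apply, e2]
    simp
  have hsum := memLp_sum_range hL K
  refine ⟨hsum.integrable (by norm_num), integral_abs_le_sqrt hsum ?_⟩
  have hB0 : 0 ≤ B := (integral_nonneg fun _ => sq_nonneg _).trans (hB 0)
  refine (integral_sq_sum_le hm hL hce K).trans ?_
  calc ∑ k ∈ range K, ∫ w, (u k * mean fun i => ∑ j, c k i j w * y k i j w) ^ 2 ∂P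
      ≤ ∑ k ∈ range K, u k ^ 2 * B := by
        refine sum_le_sum fun k _ => ?_
        simp_rw [mul_pow]
        rw [integral_const_mul]
        gcongr
        exact hB k
    _ ≤ S * B := by
        rw [← sum_mul]
        gcongr

end MartingaleTransforms

section Recurrence

open scoped BoundedContinuousFunction

variable {S : Type*} [PseudoEMetricSpace S] [MeasurableSpace S] [BorelSpace S]

/-- The truncation `min 1 f` of a continuous function `f`. -/
def truncate {f : S → ℝ≥0∞} (hf : Continuous f) : S →ᵇ ℝ≥0 :=
  BoundedContinuousFunction.mkOfBound ⟨fun x => (min 1 (f x)).toNNReal,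
    ENNReal.continuousOn_toNNReal.comp_continuous (by fun_prop) fun x => by simp⟩ 1 fun x y => by
      have h : ∀ x, (min 1 (f x)).toNNReal ≤ 1 := fun x =>
        ENNReal.toNNReal_mono (b := 1) (by simp) (min_le_left _ _)
      rw [ContinuousMap.coe_mk, NNReal.dist_eq, abs_le]
      have h1 := NNReal.coe_le_coe.2 (h x)
      have h2 := NNReal.coe_le_coe.2 (h y)
      constructor <;> push_cast at * <;>
        linarith [toReal_nonneg (a := min 1 (f x)), toReal_nonneg (a := min 1 (f y))]

lemma coe_truncate {f : S → ℝ≥0∞} (hf : Continuous f) (x : S) :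
    (truncate hf x : ℝ≥0∞) = min 1 (f x) :=
  ENNReal.coe_toNNReal (by simp)

/-- Poincaré recurrence for a tight measure. -/
lemma ae_recurrent {μ : Measure S} [IsFiniteMeasure μ] {K : ℕ → Set S} (hK : ∀ j, IsCompact (K j))
    (hμ : μ (⋃ j, K j)ᶜ = 0) {T : S → S} (hT : MeasurePreserving T μ μ) :
    ∀ᵐ x ∂μ, ∀ U ∈ 𝓝 x, μ U ≠ 0 ∧ ∃ᶠ n in atTop, T^[n] x ∈ U := by
  obtain ⟨c, hc, hcK⟩ := TopologicalSpace.IsSeparable.iUnion fun j => (hK j).isSeparable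
  have h : ∀ᵐ x ∂μ, ∀ y ∈ c, ∀ m : ℕ, x ∈ Metric.eball y (m : ℝ≥0∞)⁻¹ →
      μ (Metric.eball y (m : ℝ≥0∞)⁻¹) ≠ 0 ∧
        ∃ᶠ n in atTop, T^[n] x ∈ Metric.eball y (m : ℝ≥0∞)⁻¹ := by
    refine (ae_ball_iff hc).2 fun y _ => ae_all_iff.2 fun m => ?_
    by_cases h0 : μ (Metric.eball y (m : ℝ≥0∞)⁻¹) = 0
    · filter_upwards [measure_eq_zero_iff_ae_notMem.1 h0] with x hx hx'
      exact absurd hx' hx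
    · filter_upwards [hT.conservative.ae_mem_imp_frequently_image_mem
        Metric.isOpen_eball.measurableSet.nullMeasurableSet] with x hx hx'
      exact ⟨h0, hx hx'⟩
  filter_upwards [h, mem_ae_iff.2 hμ] with x hx hxK U hU
  obtain ⟨ε, hε, hεU⟩ := EMetric.mem_nhds_iff.1 hU
  obtain ⟨m, hm⟩ := ENNReal.exists_inv_nat_lt (ENNReal.half_pos hε.ne').ne'
  obtain ⟨y, hy, hxy⟩ := EMetric.mem_closure_iff.1 (hcK hxK) _
    (ENNReal.inv_pos.2 (ENNReal.natCast_ne_top m))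
  have hsub : Metric.eball y (m : ℝ≥0∞)⁻¹ ⊆ U := fun z hz => hεU <| by
    refine (edist_triangle z y x).trans_lt ?_
    rw [edist_comm y x, ← ENNReal.add_halves ε]
    exact ENNReal.add_lt_add ((Metric.mem_eball.1 hz).trans hm) (hxy.trans hm)
  obtain ⟨h1, h2⟩ := hx y hy m hxy
  exact ⟨fun h => h1 (measure_mono_null hsub h), h2.mono fun n hn => hsub hn⟩

/-- Limits of asymptotically invariant measures are carried by recurrent points. -/
lemma tendsto_lintegral_of_recurrent [T0Space S] {ι : Type*} {l : Filter ι} {Γ : ι → Measure S}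
    [∀ i, IsProbabilityMeasure (Γ i)] {K : ℕ → Set S} (hK : ∀ j, IsCompact (K j)) {e : ℕ → ℝ≥0}
    (he : Tendsto e atTop (𝓝 0)) (hΓ : ∀ i j, Γ i (K j)ᶜ ≤ (e j : ℝ≥0∞)) {T : S → S}
    (hT : Continuous T) {c : ι → ℝ≥0∞} (hc : Tendsto c l (𝓝 0)) (hinv : ∀ (f : S → ℝ≥0∞) (B : ℝ≥0),
    Measurable f → (∀ x, f x ≤ B) → ∀ i, ∫⁻ x, f (T x) ∂Γ i ≤ ∫⁻ x, f x ∂Γ i + B * c i ∧ ∫⁻ x, f x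
    ∂Γ i ≤ ∫⁻ x, f (T x) ∂Γ i + B * c i) {𝒟 : Set (S → ℝ≥0∞)} (h𝒟c : ∀ f ∈ 𝒟, Continuous f)
    (h𝒟 : ∀ f ∈ 𝒟, Tendsto (fun i => ∫⁻ x, min 1 (f x) ∂Γ i) l (𝓝 0)) {g : S → ℝ≥0∞}
    (hgc : Continuous g)
    (hg : ∀ x, (∀ f ∈ 𝒟, f x = 0) → (∀ U ∈ 𝓝 x, ∃ᶠ n in atTop, T^[n] x ∈ U) → g x = 0) :
    Tendsto (fun i => ∫⁻ x, min 1 (g x) ∂Γ i) l (𝓝 0) := by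
  let Γ' : ι → ProbabilityMeasure S := fun i => ⟨Γ i, inferInstance⟩
  refine (tendsto_iff_ultrafilter _ _ _).2 fun U hU => ?_
  obtain ⟨μ, hμ, hlim⟩ := (isCompact_setOfPred_probabilityMeasure_mass_eq_compl_isCompact_le he hK
    (Or.inl inferInstance)).ultrafilter_le_nhds (U.map Γ') (by
      rw [le_principal_iff]
      refine Filter.mem_map.2 (Filter.univ_mem' fun i j => ?_)
      rw [← coe_le_coe, ProbabilityMeasure.ennreal_coeFn_eq_coeFn_toMeasure]
      exact hΓ i j)
  have hw := ProbabilityMeasure.tendsto_iff_forall_lintegral_tendsto.1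
    (show Tendsto Γ' U (𝓝 μ) from hlim)
  have hpres : MeasurePreserving T (μ : Measure S) μ := by
    refine ⟨hT.measurable, ext_of_forall_lintegral_eq_of_IsFiniteMeasure fun f => ?_⟩
    rw [lintegral_map (by fun_prop) hT.measurable]
    have h1 := hw (f.compContinuous ⟨T, hT⟩)
    have h0 : Tendsto (fun i => (nndist f 0 : ℝ≥0∞) * c i) U (𝓝 0) := by
      have := ENNReal.Tendsto.const_mul (hc.mono_left hU)
        (Or.inr (ENNReal.coe_ne_top (r := nndist f 0)))
      rwa [mul_zero] at this
    have hb := hinv (fun x => f x) (nndist f 0) (by fun_prop) fun x => by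
      exact_mod_cast BoundedContinuousFunction.NNReal.upper_bound f x
    refine le_antisymm ?_ ?_
    · simpa using le_of_tendsto_of_tendsto' h1 ((hw f).add h0) fun i => (hb i).1
    · simpa using le_of_tendsto_of_tendsto' (hw f) (h1.add h0) fun i => (hb i).2
  have hw' : ∀ {f : S → ℝ≥0∞}, Continuous f → Tendsto (fun i => ∫⁻ x, min 1 (f x)
      ∂Γ i) U (𝓝 (∫⁻ x, min 1 (f x) ∂(μ : Measure S))) := fun hf => by
    have := hw (truncate hf)
    simp only [coe_truncate] at this
    exact this
  have hz : ∀ f ∈ 𝒟, (μ : Measure S) {x | f x ≠ 0} = 0 := fun f hf => by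
    have h1 := tendsto_nhds_unique (hw' (h𝒟c f hf)) ((h𝒟 f hf).mono_left hU)
    have := (h𝒟c f hf).measurable
    rw [lintegral_eq_zero_iff (by fun_prop)] at h1
    refine measure_mono_null (fun x hx (h2 : min 1 (f x) = 0) => hx ?_) h1
    simpa using h2
  have hσ : (μ : Measure S) (⋃ j, K j)ᶜ = 0 := by
    refine le_antisymm (ge_of_tendsto' (ENNReal.tendsto_coe.2 he) fun j => ?_) zero_le
    refine (measure_mono (Set.compl_subset_compl.2 (Set.subset_iUnion K j))).trans ?_
    rw [← ProbabilityMeasure.ennreal_coeFn_eq_coeFn_toMeasure]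
    exact_mod_cast hμ j
  have hae : ∫⁻ x, min 1 (g x) ∂(μ : Measure S) = 0 := by
    have := hgc.measurable
    rw [lintegral_eq_zero_iff (by fun_prop)]
    filter_upwards [ae_recurrent hK hσ hpres] with x hx
    have h0 : g x = 0 := hg x (fun f hf => by
      by_contra hfx
      exact (hx _ ((isOpen_ne_fun (h𝒟c f hf) continuous_const).mem_nhds hfx)).1 (hz f hf))
      fun V hV => (hx V hV).2
    simp [h0]
  simpa only [hae] using hw' hgc

variable {Ω : Type*} [MeasurableSpace Ω] {P : Measure Ω} [IsProbabilityMeasure P]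

/-- The occupation measure of the process `Φ` up to time `t`. -/
def occupation (P : Measure Ω) (Φ : ℝ≥0 → Ω → S) (t : ℝ) : Measure S :=
  (((ofReal t)⁻¹ • volume.restrict (Set.Ioc 0 t)).prod P).map fun z => Φ z.1.toNNReal z.2

lemma lintegral_occupation {Φ : ℝ≥0 → Ω → S} (hΦ : Measurable (Function.uncurry Φ)) (t : ℝ)
    {f : S → ℝ≥0∞} (hf : Measurable f) : ∫⁻ x, f x ∂occupation P Φ t = (ofReal t)⁻¹ * ∫⁻ u in
    Set.Ioc 0 t, ∫⁻ w, f (Φ u.toNNReal w) ∂P := by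
  have h : Measurable fun z : ℝ × Ω => Φ z.1.toNNReal z.2 :=
    hΦ.comp ((measurable_real_toNNReal.comp measurable_fst).prodMk measurable_snd)
  rw [occupation, lintegral_map hf h, lintegral_prod (fun z : ℝ × Ω => f (Φ z.1.toNNReal z.2)) (hf.comp h).aemeasurable,
    lintegral_smul_measure]
  rfl

lemma inv_mul_setLIntegral_le {F : ℝ → ℝ≥0∞} {t u₀ : ℝ} {a : ℝ≥0∞} (ht : 0 < t) (h1 : ∀ u, F u ≤ 1)
    (h : ∀ u, u₀ < u → F u ≤ a) : (ofReal t)⁻¹ * ∫⁻ u in Set.Ioc 0 t, F u ≤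
      (ofReal t)⁻¹ * ofReal u₀ + a := by
  have ht0 : ofReal t ≠ 0 := by simpa using ht
  calc _ ≤ (ofReal t)⁻¹ *
        ∫⁻ u in Set.Ioc 0 t, ((Set.Ioc 0 u₀).indicator 1 u + a) := by
        refine mul_le_mul_right (setLIntegral_mono' measurableSet_Ioc fun u hu => ?_) _
        by_cases hu0 : u ≤ u₀
        · rw [Set.indicator_of_mem (show u ∈ Set.Ioc 0 u₀ from ⟨hu.1, hu0⟩)]
          exact (h1 u).trans le_self_add
        · exact (h u (not_le.1 hu0)).trans le_add_self
    _ ≤ (ofReal t)⁻¹ * (ofReal u₀ + a * ofReal t) := by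
        gcongr
        rw [lintegral_add_right _ measurable_const, setLIntegral_const, Real.volume_Ioc, sub_zero]
        gcongr
        refine (setLIntegral_le_lintegral _ _).trans ?_
        rw [lintegral_indicator_one measurableSet_Ioc, Real.volume_Ioc, sub_zero]
    _ = _ := by
        rw [mul_add, mul_comm a, ← mul_assoc (ofReal t)⁻¹ (ofReal t),
          ENNReal.inv_mul_cancel ht0 ofReal_ne_top, one_mul]

lemma setLIntegral_le_add {F : ℝ → ℝ≥0∞} {B : ℝ≥0} (hB : ∀ u, F u ≤ B) {A A' : Set ℝ} {a : ℝ}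
    (h : A ⊆ A' ∪ Set.Ioc a (a + 1)) : ∫⁻ u in A, F u ≤ (∫⁻ u in A', F u) + B := by
  refine (lintegral_mono_set h).trans ((lintegral_union_le _ _ _).trans ?_)
  refine add_le_add_right ?_ _
  refine (lintegral_mono hB).trans ?_
  rw [setLIntegral_const, Real.volume_Ioc]
  simp

/-- Occupation measures of asymptotically stationary processes charge recurrent points only. -/
lemma tendsto_occupation [T0Space S] {Φ : ℕ+ → ℝ≥0 → Ω → S}
    (hΦ : ∀ n, Measurable (Function.uncurry (Φ n))) {T : S → S} (hT : Continuous T)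
    (hΦT : ∀ n u w, Φ n (u + 1) w = T (Φ n u w)) {K : ℕ → Set S} (hK : ∀ j, IsCompact (K j))
    {e : ℕ → ℝ≥0} (he : Tendsto e atTop (𝓝 0)) (hP : ∀ n u j, P {w | Φ n u w ∉ K j} ≤ e j)
    {𝒟 : Set (S → ℝ≥0∞)} (h𝒟c : ∀ f ∈ 𝒟, Continuous f) (h𝒟 : ∀ f ∈ 𝒟, ∀ ε : ℝ≥0∞, 0 < ε → ∃ (u₀ :
    ℝ≥0) (n₀ : ℕ+), ∀ u ≥ u₀, ∀ n ≥ n₀, ∫⁻ w, min 1 (f (Φ n u w)) ∂P ≤ ε) {g : S → ℝ≥0∞}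
    (hgc : Continuous g)
    (hg : ∀ x, (∀ f ∈ 𝒟, f x = 0) → (∀ U ∈ 𝓝 x, ∃ᶠ n in atTop, T^[n] x ∈ U) → g x = 0) :
    Tendsto (fun z : ℝ × ℕ+ => (ofReal z.1)⁻¹ * ∫⁻ u in Set.Ioc 0 z.1,
      ∫⁻ w, min 1 (g (Φ z.2 u.toNNReal w)) ∂P) (atTop ×ˢ atTop) (𝓝 0) := by
  have hm : ∀ n (t : ℝ), Measurable fun z : ℝ × Ω => Φ n z.1.toNNReal z.2 := fun n t =>
    (hΦ n).comp ((measurable_real_toNNReal.comp measurable_fst).prodMk measurable_snd)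
  set τ : ℝ × ℕ+ → ℝ := fun z => max z.1 1 with hτ
  have hτ0 : ∀ z, 0 < τ z := fun z => lt_max_of_lt_right one_pos
  have hprob : ∀ z, IsProbabilityMeasure (occupation P (Φ z.2) (τ z)) := fun z => ⟨by
    have h := lintegral_occupation (P := P) (hΦ z.2) (τ z) (f := fun _ => 1) measurable_const
    have h0 : ofReal (τ z) ≠ 0 := by simpa using hτ0 z
    simpa [ENNReal.inv_mul_cancel h0] using h⟩
  have hlimτ : Tendsto τ (atTop ×ˢ atTop) atTop :=
    tendsto_atTop_mono (fun z => le_max_left _ _) tendsto_fst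
  have hinvτ : Tendsto (fun z => (ofReal (τ z))⁻¹) (atTop ×ˢ atTop) (𝓝 0) := by
    simpa using (ENNReal.tendsto_ofReal_atTop.comp hlimτ).inv
  have hone : ∀ {f : S → ℝ≥0∞} {n} {u : ℝ≥0}, ∫⁻ w, min 1 (f (Φ n u w)) ∂P ≤ 1 := fun {f n u} =>
    (lintegral_mono fun w => min_le_left _ _).trans (by simp)
  have key := tendsto_lintegral_of_recurrent (l := (atTop ×ˢ atTop : Filter (ℝ × ℕ+)))
    (Γ := fun z => occupation P (Φ z.2) (τ z)) hK he (fun z j => ?_) hT hinvτ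
    (fun f B hf hB z => ?_) h𝒟c (fun f hf => ?_) hgc hg
  · refine key.congr' ?_
    filter_upwards [tendsto_fst.eventually (eventually_ge_atTop (1 : ℝ))] with z hz
    have h1 : τ z = z.1 := max_eq_left hz
    have := hgc.measurable
    rw [lintegral_occupation (hΦ z.2) _ (by fun_prop), h1]
  · rw [← lintegral_indicator_one (hK j).measurableSet.compl,
      lintegral_occupation (hΦ z.2) _ (measurable_one.indicator (hK j).measurableSet.compl)]
    have h1 : ∀ u : ℝ, ∫⁻ w, (K j)ᶜ.indicator 1 (Φ z.2 u.toNNReal w) ∂P =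
        P {w | Φ z.2 u.toNNReal w ∉ K j} := fun u =>
      lintegral_indicator_one (((hΦ z.2).comp measurable_prodMk_left) (hK j).measurableSet.compl)
    simp_rw [h1]
    simpa using inv_mul_setLIntegral_le (u₀ := 0) (hτ0 z) (fun u => prob_le_one)
      fun u _ => hP z.2 u.toNNReal j
  · rw [lintegral_occupation (hΦ z.2) _ hf,
      lintegral_occupation (f := fun x => f (T x)) (hΦ z.2) _ (hf.comp hT.measurable),
      mul_comm (B : ℝ≥0∞), ← mul_add, ← mul_add]
    set F : ℝ → ℝ≥0∞ := fun u => ∫⁻ w, f (Φ z.2 u.toNNReal w) ∂P with hF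
    have hFm : Measurable F := (hf.comp (hm z.2 0)).lintegral_prod_right'
    have hFB : ∀ u, F u ≤ B := fun u => (lintegral_mono fun w => hB _).trans (by simp)
    have h1 : ∫⁻ u in Set.Ioc 0 (τ z), ∫⁻ w, f (T (Φ z.2 u.toNNReal w)) ∂P =
        ∫⁻ u in Set.Ioc 1 (τ z + 1), F u := by
      rw [← (measurePreserving_add_right volume (1 : ℝ)).setLIntegral_comp_preimage
        measurableSet_Ioc hFm, Set.preimage_add_const_Ioc, sub_self, add_sub_cancel_right]
      refine setLIntegral_congr_fun measurableSet_Ioc fun u hu => ?_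
      simp only [hF, Real.toNNReal_add hu.1.le zero_le_one, Real.toNNReal_one, hΦT]
    have h2 := (hτ0 z).le
    constructor
    · gcongr
      rw [h1]
      exact setLIntegral_le_add hFB (a := τ z) fun u hu => by
        rcases le_or_gt u (τ z) with h | h
        · exact Or.inl ⟨by linarith [hu.1], h⟩
        · exact Or.inr ⟨h, hu.2⟩
    · gcongr
      rw [h1]
      exact setLIntegral_le_add hFB (a := 0) fun u hu => by
        rcases le_or_gt u 1 with h | h
        · exact Or.inr ⟨hu.1, by linarith⟩
        · exact Or.inl ⟨h, by linarith [hu.2]⟩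
  · refine tendsto_nhds_zero.2 fun ε hε => ?_
    obtain ⟨u₀, n₀, h⟩ := h𝒟 f hf (ε / 2) (ENNReal.half_pos hε.ne')
    have h0 : Tendsto (fun z => (ofReal (τ z))⁻¹ * ofReal u₀) (atTop ×ˢ atTop)
        (𝓝 0) := by
      simpa using ENNReal.Tendsto.mul_const hinvτ (Or.inr (ENNReal.coe_ne_top (r := u₀)))
    filter_upwards [tendsto_nhds_zero.1 h0 _ (ENNReal.half_pos hε.ne'),
      tendsto_snd.eventually (eventually_ge_atTop n₀)] with z hz hn
    have := (h𝒟c f hf).measurable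
    rw [lintegral_occupation (hΦ z.2) _ (by fun_prop)]
    refine (inv_mul_setLIntegral_le (hτ0 z) (fun u => hone) fun u hu => h _ ?_ _ hn).trans
      ((add_le_add_left hz _).trans (ENNReal.add_halves ε).le)
    exact NNReal.le_toNNReal_of_coe_le hu.le

end Recurrence

section MeanField

lemma trace_transpose_mul_mul {d d' : ℕ} (S : Matrix (Fin d) (Fin d') ℝ)
    (A : Matrix (Fin d) (Fin d) ℝ) :
    Matrix.trace (S.transpose * A * S) = ∑ z : Fin d × Fin d, A z.1 z.2 * (S * S.transpose) z.1 z.2 := by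
  simp only [Matrix.trace, Matrix.diag_apply, Matrix.mul_apply, Matrix.transpose_apply,
    Fintype.sum_prod_type, sum_mul, mul_sum]
  rw [sum_comm]
  simp_rw [sum_comm (s := (univ : Finset (Fin d')))]
  rw [sum_comm]
  refine sum_congr rfl fun a _ => sum_congr rfl fun c _ =>
    sum_congr rfl fun j _ => ?_
  ring

variable {d : ℕ} {φ : State d → ℝ}

lemma remainder_le {u v C ε γ δ : ℝ} (hu : 0 ≤ u) (hv : 0 ≤ v) (hC0 : 0 ≤ C) (hε : 0 ≤ ε)
    (hγ0 : 0 ≤ γ) (hγδ : γ ≤ δ) (hδ : δ ≤ 1) :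
    C * ((γ * u) ^ 2 + γ * u * (√(2 * γ) * v) + (√(2 * γ) * v) ^ 4) + ε / 2 * (√(2 * γ) * v) ^ 2 ≤
      γ * (C * √δ * (2 * u ^ 2 + 1 + 5 * v ^ 4) + ε * (1 + v ^ 4)) := by
  have hδ0 := hγ0.trans hγδ
  have hs : √(2 * γ) * √(2 * γ) = 2 * γ := Real.mul_self_sqrt (by positivity)
  have hv2 : v ^ 2 ≤ 1 + v ^ 4 := by nlinarith [sq_nonneg (v ^ 2 - 1)]
  have hr0 : 0 ≤ √δ := sqrt_nonneg δ
  have hδs : δ ≤ √δ := by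
    rw [Real.le_sqrt hδ0 hδ0]
    nlinarith
  have hγs : γ ≤ √δ := hγδ.trans hδs
  have h4 : √(2 * γ) * (u * v) ≤ √δ * (u ^ 2 + v ^ 2) := by
    have h5 : √(2 * γ) ≤ 2 * √δ := by
      rw [show (2 : ℝ) * √δ = √(4 * δ) by
        rw [sqrt_mul (by norm_num), show (4 : ℝ) = 2 ^ 2 by norm_num,
          Real.sqrt_sq (by norm_num)]]
      exact Real.sqrt_le_sqrt (by linarith)
    calc √(2 * γ) * (u * v) ≤ 2 * √δ * (u * v) := by gcongr
      _ ≤ √δ * (u ^ 2 + v ^ 2) := by nlinarith [mul_nonneg hr0 (sq_nonneg (u - v))]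
  have h6 : (√(2 * γ)) ^ 4 = 4 * γ ^ 2 := by
    rw [show (√(2 * γ)) ^ 4 = (√(2 * γ) * √(2 * γ)) ^ 2 by ring, hs]
    ring
  have h7 : (√(2 * γ)) ^ 2 = 2 * γ := by rw [sq, hs]
  rw [mul_pow, mul_pow, h6, mul_pow, h7]
  have h8 : γ * u ^ 2 ≤ √δ * u ^ 2 := by gcongr
  have h9 : γ * v ^ 4 ≤ √δ * v ^ 4 := by gcongr
  have h10 : γ * u ^ 2 + √(2 * γ) * (u * v) + 4 * (γ * v ^ 4) ≤
      √δ * (2 * u ^ 2 + 1 + 5 * v ^ 4) := by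
    nlinarith [mul_le_mul_of_nonneg_left hv2 hr0]
  have h11 : C * γ * (γ * u ^ 2 + √(2 * γ) * (u * v) + 4 * (γ * v ^ 4)) ≤
      C * γ * (√δ * (2 * u ^ 2 + 1 + 5 * v ^ 4)) := by gcongr
  have h12 : ε * γ * v ^ 2 ≤ ε * γ * (1 + v ^ 4) := by gcongr
  calc _ = C * γ * (γ * u ^ 2 + √(2 * γ) * (u * v) + 4 * (γ * v ^ 4)) + ε * γ * v ^ 2 := by ring
    _ ≤ _ := add_le_add h11 h12
    _ = _ := by ring

/-- One step of the discrete Itô formula. -/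
lemma exists_ito_step_le {d' : ℕ} (hφ : ContDiff ℝ 2 φ) (hφc : HasCompactSupport φ) {ε : ℝ}
    (hε : 0 < ε) : ∃ C : ℝ, 0 ≤ C ∧ ∀ (x b ζ ξ : State d) (S : Matrix (Fin d) (Fin d') ℝ)
    (E : Fin d → ℝ) (γ δ : ℝ), 0 ≤ γ → γ ≤ δ → δ ≤ 1 → |φ (x + (γ • (b + ζ) + √(2 * γ) • ξ)) - φ x -
    γ * (inner ℝ b (gradient φ x) + Matrix.trace (S.transpose * hessianMatrix φ x * S)) - √(2 * γ) *
    ∑ a, gradient φ x a * ξ a - γ * ∑ a, gradient φ x a * (ζ a - E a) - γ * ∑ z : Fin d × Fin d,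
    hessianMatrix φ x z.1 z.2 * (ξ z.1 * ξ z.2 - (S * S.transpose) z.1 z.2)| ≤ γ *
    (∑ a, ‖gradient φ x‖ * |E a| + C * √δ * (2 * ‖b + ζ‖ ^ 2 + 1 + 5 * ‖ξ‖ ^ 4) + ε * (1 + ‖ξ‖ ^ 4))
    := by
  obtain ⟨C, hC0, hC⟩ := exists_taylor_le hφ hφc (half_pos hε)
  refine ⟨C, hC0, fun x b ζ ξ S E γ δ hγ0 hγδ hδ => ?_⟩
  have hδ0 := hγ0.trans hγδ
  set g := gradient φ x
  set H := hessianMatrix φ x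
  have hin : ∀ v : State d, (inner ℝ g v : ℝ) = ∑ a, g a * v a := fun v => by
    simp [PiLp.inner_apply, mul_comm]
  have h1 := hC x (√(2 * γ) • ξ) (γ • (b + ζ))
  have hs : √(2 * γ) * √(2 * γ) = 2 * γ := Real.mul_self_sqrt (by positivity)
  have e1 : (∑ i, ∑ j, (√(2 * γ) • ξ) i * (√(2 * γ) • ξ) j * H i j) / 2 =
      γ * ∑ z : Fin d × Fin d, H z.1 z.2 * (ξ z.1 * ξ z.2) := by
    rw [Fintype.sum_prod_type, mul_sum, sum_div]
    refine sum_congr rfl fun i _ => ?_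
    rw [mul_sum, sum_div]
    refine sum_congr rfl fun j _ => ?_
    simp only [PiLp.smul_apply, smul_eq_mul]
    linear_combination ξ i * ξ j * H i j / 2 * hs
  have e2 : (inner ℝ g (γ • (b + ζ)) : ℝ) = γ * inner ℝ b g + γ * ∑ a, g a * ζ a := by
    rw [inner_smul_right, inner_add_right, hin ζ, real_inner_comm]
    ring
  have e3 : (inner ℝ g (√(2 * γ) • ξ) : ℝ) = √(2 * γ) * ∑ a, g a * ξ a := by
    rw [inner_smul_right, hin ξ]
  rw [e1, e2, e3] at h1
  have e4 : ∑ a, g a * (ζ a - E a) = ∑ a, g a * ζ a - ∑ a, g a * E a := by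
    rw [← sum_sub_distrib]
    exact sum_congr rfl fun a _ => by ring
  have e5 : ∑ z : Fin d × Fin d, H z.1 z.2 * (ξ z.1 * ξ z.2 - (S * S.transpose) z.1 z.2) =
      ∑ z : Fin d × Fin d, H z.1 z.2 * (ξ z.1 * ξ z.2) -
        Matrix.trace (S.transpose * H * S) := by
    rw [trace_transpose_mul_mul, ← sum_sub_distrib]
    exact sum_congr rfl fun a _ => by ring
  rw [e4, e5]
  have h2 : |∑ a, g a * E a| ≤ ∑ a, ‖g‖ * |E a| := by
    refine (abs_sum_le_sum_abs _ _).trans (sum_le_sum fun a _ => ?_)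
    rw [abs_mul]
    exact mul_le_mul_of_nonneg_right (abs_coord_le g a) (abs_nonneg _)
  have h3 : C * (‖γ • (b + ζ)‖ ^ 2 + ‖γ • (b + ζ)‖ * ‖√(2 * γ) • ξ‖ + ‖√(2 * γ) • ξ‖ ^ 4) +
      ε / 2 * ‖√(2 * γ) • ξ‖ ^ 2 ≤
      γ * (C * √δ * (2 * ‖b + ζ‖ ^ 2 + 1 + 5 * ‖ξ‖ ^ 4) + ε * (1 + ‖ξ‖ ^ 4)) := by
    rw [norm_smul, norm_smul, norm_eq_abs, norm_eq_abs, abs_of_nonneg hγ0,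
      abs_of_nonneg (sqrt_nonneg _)]
    exact remainder_le (norm_nonneg _) (norm_nonneg _) hC0 hε.le hγ0 hγδ hδ
  have h4 : γ * |∑ a, g a * E a| ≤ γ * ∑ a, ‖g‖ * |E a| := by gcongr
  have h5 : |γ * ∑ a, g a * E a| = γ * |∑ a, g a * E a| := by rw [abs_mul, abs_of_nonneg hγ0]
  have h6 := abs_le.1 (h5.le.trans h4)
  have h7 := abs_le.1 (h1.trans h3)
  have h8 := mul_add γ (∑ a, ‖g‖ * |E a|)
    (C * √δ * (2 * ‖b + ζ‖ ^ 2 + 1 + 5 * ‖ξ‖ ^ 4) + ε * (1 + ‖ξ‖ ^ 4))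
  rw [← add_assoc] at h8
  rw [abs_le, h8]
  constructor <;> linarith [h6.1, h6.2, h7.1, h7.2]

variable {p : ℝ} [hp : Fact (1 ≤ p)] {d' : ℕ} {Ω : Type*} [mΩ : MeasurableSpace Ω]
  {P : Measure Ω} [IsProbabilityMeasure P] {b : Drift p d} {σ : Diffusion p d d'} {γ : ℕ → ℝ}
  {X ξ ζ : Particles Ω d} {F : ℕ+ → Filtration ℕ mΩ} {q : ℕ} {C M : ℝ} {η : ℕ → ℕ+ → ℝ}

lemma SymmetrizedSystem.mean_integral_drift_le (h : SymmetrizedSystem P b σ γ X ξ ζ F q C η)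
    (hcoef : CoefficientAssumption b σ) (hq : q = 2 ∨ q = 4) {M : ℝ}
    (hM : ∀ n k, mean (fun i => ∫ w, ‖X n k i w‖ ^ q ∂P) ≤ M) :
    ∃ A : ℝ, 0 ≤ A ∧ ∀ n k, mean (fun i => ∫ w,
      ‖b (X n k i w) (empirical fun j => X n k j w)‖ ^ q ∂P) ≤ A := by
  obtain ⟨Cb, hCb, hb⟩ := hcoef.bound
  have hq4 : q ≤ 4 := by omega
  have key : ∃ D : ℝ, 0 ≤ D ∧ ∀ (n : ℕ+) (x : Fin n → State d),
      mean (fun i => ‖b (x i) (empirical x)‖ ^ q) ≤ D * (1 + 2 * mean fun i => ‖x i‖ ^ q) := by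
    rcases hq with rfl | rfl
    · exact ⟨3 * Cb ^ 2, by positivity, fun n x => mean_norm_drift_sq_le (fun x μ => (hb x μ).1) x⟩
    · exact ⟨27 * Cb ^ 4, by positivity,
        fun n x => mean_norm_drift_pow_four_le (fun x μ => (hb x μ).1) x⟩
  obtain ⟨D, hD, hkey⟩ := key
  have hM0 : 0 ≤ M := (mean_nonneg fun i => integral_nonneg fun _ => by positivity).trans (hM 1 0)
  refine ⟨D * (1 + 2 * M), by positivity, fun n k => ?_⟩
  have i1 : ∀ i, Integrable (fun w => ‖X n k i w‖ ^ q) P := fun i =>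
    (h.memLp_X hcoef hq4 n k i).integrable_norm_pow'
  have i2 : ∀ i, Integrable (fun w => ‖b (X n k i w) (empirical fun j => X n k j w)‖ ^ q) P :=
    fun i => (memLp_drift hcoef (h.memLp_X hcoef hq4 n k) (h.measurable_X' n k) i).integrable_norm_pow'
  have i3 : Integrable (fun w => 2 * mean fun i => ‖X n k i w‖ ^ q) P :=
    (integrable_mean i1).const_mul 2
  have i4 : Integrable (fun w => 1 + 2 * mean fun i => ‖X n k i w‖ ^ q) P :=
    (integrable_const (1 : ℝ)).add i3
  rw [← integral_mean i2]
  refine (integral_mono (integrable_mean i2) (i4.const_mul D) fun w => hkey n _).trans ?_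
  rw [integral_const_mul, integral_add (integrable_const (1 : ℝ)) i3, integral_const_mul,
    integral_mean i1, integral_const]
  have := hM n k
  simp only [probReal_univ, smul_eq_mul, mul_one]
  gcongr

/-- The drift of the particles, including the perturbation. -/
def particleDrift (b : Drift p d)
    (X ζ : Particles Ω d) (n : ℕ+) (k : ℕ) (i : Fin n) (w : Ω) : State d :=
  b (X n k i w) (empirical fun j => X n k j w) + ζ n (k + 1) i w

lemma SymmetrizedSystem.exists_stepDynamics (h : SymmetrizedSystem P b σ γ X ξ ζ F q C η)
    (hC : 0 ≤ C) (hcoef : CoefficientAssumption b σ) (hq : q = 2 ∨ q = 4)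
    (hM : ∃ M, ∀ n k, mean (fun i => ∫ w, ‖X n k i w‖ ^ q ∂P) ≤ M) :
    ∃ M : ℝ, 0 ≤ M ∧ ∀ n, StepDynamics P γ (X n) (particleDrift b X ζ n)
      (fun k => ξ n (k + 1)) (F n) q M := by
  obtain ⟨M, hM⟩ := hM
  have hq4 : q ≤ 4 := by omega
  have hM0 : 0 ≤ M := (mean_nonneg fun i => integral_nonneg fun _ => by positivity).trans (hM 1 0)
  obtain ⟨A, hA0, hA⟩ := h.mean_integral_drift_le hcoef hq hM
  have hb := fun n k i => memLp_drift hcoef (h.memLp_X hcoef hq4 n k) (h.measurable_X' n k) i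
  have hβ : ∀ n k i, MemLp (particleDrift b X ζ n k i) q P := fun n k i =>
    (hb n k i).add (h.memLp_ζ n k i)
  refine ⟨M + C + 2 ^ q * (A + C), by positivity, fun n => ⟨fun k i w => ?_, h.measurable_X' n,
    h.measurable_ξ n, h.memLp_X hcoef hq4 n, hβ n, h.memLp_ξ n, fun k => ?_, fun k => ?_,
    fun k i => ?_, h.condExp_ξ n⟩⟩
  · rw [h.step, particleDrift, smul_add]
    abel
  · have : 0 ≤ 2 ^ q * (A + C) := by positivity
    linarith [hM n k]
  · have i1 := fun i => (hb n k i).integrable_norm_pow'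
    have i2 := fun i => (h.memLp_ζ n k i).integrable_norm_pow'
    have h1 : ∀ i, ∫ w, ‖particleDrift b X ζ n k i w‖ ^ q ∂P ≤
        2 ^ q * (∫ w, ‖b (X n k i w) (empirical fun j => X n k j w)‖ ^ q ∂P + C) := by
      intro i
      refine (integral_mono (hβ n k i).integrable_norm_pow' (((i1 i).add (i2 i)).const_mul (2 ^ q))
        fun w => ?_).trans ?_
      · have e1 := norm_add_le (b (X n k i w) (empirical fun j => X n k j w)) (ζ n (k + 1) i w)
        calc ‖particleDrift b X ζ n k i w‖ ^ q ≤
            (‖b (X n k i w) (empirical fun j => X n k j w)‖ + ‖ζ n (k + 1) i w‖) ^ q := by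
              rw [particleDrift]
              gcongr
          _ ≤ _ := (add_pow_le (norm_nonneg _) (norm_nonneg _) q).trans
              (mul_le_mul_of_nonneg_right (pow_le_pow_right₀ (by norm_num) (Nat.sub_le q 1))
                (by positivity))
      · simp only [Pi.add_apply]
        rw [integral_const_mul, integral_add (i1 i) (i2 i)]
        gcongr
        exact h.integral_ζ n k i
    refine (mean_mono h1).trans ?_
    rw [mean_const_mul, mean_add, mean_const]
    have h2 : 2 ^ q * (mean (fun i => ∫ w,
        ‖b (X n k i w) (empirical fun j => X n k j w)‖ ^ q ∂P) + C) ≤ 2 ^ q * (A + C) := by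
      gcongr
      exact hA n k
    linarith
  · have : 0 ≤ 2 ^ q * (A + C) := by positivity
    linarith [h.integral_ξ n k i]

/-- Centered versions of square integrable variables. -/
lemma integral_abs_centered_le {F : Filtration ℕ mΩ} {n : ℕ+} {ι : Type*} [Fintype ι]
    {c f : ℕ → Fin n → ι → Ω → ℝ} {G : ℝ} {r : ℕ → ℝ} {B S : ℝ}
    (hc : ∀ k i j, Measurable[F k] (c k i j)) (hcG : ∀ k i j w, |c k i j w| ≤ G)
    (hfm : ∀ k i j, Measurable[F (k + 1)] (f k i j)) (hf : ∀ k i j, MemLp (f k i j) 2 P)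
    (hB : ∀ k i j, ∫ w, f k i j w ^ 2 ∂P ≤ B) (K : ℕ) (hS : ∑ k ∈ range K, r k ^ 2 ≤ S) :
    Integrable (fun w => ∑ k ∈ range K, r k * mean fun i => ∑ j, c k i j w *
      (f k i j w - (P[f k i j | F k]) w)) P ∧
    ∫ w, |∑ k ∈ range K, r k * mean fun i => ∑ j, c k i j w *
      (f k i j w - (P[f k i j | F k]) w)| ∂P ≤ √(S * (Fintype.card ι ^ 2 * G ^ 2 * B)) := by
  have h1 := fun k i j => integral_sq_sub_condExp_le (P := P) (F.le k) (hf k i j)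
  refine integral_abs_martingaleTransform_le (F := F) (y := fun k i j w =>
    f k i j w - (P[f k i j | F k]) w) hc hcG (fun k i j => ?_) (fun k i j => (h1 k i j).1)
    (fun k i j => (h1 k i j).2.1) (fun k => ?_) K hS
  · have : Measurable[F k] (P[f k i j | F k]) := stronglyMeasurable_condExp.measurable
    exact (hfm k i j).sub (this.mono (F.mono k.le_succ) le_rfl)
  · exact integral_sq_mean_sum_le (fun i j => (hc k i j).mono (F.le k) le_rfl) (hcG k)
      (fun i j => (h1 k i j).1) fun i j => (h1 k i j).2.2.trans (hB k i j)

/-- The error made when `φ` is replaced by its generator along one step. -/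
def itoTerm (b : Drift p d) (σ : Diffusion p d d') (γ : ℕ → ℝ)
    (X : Particles Ω d) (φ : State d → ℝ) (n : ℕ+) (k : ℕ) (i : Fin n) (w : Ω) : ℝ :=
  φ (X n (k + 1) i w) - φ (X n k i w) -
    γ (k + 1) * generator b σ (empirical fun j => X n k j w) φ (X n k i w)

lemma integral_coord_sq_le {f : Ω → State d} (hq : 2 ≤ q) (hf : MemLp f q P)
    (hC : ∫ w, ‖f w‖ ^ q ∂P ≤ C) (a : Fin d) : ∫ w, f w a ^ 2 ∂P ≤ 1 + C := by
  have h3 : MemLp f 2 P := hf.mono_exponent (by exact_mod_cast hq)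
  refine le_trans (integral_mono (memLp_coord h3 a).integrable_sq (integrable_norm_sq h3)
    fun w => ?_) ((integral_sq_le_one_add hq hf).trans (by linarith))
  exact sq_le_sq.2 ((abs_coord_le (f w) a).trans (le_abs_self _))

lemma SymmetrizedSystem.memLp_ξ_mul (h : SymmetrizedSystem P b σ γ X ξ ζ F q C η)
    (n : ℕ+) (k : ℕ) (i : Fin n) (z : Fin d × Fin d) :
    MemLp (fun w => ξ n (k + 1) i w z.1 * ξ n (k + 1) i w z.2) 2 P ∧
      ∫ w, (ξ n (k + 1) i w z.1 * ξ n (k + 1) i w z.2) ^ 2 ∂P ≤ C := by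
  have hpt : ∀ w, (ξ n (k + 1) i w z.1 * ξ n (k + 1) i w z.2) ^ 2 ≤ ‖ξ n (k + 1) i w‖ ^ 4 := by
    intro w
    have h1 := abs_coord_le (ξ n (k + 1) i w) z.1
    have h2 := abs_coord_le (ξ n (k + 1) i w) z.2
    rw [← sq_abs, abs_mul]
    calc (|ξ n (k + 1) i w z.1| * |ξ n (k + 1) i w z.2|) ^ 2 ≤
        (‖ξ n (k + 1) i w‖ * ‖ξ n (k + 1) i w‖) ^ 2 := by gcongr
      _ = _ := by ring
  have hm : ∀ a, AEStronglyMeasurable (fun w => ξ n (k + 1) i w a) P := fun a =>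
    (memLp_coord (h.memLp_ξ n k i) a).1
  have i1 : Integrable (fun w => (ξ n (k + 1) i w z.1 * ξ n (k + 1) i w z.2) ^ 2) P := by
    refine (integrable_norm_pow_four (h.memLp_ξ n k i)).mono'
      (((hm z.1).mul (hm z.2)).pow 2) (ae_of_all _ fun w => ?_)
    rw [norm_eq_abs, abs_of_nonneg (sq_nonneg _)]
    exact hpt w
  exact ⟨(memLp_two_iff_integrable_sq ((hm z.1).mul (hm z.2))).2 i1,
    (integral_mono i1 (integrable_norm_pow_four (h.memLp_ξ n k i)) hpt).trans (h.integral_ξ n k i)⟩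

lemma measurable_coord_comp {m : MeasurableSpace Ω} {V : Type*} [MeasurableSpace V]
    {f : V → ℝ} (hf : Measurable f) {Z : Ω → ℝ} {x : Ω → V} (hZ : Measurable[m] Z)
    (hx : Measurable[m] x) : Measurable[m] fun w => Z w * f (x w) :=
  hZ.mul (hf.comp hx)

lemma mean_sum_comm {n : ℕ+} {ι : Type*} (s : Finset ι) (f : Fin n → ι → ℝ) :
    mean (fun i => ∑ k ∈ s, f i k) = ∑ k ∈ s, mean fun i => f i k := by
  unfold mean
  rw [sum_comm, mul_sum]

lemma abs_sum_le_of_abs_sub_le {α a₁ a₂ a₃ D : ℕ → ℝ} (h : ∀ k, |α k - a₁ k - a₂ k - a₃ k| ≤ D k)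
    (K : ℕ) : |∑ k ∈ range K, α k| ≤ |∑ k ∈ range K, a₁ k| + |∑ k ∈ range K, a₂ k| +
      |∑ k ∈ range K, a₃ k| + ∑ k ∈ range K, D k := by
  have e : ∑ k ∈ range K, α k = ∑ k ∈ range K, a₁ k + ∑ k ∈ range K, a₂ k +
      ∑ k ∈ range K, a₃ k + ∑ k ∈ range K, (α k - a₁ k - a₂ k - a₃ k) := by
    simp only [sum_sub_distrib]
    ring
  rw [e]
  refine (abs_add_le _ _).trans (add_le_add ((abs_add_le _ _).trans (add_le_add (abs_add_le _ _) le_rfl))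
    ((abs_sum_le_sum_abs _ _).trans (sum_le_sum fun k _ => h k)))

lemma integral_add_four_le {f₁ f₂ f₃ f₄ : Ω → ℝ} (h₁ : Integrable f₁ P) (h₂ : Integrable f₂ P)
    (h₃ : Integrable f₃ P) (h₄ : Integrable f₄ P) :
    Integrable (fun w => |f₁ w| + |f₂ w| + |f₃ w| + f₄ w) P ∧
    ∫ w, (|f₁ w| + |f₂ w| + |f₃ w| + f₄ w) ∂P =
      ∫ w, |f₁ w| ∂P + ∫ w, |f₂ w| ∂P + ∫ w, |f₃ w| ∂P + ∫ w, f₄ w ∂P := by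
  have q1 : Integrable (fun w => |f₁ w| + |f₂ w|) P := h₁.abs.add h₂.abs
  have q2 : Integrable (fun w => |f₁ w| + |f₂ w| + |f₃ w|) P := q1.add h₃.abs
  exact ⟨q2.add h₄, by
    rw [integral_add q2 h₄, integral_add q1 h₃.abs, integral_add h₁.abs h₂.abs]⟩

lemma exists_norm_gradient_le' (hφ : ContDiff ℝ 2 φ) (hφc : HasCompactSupport φ) :
    ∃ G : ℝ, 0 ≤ G ∧ ∀ x, ‖gradient φ x‖ ≤ G := by
  obtain ⟨G, hG0, hG⟩ := exists_norm_gradient_le hφ hφc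
  exact ⟨G, hG0, fun x => le_trans (le_mul_of_one_le_left (norm_nonneg _)
    (by linarith [norm_nonneg x])) (hG x)⟩

variable {t : ℕ} {n : ℕ+} {Z : Fin n → Ω → ℝ}

/-- The contribution of the first order martingale term is small by averaging over particles. -/
lemma SymmetrizedSystem.integral_abs_first_order_le (h : SymmetrizedSystem P b σ γ X ξ ζ F q C η)
    (hγ : StepAssumption γ) (hφ : ContDiff ℝ 2 φ) {G : ℝ} (hG : ∀ x, ‖gradient φ x‖ ≤ G)
    (hZ : ∀ i, Measurable[F n t] (Z i)) (hZ1 : ∀ i w, |Z i w| ≤ 1) {K : ℕ} {T : ℝ}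
    (hT : ∑ k ∈ range K, γ (t + k + 1) ≤ T) :
    Integrable (fun w => ∑ k ∈ range K, √(2 * γ (t + k + 1)) * mean fun i => ∑ a,
      Z i w * gradient φ (X n (t + k) i w) a * ξ n (t + k + 1) i w a) P ∧
    ∫ w, |∑ k ∈ range K, √(2 * γ (t + k + 1)) * mean fun i => ∑ a,
      Z i w * gradient φ (X n (t + k) i w) a * ξ n (t + k + 1) i w a| ∂P ≤
      √(2 * T * (d ^ 2 * G ^ 2 * (1 + C) / (n : ℕ))) := by
  have hg : ∀ a, Measurable fun x => gradient φ x a := fun a => by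
    have := (continuous_gradient hφ).measurable
    exact (by fun_prop : Measurable fun v : State d => v a).comp this
  have hc : ∀ k i a, Measurable[F n (t + k)] fun w =>
      Z i w * gradient φ (X n (t + k) i w) a := fun k i a =>
    measurable_coord_comp (hg a) ((hZ i).mono ((F n).mono (Nat.le_add_right _ _)) le_rfl)
      (h.measurable_X n _ i)
  have hcG : ∀ k i a w, |Z i w * gradient φ (X n (t + k) i w) a| ≤ G := fun k i a w => by
    rw [abs_mul]
    exact (mul_le_of_le_one_left (abs_nonneg _) (hZ1 i w)).trans
      ((abs_coord_le _ a).trans (hG _))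
  have hy : ∀ k i a, MemLp (fun w => ξ n (t + k + 1) i w a) 2 P := fun k i a =>
    memLp_coord ((h.memLp_ξ n (t + k) i).mono_exponent (by norm_num)) a
  have hcm := fun k i a => (hc k i a).mono ((F n).le _) le_rfl
  refine integral_abs_martingaleTransform_le (F := shiftFiltration (F n) t)
    (c := fun k i a w => Z i w * gradient φ (X n (t + k) i w) a)
    (y := fun k i a w => ξ n (t + k + 1) i w a) hc hcG (fun k i a => ?_) hy
    (fun k i a => h.condExp_ξ n (t + k) i a) (fun k => ?_) K ?_
  · exact (by fun_prop : Measurable fun v : State d => v a).comp (h.measurable_ξ n (t + k) i)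
  · have := integral_sq_mean_sum_le_div (hcm k) (hcG k) (hy k)
      (fun i a => integral_coord_sq_le (q := 4) (by norm_num)
        (by exact_mod_cast h.memLp_ξ n (t + k) i) (h.integral_ξ n (t + k) i) a) (fun i i' hne => ?_)
    · rwa [Fintype.card_fin] at this
    · simp_rw [Finset.sum_mul_sum]
      have hi : ∀ a a', Integrable (fun w => Z i w * gradient φ (X n (t + k) i w) a *
          ξ n (t + k + 1) i w a * (Z i' w * gradient φ (X n (t + k) i' w) a' *
          ξ n (t + k + 1) i' w a')) P := fun a a' =>
        (memLp_mul_bounded (hcm k i a) (hcG k i a) (hy k i a)).integrable_mul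
          (memLp_mul_bounded (hcm k i' a') (hcG k i' a') (hy k i' a'))
      rw [integral_finsetSum _ fun a _ => integrable_finsetSum _ fun a' _ => hi a a']
      refine sum_eq_zero fun a _ => ?_
      rw [integral_finsetSum _ fun a' _ => hi a a']
      refine sum_eq_zero fun a' _ => ?_
      have e : ∀ w, Z i w * gradient φ (X n (t + k) i w) a *
          ξ n (t + k + 1) i w a * (Z i' w * gradient φ (X n (t + k) i' w) a' *
          ξ n (t + k + 1) i' w a') = (Z i w * gradient φ (X n (t + k) i w) a) *
          (Z i' w * gradient φ (X n (t + k) i' w) a') *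
          (ξ n (t + k + 1) i w a * ξ n (t + k + 1) i' w a') := fun w => by ring
      have hi' := hi a a'
      simp_rw [e] at hi' ⊢
      refine integral_mul_eq_zero_of_condExp ((F n).le (t + k))
        ((hc k i a).mul (hc k i' a')).stronglyMeasurable
        ((hy k i a).integrable_mul (hy k i' a')) hi' ?_
      filter_upwards [h.condCov_ξ n (t + k) i i' a a'] with w e1
      rw [e1, if_neg hne]
      rfl
  · refine le_trans (le_of_eq ?_) (mul_le_mul_of_nonneg_left hT zero_le_two)
    rw [mul_sum]
    exact sum_congr rfl fun k _ =>
      sq_sqrt (mul_nonneg zero_le_two (hγ.nonneg (t + k)))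

lemma sum_sq_step_le (hγ : StepAssumption γ) {K : ℕ} {δ T : ℝ} (hδ : ∀ k, γ (t + k + 1) ≤ δ)
    (hT : ∑ k ∈ range K, γ (t + k + 1) ≤ T) : ∑ k ∈ range K, γ (t + k + 1) ^ 2 ≤ T * δ := by
  have hδ0 : 0 ≤ δ := (hγ.nonneg (t + 0)).trans (hδ 0)
  calc ∑ k ∈ range K, γ (t + k + 1) ^ 2
      ≤ ∑ k ∈ range K, γ (t + k + 1) * δ := sum_le_sum fun k _ => by
        rw [sq]
        exact mul_le_mul_of_nonneg_left (hδ k) (hγ.nonneg (t + k))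
    _ ≤ T * δ := by
        rw [← sum_mul]
        gcongr

/-- The remainder terms in the discrete Itô formula. -/
lemma integral_remainder_le {u : ℕ → Fin n → Fin d → Ω → ℝ} {v w : ℕ → Fin n → Ω → ℝ}
    {g : ℕ → ℝ} {K : ℕ} {T e G r ε B : ℝ} (hg : ∀ k, 0 ≤ g k) (hT : ∑ k ∈ range K, g k ≤ T)
    (hG : 0 ≤ G) (hr : 0 ≤ r) (hε : 0 ≤ ε) (he : 0 ≤ e) (hB : 0 ≤ B) (hM : 0 ≤ M)
    (iu : ∀ k i a, Integrable (u k i a) P) (iv : ∀ k i, Integrable (v k i) P)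
    (iw : ∀ k i, Integrable (w k i) P) (hu : ∀ k i a, ∫ ω, |u k i a ω| ∂P ≤ e)
    (hv : ∀ k, mean (fun i => ∫ ω, v k i ω ∂P) ≤ B) (hw : ∀ k i, ∫ ω, w k i ω ∂P ≤ M) :
    Integrable (fun ω => ∑ k ∈ range K, g k * mean fun i => ∑ a, G * |u k i a ω| +
      r * (2 * v k i ω + 1 + 5 * w k i ω) + ε * (1 + w k i ω)) P ∧
    ∫ ω, ∑ k ∈ range K, g k * mean (fun i => ∑ a, G * |u k i a ω| +
      r * (2 * v k i ω + 1 + 5 * w k i ω) + ε * (1 + w k i ω)) ∂P ≤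
      T * (d * (G * e) + r * (2 * B + 1 + 5 * M) + ε * (1 + M)) := by
  have i1 := fun k i a => (iu k i a).abs.const_mul G
  have j1 : ∀ k i, Integrable (fun ω => ∑ a, G * |u k i a ω|) P := fun k i =>
    integrable_finsetSum _ fun a _ => i1 k i a
  have j4 : ∀ k i, Integrable (fun ω => (5 * r + ε) * w k i ω + (r + ε)) P :=
    fun k i => ((iw k i).const_mul _).add (integrable_const (r + ε))
  have j5 : ∀ k i, Integrable (fun ω => 2 * r * v k i ω + ((5 * r + ε) * w k i ω + (r + ε))) P :=
    fun k i => ((iv k i).const_mul _).add (j4 k i)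
  have e1 : ∀ k i ω, ∑ a, G * |u k i a ω| + r * (2 * v k i ω + 1 + 5 * w k i ω) +
      ε * (1 + w k i ω) = ∑ a, G * |u k i a ω| +
      (2 * r * v k i ω + ((5 * r + ε) * w k i ω + (r + ε))) := fun k i ω => by ring
  simp_rw [e1]
  have j6 : ∀ k i, Integrable (fun ω => ∑ a, G * |u k i a ω| +
      (2 * r * v k i ω + ((5 * r + ε) * w k i ω + (r + ε)))) P := fun k i => (j1 k i).add (j5 k i)
  have j7 := fun k => (integrable_mean (j6 k)).const_mul (g k)
  refine ⟨integrable_finsetSum _ fun k _ => j7 k, ?_⟩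
  rw [integral_finsetSum _ fun k _ => j7 k]
  refine le_trans (sum_le_sum fun k _ => ?_) (le_trans (le_of_eq (sum_mul ..).symm)
    (mul_le_mul_of_nonneg_right hT (by positivity)))
  rw [integral_const_mul]
  refine mul_le_mul_of_nonneg_left ?_ (hg k)
  rw [integral_mean (j6 k)]
  have e2 : ∀ i, ∫ ω, (∑ a, G * |u k i a ω| +
      (2 * r * v k i ω + ((5 * r + ε) * w k i ω + (r + ε)))) ∂P ≤
      2 * r * ∫ ω, v k i ω ∂P + (d * (G * e) + (5 * r + ε) * M + (r + ε)) := fun i => by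
    rw [integral_add (j1 k i) (j5 k i), integral_add ((iv k i).const_mul _) (j4 k i),
      integral_add ((iw k i).const_mul _) (integrable_const (r + ε)),
      integral_finsetSum _ fun a _ => i1 k i a, integral_const_mul, integral_const_mul,
      integral_const]
    simp_rw [integral_const_mul]
    have h1 : ∑ a, G * ∫ ω, |u k i a ω| ∂P ≤ ∑ _a : Fin d, G * e := sum_le_sum fun a _ =>
      mul_le_mul_of_nonneg_left (hu k i a) hG
    rw [sum_const, card_univ, Fintype.card_fin, nsmul_eq_mul] at h1
    have h2 := mul_le_mul_of_nonneg_left (hw k i) (by positivity : 0 ≤ 5 * r + ε)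
    simp only [probReal_univ, one_smul]
    linarith
  refine (mean_mono e2).trans ?_
  rw [mean_add, mean_const_mul, mean_const]
  linarith [mul_le_mul_of_nonneg_left (hv k) (by positivity : 0 ≤ 2 * r)]

/-- The discrete Itô formula: the sums of the error terms, averaged over the particles, are small
in mean. -/
lemma SymmetrizedSystem.exists_ito_le (h : SymmetrizedSystem P b σ γ X ξ ζ F q C η) (hC : 0 ≤ C)
    (hγ : StepAssumption γ) (hq : 2 ≤ q) (hM : 0 ≤ M)
    (hsd : ∀ n, StepDynamics P γ (X n) (particleDrift b X ζ n) (fun k => ξ n (k + 1)) (F n) q M)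
    (hφ : ContDiff ℝ 2 φ) (hφc : HasCompactSupport φ) {T ε : ℝ} (hT : 0 ≤ T) (hε : 0 < ε) :
    ∃ A : ℝ, 0 ≤ A ∧ ∀ (n : ℕ+) (t K : ℕ) (δ e : ℝ) (Z : Fin n → Ω → ℝ), δ ≤ 1 → 0 ≤ e →
      (∀ k, γ (t + k + 1) ≤ δ) → (∀ k, η (t + k) n ≤ e) →
      ∑ k ∈ range K, γ (t + k + 1) ≤ T → (∀ i, Measurable[F n t] (Z i)) → (∀ i ω, |Z i ω| ≤ 1) →
      ∃ V : Ω → ℝ, Integrable V P ∧ (∀ᵐ ω ∂P, |mean fun i => Z i ω *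
        ∑ k ∈ range K, itoTerm b σ γ X φ n (t + k) i ω| ≤ V ω) ∧
        ∫ ω, V ω ∂P ≤ ε + A * (√δ + √(1 / (n : ℕ)) + e) := by
  obtain ⟨G, hG0, hG⟩ := exists_norm_gradient_le' hφ hφc
  obtain ⟨H, hH0, hH⟩ := exists_abs_hessianMatrix_le hφ hφc
  obtain ⟨Cτ, hCτ0, hCτ⟩ := exists_ito_step_le (d' := d') hφ hφc
    (ε := ε / ((T + 1) * (1 + M))) (by positivity)
  set ε' := ε / ((T + 1) * (1 + M)) with hε'
  have hε'0 : 0 < ε' := by positivity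
  have hTε : T * (ε' * (1 + M)) ≤ ε := by
    have : (T + 1) * (ε' * (1 + M)) = ε := by
      rw [hε']
      field_simp
    nlinarith [mul_pos hε'0 (by positivity : 0 < 1 + M)]
  set A₁ := √(2 * T * (d ^ 2 * G ^ 2 * (1 + C))) with hA₁
  set A₂ := √(T * (d ^ 2 * G ^ 2 * (1 + C))) with hA₂
  set A₃ := √(T * ((d * d : ℕ) ^ 2 * H ^ 2 * C)) with hA₃
  have hA₁0 : 0 ≤ A₁ := sqrt_nonneg _
  have hA₂0 : 0 ≤ A₂ := sqrt_nonneg _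
  have hA₃0 : 0 ≤ A₃ := sqrt_nonneg _
  refine ⟨A₁ + A₂ + A₃ + T * (d * G) + T * (Cτ * (2 * (1 + M) + 1 + 5 * M)), by positivity, ?_⟩
  intro n t K δ e Z hδ1 he0 hδ he hKT hZ hZ1
  have hδ0 : 0 ≤ δ := (hγ.nonneg (t + 0)).trans (hδ 0)
  have hgc : ∀ a, Measurable fun x => gradient φ x a := fun a =>
    (by fun_prop : Measurable fun v : State d => v a).comp (continuous_gradient hφ).measurable
  have hHc : ∀ z : Fin d × Fin d, Measurable fun x => hessianMatrix φ x z.1 z.2 := fun z =>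
    ((continuous_hessianMatrix hφ).matrix_elem z.1 z.2).measurable
  have hZm : ∀ k i, Measurable[F n (t + k)] (Z i) := fun k i =>
    (hZ i).mono ((F n).mono (Nat.le_add_right _ _)) le_rfl
  have hZb : ∀ {x B : ℝ} i ω, |x| ≤ B → |Z i ω * x| ≤ B := fun i ω hx => by
    rw [abs_mul]
    exact (mul_le_of_le_one_left (abs_nonneg _) (hZ1 i ω)).trans hx
  have hS := sum_sq_step_le hγ hδ hKT
  obtain ⟨p1, p1'⟩ := h.integral_abs_first_order_le hγ hφ hG hZ hZ1 hKT
  have hζ2 : ∀ k i a, MemLp (fun ω => ζ n (t + k + 1) i ω a) 2 P := fun k i a =>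
    memLp_coord ((h.memLp_ζ n (t + k) i).mono_exponent (by exact_mod_cast hq)) a
  obtain ⟨p2, p2'⟩ := integral_abs_centered_le (P := P) (F := shiftFiltration (F n) t)
    (c := fun k i a ω => Z i ω * gradient φ (X n (t + k) i ω) a)
    (f := fun k i a ω => ζ n (t + k + 1) i ω a) (G := G)
    (fun k i a => measurable_coord_comp (hgc a) (hZm k i) (h.measurable_X n _ i))
    (fun k i a ω => hZb i ω ((abs_coord_le _ a).trans (hG _)))
    (fun k i a => (by fun_prop : Measurable fun v : State d => v a).comp
      (h.measurable_ζ n (t + k) i)) hζ2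
    (fun k i a => integral_coord_sq_le hq (h.memLp_ζ n (t + k) i)
      (h.integral_ζ n (t + k) i) a) K hS
  obtain ⟨p3, p3'⟩ := integral_abs_centered_le (P := P) (F := shiftFiltration (F n) t)
    (c := fun k i z ω => Z i ω * hessianMatrix φ (X n (t + k) i ω) z.1 z.2)
    (f := fun k i (z : Fin d × Fin d) ω => ξ n (t + k + 1) i ω z.1 * ξ n (t + k + 1) i ω z.2)
    (G := H)
    (fun k i z => measurable_coord_comp (hHc z) (hZm k i) (h.measurable_X n _ i))
    (fun k i z ω => hZb i ω (hH _ _ _))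
    (fun k i z => (by fun_prop : Measurable fun v : State d => v z.1 * v z.2).comp
      (h.measurable_ξ n (t + k) i)) (fun k i z => (h.memLp_ξ_mul n (t + k) i z).1)
    (fun k i z => (h.memLp_ξ_mul n (t + k) i z).2) K hS
  obtain ⟨p4, p4'⟩ := integral_remainder_le (P := P) (K := K)
    (u := fun k i a => P[fun ω => ζ n (t + k + 1) i ω a | F n (t + k)])
    (v := fun k i ω => ‖particleDrift b X ζ n (t + k) i ω‖ ^ 2)
    (w := fun k i ω => ‖ξ n (t + k + 1) i ω‖ ^ 4) (B := 1 + M)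
    (fun k => hγ.nonneg (t + k)) hKT hG0 (mul_nonneg hCτ0 (sqrt_nonneg δ)) hε'0.le he0
    (by positivity) hM (fun _ _ _ => integrable_condExp)
    (fun k i => by simpa using ((hsd n).memLp_β_two hq (t + k) i).integrable_norm_pow')
    (fun k i => integrable_norm_pow_four (h.memLp_ξ n (t + k) i))
    (fun k i a => (h.condExp_ζ n (t + k) i a).trans (he k))
    (fun k => (hsd n).moment_β_two hq (t + k)) fun k => (hsd n).moment_ξ (t + k)
  simp only [shiftFiltration_apply] at p2 p2' p3 p3'
  obtain ⟨q1, q2⟩ := integral_add_four_le p1 p2 p3 p4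
  refine ⟨_, q1, ?_, ?_⟩
  · have hcov : ∀ᵐ ω ∂P, ∀ (k : ℕ) (i : Fin n) (z : Fin d × Fin d),
        (P[fun ω => ξ n (t + k + 1) i ω z.1 * ξ n (t + k + 1) i ω z.2 | F n (t + k)]) ω =
        (σ (X n (t + k) i ω) (empirical fun l => X n (t + k) l ω) *
          (σ (X n (t + k) i ω) (empirical fun l => X n (t + k) l ω)).transpose) z.1 z.2 := by
      rw [ae_all_iff]
      intro k
      rw [ae_all_iff]
      intro i
      rw [ae_all_iff]
      intro z
      filter_upwards [h.condCov_ξ n (t + k) i i z.1 z.2] with ω e1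
      rw [e1, if_pos rfl]
    filter_upwards [hcov] with ω hω
    simp_rw [mul_sum]
    rw [mean_sum_comm]
    refine abs_sum_le_of_abs_sub_le (fun k => ?_) K
    rw [← mean_const_mul, ← mean_const_mul, ← mean_const_mul, ← mean_const_mul, ← mean_sub,
      ← mean_sub, ← mean_sub]
    refine (abs_mean_le _).trans (mean_mono fun i => ?_)
    have h1 := hCτ (X n (t + k) i ω) (b (X n (t + k) i ω) (empirical fun j => X n (t + k) j ω))
      (ζ n (t + k + 1) i ω) (ξ n (t + k + 1) i ω)
      (σ (X n (t + k) i ω) (empirical fun j => X n (t + k) j ω))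
      (fun a => (P[fun ω => ζ n (t + k + 1) i ω a | F n (t + k)]) ω) (γ (t + k + 1)) δ
      (hγ.nonneg (t + k)) (hδ k) hδ1
    have h2 := (hsd n).step (t + k) i ω
    rw [particleDrift] at h2
    rw [← h2] at h1
    simp_rw [mul_assoc (Z i ω)]
    rw [← mul_sum, ← mul_sum, ← mul_sum]
    have h3 : ∑ z : Fin d × Fin d, hessianMatrix φ (X n (t + k) i ω) z.1 z.2 *
        (ξ n (t + k + 1) i ω z.1 * ξ n (t + k + 1) i ω z.2 -
        (P[fun ω => ξ n (t + k + 1) i ω z.1 * ξ n (t + k + 1) i ω z.2 | F n (t + k)]) ω) =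
        ∑ z : Fin d × Fin d, hessianMatrix φ (X n (t + k) i ω) z.1 z.2 *
        (ξ n (t + k + 1) i ω z.1 * ξ n (t + k + 1) i ω z.2 -
        (σ (X n (t + k) i ω) (empirical fun l => X n (t + k) l ω) *
          (σ (X n (t + k) i ω) (empirical fun l => X n (t + k) l ω)).transpose) z.1 z.2) :=
      sum_congr rfl fun z _ => by rw [hω k i z]
    rw [← h3] at h1
    have h4 := hZb i ω h1
    refine le_trans (le_of_eq ?_) (h4.trans ?_)
    · congr 1
      simp only [itoTerm, generator]
      ring
    · refine mul_le_mul_of_nonneg_left ?_ (hγ.nonneg (t + k))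
      rw [particleDrift]
      gcongr with a _
      exact hG _
  · rw [q2]
    rw [Fintype.card_fin] at p2'
    rw [Fintype.card_prod, Fintype.card_fin] at p3'
    have r : ∀ {x y z : ℝ}, 0 ≤ x → z = x * y → √z = √x * √y := fun hx e => by
      rw [e, sqrt_mul hx]
    have s1 := p1'.trans (r (x := 2 * T * (d ^ 2 * G ^ 2 * (1 + C))) (y := 1 / (n : ℕ))
      (by positivity) (by ring)).le
    have s2 := p2'.trans (r (x := T * (d ^ 2 * G ^ 2 * (1 + C))) (y := δ) (by positivity)
      (by ring)).le
    have s3 := p3'.trans (r (x := T * ((d * d : ℕ) ^ 2 * H ^ 2 * C)) (y := δ) (by positivity)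
      (by ring)).le
    refine (add_le_add (add_le_add (add_le_add s1 s2) s3) p4').trans ?_
    rw [← hA₁, ← hA₂, ← hA₃]
    have : 0 ≤ A₁ * (√δ + e) + (A₂ + A₃) * (√(1 / (n : ℕ)) + e) + T * (d * G) * (√δ +
      √(1 / (n : ℕ))) + T * (Cτ * (2 * (1 + M) + 1 + 5 * M)) * (√(1 / (n : ℕ)) + e) := by
      positivity
    linarith

lemma exists_modulus {E : Type*} [TopologicalSpace E] {f : ℝ≥0 × E → ℝ} (hf : Continuous f)
    {K : Set E} (hK : IsCompact K) (T : ℝ≥0) {ε : ℝ} (hε : 0 < ε) :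
    (∃ B : ℝ, 0 ≤ B ∧ ∀ ρ ∈ K, ∀ v ≤ T, |f (v, ρ)| ≤ B) ∧
    ∃ η : ℝ, 0 < η ∧ ∀ ρ ∈ K, ∀ v w : ℝ≥0, v ≤ T → w ≤ T → dist v w < η →
      |f (v, ρ) - f (w, ρ)| < ε := by
  constructor
  · obtain ⟨B, hB⟩ := (isCompact_Icc (a := (0 : ℝ≥0)) (b := T)).prod hK |>.exists_bound_of_continuousOn
      hf.continuousOn
    exact ⟨max B 0, le_max_right _ _, fun ρ hρ v hv =>
      (hB (v, ρ) ⟨⟨zero_le, hv⟩, hρ⟩).trans (le_max_left _ _)⟩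
  let D : Set (ℝ≥0 × ℝ≥0 × E) := (Set.Icc 0 T ×ˢ Set.Icc 0 T ×ˢ K) ∩
    {z | ε ≤ |f (z.1, z.2.2) - f (z.2.1, z.2.2)|}
  have hD : IsCompact D := (isCompact_Icc.prod (isCompact_Icc.prod hK)).inter_right
    (isClosed_le continuous_const (by fun_prop))
  by_cases hne : D.Nonempty
  · obtain ⟨z₁, hz₁, hmin⟩ := hD.exists_isMinOn hne (f := fun z => dist z.1 z.2.1) (by fun_prop)
    refine ⟨dist z₁.1 z₁.2.1, dist_pos.2 fun heq => ?_, fun ρ hρ v w hv hw hvw => ?_⟩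
    · have h1 : ε ≤ |f (z₁.1, z₁.2.2) - f (z₁.2.1, z₁.2.2)| := hz₁.2
      rw [heq, sub_self, abs_zero] at h1
      linarith
    · by_contra hcon
      have : (v, w, ρ) ∈ D := ⟨⟨⟨zero_le, hv⟩, ⟨zero_le, hw⟩, hρ⟩, not_lt.1 hcon⟩
      exact absurd (hmin this) (not_le.2 hvw)
  · refine ⟨1, one_pos, fun ρ hρ v w hv hw _ => ?_⟩
    by_contra hcon
    exact hne ⟨(v, w, ρ), ⟨⟨zero_le, hv⟩, ⟨zero_le, hw⟩, hρ⟩, not_lt.1 hcon⟩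

/-- Riemann sums along a grid which nearly covers `[s, t]`. -/
lemma abs_integral_sub_sum_le {g : ℝ → ℝ} (hg : Continuous g) {r : ℕ → ℝ} (hr : Monotone r) {K : ℕ}
    {s t δ B ε : ℝ} (hst : s ≤ t) (h0 : s ≤ r 0) (h0' : r 0 ≤ s + δ) (hK : t ≤ r K)
    (hK' : r K ≤ t + δ) (hδ : ∀ k, r (k + 1) ≤ r k + δ) (hB : ∀ v, s ≤ v → v ≤ t + δ → |g v| ≤ B)
    (hε : ∀ v w, s ≤ v → v ≤ t + δ → s ≤ w → w ≤ t + δ → |v - w| ≤ δ → |g v - g w| ≤ ε) :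
    |(∫ v in s..t, g v) - ∑ k ∈ range K, (r (k + 1) - r k) * g (r k)| ≤
      ε * (r K - r 0) + 2 * (B * δ) := by
  have hi : ∀ a b, IntervalIntegrable g volume a b := fun a b => hg.intervalIntegrable a b
  have hδ0 : 0 ≤ δ := by linarith
  have hB0 : 0 ≤ B := (abs_nonneg _).trans (hB s le_rfl (by linarith))
  have e1 : ∫ v in s..t, g v = (∫ v in s..(r 0), g v) +
      ∑ k ∈ range K, (∫ v in (r k)..(r (k + 1)), g v) - ∫ v in t..(r K), g v := by
    rw [intervalIntegral.sum_integral_adjacent_intervals fun k _ => hi _ _,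
      intervalIntegral.integral_add_adjacent_intervals (hi _ _) (hi _ _), eq_sub_iff_add_eq,
      intervalIntegral.integral_add_adjacent_intervals (hi _ _) (hi _ _)]
  have hbd : ∀ a b, s ≤ a → a ≤ b → b ≤ t + δ → b ≤ a + δ → |∫ v in a..b, g v| ≤ B * δ := by
    intro a b ha hab hb hd
    have := intervalIntegral.norm_integral_le_of_norm_le_const (a := a) (b := b) (C := B) (f := g)
      fun v hv => by
        rw [Set.uIoc_of_le hab] at hv
        exact hB v (by linarith [hv.1]) (by linarith [hv.2])
    rw [abs_of_nonneg (by linarith : 0 ≤ b - a)] at this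
    exact this.trans (mul_le_mul_of_nonneg_left (by linarith) hB0)
  have e2 : |∑ k ∈ range K, (∫ v in (r k)..(r (k + 1)), g v) -
      ∑ k ∈ range K, (r (k + 1) - r k) * g (r k)| ≤ ε * (r K - r 0) := by
    rw [← sum_sub_distrib, ← sum_range_sub, mul_sum]
    refine (abs_sum_le_sum_abs _ _).trans (sum_le_sum fun k hk => ?_)
    have hk1 : r 0 ≤ r k := hr (Nat.zero_le k)
    have hk2 : r (k + 1) ≤ r K := hr (mem_range.1 hk)
    have hk3 : r k ≤ r (k + 1) := hr k.le_succ
    have e3 : (∫ v in (r k)..(r (k + 1)), g v) - (r (k + 1) - r k) * g (r k) =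
        ∫ v in (r k)..(r (k + 1)), (g v - g (r k)) := by
      rw [intervalIntegral.integral_sub (hi _ _) intervalIntegrable_const,
        intervalIntegral.integral_const, smul_eq_mul]
    rw [e3]
    have := intervalIntegral.norm_integral_le_of_norm_le_const (a := r k) (b := r (k + 1)) (C := ε)
      (f := fun v => g v - g (r k)) fun v hv => by
        rw [Set.uIoc_of_le hk3] at hv
        have := hδ k
        exact hε v (r k) (by linarith [hv.1]) (by linarith [hv.2]) (by linarith) (by linarith)
          (by rw [abs_of_nonneg (by linarith [hv.1])]; linarith [hv.2])
    rwa [abs_of_nonneg (by linarith : 0 ≤ r (k + 1) - r k)] at this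
  have b1 := abs_le.1 (hbd s (r 0) le_rfl h0 (by linarith) h0')
  have b2 := abs_le.1 (hbd t (r K) hst hK hK' hK')
  have b3 := abs_le.1 e2
  rw [e1, abs_le]
  constructor <;> linarith [b1.1, b1.2, b2.1, b2.2, b3.1, b3.2]

lemma exists_gridTime_near {γ : ℕ → ℝ} (hγ : StepAssumption γ) {k₀ : ℕ} {δ t : ℝ}
    (hδ : ∀ k ≥ k₀, γ (k + 1) ≤ δ) (h0 : gridTime γ k₀ ≤ t + δ) :
    ∃ K, t ≤ gridTime γ (k₀ + K) ∧ gridTime γ (k₀ + K) ≤ t + δ := by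
  classical
  have hex : ∃ K, t ≤ gridTime γ (k₀ + K) := by
    obtain ⟨K, hK⟩ := exists_le_gridTime hγ t
    exact ⟨K, hK.trans (gridTime_mono hγ (Nat.le_add_left _ _))⟩
  refine ⟨Nat.find hex, Nat.find_spec hex, ?_⟩
  rcases h : Nat.find hex with _ | K
  · exact h0
  · have h1 := not_le.1 (Nat.find_min hex (m := K) (by omega))
    rw [← Nat.add_assoc, gridTime_succ]
    linarith [hδ (k₀ + K) (Nat.le_add_right _ _)]

/-- The law of the interpolated path of a uniformly chosen particle, from time `u` on. -/
def flow (hγ : StepAssumption γ) (X : Particles Ω d) (n : ℕ+)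
    (u : ℝ≥0) (w : Ω) : PathWSpace p d :=
  empiricalPath fun i => shiftPath u (traj hγ (X n) i w)

lemma abs_sub_le_of_gradient (hφ : ContDiff ℝ 2 φ) {G : ℝ} (hG : ∀ x, ‖gradient φ x‖ ≤ G)
    (x y : State d) : |φ y - φ x| ≤ G * ‖y - x‖ :=
  convex_univ.norm_image_sub_le_of_norm_fderiv_le (𝕜 := ℝ)
    (fun z _ => hφ.differentiable (by norm_num) z)
    (fun z _ => by
      have := hG z
      rwa [gradient, LinearIsometryEquiv.norm_map] at this) (Set.mem_univ x) (Set.mem_univ y)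

/-- The defect of the empirical law, in terms of the discrete Itô formula. -/
lemma abs_defect_flow_le (hγ : StepAssumption γ) (hφ : ContDiff ℝ 2 φ) {G : ℝ}
    (hG : ∀ x, ‖gradient φ x‖ ≤ G) {n : ℕ+} {ω : Ω}
    (hX : ∀ i k, γ (k + 1) = 0 → X n (k + 1) i ω = X n k i ω) {u s t : ℝ≥0} {k₀ K : ℕ} {r : ℕ → ℝ≥0}
    (hr : ∀ k, ((u + r k : ℝ≥0) : ℝ) = gridTime γ (k₀ + k)) {h : PathSpace d → ℝ}
    (hh : Continuous h) (hh1 : ∀ x, |h x| ≤ 1) (hcoef : CoefficientAssumption b σ)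
    {ρ : PathWSpace p d} (hρ : ρ = flow hγ X n u ω) : |defect b σ φ s t h ρ| ≤
      |mean fun i => h (shiftPath u (traj hγ (X n) i ω)) *
        ∑ k ∈ range K, itoTerm b σ γ X φ n (k₀ + k) i ω| +
      G * mean (fun i => ‖traj hγ (X n) i ω (u + r K) - traj hγ (X n) i ω (u + t)‖) +
      G * mean (fun i => ‖traj hγ (X n) i ω (u + r 0) - traj hγ (X n) i ω (u + s)‖) +
      |(∫ v in (s : ℝ)..t, ∫ x, pathGenerator b σ φ v.toNNReal ρ x * h x
          ∂ρ.toMeasure) - ∑ k ∈ range K, ((r (k + 1) : ℝ) - r k) *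
        ∫ x, pathGenerator b σ φ (r k) ρ x * h x ∂ρ.toMeasure| := by
  set x : Fin n → PathSpace d := fun i => traj hγ (X n) i ω with hx
  set z : Fin n → ℝ := fun i => h (shiftPath u (x i)) with hz
  have hxX : ∀ i k, x i (u + r k) = X n (k₀ + k) i ω := fun i k =>
    interp_gridTime hγ (x := fun k => X n k i ω) (hX i) (k₀ + k) (hr k)
  have hmean : ∀ {f : PathSpace d → ℝ}, Measurable f →
      ∫ y, f y ∂ρ.toMeasure = mean fun i => f (shiftPath u (x i)) :=
    by
    intro f hf
    rw [hρ, flow, integral_empiricalPath _ hf, mean]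
  have hgen : ∀ k, ∫ y, pathGenerator b σ φ (r k) ρ y * h y
      ∂ρ.toMeasure = mean fun i => z i * generator b σ
        (empirical fun j => X n (k₀ + k) j ω) φ (X n (k₀ + k) i ω) := by
    intro k
    have hm : Measurable fun y => pathGenerator b σ φ (r k) ρ y * h y :=
      (((continuous_pathGenerator hcoef hφ).comp (by fun_prop :
        Continuous fun y : PathSpace d => (y, (r k, ρ)))).mul hh).measurable
    rw [hmean hm]
    congr 1
    ext i
    rw [pathGenerator, hρ, flow, marginal_empiricalPath, mul_comm]
    simp only [shiftPath_apply]
    change z i * generator b σ (empirical fun i => x i (u + r k)) φ (x i (u + r k)) = _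
    simp_rw [hxX]
  have hstep : ∀ k, (r (k + 1) : ℝ) - r k = γ (k₀ + k + 1) := fun k => by
    have h1 := hr (k + 1)
    have h2 := hr k
    rw [← Nat.add_assoc, gridTime_succ] at h1
    push_cast at h1 h2
    linarith
  have hm1 : Measurable fun y : PathSpace d => (φ (y t) - φ (y s)) * h y := by
    have := hφ.continuous
    exact (((this.comp (continuous_eval_const t)).sub
      (this.comp (continuous_eval_const s))).mul hh).measurable
  have hφ1 : ∀ i, |z i| ≤ 1 := fun i => hh1 _
  have hbd : ∀ v w : ℝ≥0, |mean fun i => z i * (φ (x i v) - φ (x i w))| ≤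
      G * mean fun i => ‖x i v - x i w‖ := by
    intro v w
    rw [← mean_const_mul]
    refine (abs_mean_le _).trans (mean_mono fun i => ?_)
    rw [abs_mul]
    exact (mul_le_of_le_one_left (abs_nonneg _) (hφ1 i)).trans (abs_sub_le_of_gradient hφ hG _ _)
  have hsum : mean (fun i => z i * ∑ k ∈ range K, itoTerm b σ γ X φ n (k₀ + k) i ω) =
      mean (fun i => z i * (φ (x i (u + r K)) - φ (x i (u + r 0)))) -
      ∑ k ∈ range K, ((r (k + 1) : ℝ) - r k) *
        ∫ y, pathGenerator b σ φ (r k) ρ y * h y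
          ∂ρ.toMeasure := by
    simp_rw [hgen, hstep, ← mean_const_mul]
    rw [← mean_sum_comm, ← mean_sub]
    congr 1
    ext i
    rw [hxX, hxX, ← sum_range_sub (fun k => φ (X n (k₀ + k) i ω)), mul_sum,
      mul_sum, ← sum_sub_distrib]
    refine sum_congr rfl fun k _ => ?_
    rw [itoTerm, ← Nat.add_assoc]
    ring
  rw [defect, hmean hm1, hsum]
  have b1 := abs_le.1 (hbd (u + r K) (u + t))
  have b2 := abs_le.1 (hbd (u + r 0) (u + s))
  have e1 : mean (fun i => (φ (shiftPath u (x i) t) - φ (shiftPath u (x i) s)) *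
      h (shiftPath u (x i))) = mean (fun i => z i * (φ (x i (u + r K)) - φ (x i (u + r 0)))) -
      mean (fun i => z i * (φ (x i (u + r K)) - φ (x i (u + t)))) +
      mean fun i => z i * (φ (x i (u + r 0)) - φ (x i (u + s))) := by
    rw [← mean_sub, ← mean_add]
    congr 1
    ext i
    simp only [shiftPath_apply, hz]
    ring
  rw [e1]
  set a := ∑ k ∈ range K, ((r (k + 1) : ℝ) - r k) *
        ∫ y, pathGenerator b σ φ (r k) ρ y * h y ∂ρ.toMeasure
  set c := ∫ v in (s : ℝ)..t, ∫ x, pathGenerator b σ φ v.toNNReal ρ x * h x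
          ∂ρ.toMeasure
  set A := mean fun i => z i * (φ (x i (u + r K)) - φ (x i (u + r 0)))
  have c1 := abs_le.1 (le_refl |A - a|)
  have c2 := abs_le.1 (le_refl |c - a|)
  rw [abs_le]
  constructor <;> linarith [b1.1, b1.2, b2.1, b2.2, c1.1, c1.2, c2.1, c2.2]

lemma measurable_past (hγ : StepAssumption γ) {m : MeasurableSpace Ω} {x : ℕ → Ω → State d} {k₀ : ℕ}
    (hx : ∀ k ≤ k₀, Measurable[m] (x k)) {u s : ℝ≥0} (hus : (u + s : ℝ≥0) ≤ gridTime γ k₀)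
    {h : PathSpace d → ℝ} (hh : Continuous h) (hs : ∀ y, h (stopPath s y) = h y) :
    Measurable[m] fun w => h (shiftPath u (interp hγ fun k => x k w)) := by
  have e : ∀ w, h (shiftPath u (interp hγ fun k => x k w)) =
      h (stopPath s (shiftPath u (interp hγ fun k => x (min k k₀) w))) := by
    intro w
    rw [← hs]
    congr 1
    ext1 r
    refine interp_congr hγ (K := k₀) (le_trans ?_ hus) fun k hk => by rw [min_eq_left hk]
    exact_mod_cast add_le_add_right (Set.projIcc 0 s zero_le r).2.2 u
  simp_rw [e]
  exact (hh.comp ((continuous_stopPath s).comp (continuous_shiftPath u))).measurable.comp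
    (measurable_interp hγ fun k => hx _ (min_le_right k k₀))

lemma mean_integral_le_sqrt {n : ℕ+} {f : Fin n → Ω → ℝ} (hf : ∀ i, Measurable (f i))
    (hi : ∀ i, Integrable (fun w => f i w ^ 2) P) {δ E : ℝ} (hδ : 0 < δ)
    (hE : mean (fun i => ∫ w, f i w ^ 2 ∂P) ≤ E * δ) :
    (∀ i, Integrable (f i) P) ∧ ∫ w, mean (fun i => f i w) ∂P ≤ (1 + E) * √δ := by
  have hκ : 0 < √δ := Real.sqrt_pos.2 hδ
  have j3 : ∀ i, Integrable (f i) P := fun i =>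
    ((memLp_two_iff_integrable_sq (hf i).aestronglyMeasurable).2 (hi i)).integrable (by norm_num)
  refine ⟨j3, ?_⟩
  rw [integral_mean j3]
  have h2 : ∀ i, ∫ w, f i w ∂P ≤ √δ + (√δ)⁻¹ * ∫ w, f i w ^ 2 ∂P := fun i => by
    refine (integral_mono (j3 i) ((integrable_const √δ).add ((hi i).const_mul (√δ)⁻¹))
      fun w => ?_).trans (le_of_eq ?_)
    · simp only [Pi.add_apply]
      rw [← sub_nonneg, show √δ + (√δ)⁻¹ * f i w ^ 2 - f i w =
        (√δ)⁻¹ * ((√δ - f i w / 2) ^ 2 + 3 / 4 * f i w ^ 2) by field_simp; ring]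
      positivity
    · simp only [Pi.add_apply]
      rw [integral_add (integrable_const √δ) ((hi i).const_mul _), integral_const_mul,
        integral_const]
      simp
  refine (mean_mono h2).trans ?_
  rw [mean_add, mean_const, mean_const_mul]
  have h4 := mul_le_mul_of_nonneg_left hE (inv_nonneg.2 hκ.le)
  have h5 : (√δ)⁻¹ * (E * δ) = E * √δ := by
    field_simp
    rw [sq_sqrt hδ.le, mul_comm]
  linarith

lemma StepDynamics.mean_integral_increment_le {n : ℕ+} {x β ξ : ℕ → Fin n → Ω → State d}
    {F : Filtration ℕ mΩ} (h : StepDynamics P γ x β ξ F q M) (hγ : StepAssumption γ) (hq : 2 ≤ q)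
    {δ D : ℝ} (hδ : 0 < δ) {s t : ℝ≥0} (hst : s ≤ t) (hts : (t : ℝ) ≤ s + δ)
    (hD : 1 + 2 * (1 + M) * δ + (1 + 64 * d ^ 2 * M) ≤ D) : (∀ i, Integrable (fun w =>
      ‖traj hγ x i w t - traj hγ x i w s‖) P) ∧ ∫ w, mean (fun i =>
      ‖traj hγ x i w t - traj hγ x i w s‖) ∂P ≤ D * √δ := by
  obtain ⟨i1, h1⟩ := h.mean_integral_sq_increment_le hγ hq hst
  have hM := h.moment_nonneg
  have : (s : ℝ) ≤ t := by exact_mod_cast hst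
  obtain ⟨j, hj⟩ := mean_integral_le_sqrt (fun i =>
    ((continuous_eval_const t).sub (continuous_eval_const s)).norm.measurable.comp
      (measurable_interp hγ fun k => h.measurable_x k i)) i1 hδ
    (E := 2 * (1 + M) * δ + (1 + 64 * d ^ 2 * M)) (h1.trans (by
      rw [add_mul (_ * δ), mul_assoc _ δ, ← sq]
      gcongr <;> linarith))
  exact ⟨j, hj.trans (mul_le_mul_of_nonneg_right (by linarith) (sqrt_nonneg δ))⟩

set_option maxHeartbeats 1000000 in
/-- The laws of the interpolated paths asymptotically solve the nonlinear martingale problem. -/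
lemma SymmetrizedSystem.exists_measure_defect_le (h : SymmetrizedSystem P b σ γ X ξ ζ F q C η)
    (hC : 0 ≤ C) (hcoef : CoefficientAssumption b σ) (hγ : StepAssumption γ) (hq : 2 ≤ q)
    (hM : 0 ≤ M)
    (hsd : ∀ n, StepDynamics P γ (X n) (particleDrift b X ζ n) (fun k => ξ n (k + 1)) (F n) q M)
    (hη : Tendsto (fun z : ℕ × ℕ+ => η z.1 z.2) (atTop ×ˢ atTop) (𝓝 0)) (htight : ∀ ε : ℝ, 0 < ε → ∃
    Kc : Set (PathWSpace p d), IsCompact Kc ∧ ∀ n u, P {ω | flow hγ X n u ω ∉ Kc} ≤ ofReal ε)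
    (hφ : ContDiff ℝ 2 φ) (hφc : HasCompactSupport φ) {s t : ℝ≥0} (hst : s ≤ t)
    {g : PathSpace d → ℝ} (hg : Continuous g) (hg1 : ∀ x, |g x| ≤ 1)
    (hgs : ∀ x, g (stopPath s x) = g x) {ε : ℝ} (hε : 0 < ε) :
    ∃ (u₀ : ℝ≥0) (n₀ : ℕ+), ∀ u ≥ u₀, ∀ n ≥ n₀,
      P {ω | ε < |defect b σ φ s t g (flow hγ X n u ω)|} ≤ ofReal ε := by
  obtain ⟨Kc, hKc, hKP⟩ := htight (ε / 2) (by positivity)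
  obtain ⟨⟨B, hB0, hB⟩, η₁, hη₁, hmod⟩ := exists_modulus
    (continuous_integral_pathGenerator_mul hcoef hφ hφc hg hg1 hgs) hKc (t + 1)
    (ε := ε / (8 * (t + 1))) (by positivity)
  obtain ⟨G, hG0, hG⟩ := exists_norm_gradient_le' hφ hφc
  obtain ⟨A, hA0, hA⟩ := h.exists_ito_le hC hγ hq hM hsd hφ hφc (T := t + 1)
    (ε := ε ^ 2 / 16) (by positivity) (by positivity)
  set D : ℝ := 1 + 2 * (1 + M) * 1 + (1 + 64 * d ^ 2 * M) with hD
  have hD0 : 0 ≤ D := by positivity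
  set κ : ℝ := ε ^ 2 / (16 * (A + 2 * (G * D) + 1)) with hκ
  have hκ0 : 0 < κ := by positivity
  have hκA : (A + 2 * (G * D)) * κ ≤ ε ^ 2 / 16 := by
    rw [hκ, ← mul_div_assoc, div_le_div_iff₀ (by positivity) (by norm_num)]
    nlinarith [sq_nonneg ε, mul_nonneg hG0 hD0]
  have hκA' : A * κ ≤ ε ^ 2 / 16 := le_trans (mul_le_mul_of_nonneg_right
    (by nlinarith [mul_nonneg hG0 hD0]) hκ0.le) hκA
  set δ : ℝ := min (min 1 (κ ^ 2)) (min (η₁ / 2) (ε / (16 * (B + 1)))) with hδ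
  have hδ0 : 0 < δ := by positivity
  have hδ1 : δ ≤ 1 := (min_le_left _ _).trans (min_le_left _ _)
  have hδκ : √δ ≤ κ := Real.sqrt_le_iff.2 ⟨hκ0.le, (min_le_left _ _).trans (min_le_right _ _)⟩
  have hδη : δ < η₁ := lt_of_le_of_lt ((min_le_right _ _).trans (min_le_left _ _)) (half_lt_self hη₁)
  have hδB : 2 * (B * δ) ≤ ε / 8 := by
    have h1 : δ ≤ ε / (16 * (B + 1)) := (min_le_right _ _).trans (min_le_right _ _)
    rw [le_div_iff₀ (by positivity)] at h1
    nlinarith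
  obtain ⟨⟨k₁, n₁⟩, hkn⟩ := eventually_atTop.1 (prod_atTop_atTop_eq (α := ℕ) (β := ℕ+) ▸
    (hη.eventually (gt_mem_nhds hκ0)))
  obtain ⟨k₂, hk₂⟩ := eventually_atTop.1 (hγ.tendsto_zero.eventually (gt_mem_nhds hδ0))
  obtain ⟨N, hN⟩ := exists_nat_gt ((κ ^ 2)⁻¹)
  set k₃ := max k₁ k₂
  refine ⟨⟨gridTime γ k₃, gridTime_nonneg hγ k₃⟩, max n₁ ⟨N + 1, N.succ_pos⟩, fun u hu n hn => ?_⟩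
  have hu' : gridTime γ k₃ ≤ u := by exact_mod_cast hu
  have hγδ : ∀ k ≥ k₃, γ (k + 1) ≤ δ := fun k hk =>
    (hk₂ (k + 1) (by have := le_max_right k₁ k₂; omega)).le
  have hn1 : n₁ ≤ n := (le_max_left _ _).trans hn
  have hnκ : √(1 / (n : ℝ)) ≤ κ := by
    refine Real.sqrt_le_iff.2 ⟨hκ0.le, ?_⟩
    have h1 : N + 1 ≤ (n : ℕ) := by exact_mod_cast (le_max_right _ _).trans hn
    have h2 : ((N : ℝ) + 1) ≤ (n : ℕ) := by exact_mod_cast h1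
    rw [one_div]
    exact inv_le_of_inv_le₀ (by positivity) (by linarith)
  obtain ⟨K₀, hK₀, hK₀'⟩ := exists_gridTime_near hγ (t := (u + s : ℝ≥0)) hγδ
    (by push_cast; linarith [s.coe_nonneg])
  set k₀ := k₃ + K₀ with hk₀
  have hst' : (s : ℝ) ≤ t := by exact_mod_cast hst
  obtain ⟨K, hK, hK'⟩ := exists_gridTime_near hγ (k₀ := k₀) (t := (u + t : ℝ≥0))
    (fun k hk => hγδ k (by omega)) (by push_cast at *; linarith)
  push_cast at hK₀ hK₀' hK hK'
  have hrn : ∀ k, 0 ≤ gridTime γ (k₀ + k) - u := fun k => by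
    linarith [gridTime_mono hγ (Nat.le_add_right k₀ k), s.coe_nonneg]
  set r : ℕ → ℝ≥0 := fun k => ⟨gridTime γ (k₀ + k) - u, hrn k⟩ with hr
  have hrc : ∀ k, (r k : ℝ) = gridTime γ (k₀ + k) - u := fun k => rfl
  have hru : ∀ k, ((u + r k : ℝ≥0) : ℝ) = gridTime γ (k₀ + k) := fun k => by
    push_cast
    rw [hrc]
    ring
  have hrm : Monotone fun k => (r k : ℝ) := fun a b hab => by
    simp only [hrc]
    linarith [gridTime_mono hγ (Nat.add_le_add_left hab k₀)]
  have hrs : ∀ k, (r (k + 1) : ℝ) - r k = γ (k₀ + k + 1) := fun k => by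
    rw [hrc, hrc, ← Nat.add_assoc, gridTime_succ]
    ring
  have hr0 : (r 0 : ℝ) = gridTime γ k₀ - u := hrc 0
  have hsum : ∑ k ∈ range K, γ (k₀ + k + 1) ≤ t + 1 := by
    simp_rw [← hrs]
    rw [sum_range_sub fun k => (r k : ℝ), hrc K]
    linarith [(r 0).coe_nonneg]
  set Z : Fin n → Ω → ℝ := fun i ω => g (shiftPath u (traj hγ (X n) i ω)) with hZ
  obtain ⟨V, hV1, hV2, hV3⟩ := hA n k₀ K δ κ Z hδ1 hκ0.le (fun k => hγδ _ (by omega))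
    (fun k => (hkn (k₀ + k, n) ⟨by have := le_max_left k₁ k₂; simp only; omega, hn1⟩).le) hsum
    (fun i => measurable_past hγ (fun k hk => (h.measurable_X n k i).mono ((F n).mono hk) le_rfl)
      (by push_cast; exact hK₀) hg hgs) fun i ω => hg1 _
  obtain ⟨a1, a2⟩ := (hsd n).mean_integral_increment_le hγ hq (D := D) hδ0 (s := u + t)
    (t := u + r K) (by rw [← NNReal.coe_le_coe, hru]; push_cast; linarith)
    (by rw [hru]; push_cast; linarith) (by rw [hD]; gcongr)
  obtain ⟨a3, a4⟩ := (hsd n).mean_integral_increment_le hγ hq (D := D) hδ0 (s := u + s)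
    (t := u + r 0) (by rw [← NNReal.coe_le_coe, hru]; push_cast; exact hK₀)
    (by rw [hru]; push_cast; exact hK₀') (by rw [hD]; gcongr)
  set W : Ω → ℝ := fun ω => |V ω| + G * mean (fun i => ‖traj hγ (X n) i ω (u + r K) -
    traj hγ (X n) i ω (u + t)‖) + G * mean (fun i =>
      ‖traj hγ (X n) i ω (u + r 0) - traj hγ (X n) i ω (u + s)‖) with hW
  have hV0 : ∫ ω, |V ω| ∂P ≤ ∫ ω, V ω ∂P := le_of_eq (integral_congr_ae (by
    filter_upwards [hV2] with ω h1
    exact abs_of_nonneg ((abs_nonneg _).trans h1)))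
  have w1 := (integrable_mean a1).const_mul G
  have w2 := (integrable_mean a3).const_mul G
  have w3 : Integrable (fun ω => |V ω| + G * mean (fun i =>
    ‖traj hγ (X n) i ω (u + r K) - traj hγ (X n) i ω (u + t)‖)) P :=
    hV1.abs.add w1
  have hWi : Integrable W P := w3.add w2
  have hWint : ∫ ω, W ω ∂P ≤ ε ^ 2 / 4 := by
    rw [hW, integral_add w3 w2, integral_add hV1.abs w1, integral_const_mul, integral_const_mul]
    have b1 := mul_le_mul_of_nonneg_left a2 hG0
    have b2 := mul_le_mul_of_nonneg_left a4 hG0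
    have b3 := (mul_le_mul_of_nonneg_left hδκ (by positivity : 0 ≤ A + 2 * (G * D))).trans hκA
    have b4 := (mul_le_mul_of_nonneg_left hnκ hA0).trans hκA'
    rw [add_mul] at b3
    linarith
  have hWnn : ∀ ω, 0 ≤ W ω := fun ω => add_nonneg (add_nonneg (abs_nonneg _)
    (mul_nonneg hG0 (mean_nonneg fun i => norm_nonneg _)))
    (mul_nonneg hG0 (mean_nonneg fun i => norm_nonneg _))
  have hmarkov : P {ω | ε / 2 ≤ W ω} ≤ ofReal (ε / 2) := by
    have h1 := mul_meas_ge_le_integral_of_nonneg (ae_of_all _ hWnn) hWi (ε / 2)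
    rw [← ofReal_measureReal]
    refine ofReal_le_ofReal ?_
    nlinarith
  have hsub : {ω | ε < |defect b σ φ s t g (flow hγ X n u ω)|} ≤ᵐ[P]
      ({ω | flow hγ X n u ω ∉ Kc} ∪ {ω | ε / 2 ≤ W ω} : Set Ω) := by
    filter_upwards [hV2] with ω h1 h2
    by_contra hcon
    have hcon1 : flow hγ X n u ω ∈ Kc := by
      by_contra h3
      exact hcon (Or.inl h3)
    have hcon2 : W ω < ε / 2 := by
      by_contra h3
      exact hcon (Or.inr (not_lt.1 h3))
    have h2' : ε < |defect b σ φ s t g (flow hγ X n u ω)| := h2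
    have h3 := abs_defect_flow_le (b := b) (σ := σ) (s := s) (t := t) (K := K) hγ hφ hG
      (fun i k hk => (hsd n).eq_of_step_eq_zero i ω k hk) hru hg hg1 hcoef (ρ := flow hγ X n u ω) rfl
    set ρ : PathWSpace p d := flow hγ X n u ω
    set Θ : ℝ≥0 → ℝ := fun v => ∫ x, pathGenerator b σ φ v ρ x * g x ∂ρ.toMeasure with hΘ
    have hcΘ : Continuous Θ :=
      (continuous_integral_pathGenerator_mul hcoef hφ hφc hg hg1 hgs).comp
        (continuous_id.prodMk continuous_const)
    have hle : ∀ {v : ℝ}, v ≤ t + δ → v.toNNReal ≤ t + 1 := fun hv =>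
      Real.toNNReal_le_iff_le_coe.2 (by push_cast; linarith)
    have h4 := abs_integral_sub_sum_le (g := fun v => Θ v.toNNReal)
      (hcΘ.comp continuous_real_toNNReal) hrm (K := K) (s := s) (t := t) (δ := δ) (B := B)
      (ε := ε / (8 * (t + 1))) hst'
      (by rw [hr0]; linarith) (by rw [hr0]; linarith) (by rw [hrc]; linarith) (by rw [hrc]; linarith)
      (fun k => by linarith [hrs k, hγδ (k₀ + k) (by omega)])
      (fun v _ hv => hB _ hcon1 _ (hle hv)) (fun v w hv1 hv2 hw1 hw2 hvw => by
        refine (hmod _ hcon1 _ _ (hle hv2) (hle hw2) (lt_of_le_of_lt ?_ hδη)).le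
        rw [NNReal.dist_eq, Real.coe_toNNReal _ (s.coe_nonneg.trans hv1),
          Real.coe_toNNReal _ (s.coe_nonneg.trans hw1)]
        exact hvw)
    simp only [Real.toNNReal_coe] at h4
    have h5 : ε / (8 * (t + 1)) * ((r K : ℝ) - r 0) ≤ ε / 8 := by
      have : (r K : ℝ) - r 0 ≤ t + 1 := by
        rw [hrc]
        linarith [(r 0).coe_nonneg]
      calc _ ≤ ε / (8 * (t + 1)) * ((t : ℝ) + 1) := by gcongr
        _ = ε / 8 := by
          field_simp
    have h6 := h1.trans (le_abs_self (V ω))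
    simp only [hW] at hcon2
    linarith
  calc _ ≤ P ({ω | flow hγ X n u ω ∉ Kc} ∪ {ω | ε / 2 ≤ W ω}) := measure_mono_ae hsub
    _ ≤ ofReal (ε / 2) + ofReal (ε / 2) :=
        (measure_union_le _ _).trans (add_le_add (hKP n u) hmarkov)
    _ = ofReal ε := by
        rw [← ofReal_add (by positivity) (by positivity), add_halves]

lemma continuous_uncurry_shiftPath : Continuous fun z : ℝ≥0 × PathSpace d => shiftPath z.1 z.2 :=
  ContinuousMap.continuous_of_continuous_uncurry _
    ((continuous_snd.comp continuous_fst).eval (by fun_prop :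
      Continuous fun z : (ℝ≥0 × PathSpace d) × ℝ≥0 => z.1.1 + z.2))

lemma measurable_flow (hγ : StepAssumption γ) {n : ℕ+} (hX : ∀ k i, Measurable (X n k i)) :
    Measurable (Function.uncurry (flow hγ X n : ℝ≥0 → Ω → PathWSpace p d)) :=
  continuous_empiricalPath.measurable.comp (measurable_pi_iff.2 fun i =>
    continuous_uncurry_shiftPath.measurable.comp
      (measurable_fst.prodMk ((measurable_interp hγ fun k => hX k i).comp measurable_snd)))

lemma flow_add_one (hγ : StepAssumption γ) (n : ℕ+) (u : ℝ≥0) (w : Ω) :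
    (flow hγ X n (u + 1) w : PathWSpace p d) = (flow hγ X n u w).shift 1 := by
  rw [flow, flow, shift_empiricalPath]
  congr 1
  ext1 i
  ext1 s
  simp only [shiftPath_apply, add_assoc]

lemma flow_marginal (hγ : StepAssumption γ) (n : ℕ+) (u : ℝ≥0) (w : Ω) :
    (flow hγ X n u w : PathWSpace p d).marginal 0 = empirical fun i => traj hγ (X n) i w u := by
  rw [flow, marginal_empiricalPath]
  simp only [shiftPath_apply, add_zero]

lemma exists_isCompact_flow_mem (hγ : StepAssumption γ) (hq2 : 2 ≤ q) (hq4 : q ≤ 4)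
    (hpq : p < q) (hM : 0 ≤ M) {β : Particles Ω d}
    (hsd : ∀ n, StepDynamics P γ (X n) (β n) (fun k => ξ n (k + 1)) (F n) q M) :
    ∃ K : ℕ → Set (PathWSpace p d), (∀ j, IsCompact (K j)) ∧
      ∀ n u j, P {w | flow hγ X n u w ∉ K j} ≤ ((2 / ((j : ℝ≥0) + 1) : ℝ≥0) : ℝ≥0∞) := by
  obtain ⟨c, hc, h⟩ := StepDynamics.exists_lintegral_energy_le (P := P) (γ := γ) d M hM
    hq2 hq4
  refine ⟨fun j => _, fun j => isCompact_lintegral_energy_le hc hpq ((j : ℝ≥0) + 1),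
    fun n u j => ?_⟩
  have hm : ∀ i, Measurable fun w => energy c q (shiftPath u (traj hγ (X n) i w)) :=
    fun i => measurable_energy.comp ((continuous_shiftPath u).measurable.comp
      (measurable_interp hγ fun k => (hsd n).measurable_x k i))
  have h1 := meas_ge_le_lintegral_div (μ := P) (ε := (((j : ℝ≥0) + 1 : ℝ≥0) : ℝ≥0∞))
    (f := fun w => (n : ℝ≥0∞)⁻¹ *
      ∑ i, energy c q (shiftPath u (traj hγ (X n) i w)))
    ((Finset.measurable_fun_sum _ fun i _ => hm i).const_mul _).aemeasurable (by simp)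
    ENNReal.coe_ne_top
  rw [lintegral_const_mul _ (Finset.measurable_fun_sum _ fun i _ => hm i),
    lintegral_finsetSum _ fun i _ => hm i] at h1
  refine (measure_mono fun w hw => ?_).trans (h1.trans ?_)
  · rw [Set.mem_ofPred_eq, Set.mem_ofPred_eq, not_le, flow,
      lintegral_empiricalPath _ measurable_energy] at hw
    exact hw.le
  · rw [ENNReal.coe_div (by positivity)]
    exact ENNReal.div_le_div_right (h (hsd n) hγ u) _

/-- The time averages of the laws of the paths charge recurrent solutions only. -/
lemma SymmetrizedSystem.tendsto_average
    (h : SymmetrizedSystem P b σ γ X ξ ζ F q C η) (hC : 0 ≤ C) (hcoef : CoefficientAssumption b σ)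
    (hγ : StepAssumption γ) (hq2 : 2 ≤ q) (hq4 : q ≤ 4) (hpq : p < q) (hM : 0 ≤ M)
    (hsd : ∀ n, StepDynamics P γ (X n) (particleDrift b X ζ n) (fun k => ξ n (k + 1)) (F n) q M)
    (hη : Tendsto (fun z : ℕ × ℕ+ => η z.1 z.2) (atTop ×ˢ atTop) (𝓝 0)) :
    Tendsto (fun z : ℝ × ℕ+ => (ofReal z.1)⁻¹ * ∫⁻ u in Set.Ioc 0 z.1,
      ∫⁻ w, min 1 (Metric.infEDist (empirical fun i => traj hγ (X z.2) i w u.toNNReal)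
        (recurrentMarginals b σ)) ∂P) (atTop ×ˢ atTop) (𝓝 0) := by
  obtain ⟨K, hK, hPK⟩ := exists_isCompact_flow_mem (p := p) hγ hq2 hq4 hpq hM hsd
  have he : Tendsto (fun j : ℕ => 2 / ((j : ℝ≥0) + 1)) atTop (𝓝 0) := by
    simpa [div_eq_mul_inv] using tendsto_one_div_add_atTop_nhds_zero_nat (𝕜 := ℝ≥0) |>.const_mul 2
  have htight : ∀ ε : ℝ, 0 < ε → ∃ Kc : Set (PathWSpace p d), IsCompact Kc ∧
      ∀ n u, P {w | flow hγ X n u w ∉ Kc} ≤ ofReal ε := fun ε hε => by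
    obtain ⟨j, hj⟩ := (he.eventually (gt_mem_nhds (Real.toNNReal_pos.2 hε))).exists
    exact ⟨K j, hK j, fun n u => (hPK n u j).trans (coe_le_coe.2 hj.le)⟩
  have hm : ∀ n, Measurable (Function.uncurry (flow hγ X n : ℝ≥0 → Ω → PathWSpace p d)) :=
    fun n => measurable_flow hγ fun k i => (hsd n).measurable_x k i
  have key := tendsto_occupation (P := P) hm (PathWSpace.continuous_shift 1) (flow_add_one hγ) hK he
    hPK (𝒟 := {f | ∃ φ : State d → ℝ, ContDiff ℝ 2 φ ∧ HasCompactSupport φ ∧ ∃ s t : ℝ≥0, s ≤ t ∧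
      ∃ g : PathSpace d → ℝ, Continuous g ∧ (∀ x, |g x| ≤ 1) ∧ (∀ x, g (stopPath s x) = g x) ∧
        f = fun ρ => ofReal |defect b σ φ s t g ρ|}) ?_ ?_
    (g := fun ρ => Metric.infEDist (ρ.marginal 0) (recurrentMarginals b σ))
    (Metric.continuous_infEDist.comp (PathWSpace.continuous_marginal.comp
      (continuous_const.prodMk continuous_id))) ?_
  · simpa only [flow_marginal] using key
  · rintro f ⟨φ, hφ, hφc, s, t, hst, g, hg, hg1, hgs, rfl⟩
    exact continuous_ofReal.comp (continuous_defect hcoef hφ hφc hg hg1 hst hgs).abs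
  · rintro f ⟨φ, hφ, hφc, s, t, hst, g, hg, hg1, hgs, rfl⟩ ε hε
    obtain ⟨e, he0, heε⟩ := ENNReal.lt_iff_exists_nnreal_btwn.1 hε
    have he0' : 0 < (e : ℝ) / 2 := by
      have : 0 < e := by exact_mod_cast he0
      positivity
    obtain ⟨u₀, n₀, h1⟩ := h.exists_measure_defect_le hC hcoef hγ hq2 hM hsd hη htight hφ hφc hst hg
      hg1 hgs he0'
    refine ⟨u₀, n₀, fun u hu n hn => ?_⟩
    set A : Set Ω := {w | (e : ℝ) / 2 < |defect b σ φ s t g (flow hγ X n u w)|} with hA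
    calc _ ≤ ∫⁻ w, (ofReal ((e : ℝ) / 2) + A.indicator 1 w) ∂P := by
          refine lintegral_mono fun w => ?_
          by_cases hw : w ∈ A
          · rw [Set.indicator_of_mem hw]
            exact (min_le_left _ _).trans le_add_self
          · exact (min_le_right _ _).trans
              ((ofReal_le_ofReal (not_lt.1 hw)).trans le_self_add)
      _ ≤ ofReal ((e : ℝ) / 2) + ofReal ((e : ℝ) / 2) := by
          rw [lintegral_add_left measurable_const, lintegral_const, measure_univ, mul_one]
          gcongr
          exact (lintegral_indicator_one_le _).trans (h1 u hu n hn)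
      _ ≤ ε := by
          rw [← ofReal_add he0'.le he0'.le, add_halves, ENNReal.ofReal_coe_nnreal]
          exact heε.le
  · intro ρ hρ hrec
    refine Metric.infEDist_zero_of_mem (subset_closure ⟨ρ, ?_, ?_, rfl⟩)
    · refine mem_mckeanVlasov_of_defect_eq_zero hcoef fun φ hφ hφc s t hst g hg hg1 hgs => ?_
      simpa using hρ _ ⟨φ, hφ, hφc, s, t, hst, g, hg, hg1, hgs, rfl⟩
    · refine Set.mem_iInter₂.2 fun t _ => mem_closure_iff_nhds.2 fun U hU => ?_
      obtain ⟨N, hN⟩ := exists_nat_gt t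
      obtain ⟨n, hn, hnU⟩ := (frequently_atTop.1 (hrec U hU)) N
      have hit : ∀ n : ℕ, (PathWSpace.shift 1)^[n] ρ = ρ.shift n := fun n => by
        induction n with
        | zero =>
          have h0 : shiftPath (d := d) 0 = id := by
            ext1 x
            ext1 s
            rw [shiftPath_apply, zero_add, id]
          ext1
          simp [PathWSpace.shift, h0]
        | succ n ih => rw [Function.iterate_succ_apply', ih, PathWSpace.shift_shift, Nat.cast_succ]
      exact ⟨_, hnU, n, hN.trans_le (by exact_mod_cast hn), hit n⟩

lemma edist_empirical_pow_le {n : ℕ+} {r : ℕ} (hr : p ≤ r) (x y : Fin n → State d) :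
    edist (empirical x : WSpace p (State d)) (empirical y) ^ r ≤
      (n : ℝ≥0∞)⁻¹ * ∑ i, ‖x i - y i‖ₑ ^ r := by
  have hp0 : 0 < p := lt_of_lt_of_le one_pos hp.out
  have hr0 : (0 : ℝ) < r := hp0.trans_le hr
  have hprob : IsProbabilityMeasure ((n : ℝ≥0∞)⁻¹ • ∑ i : Fin n, dirac i) :=
    ⟨by simp [ENNReal.inv_mul_cancel]⟩
  have h := eLpNorm'_le_eLpNorm'_of_exponent_le hp0 hr
    ((n : ℝ≥0∞)⁻¹ • ∑ i : Fin n, dirac i) (f := fun i => x i - y i)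
    (Measurable.of_discrete).aestronglyMeasurable
  rw [eLpNorm', eLpNorm', lintegral_uniform, lintegral_uniform] at h
  have h1 := rpow_le_rpow ((edist_empirical_le (p := p) x y).trans h) hr0.le
  rw [← rpow_mul, one_div_mul_cancel hr0.ne', rpow_one] at h1
  simpa only [rpow_natCast] using h1

lemma lintegral_edist_empirical_pow_le {n : ℕ+} {r : ℕ} (hr : p ≤ r) {x y : Fin n → Ω → State d}
    (hm : ∀ i, Measurable fun w => x i w - y i w)
    (hi : ∀ i, Integrable (fun w => ‖x i w - y i w‖ ^ r) P) {B : ℝ}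
    (hB : mean (fun i => ∫ w, ‖x i w - y i w‖ ^ r ∂P) ≤ B) :
    ∫⁻ w, edist (empirical fun i => x i w : WSpace p (State d)) (empirical fun i => y i w) ^ r ∂P ≤
      ofReal B := by
  refine (lintegral_mono fun w => edist_empirical_pow_le hr _ _).trans ?_
  have hm' : ∀ i, Measurable fun w => ‖x i w - y i w‖ₑ ^ r := fun i => (hm i).enorm.pow_const r
  rw [lintegral_const_mul _ (Finset.measurable_fun_sum _ fun i _ => hm' i),
    lintegral_finsetSum _ fun i _ => hm' i]
  refine inv_mul_sum_le (fun i => integral_nonneg fun w => by positivity) (fun i => ?_) hB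
  rw [ofReal_integral_eq_lintegral_ofReal (hi i) (ae_of_all _ fun w => by positivity)]
  simp_rw [ofReal_pow (norm_nonneg _), ofReal_norm]
  rfl

lemma le_add_inv_mul_sq (a : ℝ≥0∞) {ε : ℝ} (hε : 0 < ε) : a ≤ ofReal ε + ofReal ε⁻¹ * a ^ 2 := by
  rcases le_total a (ofReal ε) with h | h
  · exact h.trans le_self_add
  · refine le_trans ?_ le_add_self
    have h0 : ofReal ε ≠ 0 := by simpa using hε
    rw [sq, ← mul_assoc, ofReal_inv_of_pos hε]
    refine le_mul_of_one_le_left zero_le ?_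
    rw [← ENNReal.inv_mul_cancel h0 ofReal_ne_top]
    gcongr

/-- Comparison of the weighted averages along the grid with the time averages of the
interpolation. -/
lemma exists_sum_lintegral_le (hγ : StepAssumption γ) (hp2 : p ≤ 2) (hq2 : 2 ≤ q) (hM : 0 ≤ M)
    {β : Particles Ω d} (hsd : ∀ n, StepDynamics P γ (X n) (β n) (fun k => ξ n (k + 1)) (F n) q M)
    {G : WSpace p (State d) → ℝ≥0∞} (hG : Continuous G) (hGl : ∀ μ ν, G μ ≤ G ν + edist μ ν) {ε : ℝ}
    (hε : 0 < ε) : ∃ c : ℝ, 0 ≤ c ∧ ∀ n k, ∑ l ∈ range k, ofReal (γ (l + 1)) *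
        ∫⁻ w, G (empirical fun i => X n (l + 1) i w) ∂P ≤ (∫⁻ u in Set.Ioc 0 (gridTime γ k),
        ∫⁻ w, G (empirical fun i => traj hγ (X n) i w u.toNNReal) ∂P) +
      ofReal (∑ l ∈ range k, γ (l + 1) * (ε + c * γ (l + 1))) := by
  obtain ⟨Γ, hΓ0, hΓ⟩ := hγ.exists_le
  set D := 2 * (1 + M) * Γ + (1 + 64 * d ^ 2 * M) with hD
  have hc : 0 ≤ ε⁻¹ * D := by positivity
  refine ⟨ε⁻¹ * D, hc, fun n k => ?_⟩
  have hterm : ∀ l, 0 ≤ ε + ε⁻¹ * D * γ (l + 1) := fun l =>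
    add_nonneg hε.le (mul_nonneg hc (hγ.nonneg l))
  induction k with
  | zero => simp
  | succ k ih =>
    have hk := gridTime_nonneg hγ k
    have hk1 : gridTime γ k ≤ gridTime γ (k + 1) := gridTime_mono hγ k.le_succ
    rw [sum_range_succ, sum_range_succ, ofReal_add (sum_nonneg
        fun l _ => mul_nonneg (hγ.nonneg l) (hterm l)) (mul_nonneg (hγ.nonneg k) (hterm k)),
      ← Set.Ioc_union_Ioc_eq_Ioc hk hk1,
      lintegral_union measurableSet_Ioc (Set.Ioc_disjoint_Ioc_of_le le_rfl), add_add_add_comm]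
    refine add_le_add ih ?_
    have hvol : volume (Set.Ioc (gridTime γ k) (gridTime γ (k + 1))) =
        ofReal (γ (k + 1)) := by
      rw [Real.volume_Ioc, gridTime_succ, add_sub_cancel_left]
    have hx : ∀ u : ℝ≥0, ∀ i, Measurable fun w => traj hγ (X n) i w u := fun u i =>
      (continuous_eval_const u).measurable.comp
        (measurable_interp hγ fun k => (hsd n).measurable_x k i)
    have hpt : ∀ u ∈ Set.Ioc (gridTime γ k) (gridTime γ (k + 1)),
        ∫⁻ w, G (empirical fun i => X n (k + 1) i w) ∂P ≤
        ∫⁻ w, G (empirical fun i => traj hγ (X n) i w u.toNNReal) ∂P +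
          ofReal (ε + ε⁻¹ * D * γ (k + 1)) := by
      intro u hu
      set t : ℝ≥0 := ⟨gridTime γ (k + 1), hk.trans hk1⟩
      have hXt : ∀ i w, X n (k + 1) i w = traj hγ (X n) i w t := fun i w =>
        (interp_gridTime hγ (x := fun k => X n k i w)
          (fun k hk => (hsd n).eq_of_step_eq_zero i w k hk) (k + 1) rfl).symm
      have hut : u.toNNReal ≤ t := Real.toNNReal_le_iff_le_coe.2 hu.2
      have hu0 : ((u.toNNReal : ℝ≥0) : ℝ) = u := Real.coe_toNNReal _ (hk.trans hu.1.le)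
      obtain ⟨h1, h2⟩ := (hsd n).mean_integral_sq_increment_le hγ hq2 hut
      have h3 : 2 * (1 + M) * ((t : ℝ) - u.toNNReal) ^ 2 +
          (1 + 64 * d ^ 2 * M) * ((t : ℝ) - u.toNNReal) ≤ D * γ (k + 1) := by
        have a1 : (t : ℝ) - u.toNNReal ≤ γ (k + 1) := by
          rw [hu0, show (t : ℝ) = gridTime γ (k + 1) from rfl, gridTime_succ]
          linarith [hu.1]
        have a2 : 0 ≤ (t : ℝ) - u.toNNReal := sub_nonneg.2 (NNReal.coe_le_coe.2 hut)
        calc _ ≤ 2 * (1 + M) * (Γ * γ (k + 1)) + (1 + 64 * d ^ 2 * M) * γ (k + 1) := by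
              rw [sq]
              have := hΓ k
              gcongr
              linarith
          _ = D * γ (k + 1) := by ring
      have h4 := lintegral_edist_empirical_pow_le (p := p) (r := 2) (by exact_mod_cast hp2)
        (fun i => (hx t i).sub (hx u.toNNReal i)) h1 (h2.trans h3)
      have hme : Measurable fun w => G (empirical fun i =>
          traj hγ (X n) i w u.toNNReal) :=
        (hG.comp continuous_empirical).measurable.comp
          (measurable_pi_iff.2 fun i => hx u.toNNReal i)
      simp_rw [hXt]
      calc _ ≤ ∫⁻ w, (G (empirical fun i => traj hγ (X n) i w u.toNNReal) +
            (ofReal ε + ofReal ε⁻¹ *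
              edist (empirical fun i => traj hγ (X n) i w t : WSpace p (State d))
                (empirical fun i => traj hγ (X n) i w u.toNNReal) ^ 2)) ∂P :=
            lintegral_mono fun w => (hGl _ _).trans
              (add_le_add_right (le_add_inv_mul_sq _ hε) _)
        _ ≤ _ := by
            rw [lintegral_add_left hme, lintegral_add_left measurable_const,
              lintegral_const_mul' _ _ ofReal_ne_top, lintegral_const, measure_univ, mul_one,
              ofReal_add hε.le (mul_nonneg hc (hγ.nonneg k)), mul_assoc ε⁻¹,
              ofReal_mul (inv_nonneg.2 hε.le)]
            gcongr
    calc _ = ∫⁻ _ in Set.Ioc (gridTime γ k) (gridTime γ (k + 1)),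
          ∫⁻ w, G (empirical fun i => X n (k + 1) i w) ∂P := by
          rw [setLIntegral_const, hvol, mul_comm]
      _ ≤ ∫⁻ u in Set.Ioc (gridTime γ k) (gridTime γ (k + 1)),
          (∫⁻ w, G (empirical fun i => traj hγ (X n) i w u.toNNReal) ∂P +
            ofReal (ε + ε⁻¹ * D * γ (k + 1))) := setLIntegral_mono' measurableSet_Ioc hpt
      _ = _ := by
          rw [lintegral_add_right _ measurable_const, setLIntegral_const, hvol,
            ofReal_mul (hγ.nonneg k), mul_comm (ofReal (γ (k + 1)))]

lemma rpow_le_truncation (a : ℝ≥0∞) {A r : ℝ} (hA : 1 ≤ A) (hr : 1 ≤ r) (hrq : r < q) :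
    a ^ r ≤ ofReal (A ^ r) * min 1 a + ofReal (A ^ (-(q - r))) * a ^ q := by
  have hA0 : 0 < A := one_pos.trans_le hA
  rcases le_total a 1 with h1 | h1
  · refine le_trans ?_ le_self_add
    rw [min_eq_right h1]
    refine (ENNReal.rpow_le_self_of_le_one h1 hr).trans (le_mul_of_one_le_left zero_le ?_)
    exact ENNReal.one_le_ofReal.2 (Real.one_le_rpow hA (by linarith))
  rcases le_total a (ofReal A) with h2 | h2
  · refine le_trans ?_ le_self_add
    rw [min_eq_left h1, mul_one, ← ENNReal.ofReal_rpow_of_pos hA0]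
    exact rpow_le_rpow h2 (by linarith)
  · refine le_trans ?_ le_add_self
    have hq0 : q ≠ 0 := by
      rintro rfl
      norm_num at hrq
      linarith
    rcases eq_or_ne a ⊤ with rfl | ha
    · rw [ENNReal.top_pow hq0, ENNReal.mul_top]
      · exact le_top
      · simpa using Real.rpow_pos_of_pos hA0 _
    · have e1 : a ^ r = a ^ (-(q - r) : ℝ) * a ^ q := by
        rw [← rpow_natCast, ← rpow_add _ _ (one_pos.trans_le h1).ne' ha]
        congr 1
        ring
      rw [e1, ← ENNReal.ofReal_rpow_of_pos hA0, rpow_neg, rpow_neg]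
      gcongr

lemma edist_empirical_zero_le (n : ℕ+) (ν : WSpace p (State d)) :
    edist (empirical fun _ : Fin n => (0 : State d)) ν ≤
      (∫⁻ x, ‖x‖ₑ ^ p ∂ν.toMeasure) ^ (1 / p) := by
  have h := wasserstein_map_map_le hp.out ν.toMeasure (f := fun _ => (0 : State d)) (g := id)
    measurable_const measurable_id
  have e : (empirical fun _ : Fin n => (0 : State d) : WSpace p (State d)).toMeasure =
      ν.toMeasure.map fun _ => (0 : State d) := by
    simp [empirical, Measure.map_const, ← Nat.cast_smul_eq_nsmul ℝ≥0∞, smul_smul,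
      ENNReal.inv_mul_cancel]
  rw [Measure.map_id, ← e] at h
  simp only [zero_sub, id, enorm_neg] at h
  exact h

lemma measurable_comp_empirical {n : ℕ+} {x : Fin n → Ω → State d} (hx : ∀ i, Measurable (x i))
    {G : WSpace p (State d) → ℝ≥0∞} (hG : Continuous G) :
    Measurable fun w => G (empirical fun i => x i w) :=
  (hG.comp continuous_empirical).measurable.comp (measurable_pi_iff.2 hx)

lemma lintegral_ergodicAverage {n : ℕ+} (hX : ∀ k i, Measurable (X n k i))
    {G : WSpace p (State d) → ℝ≥0∞} (hG : Continuous G) (k : ℕ) :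
    Measurable (ergodicAverage γ X G k n) ∧
    ∫⁻ w, ergodicAverage γ X G k n w ∂P = (ofReal (gridTime γ k))⁻¹ *
      ∑ l ∈ range k, ofReal (γ (l + 1)) * ∫⁻ w, G (empirical fun i => X n (l + 1) i w) ∂P := by
  have hm := fun l => measurable_comp_empirical (hX l) hG
  have e : ∀ w, ergodicAverage γ X G k n w = (ofReal (gridTime γ k))⁻¹ *
      ∑ l ∈ range k, ofReal (γ (l + 1)) *
        G (empirical fun i => X n (l + 1) i w) := fun w => by
    rw [ergodicAverage, sum_Icc_eq_gridTime, ENNReal.div_eq_inv_mul, Finset.range_eq_Ico,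
      Finset.sum_Ico_add' (fun l => ofReal (γ l) * G (empirical fun i => X n l i w)) 0 k 1]
    rfl
  have hs : ∀ l, Measurable fun w => ofReal (γ (l + 1)) *
      G (empirical fun i => X n (l + 1) i w) := fun l => (hm (l + 1)).const_mul _
  have hs' := Finset.measurable_fun_sum (range k) fun l _ => hs l
  constructor
  · rw [funext e]
    exact hs'.const_mul _
  · simp_rw [e]
    rw [lintegral_const_mul _ hs', lintegral_finsetSum _ fun l _ => hs l]
    simp_rw [lintegral_const_mul _ (hm _)]

lemma tendsto_sum_sq_div (hγ : StepAssumption γ) (ε c : ℝ) :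
    Tendsto (fun k => (∑ l ∈ range k, γ (l + 1) * (ε + c * γ (l + 1))) / gridTime γ k) atTop
      (𝓝 ε) := by
  have h1 : (fun l => γ (l + 1) * (c * γ (l + 1))) =o[atTop] fun l => γ (l + 1) := by
    have h0 : (fun l => c * γ (l + 1)) =o[atTop] fun _ => (1 : ℝ) :=
      (Asymptotics.isLittleO_one_iff ℝ).2 (by
        simpa using (hγ.tendsto_zero.comp (tendsto_add_atTop_nat 1)).const_mul c)
    simpa using (Asymptotics.isBigO_refl (fun l => γ (l + 1)) atTop).mul_isLittleO h0
  have h2 := (h1.sum_range hγ.nonneg (tendsto_gridTime hγ)).tendsto_div_nhds_zero.const_add ε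
  rw [add_zero] at h2
  refine h2.congr' ?_
  filter_upwards [(tendsto_gridTime hγ).eventually (eventually_gt_atTop 0)] with k hk
  have e : ∑ l ∈ range k, γ (l + 1) = gridTime γ k := rfl
  simp_rw [mul_add, sum_add_distrib, ← sum_mul, e]
  rw [add_div, mul_div_cancel_left₀ _ hk.ne']

lemma inv_mul_sum_step_le (hγ : StepAssumption γ) {a : ℕ → ℝ≥0∞} {B : ℝ≥0∞} (ha : ∀ l, a l ≤ B)
    (k : ℕ) : (ofReal (gridTime γ k))⁻¹ * ∑ l ∈ range k, ofReal (γ (l + 1)) * a l ≤ B := by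
  rw [mul_comm, ← div_eq_mul_inv]
  refine ENNReal.div_le_of_le_mul ?_
  calc _ ≤ ∑ l ∈ range k, ofReal (γ (l + 1)) * B := by
        gcongr with l
        exact ha l
    _ = _ := by
        rw [← sum_mul, ← ofReal_sum_of_nonneg fun l _ => hγ.nonneg l, mul_comm]
        rfl

lemma SymmetrizedSystem.tendsto_ergodicAverage (h : SymmetrizedSystem P b σ γ X ξ ζ F q C η)
    (hC : 0 ≤ C) (hcoef : CoefficientAssumption b σ) (hγ : StepAssumption γ) (hp2 : p ≤ 2)
    (hq2 : 2 ≤ q) (hq4 : q ≤ 4) (hpq : p < q) (hM : 0 ≤ M)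
    (hsd : ∀ n, StepDynamics P γ (X n) (particleDrift b X ζ n) (fun k => ξ n (k + 1)) (F n) q M)
    (hη : Tendsto (fun z : ℕ × ℕ+ => η z.1 z.2) (atTop ×ˢ atTop) (𝓝 0)) {r : ℝ} (hr : 1 ≤ r)
    (hrq : r < q) : TendstoZeroInProbability (ergodicAverage γ X fun μ =>
      Metric.infEDist μ (recurrentMarginals b σ) ^ r) P := by
  set g : WSpace p (State d) → ℝ≥0∞ := fun μ => Metric.infEDist μ (recurrentMarginals b σ)
  have hgc : Continuous g := Metric.continuous_infEDist
  have hmc : Continuous fun μ => min 1 (g μ) := continuous_const.min hgc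
  have hrc : Continuous fun μ => g μ ^ r := continuous_rpow_const.comp hgc
  set E : (WSpace p (State d) → ℝ≥0∞) → ℕ × ℕ+ → ℝ≥0∞ := fun G z =>
    (ofReal (gridTime γ z.1))⁻¹ * ∑ l ∈ range z.1, ofReal (γ (l + 1)) *
      ∫⁻ w, G (empirical fun i => X z.2 (l + 1) i w) ∂P with hE
  have hXm : ∀ n k i, Measurable (X n k i) := fun n => (hsd n).measurable_x
  have hmin : Tendsto (E fun μ => min 1 (g μ)) (atTop ×ˢ atTop) (𝓝 0) := by
    refine tendsto_nhds_zero.2 fun δ hδ => ?_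
    obtain ⟨e, he0, heδ⟩ := ENNReal.lt_iff_exists_nnreal_btwn.1 hδ
    have he : 0 < (e : ℝ) := by exact_mod_cast he0
    have he3 : 0 < (e : ℝ) / 3 := by positivity
    obtain ⟨c, hc, hsum⟩ := exists_sum_lintegral_le hγ hp2 hq2 hM hsd hmc (fun μ ν =>
      (min_le_min_left 1 Metric.infEDist_le_infEDist_add_edist).trans (by
        rcases le_total 1 (g ν) with h1 | h1
        · rw [min_eq_left h1]
          exact (min_le_left _ _).trans le_self_add
        · rw [min_eq_right h1]
          exact min_le_right _ _)) he3
    have h1 := (h.tendsto_average hC hcoef hγ hq2 hq4 hpq hM hsd hη).comp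
      ((tendsto_gridTime hγ).prodMap (tendsto_id (x := (atTop : Filter ℕ+))))
    have h2 := ((tendsto_sum_sq_div hγ (e / 3) c).comp
      (tendsto_fst (f := atTop) (g := (atTop : Filter ℕ+)))).eventually
      (gt_mem_nhds (show (e : ℝ) / 3 < 2 * (e / 3) by linarith))
    filter_upwards [tendsto_nhds_zero.1 h1 (ofReal (e / 3)) (by simpa using he3), h2,
      ((tendsto_gridTime hγ).comp tendsto_fst).eventually (eventually_gt_atTop 0)] with z hz1 hz2 hz3
    have hz3' : 0 < gridTime γ z.1 := hz3
    calc _ ≤ (ofReal (gridTime γ z.1))⁻¹ * _ := mul_le_mul_right (hsum z.2 z.1) _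
      _ ≤ ofReal (e / 3) + ofReal (2 * (e / 3)) := by
          rw [mul_add]
          refine add_le_add hz1 ?_
          rw [← ofReal_inv_of_pos hz3', ← ofReal_mul (by positivity),
            inv_mul_eq_div]
          exact ofReal_le_ofReal hz2.le
      _ = e := by
          rw [← ofReal_add he3.le (by positivity), ← ENNReal.ofReal_coe_nnreal]
          congr 1
          ring
      _ ≤ δ := heδ.le
  have hne : (recurrentMarginals b σ).Nonempty := by
    by_contra hemp
    have hg1 : ∀ μ, min 1 (g μ) = 1 := fun μ => by
      simp [g, Set.not_nonempty_iff_eq_empty.1 hemp]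
    have h1 : Tendsto (E fun μ => min 1 (g μ)) (atTop ×ˢ atTop) (𝓝 1) := by
      refine tendsto_const_nhds.congr' ?_
      filter_upwards [((tendsto_gridTime hγ).comp tendsto_fst).eventually
        (eventually_gt_atTop 0)] with z hz
      simp only [hE, hg1, lintegral_const, measure_univ, mul_one]
      rw [← ofReal_sum_of_nonneg fun l _ => hγ.nonneg l]
      exact (ENNReal.inv_mul_cancel (by simpa using hz) ofReal_ne_top).symm
    exact zero_ne_one (tendsto_nhds_unique hmin h1)
  obtain ⟨ν, hν⟩ := hne
  set R := (∫⁻ x, ‖x‖ₑ ^ p ∂ν.toMeasure) ^ (1 / p)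
  have hR : R < ⊤ := ENNReal.rpow_lt_top_of_nonneg (by have := hp.out; positivity) ν.moment_lt_top.ne
  set B := (2 : ℝ≥0∞) ^ q * (ofReal M + R ^ q) with hBdef
  have hB : B ≠ ⊤ := mul_ne_top (by simp)
    (ENNReal.add_ne_top.2 ⟨ofReal_ne_top, (ENNReal.pow_lt_top hR).ne⟩)
  have hmom : ∀ n k, ∫⁻ w, g (empirical fun i => X n k i w) ^ q ∂P ≤ B := by
    intro n k
    have h1 := lintegral_edist_empirical_pow_le (P := P) (p := p) (r := q) hpq.le
      (x := fun i => X n k i) (y := fun _ _ => 0) (B := M) (by simpa using hXm n k)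
      (fun i => by simpa using ((hsd n).memLp_x k i).integrable_norm_pow (by omega)) (by simpa using (hsd n).moment_x k)
    have h2 : ∀ w, g (empirical fun i => X n k i w) ^ q ≤ 2 ^ q * (edist
        (empirical fun i => X n k i w : WSpace p (State d)) (empirical fun _ : Fin n => 0) ^ q + R ^ q) := by
      intro w
      set a := edist (empirical fun i => X n k i w : WSpace p (State d)) (empirical fun _ : Fin n => 0)
      have h3 : g (empirical fun i => X n k i w) ≤ 2 * max a R :=
        (Metric.infEDist_le_edist_of_mem hν).trans ((edist_triangle _ _ _).trans ((add_le_add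
          (le_max_left a R) ((edist_empirical_zero_le n ν).trans (le_max_right a R))).trans
            (two_mul _).ge))
      refine (pow_le_pow_left' h3 q).trans ?_
      rw [mul_pow]
      gcongr
      rcases max_cases a R with ⟨h4, _⟩ | ⟨h4, _⟩ <;> rw [h4]
      exacts [le_self_add, le_add_self]
    refine (lintegral_mono h2).trans ?_
    rw [lintegral_const_mul' _ _ (by simp), lintegral_add_right _ measurable_const, lintegral_const,
      measure_univ, mul_one]
    exact mul_le_mul_right (add_le_add_left h1 _) _
  have hEr : Tendsto (E fun μ => g μ ^ r) (atTop ×ˢ atTop) (𝓝 0) := by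
    refine tendsto_nhds_zero.2 fun δ hδ => ?_
    have hA : Tendsto (fun A : ℝ => ofReal (A ^ (-(q - r))) * B) atTop (𝓝 0) := by
      simpa using ENNReal.Tendsto.mul_const (ENNReal.tendsto_ofReal
        (tendsto_rpow_neg_atTop (sub_pos.2 hrq))) (Or.inr hB)
    obtain ⟨A, hA1, hA2⟩ := ((eventually_ge_atTop (1 : ℝ)).and
      (tendsto_nhds_zero.1 hA (δ / 2) (ENNReal.half_pos hδ.ne'))).exists
    have h1 : Tendsto (fun z => ofReal (A ^ r) * E (fun μ => min 1 (g μ)) z)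
        (atTop ×ˢ atTop) (𝓝 0) := by
      simpa using ENNReal.Tendsto.const_mul hmin (Or.inr (ofReal_ne_top (r := A ^ r)))
    filter_upwards [tendsto_nhds_zero.1 h1 (δ / 2) (ENNReal.half_pos hδ.ne')] with z hz
    have h2 : ∀ l, ∫⁻ w, g (empirical fun i => X z.2 l i w) ^ r ∂P ≤ ofReal (A ^ r) *
        ∫⁻ w, min 1 (g (empirical fun i => X z.2 l i w)) ∂P + ofReal (A ^ (-(q - r))) * B :=
      fun l => by
        refine (lintegral_mono fun w => rpow_le_truncation _ hA1 hr hrq).trans ?_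
        have hm := measurable_comp_empirical (hXm z.2 l) hmc
        rw [lintegral_add_left (hm.const_mul _), lintegral_const_mul _ hm,
          lintegral_const_mul' _ _ ofReal_ne_top]
        gcongr
        exact hmom z.2 l
    calc _ ≤ ofReal (A ^ r) * E (fun μ => min 1 (g μ)) z +
          (ofReal (gridTime γ z.1))⁻¹ * ∑ l ∈ range z.1,
            ofReal (γ (l + 1)) * (ofReal (A ^ (-(q - r))) * B) := by
          rw [hE]
          dsimp only
          rw [mul_left_comm, ← mul_add, mul_sum _ _ (ofReal (A ^ r)),
            ← sum_add_distrib]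
          refine mul_le_mul_right (sum_le_sum fun l _ => ?_) _
          rw [mul_left_comm, ← mul_add]
          exact mul_le_mul_right (h2 _) _
      _ ≤ δ / 2 + δ / 2 := add_le_add hz ((inv_mul_sum_step_le hγ (fun _ => le_rfl) _).trans hA2)
      _ = δ := ENNReal.add_halves δ
  intro ε hε
  have hε0 : ofReal ε ≠ 0 := by simpa using hε
  have h0 : Tendsto (fun z => E (fun μ => g μ ^ r) z / ofReal ε) (atTop ×ˢ atTop) (𝓝 0) := by
    simpa using ENNReal.Tendsto.div_const hEr (Or.inr hε0)
  refine tendsto_of_tendsto_of_tendsto_of_le_of_le tendsto_const_nhds h0 (fun _ => zero_le)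
    fun z => ?_
  obtain ⟨h1, h2⟩ := lintegral_ergodicAverage (P := P) (γ := γ) (hXm z.2) hrc z.1
  have h3 := meas_ge_le_lintegral_div (μ := P) h1.aemeasurable hε0 ofReal_ne_top
  rw [h2] at h3
  exact (measure_mono (Set.ofPred_subset_ofPred.2 fun w hw => le_of_lt hw)).trans h3

end MeanField

end MKV

end

theorem mainTheorem2 {p : ℝ} [Fact (1 ≤ p)] {d d' : ℕ}
    {Ω : Type*} [mΩ : MeasurableSpace Ω] (P : Measure Ω) [IsProbabilityMeasure P]
    (b : State d → WSpace p (State d) → State d)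
    (σ : State d → WSpace p (State d) → Matrix (Fin d) (Fin d') ℝ)
    (γ : ℕ → ℝ)
    (X ξ ζ : (n : ℕ+) → ℕ → Fin n → Ω → State d)
    (ℱ : ℕ+ → Filtration ℕ mΩ)
    (hsys : IsParticleSystem b γ X ξ ζ ℱ)
    (hcoef : CoefficientAssumption b σ)
    (hstep : StepAssumption γ)
    (hnoise : NoiseAssumption σ X ξ ζ ℱ P)
    (hmom : MomentAssumption b X ζ P)
    (hp : p < 2 ∨ (p = 2 ∧ FourthMomentAssumption b X ζ P)) :
    TendstoZeroInProbability
      (ergodicAverage γ X fun μ => Metric.infEDist μ (recurrentMarginals b σ)) P ∧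
    TendstoZeroInProbability
      (ergodicAverage γ X fun μ => Metric.infEDist μ (recurrentMarginals b σ) ^ p) P := by
  have hp1 : 1 ≤ p := Fact.out
  suffices h : ∃ q : ℕ, p < q ∧ ∀ r : ℝ, 1 ≤ r → r < q → TendstoZeroInProbability
      (ergodicAverage γ X fun μ => Metric.infEDist μ (recurrentMarginals b σ) ^ r) P by
    obtain ⟨q, hpq, h⟩ := h
    refine ⟨?_, h p hp1 hpq⟩
    simpa only [ENNReal.rpow_one] using h 1 le_rfl (hp1.trans_lt hpq)
  rcases hp with hp | ⟨hp, hmom4⟩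
  · obtain ⟨𝒢, C, hC, h⟩ := exists_symmetrizedSystem hsys hcoef hnoise two_ne_zero
      hmom.moment_init hmom.moment_ζ
    obtain ⟨M, hM, hsd⟩ := h.exists_stepDynamics hC hcoef (Or.inl rfl)
      (h.exists_second_moment_le hC hcoef hstep hmom)
    have hpq : p < (2 : ℕ) := by exact_mod_cast hp
    exact ⟨2, hpq, fun r hr hrq => h.tendsto_ergodicAverage hC hcoef hstep hp.le le_rfl (by norm_num)
      hpq hM hsd hnoise.condExp_ζ hr hrq⟩
  · obtain ⟨𝒢, C, hC, h⟩ := exists_symmetrizedSystem hsys hcoef hnoise four_ne_zero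
      hmom4.moment_init hmom4.moment_ζ
    obtain ⟨M, hM, hsd⟩ := h.exists_stepDynamics hC hcoef (Or.inr rfl)
      (h.exists_fourth_moment_le hC hcoef hstep hmom hmom4)
    have hpq : p < (4 : ℕ) := by rw [hp]; norm_num
    exact ⟨4, hpq, fun r hr hrq => h.tendsto_ergodicAverage hC hcoef hstep hp.le (by norm_num) le_rfl
      hpq hM hsd hnoise.condExp_ζ hr hrq⟩
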